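/- All vector spaces are over $\mathbb{C}$ and all gradings are by $\mathbb{Z}$. Data. Let $(\Omega^*,d)$ be a unital DG algebra with $\Omega^n=0$ for $n<0$ and $\deg d=1$, equipped with a ring topology for which $d$ and the projections $\Omega^*\to\Omega^n$ are continuous (the discrete topology is allowed), and let $\mathcal{A}=\Omega^0$. Let $(\mathcal{H}^*,d)$ be a DG Hopf algebra (multiplicativity of $\Delta$ and all other identities are understood with Koszul signs, and the structure maps preserve degrees and commute with $d$), with comultiplication $\Delta h=\sum h_{(0)}\otimes h_{(1)}$, counit $\varepsilon$, antipode $S$, and a modular pair in involution $(\delta,\sigma)$: $\delta:\mathcal{H}^*\to\mathbb{C}$ is an algebra homomorphism with $\delta\circ d=0$ vanishing in non-zero degrees, $\sigma\in\mathcal{H}^0$ is group-like with $d\sigma=0$ and $\delta(\sigma)=1$, and $(\sigma^{-1}\widetilde S)^2=\mathrm{id}$, where $\widetilde S(h)=\sum\delta(h_{(0)})S(h_{(1)})$. Let $\pi$ be an action of $\mathcal{H}^*$ on $\Omega^*$ by continuous operators: $\pi(1)=\mathrm{id}$, $\pi(gh)=\pi(g)\pi(h)$, $\pi(h)(1)=\varepsilon(h)1$,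 $\pi(h)(ab)=\sum(-1)^{\deg h_{(1)}\deg a}\pi(h_{(0)})(a)\,\pi(h_{(1)})(b)$, $\deg\pi(h)(a)=\deg h+\deg a$ and $d(\pi(h)(a))=\pi(dh)(a)+(-1)^{\deg h}\pi(h)(da)$. Let $\int:\Omega^*\to\mathbb{C}$ be a continuous linear functional which is closed ($\int da=0$), has weight $q$ ($\int a=0$ if $\deg a\neq q$), and is a $\delta$-invariant graded $\sigma$-trace for $\pi$: for homogeneous elements $$\int\pi(h)(a)\,b=(-1)^{\deg h\deg a}\int a\,\pi(\widetilde Sh)(b),\qquad \int ab=(-1)^{\deg a\deg b}\int b\,\pi(\sigma)(a).$$ Complexes. For a family $X^k$ ($k\ge0$) with faces $\delta_j:X^k\to X^{k+1}$, degeneracies $\sigma_j:X^{k+1}\to X^k$ and cyclic operators $\tau_k$, put $b=\sum_{j=0}^{k+1}(-1)^j\delta_j$ on $X^k$ and $B=\big(\sum_{j=0}^{k}(-1)^{jk}\tau_k^j\big)\sigma_k\tau_{k+1}\big(1-(-1)^{k+1}\tau_{k+1}\big):X^{k+1}\to X^k$. The complex $\mathcal{B}(\mathcal{H}^*,d)$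 consists of finite cochains $(x_{p,r})_{p,r\ge0}$, $x_{p,r}\in(\mathcal{H}^*)^{\otimes(p-r)}$ ($0$ if $p<r$), with differential $b+B+(-1)^kd$ on $(\mathcal{H}^*)^{\otimes k}$ ($b$ raises $p$ by one, $B$ raises $r$ by one); an element of weight $w$ (sum of the degrees of the factors) at the place $(p,r)$ has total degree $p+r+w$. Here $d$ is extended to tensor powers as a graded derivation, and $\delta_0(h^1\otimes\cdots\otimes h^k)=1\otimes h^1\otimes\cdots\otimes h^k$, $\delta_j=$ comultiplication of $h^j$ for $1\le j\le k$, $\delta_{k+1}(h^1\otimes\cdots\otimes h^k)=h^1\otimes\cdots\otimes h^k\otimes\sigma$, $\sigma_k(h^1\otimes\cdots\otimes h^{k+1})=\varepsilon(h^{k+1})h^1\otimes\cdots\otimes h^k$, $\tau_k(h^1\otimes\cdots\otimes h^k)=\widetilde S(h^1)\cdot(h^2\otimes\cdots\otimes h^k\otimes\sigma)$ with the diagonal action of $\mathcal{H}^*$ with Koszul signs ($\tau_0=\mathrm{id}$). Let $F^l$ be the subspace of $\mathcal{B}(\mathcal{H}^*,d)$ spanned by the elements of weight $\ge l$, and let $HC^i(\mathcal{H}^*)_q$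 be the $i$-th cohomology of $\mathcal{B}(\mathcal{H}^*,d)/F^{q+1}$. The complex $\mathcal{B}_{\rm per}(\Omega^*,d)$ is formed in the same way with places $p,r\in\mathbb{Z}$, where $X^k=C^k(\Omega^*)$ is the space of continuous $(k+1)$-linear functionals on $\Omega^*$, $(\delta_j\varphi)(a_0,\dots,a_{k+1})=\varphi(\dots,a_ja_{j+1},\dots)$ for $j\le k$, $\delta_{k+1}=\tau_{k+1}\delta_0$, $(\sigma_k\varphi)(a_0,\dots,a_k)=\varphi(a_0,\dots,a_k,1)$, $(\tau_k\varphi)(a_0,\dots,a_k)=(-1)^{\deg a_k(\deg a_0+\dots+\deg a_{k-1})}\varphi(a_k,a_0,\dots,a_{k-1})$ and $(d\varphi)(a_0,\dots,a_k)=\sum_j(-1)^{\deg a_0+\dots+\deg a_{j-1}}\varphi(\dots,da_j,\dots)$; cochains are finite, and a functional of weight $m$ (vanishing on $(a_0,\dots,a_k)$ unless $\sum\deg a_j=m$) at the place $(p,r)$ has total degree $p+r-m$. $HP^*(\Omega^*,d)$ is its cohomology, and $HP^*(\mathcal{A})$ is the same for $\mathcal{A}$ with the subspace topology, trivial grading and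 zero differential. Extension of functionals by zero gives a map $I:HP^*(\mathcal{A})\to HP^*(\Omega^*,d)$. The characteristic map is $$\chi_\pi(h^1\otimes\cdots\otimes h^k)(a_0,\dots,a_k)=(-1)^{w(w+1)/2}(-1)^{\sum_{j>i\ge0}\deg h^j\deg a_i}\int a_0\,\pi(h^1)(a_1)\cdots\pi(h^k)(a_k),\qquad w=\sum_j\deg h^j .$$ Theorem. (1) $\chi_\pi:\mathcal{B}(\mathcal{H}^*,d)\to\mathcal{B}_{\rm per}(\Omega^*,d)$ commutes with the total differentials, lowers the total degree by $q$, and vanishes on $F^{q+1}$. (2) Consequently it induces for every $i$ a map $HC^i(\mathcal{H}^*)_q\to HP^{i-q}(\Omega^*,d)$, and hence a map $\Phi:HC^i(\mathcal{H}^*)_q\to HP^{i-q}(\mathcal{A})$, namely the unique linear map such that, for every cocycle $x$ of $\mathcal{B}(\mathcal{H}^*,d)/F^{q+1}$ of degree $i$ and every cocycle $y$ of degree $i-q$ of the periodic complex of $\mathcal{A}$, $\Phi[x]=[y]$ if and only if $I[y]=[\chi_\pi(x)]$ in $HP^{i-q}(\Omega^*,d)$. (3) Let $\rho^+,\rho^-:\mathcal{H}^*\to\Omega^*$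 be degree-preserving linear maps commuting with $d$, inverse to each other for the convolution product, with $\rho^+(hg)=\sum\rho^+(h_{(0)})\pi(h_{(1)})(\rho^+(g))$, $\rho^-(hg)=\sum(-1)^{\deg h_{(1)}\deg g}\pi(h_{(0)})(\rho^-(g))\rho^-(h_{(1)})$ and $\rho^\pm(1)=\rho^\pm(\sigma)=1$, and let $\pi'(h)(a)=\sum(-1)^{\deg h_{(2)}\deg a}\rho^+(h_{(0)})\pi(h_{(1)})(a)\rho^-(h_{(2)})$. If $\int$ is also a $\delta$-invariant graded $\sigma$-trace for $\pi'$, then $\chi_\pi$ and $\chi_{\pi'}$ induce the same maps $HC^i(\mathcal{H}^*)_q\to HP^{i-q}(\mathcal{A})$. -/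

import Mathlib

open scoped TensorProduct DirectSum

noncomputable section

namespace DGHopf

/-! ### Graded algebras and Koszul signs

Every grading is by `ℤ`, and `(n : ℤ).negOnePow` is the sign `(-1) ^ n`. -/

section Koszul

variable {A : Type*} [Ring A] [Algebra ℂ A] (𝒜 : ℤ → Submodule ℂ A) [GradedAlgebra 𝒜]

/-- The linear map multiplying an element of degree `j` by `(-1) ^ (i * j)`: the Koszul sign for
moving it past an element of degree `i`. -/
def koszul (i : ℤ) : A →ₗ[ℂ] A :=
  DirectSum.toModule ℂ ℤ A (fun j => ((i * j).negOnePow : ℤ) • (𝒜 j).subtype) ∘ₗ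
    (DirectSum.decomposeLinearEquiv 𝒜).toLinearMap

/-- The projection to the even part (`s = 0`) or to the odd part (`s = 1`). An expression with
Koszul signs that depend on `deg a` is written for arbitrary `a` as a sum over `s = 0, 1`,
with `a` replaced by `parityPart 𝒜 s a` and `deg a` replaced by `s`. -/
def parityPart (s : ℕ) : A →ₗ[ℂ] A :=
  (1 / 2 : ℂ) • (LinearMap.id + (-1 : ℂ) ^ s • koszul 𝒜 1)

/-- The differential `d` has degree `1` and makes the graded algebra `A` a DG algebra. -/
structure IsDGAlgebra (d : A →ₗ[ℂ] A) : Prop where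
  d_mem : ∀ (i : ℤ), ∀ a ∈ 𝒜 i, d a ∈ 𝒜 (i + 1)
  d_d : ∀ a, d (d a) = 0
  leibniz : ∀ (i : ℤ), ∀ a ∈ 𝒜 i, ∀ b, d (a * b) = d a * b + (i.negOnePow : ℤ) • (a * d b)

/-- The projection of a graded algebra to its part of degree `0`. -/
def projZero : A →ₗ[ℂ] ↥(𝒜 0) :=
  DirectSum.component ℂ ℤ (fun i => ↥(𝒜 i)) 0 ∘ₗ (DirectSum.decomposeLinearEquiv 𝒜).toLinearMap

end Koszul

/-- The grading of an algebra concentrated in degree `0`. -/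
def trivialGrading (A : Type*) [Ring A] [Algebra ℂ A] : ℤ → Submodule ℂ A :=
  fun n => if n = 0 then ⊤ else ⊥

theorem mem_trivialGrading_zero {A : Type*} [Ring A] [Algebra ℂ A] (a : A) :
    a ∈ trivialGrading A 0 := by
  simp [trivialGrading]

theorem eq_zero_of_mem_trivialGrading {A : Type*} [Ring A] [Algebra ℂ A] {n : ℤ} (hn : n ≠ 0)
    {a : A} (ha : a ∈ trivialGrading A n) : a = 0 := by
  simpa [trivialGrading, hn] using ha

instance (A : Type*) [Ring A] [Algebra ℂ A] : GradedAlgebra (trivialGrading A) where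
  one_mem := mem_trivialGrading_zero 1
  mul_mem i j a b ha hb := by
    by_cases hi : i = 0
    · by_cases hj : j = 0
      · subst hi hj
        exact mem_trivialGrading_zero _
      · rw [eq_zero_of_mem_trivialGrading hj hb, mul_zero]
        exact Submodule.zero_mem _
    · rw [eq_zero_of_mem_trivialGrading hi ha, zero_mul]
      exact Submodule.zero_mem _
  decompose' a := DirectSum.of (fun i => ↥(trivialGrading A i)) 0 ⟨a, mem_trivialGrading_zero a⟩
  left_inv a := by simp
  right_inv x := by
    induction x using DirectSum.induction_on with
    | zero =>
      simp only [map_zero]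
      exact (DirectSum.of (fun i => ↥(trivialGrading A i)) 0).map_zero
    | of i x =>
      by_cases hi : i = 0
      · subst hi
        simp
      · obtain ⟨x, hx⟩ := x
        have h0 : x = 0 := eq_zero_of_mem_trivialGrading hi hx
        subst h0
        have : (⟨0, hx⟩ : ↥(trivialGrading A i)) = 0 := rfl
        rw [this, map_zero, map_zero]
        exact (DirectSum.of (fun i => ↥(trivialGrading A i)) 0).map_zero
    | add x y hx hy =>
      simp only [map_add] at hx hy ⊢
      refine Eq.trans ?_ (congrArg₂ (· + ·) hx hy)
      exact (DirectSum.of (fun i => ↥(trivialGrading A i)) 0).map_add ⟨_, _⟩ ⟨_, _⟩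

/-! ### Total complexes and cohomology -/

section Total

variable {X : ℕ → Type*} [∀ k, AddCommGroup (X k)] [∀ k, Module ℂ (X k)]

/-- The operator `B = (∑_{j ≤ k} (-1) ^ (j k) τ_k ^ j) σ_k τ_{k+1} (1 - (-1) ^ (k+1) τ_{k+1})`
from `X (k + 1)` to `X k`, where `τ` are the cyclic operators and `σ_k : X (k + 1) → X k` is the
last degeneracy. -/
def connesB (τ : ∀ k, X k →ₗ[ℂ] X k) (σ : ∀ k, X (k + 1) →ₗ[ℂ] X k) (k : ℕ) :
    X (k + 1) →ₗ[ℂ] X k :=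
  (∑ j ∈ Finset.range (k + 1), (-1 : ℂ) ^ (j * k) • (τ k) ^ j) ∘ₗ σ k ∘ₗ τ (k + 1) ∘ₗ
    (LinearMap.id - (-1 : ℂ) ^ (k + 1) • τ (k + 1))

variable (ι : Type*) [AddMonoidWithOne ι] [DecidableEq ι]

variable (X) in
/-- Finite cochains: the index `(k, q)` stands for the place `(p, q)`, `p = k + q`, of the
bicomplex, whose entry is `X (p - q) = X k`. For `ι = ℕ` this is the cyclic bicomplex `𝓑`, for
`ι = ℤ` the periodic one `𝓑_per`. -/
abbrev Tot : Type _ := ⨁ p : ℕ × ι, X p.1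

/-- The total differential `b + B + (-1) ^ k d`, where `b` raises `p` by one and `B` raises `q`
by one. -/
def totalD (b : ∀ k, X k →ₗ[ℂ] X (k + 1)) (B : ∀ k, X (k + 1) →ₗ[ℂ] X k)
    (d : ∀ k, X k →ₗ[ℂ] X k) : Tot X ι →ₗ[ℂ] Tot X ι :=
  DirectSum.toModule ℂ (ℕ × ι) (Tot X ι) fun p =>
    match p with
    | (0, q) =>
      DirectSum.lof ℂ (ℕ × ι) (fun p => X p.1) (1, q) ∘ₗ b 0 +
        DirectSum.lof ℂ (ℕ × ι) (fun p => X p.1) (0, q) ∘ₗ d 0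
    | (k + 1, q) =>
      DirectSum.lof ℂ (ℕ × ι) (fun p => X p.1) (k + 2, q) ∘ₗ b (k + 1) +
        DirectSum.lof ℂ (ℕ × ι) (fun p => X p.1) (k, q + 1) ∘ₗ B k +
        (-1 : ℂ) ^ (k + 1) • DirectSum.lof ℂ (ℕ × ι) (fun p => X p.1) (k + 1, q) ∘ₗ d (k + 1)

end Total

/-- The space of cocycles `Z` modulo the coboundaries `B` that lie in it. -/
abbrev Cohomology {V : Type*} [AddCommGroup V] [Module ℂ V] (Z B : Submodule ℂ V) : Type _ :=
  ↥Z ⧸ B.submoduleOf Z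

/-! ### The cyclic object of functionals on a graded algebra -/

section Functionals

theorem contractNth_update {A : Type*} [Mul A] {k : ℕ} (j : Fin (k + 1)) (v : Fin (k + 2) → A)
    (i : Fin (k + 2)) (x : A) :
    Fin.contractNth j.castSucc (· * ·) (Function.update v i x) =
      Function.update (Fin.contractNth j.castSucc (· * ·) v) (j.predAbove i)
        (if i = j.castSucc then x * v j.succ else if i = j.succ then v j.castSucc * x else x) := by
  funext l
  simp only [Fin.contractNth, Function.update_apply, Fin.predAbove, Fin.lt_def, Fin.ext_iff,
    Fin.val_castSucc, Fin.val_succ, apply_dite Fin.val, Fin.val_pred, Fin.coe_castPred]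
  split_ifs <;> first | rfl | (exfalso; omega) | (congr 2; ext; simp; omega)

variable {A : Type*} [Ring A] [Algebra ℂ A]

variable (A) in
/-- `(k + 1)`-linear functionals on `A`. -/
abbrev Functional (k : ℕ) : Type _ := MultilinearMap ℂ (fun _ : Fin (k + 1) => A) ℂ

/-- `(mulAt j φ)(a₀, …, a_{k+1}) = φ(a₀, …, a_j a_{j+1}, …, a_{k+1})`. -/
def mulAt {k : ℕ} (j : Fin (k + 1)) : Functional A k →ₗ[ℂ] Functional A (k + 1) where
  toFun φ :=
    { toFun := fun v => φ (Fin.contractNth j.castSucc (· * ·) v)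
      map_update_add' := by
        intro _ v i x y
        obtain rfl := Subsingleton.elim ‹DecidableEq (Fin (k + 2))› (instDecidableEqFin _)
        rw [contractNth_update, contractNth_update, contractNth_update, ← φ.map_update_add]
        congr 2
        split_ifs <;> simp [add_mul, mul_add]
      map_update_smul' := by
        intro _ v i c x
        obtain rfl := Subsingleton.elim ‹DecidableEq (Fin (k + 2))› (instDecidableEqFin _)
        rw [contractNth_update, contractNth_update, ← φ.map_update_smul]
        congr 2
        split_ifs <;> simp }
  map_add' _ _ := rfl
  map_smul' _ _ := rfl

/-- The last degeneracy `(σ φ)(a₀, …, a_k) = φ(a₀, …, a_k, 1)`. -/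
def insertOne (k : ℕ) : Functional A (k + 1) →ₗ[ℂ] Functional A k where
  toFun φ := φ.curryMid (Fin.last (k + 1)) 1
  map_add' _ _ := rfl
  map_smul' _ _ := rfl

variable (𝒜 : ℤ → Submodule ℂ A)

/-- Functionals of weight `m`: they vanish on `(a₀, …, a_k)` unless
`deg a₀ + … + deg a_k = m`. -/
def weightPart (k : ℕ) (m : ℤ) : Submodule ℂ (Functional A k) where
  carrier := {φ | ∀ (n : Fin (k + 1) → ℤ) (a : Fin (k + 1) → A),
    (∀ i, a i ∈ 𝒜 (n i)) → ∑ i, n i ≠ m → φ a = 0}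
  zero_mem' _ _ _ _ := rfl
  add_mem' hφ hψ n a ha hn := by
    rw [add_apply, hφ n a ha hn, hψ n a ha hn, add_zero]
  smul_mem' c φ hφ n a ha hn := by
    rw [smul_apply, hφ n a ha hn, smul_zero]

variable [GradedAlgebra 𝒜]

/-- The cyclic operator
`(τ φ)(a₀, …, a_k) = (-1) ^ (deg a_k (deg a₀ + … + deg a_{k-1})) φ(a_k, a₀, …, a_{k-1})`. -/
def cyclicOp (k : ℕ) : Functional A k →ₗ[ℂ] Functional A k where
  toFun φ := ∑ s ∈ Finset.range 2,
    (φ.domDomCongr (finRotate (k + 1)).symm).compLinearMap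
      (fun i => if i = Fin.last k then parityPart 𝒜 s else koszul 𝒜 s)
  map_add' φ ψ := by
    rw [← Finset.sum_add_distrib]; rfl
  map_smul' c φ := by
    rw [RingHom.id_apply, Finset.smul_sum]; rfl

/-- The operator `b`, the alternating sum of the faces. The last face
`(-1) ^ (deg a_{k+1} (deg a₀ + … + deg a_k)) φ(a_{k+1} a₀, a₁, …, a_k)` is `τ ∘ δ₀`. -/
def functionalb (k : ℕ) : Functional A k →ₗ[ℂ] Functional A (k + 1) :=
  ∑ j : Fin (k + 1), (-1 : ℂ) ^ (j : ℕ) • mulAt j +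
    (-1 : ℂ) ^ (k + 1) • (cyclicOp 𝒜 (k + 1) ∘ₗ mulAt 0)

/-- `(d φ)(a₀, …, a_k) = ∑_j (-1) ^ (deg a₀ + … + deg a_{j-1}) φ(a₀, …, d a_j, …, a_k)`. -/
def functionald (d : A →ₗ[ℂ] A) (k : ℕ) : Functional A k →ₗ[ℂ] Functional A k :=
  ∑ j : Fin (k + 1), MultilinearMap.compLinearMapₗ
    (fun i => if i < j then koszul 𝒜 1 else if i = j then d else LinearMap.id)

/-- The total differential of the periodic cyclic complex of the DG algebra `(A, d)`. -/
def periodicD (d : A →ₗ[ℂ] A) : Tot (Functional A) ℤ →ₗ[ℂ] Tot (Functional A) ℤ :=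
  totalD ℤ (functionalb 𝒜) (connesB (cyclicOp 𝒜) insertOne) (functionald 𝒜 d)

/-- Extension of functionals on the degree `0` part by zero to the whole graded algebra. -/
def extendByZero : Tot (Functional ↥(𝒜 0)) ℤ →ₗ[ℂ] Tot (Functional A) ℤ :=
  DirectSum.toModule ℂ (ℕ × ℤ) _ fun p =>
    DirectSum.lof ℂ (ℕ × ℤ) (fun p => Functional A p.1) p ∘ₗ
      MultilinearMap.compLinearMapₗ (fun _ => projZero 𝒜)

variable [TopologicalSpace A]

variable (A) in
/-- Continuous functionals. -/
def continuousPart (k : ℕ) : Submodule ℂ (Functional A k) where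
  carrier := {φ | Continuous φ}
  zero_mem' := continuous_const
  add_mem' hφ hψ := hφ.add hψ
  smul_mem' c _ hφ := hφ.const_smul c

/-- Cochains of total degree `j` of the periodic cyclic complex: a functional of weight `m`
at the place `(p, q) = (k + q, q)` has total degree `p + q - m`. -/
def periodicCochains (j : ℤ) : Submodule ℂ (Tot (Functional A) ℤ) :=
  ⨅ p : ℕ × ℤ, (weightPart 𝒜 p.1 (p.1 + 2 * p.2 - j) ⊓ continuousPart A p.1).comap
    (DirectSum.component ℂ (ℕ × ℤ) (fun p => Functional A p.1) p)

def periodicCocycles (d : A →ₗ[ℂ] A) (j : ℤ) : Submodule ℂ (Tot (Functional A) ℤ) :=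
  periodicCochains 𝒜 j ⊓ LinearMap.ker (periodicD 𝒜 d)

def periodicCoboundaries (d : A →ₗ[ℂ] A) (j : ℤ) : Submodule ℂ (Tot (Functional A) ℤ) :=
  (periodicCochains 𝒜 (j - 1)).map (periodicD 𝒜 d)

/-- Periodic cyclic cohomology `HP^j` of the DG algebra `(A, d)`. -/
abbrev HPdg (d : A →ₗ[ℂ] A) (j : ℤ) : Type _ :=
  Cohomology (periodicCocycles 𝒜 d j) (periodicCoboundaries 𝒜 d j)

variable (A) in
/-- Periodic cyclic cohomology `HP^j(A)` of an ungraded algebra. -/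
abbrev HP (j : ℤ) : Type _ := HPdg (trivialGrading A) 0 j

end Functionals

/-! ### DG Hopf algebras and their cyclic complex -/

section Hopf

variable {H : Type*} [Ring H] [Algebra ℂ H] [Coalgebra ℂ H]

open Coalgebra (comul counit)

/-- `(ℋ, d, S)` makes the algebra and coalgebra `H` a DG Hopf algebra: the comultiplication is a
morphism of graded algebras to the graded tensor product, the structure maps preserve degrees and
commute with the differentials, and `S` is the antipode. -/
structure IsDGHopfAlgebra (ℋ : ℤ → Submodule ℂ H) [GradedAlgebra ℋ] (d S : H →ₗ[ℂ] H) : Prop where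
  isDGAlgebra : IsDGAlgebra ℋ d
  comul_mem : ∀ (n : ℤ), ∀ h ∈ ℋ n,
    comul (R := ℂ) h ∈ ⨆ i : ℤ, Submodule.map₂ (TensorProduct.mk ℂ H H) (ℋ i) (ℋ (n - i))
  comul_one : comul (R := ℂ) (1 : H) = 1 ⊗ₜ[ℂ] 1
  comul_mul : ∀ g h : H, GradedTensorProduct.of ℂ ℋ ℋ (comul (g * h)) =
    GradedTensorProduct.of ℂ ℋ ℋ (comul g) * GradedTensorProduct.of ℂ ℋ ℋ (comul h)
  comul_d : ∀ h : H, comul (d h) =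
    TensorProduct.map d LinearMap.id (comul (R := ℂ) h) +
      TensorProduct.map (koszul ℋ 1) d (comul (R := ℂ) h)
  counit_of_ne : ∀ (n : ℤ), n ≠ 0 → ∀ h ∈ ℋ n, counit (R := ℂ) h = 0
  counit_one : counit (R := ℂ) (1 : H) = 1
  counit_mul : ∀ g h : H, counit (R := ℂ) (g * h) = counit (R := ℂ) g * counit (R := ℂ) h
  counit_d : ∀ h : H, counit (R := ℂ) (d h) = 0
  antipode_mem : ∀ (n : ℤ), ∀ h ∈ ℋ n, S h ∈ ℋ n
  antipode_d : ∀ h : H, S (d h) = d (S h)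
  antipode_left : ∀ h : H, LinearMap.mul' ℂ H (TensorProduct.map S LinearMap.id (comul h)) =
    algebraMap ℂ H (counit h)
  antipode_right : ∀ h : H, LinearMap.mul' ℂ H (TensorProduct.map LinearMap.id S (comul h)) =
    algebraMap ℂ H (counit h)

/-- The twisted antipode `S̃(h) = ∑ δ(h₀) S(h₁)`. -/
def twistedAntipode (S : H →ₗ[ℂ] H) (δ : H →ₐ[ℂ] ℂ) : H →ₗ[ℂ] H :=
  (TensorProduct.lid ℂ H).toLinearMap ∘ₗ TensorProduct.map δ.toLinearMap S ∘ₗ comul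

/-- `(δ, σ)` is a modular pair in involution of the DG Hopf algebra: `δ` is a character and `σ`
a closed group-like element of degree `0` with `δ(σ) = 1` and `(σ⁻¹ S̃)² = id`, where
`σ⁻¹ = S σ`. -/
structure IsModularPair (ℋ : ℤ → Submodule ℂ H) [GradedAlgebra ℋ] (d S : H →ₗ[ℂ] H)
    (δ : H →ₐ[ℂ] ℂ) (σ : H) : Prop where
  char_of_ne : ∀ (n : ℤ), n ≠ 0 → ∀ h ∈ ℋ n, δ h = 0
  char_d : ∀ h : H, δ (d h) = 0
  mem_zero : σ ∈ ℋ 0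
  groupLike : IsGroupLikeElem ℂ σ
  d_eq_zero : d σ = 0
  char_eq_one : δ σ = 1
  involution : ∀ h : H, S σ * twistedAntipode S δ (S σ * twistedAntipode S δ h) = h

variable (H) in
/-- The tensor power `H ⊗ ⋯ ⊗ H` (`k` factors). -/
abbrev TPow (k : ℕ) : Type _ := ⨂[ℂ] _ : Fin k, H

/-- `h ⊗ (h¹ ⊗ ⋯ ⊗ hᵏ) ↦ h ⊗ h¹ ⊗ ⋯ ⊗ hᵏ`. -/
def cons (k : ℕ) : H ⊗[ℂ] TPow H k →ₗ[ℂ] TPow H (k + 1) :=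
  TensorProduct.lift (PiTensorProduct.lift.toLinearMap ∘ₗ
    (PiTensorProduct.tprod ℂ (s := fun _ : Fin (k + 1) => H)).curryLeft)

/-- `h ⊗ h¹ ⊗ ⋯ ⊗ hᵏ ↦ h ⊗ (h¹ ⊗ ⋯ ⊗ hᵏ)`. -/
def uncons (k : ℕ) : TPow H (k + 1) →ₗ[ℂ] H ⊗[ℂ] TPow H k :=
  PiTensorProduct.lift (LinearMap.uncurryLeft
    { toFun := fun h => (TensorProduct.mk ℂ H (TPow H k) h).compMultilinearMap
        (PiTensorProduct.tprod ℂ)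
      map_add' := fun g h => by ext v; simp
      map_smul' := fun c h => by ext v; simp [TensorProduct.smul_tmul'] })

/-- `h¹ ⊗ ⋯ ⊗ hᵏ ↦ h¹ ⊗ ⋯ ⊗ hᵏ ⊗ h`. -/
def snoc (k : ℕ) (h : H) : TPow H k →ₗ[ℂ] TPow H (k + 1) :=
  PiTensorProduct.lift
    ((PiTensorProduct.tprod ℂ (s := fun _ : Fin (k + 1) => H)).curryMid (Fin.last k) h)

/-- `h¹ ⊗ ⋯ ⊗ hᵏ ↦ h¹ ⊗ ⋯ ⊗ Δ(hʲ) ⊗ ⋯ ⊗ hᵏ`, where the factors are counted from `0`. -/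
def comulAt : (k : ℕ) → Fin k → (TPow H k →ₗ[ℂ] TPow H (k + 1))
  | 0 => Fin.elim0
  | k + 1 => Fin.cases
      (cons (k + 1) ∘ₗ TensorProduct.map LinearMap.id (cons k) ∘ₗ
        (TensorProduct.assoc ℂ H H (TPow H k)).toLinearMap ∘ₗ
        TensorProduct.map comul LinearMap.id ∘ₗ uncons k)
      (fun j => cons (k + 1) ∘ₗ TensorProduct.map LinearMap.id (comulAt k j) ∘ₗ uncons k)

/-- The operator `b` on `H^{⊗k}`, the alternating sum of the faces `δ₀ = 1 ⊗ -`,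
`δ_j` (comultiplication of the `j`-th factor) and `δ_{k+1} = - ⊗ σ`. -/
def hopfb (σ : H) (k : ℕ) : TPow H k →ₗ[ℂ] TPow H (k + 1) :=
  cons k ∘ₗ TensorProduct.mk ℂ H (TPow H k) 1 +
    ∑ j : Fin k, (-1 : ℂ) ^ (j + 1 : ℕ) • comulAt k j + (-1 : ℂ) ^ (k + 1) • snoc k σ

/-- The last degeneracy `h¹ ⊗ ⋯ ⊗ hᵏ⁺¹ ↦ ε(hᵏ⁺¹) h¹ ⊗ ⋯ ⊗ hᵏ`. -/
def counitLast (k : ℕ) : TPow H (k + 1) →ₗ[ℂ] TPow H k :=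
  PiTensorProduct.lift (LinearMap.uncurryMid (M := fun _ => H) (Fin.last k)
    ((counit : H →ₗ[ℂ] ℂ).smulRight (PiTensorProduct.tprod ℂ)))

variable (ℋ : ℤ → Submodule ℂ H) [GradedAlgebra ℋ]

/-- The diagonal action of `H` on `H^{⊗k}` with Koszul signs:
`h · (g ⊗ x) = ∑ (-1) ^ (deg h₁ deg g) h₀ g ⊗ h₁ · x`. -/
def diagAct : (k : ℕ) → (H →ₗ[ℂ] TPow H k →ₗ[ℂ] TPow H k)
  | 0 => (counit : H →ₗ[ℂ] ℂ).smulRight LinearMap.id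
  | k + 1 =>
    { toFun := fun h => ∑ s ∈ Finset.range 2, cons k ∘ₗ
        TensorProduct.homTensorHomMap (RingHom.id ℂ) H (TPow H k) H (TPow H k)
          (TensorProduct.map ((LinearMap.mul ℂ H).compl₂ (parityPart ℋ s))
            (diagAct k ∘ₗ koszul ℋ s) (comul h)) ∘ₗ uncons k
      map_add' := fun g h => by
        simp only [map_add, LinearMap.add_comp, LinearMap.comp_add, Finset.sum_add_distrib]
      map_smul' := fun c h => by
        simp only [map_smul, LinearMap.smul_comp, LinearMap.comp_smul, Finset.smul_sum,
          RingHom.id_apply] }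

/-- The cyclic operator `τ(h¹ ⊗ ⋯ ⊗ hᵏ) = S̃(h¹) · (h² ⊗ ⋯ ⊗ hᵏ ⊗ σ)` with the diagonal action. -/
def hopfCyclic (S : H →ₗ[ℂ] H) (δ : H →ₐ[ℂ] ℂ) (σ : H) : (k : ℕ) → (TPow H k →ₗ[ℂ] TPow H k)
  | 0 => LinearMap.id
  | k + 1 => TensorProduct.lift
      ((diagAct ℋ (k + 1) ∘ₗ twistedAntipode S δ).compl₂ (snoc k σ)) ∘ₗ uncons k

/-- `∑_j (-1) ^ (deg h¹ + ⋯ + deg hʲ⁻¹) h¹ ⊗ ⋯ ⊗ d hʲ ⊗ ⋯ ⊗ hᵏ`. -/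
def hopfd (d : H →ₗ[ℂ] H) (k : ℕ) : TPow H k →ₗ[ℂ] TPow H k :=
  ∑ j : Fin k, PiTensorProduct.map
    (fun i => if i < j then koszul ℋ 1 else if i = j then d else LinearMap.id)

/-- The total differential of the cyclic complex `𝓑(H, d)`. -/
def hopfD (d S : H →ₗ[ℂ] H) (δ : H →ₐ[ℂ] ℂ) (σ : H) : Tot (TPow H) ℕ →ₗ[ℂ] Tot (TPow H) ℕ :=
  totalD ℕ (hopfb σ) (connesB (hopfCyclic ℋ S δ σ) counitLast) (hopfd ℋ d)

end Hopf

section Filtration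

variable {H : Type*} [Ring H] [Algebra ℂ H] (ℋ : ℤ → Submodule ℂ H)

/-- The part of `H^{⊗k}` of weight `w`, spanned by `h¹ ⊗ ⋯ ⊗ hᵏ` with
`deg h¹ + ⋯ + deg hᵏ = w`. -/
def tensorWeight (k : ℕ) (w : ℤ) : Submodule ℂ (TPow H k) :=
  Submodule.span ℂ {x | ∃ (n : Fin k → ℤ) (h : Fin k → H),
    (∀ i, h i ∈ ℋ (n i)) ∧ ∑ i, n i = w ∧ x = PiTensorProduct.tprod ℂ h}

/-- The span of `h¹ ⊗ ⋯ ⊗ hᵏ` with `deg h¹ + ⋯ + deg hᵏ ≥ l`. -/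
def tensorFiltration (k : ℕ) (l : ℤ) : Submodule ℂ (TPow H k) :=
  Submodule.span ℂ {x | ∃ (n : Fin k → ℤ) (h : Fin k → H),
    (∀ i, h i ∈ ℋ (n i)) ∧ l ≤ ∑ i, n i ∧ x = PiTensorProduct.tprod ℂ h}

/-- Cochains of total degree `i` of `𝓑(H, d)`: a tensor of weight `w` at the place
`(p, q) = (k + q, q)` has total degree `p + q + w`. -/
def hopfCochains (i : ℤ) : Submodule ℂ (Tot (TPow H) ℕ) :=
  ⨅ p : ℕ × ℕ, (tensorWeight ℋ p.1 (i - p.1 - 2 * p.2)).comap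
    (DirectSum.component ℂ (ℕ × ℕ) (fun p => TPow H p.1) p)

/-- The weight filtration `F^l 𝓑(H, d)`. -/
def hopfFiltration (l : ℤ) : Submodule ℂ (Tot (TPow H) ℕ) :=
  ⨅ p : ℕ × ℕ, (tensorFiltration ℋ p.1 l).comap
    (DirectSum.component ℂ (ℕ × ℕ) (fun p => TPow H p.1) p)

variable [Coalgebra ℂ H] [GradedAlgebra ℋ]

/-- Cochains of degree `i` that represent cocycles of the truncated complex
`𝓑(H, d)_q = 𝓑(H, d) / F^{q+1}`. -/
def truncatedCocycles (d S : H →ₗ[ℂ] H) (δ : H →ₐ[ℂ] ℂ) (σ : H) (q i : ℤ) :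
    Submodule ℂ (Tot (TPow H) ℕ) :=
  hopfCochains ℋ i ⊓ (hopfFiltration ℋ (q + 1)).comap (hopfD ℋ d S δ σ)

/-- Cochains that represent coboundaries of degree `i` of the truncated complex. -/
def truncatedCoboundaries (d S : H →ₗ[ℂ] H) (δ : H →ₐ[ℂ] ℂ) (σ : H) (q i : ℤ) :
    Submodule ℂ (Tot (TPow H) ℕ) :=
  (hopfCochains ℋ (i - 1)).map (hopfD ℋ d S δ σ) ⊔ hopfFiltration ℋ (q + 1)

/-- The cohomology `HC^i(H, d)_q` of the truncated complex `𝓑(H, d) / F^{q+1}`. -/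
abbrev HCtrunc (d S : H →ₗ[ℂ] H) (δ : H →ₐ[ℂ] ℂ) (σ : H) (q i : ℤ) : Type _ :=
  Cohomology (truncatedCocycles ℋ d S δ σ q i) (truncatedCoboundaries ℋ d S δ σ q i)

end Filtration

/-! ### Actions, invariant traces and the characteristic map -/

section Action

variable {H : Type*} [Ring H] [Algebra ℂ H] [Coalgebra ℂ H]
variable (ℋ : ℤ → Submodule ℂ H) [GradedAlgebra ℋ]
variable {Ω : Type*} [Ring Ω] [Algebra ℂ Ω] (𝒜 : ℤ → Submodule ℂ Ω) [GradedAlgebra 𝒜]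

open Coalgebra (comul counit)

/-- `π` is an action of the DG Hopf algebra `H` on the DG algebra `Ω`. The Leibniz rule is
`h(ab) = ∑ (-1) ^ (deg h₁ deg a) h₀(a) h₁(b)`. -/
structure IsDGAction (dH : H →ₗ[ℂ] H) (dΩ : Ω →ₗ[ℂ] Ω) (π : H →ₗ[ℂ] Ω →ₗ[ℂ] Ω) : Prop where
  one_act : ∀ a, π 1 a = a
  mul_act : ∀ g h a, π (g * h) a = π g (π h a)
  act_one : ∀ h, π h 1 = algebraMap ℂ Ω (counit h)
  act_mul : ∀ h (i : ℤ), ∀ a ∈ 𝒜 i, ∀ b, π h (a * b) =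
    LinearMap.mul' ℂ Ω (TensorProduct.map (π.flip a) (π.flip b ∘ₗ koszul ℋ i) (comul h))
  act_mem : ∀ (n i : ℤ), ∀ h ∈ ℋ n, ∀ a ∈ 𝒜 i, π h a ∈ 𝒜 (n + i)
  d_act : ∀ (n : ℤ), ∀ h ∈ ℋ n, ∀ a, dΩ (π h a) = π (dH h) a + (n.negOnePow : ℤ) • π h (dΩ a)

/-- The functional `T` is a `δ`-invariant graded `σ`-trace for the action `π`. -/
structure IsInvariantTrace (S : H →ₗ[ℂ] H) (δ : H →ₐ[ℂ] ℂ) (σ : H)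
    (π : H →ₗ[ℂ] Ω →ₗ[ℂ] Ω) (T : Ω →ₗ[ℂ] ℂ) : Prop where
  invariant : ∀ (n i : ℤ), ∀ h ∈ ℋ n, ∀ a ∈ 𝒜 i, ∀ b,
    T (π h a * b) = ((n * i).negOnePow : ℤ) • T (a * π (twistedAntipode S δ h) b)
  trace : ∀ (i j : ℤ), ∀ a ∈ 𝒜 i, ∀ b ∈ 𝒜 j,
    T (a * b) = ((i * j).negOnePow : ℤ) • T (b * π σ a)

/-- `ρ⁺` and `ρ⁻` are degree-preserving linear maps commuting with the differentials, inverse to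
each other for the convolution, and satisfying the cocycle identities
`ρ⁺(hg) = ∑ ρ⁺(h₀) h₁(ρ⁺(g))`, `ρ⁻(hg) = ∑ (-1) ^ (deg h₁ deg g) h₀(ρ⁻(g)) ρ⁻(h₁)` and
`ρ^±(1) = ρ^±(σ) = 1`. -/
structure IsCocyclePair (dH : H →ₗ[ℂ] H) (dΩ : Ω →ₗ[ℂ] Ω) (σ : H) (π : H →ₗ[ℂ] Ω →ₗ[ℂ] Ω)
    (ρp ρm : H →ₗ[ℂ] Ω) : Prop where
  plus_mem : ∀ (n : ℤ), ∀ h ∈ ℋ n, ρp h ∈ 𝒜 n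
  minus_mem : ∀ (n : ℤ), ∀ h ∈ ℋ n, ρm h ∈ 𝒜 n
  plus_d : ∀ h, ρp (dH h) = dΩ (ρp h)
  minus_d : ∀ h, ρm (dH h) = dΩ (ρm h)
  plus_minus : ∀ h, LinearMap.mul' ℂ Ω (TensorProduct.map ρp ρm (comul h)) =
    algebraMap ℂ Ω (counit h)
  minus_plus : ∀ h, LinearMap.mul' ℂ Ω (TensorProduct.map ρm ρp (comul h)) =
    algebraMap ℂ Ω (counit h)
  plus_mul : ∀ h g, ρp (h * g) =
    LinearMap.mul' ℂ Ω (TensorProduct.map ρp (π.flip (ρp g)) (comul h))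
  minus_mul : ∀ h (j : ℤ), ∀ g ∈ ℋ j, ρm (h * g) =
    LinearMap.mul' ℂ Ω (TensorProduct.map (π.flip (ρm g)) (ρm ∘ₗ koszul ℋ j) (comul h))
  plus_one : ρp 1 = 1
  minus_one : ρm 1 = 1
  plus_sigma : ρp σ = 1
  minus_sigma : ρm σ = 1

/-- `π'` is the twist of `π` by `ρ⁺`, `ρ⁻`:
`π'(h)(a) = ∑ (-1) ^ (deg h₂ deg a) ρ⁺(h₀) π(h₁)(a) ρ⁻(h₂)`. -/
def IsTwist (π π' : H →ₗ[ℂ] Ω →ₗ[ℂ] Ω) (ρp ρm : H →ₗ[ℂ] Ω) : Prop :=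
  ∀ h (i : ℤ), ∀ a ∈ 𝒜 i, π' h a =
    LinearMap.mul' ℂ Ω (TensorProduct.map ρp
      (LinearMap.mul' ℂ Ω ∘ₗ TensorProduct.map (π.flip a) (ρm ∘ₗ koszul ℋ i))
      (TensorProduct.map LinearMap.id comul (comul (R := ℂ) h)))

end Action

section Characteristic

variable {H : Type*} [Ring H] [Algebra ℂ H]
variable (ℋ : ℤ → Submodule ℂ H) [GradedAlgebra ℋ]
variable {Ω : Type*} [Ring Ω] [Algebra ℂ Ω] (𝒜 : ℤ → Submodule ℂ Ω) [GradedAlgebra 𝒜]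

/-- `h¹ ⊗ ⋯ ⊗ hᵏ ↦ (-1) ^ (∑_{j > i ≥ 1} deg hʲ deg a_i) h¹(a₁) ⋯ hᵏ(a_k)`. -/
def evalTail (π : H →ₗ[ℂ] Ω →ₗ[ℂ] Ω) : (k : ℕ) → (Fin k → Ω) → (TPow H k →ₗ[ℂ] Ω)
  | 0, _ => (PiTensorProduct.isEmptyEquiv (Fin 0)).toLinearMap.smulRight 1
  | k + 1, a => ∑ s ∈ Finset.range 2, LinearMap.mul' ℂ Ω ∘ₗ
      TensorProduct.map (π.flip (parityPart 𝒜 s (a 0)))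
        (evalTail π k (Fin.tail a) ∘ₗ PiTensorProduct.map (fun _ => koszul ℋ s)) ∘ₗ uncons k

/-- `h¹ ⊗ ⋯ ⊗ hᵏ ↦ (-1) ^ (∑_{j > i ≥ 0} deg hʲ deg a_i) a₀ h¹(a₁) ⋯ hᵏ(a_k)`. -/
def evalAll (π : H →ₗ[ℂ] Ω →ₗ[ℂ] Ω) (k : ℕ) (a : Fin (k + 1) → Ω) : TPow H k →ₗ[ℂ] Ω :=
  ∑ s ∈ Finset.range 2, LinearMap.mulLeft ℂ (parityPart 𝒜 s (a 0)) ∘ₗ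
    evalTail ℋ 𝒜 π k (Fin.tail a) ∘ₗ PiTensorProduct.map (fun _ => koszul ℋ s)

theorem evalTail_update_add (π : H →ₗ[ℂ] Ω →ₗ[ℂ] Ω) {k : ℕ} (a : Fin k → Ω) (i : Fin k)
    (x y : Ω) :
    evalTail ℋ 𝒜 π k (Function.update a i (x + y)) =
      evalTail ℋ 𝒜 π k (Function.update a i x) + evalTail ℋ 𝒜 π k (Function.update a i y) := by
  induction k with
  | zero => exact i.elim0
  | succ k ih =>
    simp only [evalTail, ← Finset.sum_add_distrib]
    refine Finset.sum_congr rfl fun s _ => ?_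
    induction i using Fin.cases with
    | zero =>
      simp only [Function.update_self, Fin.tail_update_zero, map_add, TensorProduct.map_add_left,
        LinearMap.add_comp, LinearMap.comp_add]
    | succ i =>
      simp only [Fin.tail_update_succ, ih, LinearMap.add_comp, TensorProduct.map_add_right,
        LinearMap.comp_add, Function.update_of_ne (Fin.succ_ne_zero i).symm]

theorem evalTail_update_smul (π : H →ₗ[ℂ] Ω →ₗ[ℂ] Ω) {k : ℕ} (a : Fin k → Ω) (i : Fin k)
    (c : ℂ) (x : Ω) :
    evalTail ℋ 𝒜 π k (Function.update a i (c • x)) =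
      c • evalTail ℋ 𝒜 π k (Function.update a i x) := by
  induction k with
  | zero => exact i.elim0
  | succ k ih =>
    simp only [evalTail, Finset.smul_sum]
    refine Finset.sum_congr rfl fun s _ => ?_
    induction i using Fin.cases with
    | zero =>
      simp only [Function.update_self, Fin.tail_update_zero, map_smul,
        TensorProduct.map_smul_left, LinearMap.smul_comp, LinearMap.comp_smul]
    | succ i =>
      simp only [Fin.tail_update_succ, ih, LinearMap.smul_comp, TensorProduct.map_smul_right,
        LinearMap.comp_smul, Function.update_of_ne (Fin.succ_ne_zero i).symm]

theorem evalAll_update_add (π : H →ₗ[ℂ] Ω →ₗ[ℂ] Ω) {k : ℕ} (a : Fin (k + 1) → Ω)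
    (i : Fin (k + 1)) (x y : Ω) :
    evalAll ℋ 𝒜 π k (Function.update a i (x + y)) =
      evalAll ℋ 𝒜 π k (Function.update a i x) + evalAll ℋ 𝒜 π k (Function.update a i y) := by
  simp only [evalAll, ← Finset.sum_add_distrib]
  refine Finset.sum_congr rfl fun s _ => ?_
  induction i using Fin.cases with
  | zero =>
    ext
    simp [Fin.tail_update_zero, add_mul]
  | succ i =>
    ext
    simp [Fin.tail_update_succ, evalTail_update_add, mul_add,
      Function.update_of_ne (Fin.succ_ne_zero i).symm]

theorem evalAll_update_smul (π : H →ₗ[ℂ] Ω →ₗ[ℂ] Ω) {k : ℕ} (a : Fin (k + 1) → Ω)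
    (i : Fin (k + 1)) (c : ℂ) (x : Ω) :
    evalAll ℋ 𝒜 π k (Function.update a i (c • x)) =
      c • evalAll ℋ 𝒜 π k (Function.update a i x) := by
  simp only [evalAll, Finset.smul_sum]
  refine Finset.sum_congr rfl fun s _ => ?_
  induction i using Fin.cases with
  | zero =>
    ext
    simp [Fin.tail_update_zero]
  | succ i =>
    ext
    simp [Fin.tail_update_succ, evalTail_update_smul,
      Function.update_of_ne (Fin.succ_ne_zero i).symm]

/-- `χ_π(h¹ ⊗ ⋯ ⊗ hᵏ)(a₀, …, a_k) = λ T(a₀ h¹(a₁) ⋯ hᵏ(a_k))`, where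
`λ = (-1) ^ (∑_{j > i ≥ 0} deg hʲ deg a_i)`. -/
def charMap (π : H →ₗ[ℂ] Ω →ₗ[ℂ] Ω) (T : Ω →ₗ[ℂ] ℂ) (k : ℕ) :
    TPow H k →ₗ[ℂ] Functional Ω k where
  toFun x :=
    { toFun := fun a => T (evalAll ℋ 𝒜 π k a x)
      map_update_add' := by
        intro _ a i x y
        obtain rfl := Subsingleton.elim ‹DecidableEq (Fin (k + 1))› (instDecidableEqFin _)
        simp [evalAll_update_add]
      map_update_smul' := by
        intro _ a i c x
        obtain rfl := Subsingleton.elim ‹DecidableEq (Fin (k + 1))› (instDecidableEqFin _)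
        simp [evalAll_update_smul] }
  map_add' x y := by ext a; simp
  map_smul' c x := by ext a; simp

/-- The characteristic map on cochains of total degree `i`. A tensor at the place `(k + q, q)` then
has weight `w = i - k - 2 q`, and `χ_π` enters with the sign `(-1) ^ (w (w + 1) / 2)`, which makes
it commute with the total differentials: `χ_π(d x) = (-1) ^ (w + 1) d χ_π(x)` for `x` of
weight `w`. -/
def charTotal (π : H →ₗ[ℂ] Ω →ₗ[ℂ] Ω) (T : Ω →ₗ[ℂ] ℂ) (i : ℤ) :
    Tot (TPow H) ℕ →ₗ[ℂ] Tot (Functional Ω) ℤ :=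
  DirectSum.toModule ℂ (ℕ × ℕ) _ fun p =>
    (((i - p.1 - 2 * p.2) * (i - p.1 - 2 * p.2 + 1) / 2).negOnePow : ℤ) •
      (DirectSum.lof ℂ (ℕ × ℤ) (fun p => Functional Ω p.1) (p.1, (p.2 : ℤ)) ∘ₗ
        charMap ℋ 𝒜 π T p.1)

/-- The linear map `Φ : HC^i(H, d)_q → HP^{i-q}(𝒜 0)` is the map induced by `χ_π`, i.e. the
composition of the map on cohomology `HC^i(H, d)_q → HP^{i-q}(Ω, d)` with the inverse of the map
`HP^{i-q}(𝒜 0) → HP^{i-q}(Ω, d)` given by extension of functionals by zero: for a cocycle `x` of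
the truncated complex and a cocycle `y` of the algebra `𝒜 0`, one has `Φ [x] = [y]` if and only if
the extension of `y` by zero and `χ_π(x)` are cohomologous. -/
def IsInducedMap [Coalgebra ℂ H] [TopologicalSpace Ω] (dH S : H →ₗ[ℂ] H) (δ : H →ₐ[ℂ] ℂ) (σ : H)
    (dΩ : Ω →ₗ[ℂ] Ω) (π : H →ₗ[ℂ] Ω →ₗ[ℂ] Ω) (T : Ω →ₗ[ℂ] ℂ) (q i : ℤ)
    (Φ : HCtrunc ℋ dH S δ σ q i →ₗ[ℂ] HP ↥(𝒜 0) (i - q)) : Prop :=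
  ∀ (x : ↥(truncatedCocycles ℋ dH S δ σ q i))
    (y : ↥(periodicCocycles (trivialGrading ↥(𝒜 0)) 0 (i - q))),
    Φ (Submodule.Quotient.mk x) = Submodule.Quotient.mk y ↔
      extendByZero 𝒜 y - charTotal ℋ 𝒜 π T i x ∈ periodicCoboundaries 𝒜 dΩ (i - q)

end Characteristic

end DGHopf

end

open DGHopf

/-! # The characteristic map of a DG Hopf algebra and its invariance under twists

*The map of complexes.* The characteristic map `χ_π` carries each face, degeneracy and cyclic
operator of the Hopf-cyclic object to the one of the cyclic object of functionals: the faces that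
comultiply a factor correspond to products because the action satisfies the Leibniz rule
(`evalTail_comulAt`), the last face because the functional is a `σ`-trace (`charMap_snoc`), and
the cyclic operator because it is moreover `δ`-invariant (`charMap_hopfCyclic`). Together with
`functionald_charMap`, a consequence of the closedness of the functional, this gives
`charTotal_hopfD`. On tensors of weight above `q` the integrand has degree above `q`, where the
functional vanishes, since `Ω` has no components of negative degree (`charTotal_eq_zero`).

*Reduction to the part of degree zero.* To every cyclic object belongs a complex of pairs
(`pairD`), for functionals on an algebra the normalized cochains of the algebra with a unit
adjoined, into which and from which the `(b, B)`-complex maps (`toPair`, `ofPair`). On pairs a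
derivation `D` has an explicit Cartan homotopy `H` with `[∂, H] = L_D + Q`, where `Q` has square
zero and commutes with `L_D`; hence `L_D²` of a cocycle is a coboundary (`pairL_pairL_eq_pairD`).
Applied to the derivation of `Ω` that multiplies by the degree, this shows that the components of
a nonzero weight of a cochain can be removed for the differential `b + B`. As the differential of
`Ω` lowers weights and cochains are finite, the components of positive weight can be removed one
after another (`Stable.exists_weight_nonpos`), and what remains is the extension by zero of a
cochain of `𝒜 0`. So extension by zero induces an isomorphism in cohomology
(`exists_extendByZero_sub_mem`, `mem_periodicCoboundaries_of_extendByZero`), which yields the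
induced map (`existsUnique_isInducedMap`).

*Continuity.* The Koszul signs involve the parity automorphism of `Ω`, which need not be
continuous for the given topology. It is continuous for the topology of componentwise
convergence, and the continuous functionals of a given weight are the same for both
(`contWeight_component`).

*Twists.* For two cocycle pairs the algebra of matrices of size two over `Ω` carries an action
that twists the entry `(i, j)` by the pair `i` on the left and by the pair `j` on the right
(`matrixAct_isDGAction`), and the trace of matrices makes the functional an invariant trace for it
(`traceFunctional_isInvariantTrace`); this uses that `δ`-invariance of a functional `T` amounts to
`T (π h a) = δ h * T a` (`IsDGAction.invariant_of_apply_act`). The restrictions of its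
characteristic map to the two corners are the characteristic maps of the two twists. The corners
are conjugate by the permutation matrix `F`, and this conjugation is `exp (π i D)` for the
derivation `D = ½ [F, ·]`, whose eigenvalues are `0` and `±1`. On functionals of a given arity
there is a polynomial `K` in `L_D` with `1 - exp (π i L_D) = L_D² K`, so that the homotopy formula
above makes the conjugation act trivially on the cohomology of pairs
(`exists_sub_conjMap_eq_pairD`). Pairs are used here because the embeddings of the corners do not
preserve the unit. Hence twists have cohomologous characteristic maps
(`charTotal_sub_charTotal_mem`), of which the original action is the one for the trivial pair. -/

open scoped TensorProduct DirectSum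

noncomputable section

namespace DGHopf

/-! ### Koszul signs and the parity automorphism -/

section KoszulLemmas

variable {A : Type*} [Ring A] [Algebra ℂ A] (𝒜 : ℤ → Submodule ℂ A) [GradedAlgebra 𝒜]

theorem koszul_of_mem (i : ℤ) {j : ℤ} {a : A} (ha : a ∈ 𝒜 j) :
    koszul 𝒜 i a = ((i * j).negOnePow : ℤ) • a := by
  simp only [koszul, LinearMap.comp_apply, LinearEquiv.coe_coe,
    DirectSum.decomposeLinearEquiv_apply, DirectSum.decompose_of_mem 𝒜 ha]
  erw [DirectSum.toModule_lof]
  simp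

/-- A linear map out of a graded algebra is determined by its values on homogeneous elements. -/
theorem linearMap_ext_homogeneous {M : Type*} [AddCommGroup M] [Module ℂ M] {f g : A →ₗ[ℂ] M}
    (h : ∀ i, ∀ a ∈ 𝒜 i, f a = g a) : f = g := by
  ext a
  induction a using DirectSum.Decomposition.inductionOn 𝒜 with
  | zero => simp
  | homogeneous m => exact h _ _ m.2
  | add a b ha hb => simp [ha, hb]

theorem koszul_of_even {i : ℤ} (hi : Even i) : koszul 𝒜 i = LinearMap.id := by
  refine linearMap_ext_homogeneous 𝒜 fun j a ha => ?_
  simp [koszul_of_mem 𝒜 i ha, Int.negOnePow_even _ (hi.mul_right j)]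

@[simp] theorem koszul_zero : koszul 𝒜 0 = LinearMap.id := koszul_of_even 𝒜 (by simp)

theorem koszul_add (i j : ℤ) : koszul 𝒜 (i + j) = koszul 𝒜 i ∘ₗ koszul 𝒜 j := by
  refine linearMap_ext_homogeneous 𝒜 fun n a ha => ?_
  simp only [LinearMap.comp_apply, koszul_of_mem 𝒜 _ ha, map_zsmul, smul_smul, add_mul,
    Int.negOnePow_add, Units.val_mul]
  rw [mul_comm]

theorem koszul_of_odd {i : ℤ} (hi : Odd i) : koszul 𝒜 i = koszul 𝒜 1 := by
  obtain ⟨j, rfl⟩ := hi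
  rw [koszul_add, koszul_of_even 𝒜 (by simp), LinearMap.id_comp]

theorem koszul_koszul (i : ℤ) (a : A) : koszul 𝒜 i (koszul 𝒜 i a) = a := by
  rw [← LinearMap.comp_apply, ← koszul_add, koszul_of_even 𝒜 ⟨i, rfl⟩, LinearMap.id_apply]

theorem koszul_comm (i j : ℤ) (a : A) :
    koszul 𝒜 i (koszul 𝒜 j a) = koszul 𝒜 j (koszul 𝒜 i a) := by
  rw [← LinearMap.comp_apply, ← LinearMap.comp_apply, ← koszul_add, ← koszul_add, add_comm]

theorem koszul_mem (i : ℤ) {j : ℤ} {a : A} (ha : a ∈ 𝒜 j) : koszul 𝒜 i a ∈ 𝒜 j := by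
  rw [koszul_of_mem 𝒜 i ha]
  exact zsmul_mem ha _

theorem koszul_mul (i : ℤ) (a b : A) : koszul 𝒜 i (a * b) = koszul 𝒜 i a * koszul 𝒜 i b := by
  have : (LinearMap.mul ℂ A).compr₂ (koszul 𝒜 i) =
      (LinearMap.mul ℂ A).compl₁₂ (koszul 𝒜 i) (koszul 𝒜 i) := by
    refine linearMap_ext_homogeneous 𝒜 fun m a ha => linearMap_ext_homogeneous 𝒜 fun n b hb => ?_
    simp only [LinearMap.compr₂_apply, LinearMap.mul_apply', LinearMap.compl₁₂_apply,
      koszul_of_mem 𝒜 i ha, koszul_of_mem 𝒜 i hb, koszul_of_mem 𝒜 i (SetLike.mul_mem_graded ha hb),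
      smul_mul_smul_comm, mul_add, Int.negOnePow_add, Units.val_mul]
  exact LinearMap.congr_fun₂ this a b

@[simp] theorem koszul_one (i : ℤ) : koszul 𝒜 i 1 = 1 := by
  simp [koszul_of_mem 𝒜 i (SetLike.GradedOne.one_mem (A := 𝒜))]

/-- The differential anticommutes with the parity automorphism. -/
theorem IsDGAlgebra.d_koszul {d : A →ₗ[ℂ] A} (hd : IsDGAlgebra 𝒜 d) (i : ℤ) (a : A) :
    d (koszul 𝒜 i a) = (i.negOnePow : ℤ) • koszul 𝒜 i (d a) := by
  have : d ∘ₗ koszul 𝒜 i = (i.negOnePow : ℤ) • (koszul 𝒜 i ∘ₗ d) := by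
    refine linearMap_ext_homogeneous 𝒜 fun j a ha => ?_
    simp only [LinearMap.comp_apply, LinearMap.smul_apply, koszul_of_mem 𝒜 i ha, map_zsmul,
      koszul_of_mem 𝒜 i (hd.d_mem _ _ ha), smul_smul, mul_add, mul_one, Int.negOnePow_add,
      Units.val_mul]
    rw [mul_left_comm, ← Units.val_mul, ← Int.negOnePow_add, Int.negOnePow_even _ ⟨i, rfl⟩]
    simp
  exact LinearMap.congr_fun this a

theorem IsDGAlgebra.d_mul {d : A →ₗ[ℂ] A} (hd : IsDGAlgebra 𝒜 d) (a b : A) :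
    d (a * b) = d a * b + koszul 𝒜 1 a * d b := by
  have : (LinearMap.mul ℂ A).compr₂ d = (LinearMap.mul ℂ A).compl₁₂ d LinearMap.id +
      (LinearMap.mul ℂ A).compl₁₂ (koszul 𝒜 1) d := by
    refine linearMap_ext_homogeneous 𝒜 fun m a ha => LinearMap.ext fun b => ?_
    simp [hd.leibniz m a ha, koszul_of_mem 𝒜 1 ha, mul_assoc]
  exact LinearMap.congr_fun₂ this a b

theorem IsDGAlgebra.d_one {d : A →ₗ[ℂ] A} (hd : IsDGAlgebra 𝒜 d) : d 1 = 0 := by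
  have := hd.d_mul 𝒜 1 1
  simpa using this

theorem parityPart_of_mem {s : ℕ} {i : ℤ} {a : A} (ha : a ∈ 𝒜 i) :
    parityPart 𝒜 s a = if (Even i ↔ Even s) then a else 0 := by
  simp only [parityPart, LinearMap.smul_apply, LinearMap.add_apply, LinearMap.id_apply,
    koszul_of_mem 𝒜 1 ha, one_mul]
  rcases Int.even_or_odd i with hi | hi <;> rcases Nat.even_or_odd s with hs | hs
  · simp only [Int.negOnePow_even _ hi, hs.neg_one_pow, hi, hs]
    simp only [Units.val_one, one_smul, if_true, ← two_smul ℂ a, smul_smul]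
    norm_num
  · simp [Int.negOnePow_even _ hi, hs.neg_one_pow, hi, Nat.not_even_iff_odd.2 hs]
  · simp [Int.negOnePow_odd _ hi, hs.neg_one_pow, Int.not_even_iff_odd.2 hi, hs]
  · simp only [Int.negOnePow_odd _ hi, hs.neg_one_pow, Int.not_even_iff_odd.2 hi,
      Nat.not_even_iff_odd.2 hs]
    simp only [Units.val_neg, Units.val_one, neg_smul, one_smul, smul_neg, neg_neg,
      if_true, ← two_smul ℂ a, smul_smul]
    norm_num

/-- The sums over parities that encode Koszul signs: on an element of degree `i` only the parity
of `i` contributes. -/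
theorem sum_parityPart {M : Type*} [AddCommGroup M] (G : ℕ → A → M) (h0 : ∀ s, G s 0 = 0)
    {i : ℤ} {a : A} (ha : a ∈ 𝒜 i) :
    ∑ s ∈ Finset.range 2, G s (parityPart 𝒜 s a) = G (if Even i then 0 else 1) a := by
  simp only [Finset.sum_range_succ, Finset.sum_range_zero, zero_add, parityPart_of_mem 𝒜 ha]
  by_cases hi : Even i <;> simp [hi, h0]

theorem koszul_parity (i : ℤ) :
    koszul 𝒜 ((if Even i then 0 else 1 : ℕ) : ℤ) = koszul 𝒜 i := by
  by_cases hi : Even i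
  · simp [hi, koszul_of_even]
  · simp [hi, koszul_of_odd 𝒜 (Int.not_even_iff_odd.1 hi)]

end KoszulLemmas

/-! ### Functionals evaluated on sequences -/

section Seq

variable {A : Type*} [Ring A] [Algebra ℂ A]

/-- The value of a functional on the initial segment of a sequence. With tuples written as
sequences, all structure maps of the cyclic object are given by formulas on natural numbers. -/
def Functional.seq {k : ℕ} (φ : Functional A k) (a : ℕ → A) : ℂ := φ fun i => a i

theorem Functional.ext_seq {k : ℕ} {φ ψ : Functional A k} (h : ∀ a, φ.seq a = ψ.seq a) :
    φ = ψ := by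
  ext v
  have := h fun n => if hn : n < k + 1 then v ⟨n, hn⟩ else 0
  simpa [Functional.seq, Fin.is_le] using this

theorem Functional.seq_congr {k : ℕ} (φ : Functional A k) {a b : ℕ → A}
    (h : ∀ l ≤ k, a l = b l) : φ.seq a = φ.seq b :=
  congrArg φ (funext fun i => h i (Nat.lt_succ_iff.1 i.2))

@[simp] theorem Functional.add_seq {k : ℕ} (φ ψ : Functional A k) (a : ℕ → A) :
    (φ + ψ).seq a = φ.seq a + ψ.seq a := rfl

@[simp] theorem Functional.neg_seq {k : ℕ} (φ : Functional A k) (a : ℕ → A) :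
    (-φ).seq a = -φ.seq a := rfl

@[simp] theorem Functional.smul_seq {k : ℕ} (c : ℂ) (φ : Functional A k) (a : ℕ → A) :
    (c • φ).seq a = c * φ.seq a := rfl

theorem Functional.sum_seq {k : ℕ} {ι : Type*} (s : Finset ι) (φ : ι → Functional A k)
    (a : ℕ → A) : (∑ i ∈ s, φ i).seq a = ∑ i ∈ s, (φ i).seq a := by
  simp [Functional.seq]

theorem Functional.seq_update {k : ℕ} (φ : Functional A k) (j : ℕ) (hj : j ≤ k) (a : ℕ → A)
    (x : A) : φ.seq (fun l => if l = j then x else a l) =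
      φ (Function.update (fun i : Fin (k + 1) => a i) ⟨j, Nat.lt_succ_iff.2 hj⟩ x) := by
  refine congrArg φ (funext fun i => ?_)
  simp [Function.update_apply, Fin.ext_iff]

/-- A functional is additive in each entry of a sequence. -/
theorem Functional.seq_add_at {k : ℕ} (φ : Functional A k) (j : ℕ) (hj : j ≤ k) (a : ℕ → A)
    (x y : A) : φ.seq (fun l => if l = j then x + y else a l) =
      φ.seq (fun l => if l = j then x else a l) + φ.seq (fun l => if l = j then y else a l) := by
  simp only [φ.seq_update j hj, φ.map_update_add]

theorem Functional.seq_smul_at {k : ℕ} (φ : Functional A k) (j : ℕ) (hj : j ≤ k) (a : ℕ → A)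
    (c : ℂ) (x : A) : φ.seq (fun l => if l = j then c • x else a l) =
      c * φ.seq (fun l => if l = j then x else a l) := by
  simp only [φ.seq_update j hj, φ.map_update_smul, smul_eq_mul]

theorem Functional.seq_zero_at {k : ℕ} (φ : Functional A k) (j : ℕ) (hj : j ≤ k) (a : ℕ → A)
    (h : a j = 0) : φ.seq a = 0 :=
  φ.map_coord_zero ⟨j, Nat.lt_succ_iff.2 hj⟩ h

/-- The functional with each entry transformed by a linear map, which may depend on the place. -/
def slotMap {A' : Type*} [Ring A'] [Algebra ℂ A'] {k : ℕ} (f : ℕ → A →ₗ[ℂ] A') :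
    Functional A' k →ₗ[ℂ] Functional A k :=
  MultilinearMap.compLinearMapₗ fun i : Fin (k + 1) => f i

@[simp] theorem slotMap_seq {A' : Type*} [Ring A'] [Algebra ℂ A'] {k : ℕ} (f : ℕ → A →ₗ[ℂ] A')
    (φ : Functional A' k) (a : ℕ → A) : (slotMap f φ).seq a = φ.seq fun l => f l (a l) := rfl

theorem mulAt_seq {k : ℕ} (j : Fin (k + 1)) (φ : Functional A k) (a : ℕ → A) :
    (mulAt j φ).seq a = φ.seq fun l =>
      if l < j then a l else if l = j then a l * a (l + 1) else a (l + 1) := by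
  refine congrArg φ (funext fun i => ?_)
  simp [Fin.contractNth]

theorem insertOne_seq {k : ℕ} (φ : Functional A (k + 1)) (a : ℕ → A) :
    (insertOne k φ).seq a = φ.seq fun l => if l = k + 1 then 1 else a l := by
  refine congrArg φ (funext fun i => ?_)
  induction i using Fin.lastCases with
  | last => simp
  | cast i =>
    have h : Fin.castSucc i = (Fin.last (k + 1)).succAbove i := by simp
    rw [h, Fin.insertNth_apply_succAbove, ← h]
    simp [i.2.ne]

variable (𝒜 : ℤ → Submodule ℂ A) [GradedAlgebra 𝒜]

/-- A functional is even (`ε = 1`) or odd (`ε = -1`) with respect to the parity automorphism. -/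
def HasParity (ε : ℂ) {k : ℕ} (φ : Functional A k) : Prop :=
  slotMap (fun _ => koszul 𝒜 1) φ = ε • φ

/-- Every functional is the sum of an even and an odd one. -/
theorem parity_induction {k : ℕ} {P : Functional A k → Prop}
    (hadd : ∀ φ ψ, P φ → P ψ → P (φ + ψ))
    (h : ∀ (ε : ℂ), ε = 1 ∨ ε = -1 → ∀ φ, HasParity 𝒜 ε φ → P φ) (φ : Functional A k) : P φ := by
  set Γ : Functional A k →ₗ[ℂ] Functional A k := slotMap (fun _ => koszul 𝒜 1)
  have hΓ : ∀ φ, Γ (Γ φ) = φ := fun φ => Functional.ext_seq fun a => by simp [Γ, koszul_koszul]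
  have e : φ = (1 / 2 : ℂ) • (φ + Γ φ) + (1 / 2 : ℂ) • (φ - Γ φ) := by
    rw [← smul_add, add_add_sub_cancel, ← two_smul ℂ, smul_smul]; norm_num
  rw [e]
  refine hadd _ _ (h 1 (Or.inl rfl) _ ?_) (h (-1) (Or.inr rfl) _ ?_)
  · change Γ _ = (1 : ℂ) • _
    simp only [map_smul, map_add, hΓ]
    module
  · change Γ _ = (-1 : ℂ) • _
    simp only [map_smul, map_sub, hΓ]
    module

/-- The automorphism through which the cyclic operator rotates functionals of parity `ε`: if
`deg a₀ + ⋯ + deg a_k` has the parity `ε`, then the Koszul sign of the rotation is `1` or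
`(-1) ^ deg a_k` for `ε = -1` or `ε = 1`. -/
def twist (ε : ℂ) : A →ₗ[ℂ] A := parityPart 𝒜 0 - ε • parityPart 𝒜 1

theorem twist_one : twist 𝒜 1 = koszul 𝒜 1 := by
  ext a
  simp only [twist, parityPart, LinearMap.sub_apply, LinearMap.smul_apply, LinearMap.add_apply,
    LinearMap.id_apply, one_smul, pow_zero, pow_one]
  module

theorem twist_neg_one : twist 𝒜 (-1) = LinearMap.id := by
  ext a
  simp only [twist, parityPart, LinearMap.sub_apply, LinearMap.smul_apply, LinearMap.add_apply,
    LinearMap.id_apply, one_smul, pow_zero, pow_one]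
  module

theorem twist_eq {ε : ℂ} (hε : ε = 1 ∨ ε = -1) : twist 𝒜 ε = koszul 𝒜 (if ε = 1 then 1 else 0) := by
  rcases hε with rfl | rfl
  · simp [twist_one]
  · have : (-1 : ℂ) ≠ 1 := by norm_num
    simp [twist_neg_one, this]

/-- The cyclic operator on arbitrary arguments, with the Koszul sign resolved by the parity of the
last argument. -/
theorem cyclicOp_seq_aux {k : ℕ} (φ : Functional A k) (a : ℕ → A) :
    (cyclicOp 𝒜 k φ).seq a =
      φ.seq (fun l => if l = 0 then parityPart 𝒜 0 (a k) else a (l - 1)) +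
      φ.seq (fun l => if l = 0 then parityPart 𝒜 1 (a k) else koszul 𝒜 1 (a (l - 1))) := by
  have key : ∀ (f g : A →ₗ[ℂ] A) (i : Fin (k + 1)),
      (if (finRotate (k + 1)).symm i = Fin.last k then f else g)
        (a ((finRotate (k + 1)).symm i : Fin (k + 1))) =
      if (i : ℕ) = 0 then f (a k) else g (a (i - 1)) := by
    intro f g i
    induction i using Fin.cases with
    | zero =>
      have h : (finRotate (k + 1)).symm 0 = Fin.last k := by
        rw [Equiv.symm_apply_eq, finRotate_last]
      simp [h]
    | succ i =>
      cases k with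
      | zero => exact i.elim0
      | succ k =>
      have h : (finRotate (k + 1 + 1)).symm i.succ = i.castSucc := by
        rw [Equiv.symm_apply_eq, finRotate_of_lt (by simpa using i.is_le)]
        ext; simp
      rw [h]
      have : i.castSucc ≠ Fin.last (k + 1) := (Fin.castSucc_lt_last i).ne
      simp [this]
  have e0 := fun i => key (parityPart 𝒜 0) (koszul 𝒜 0) i
  have e1 := fun i => key (parityPart 𝒜 1) (koszul 𝒜 1) i
  rw [koszul_zero] at e0
  change Functional.seq (∑ s ∈ Finset.range 2,
    (φ.domDomCongr (finRotate (k + 1)).symm).compLinearMap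
      (fun i => if i = Fin.last k then parityPart 𝒜 s else koszul 𝒜 s)) a = _
  rw [Functional.sum_seq]
  simp only [Finset.sum_range_succ, Finset.sum_range_zero, zero_add]
  congr 1
  · refine congrArg φ (funext fun i => ?_)
    simpa using e0 i
  · refine congrArg φ (funext fun i => ?_)
    simpa using e1 i

/-- On functionals of a fixed parity the cyclic operator is a rotation without signs, twisted by
an automorphism in the entry that is moved. -/
theorem cyclicOp_seq {ε : ℂ} (hε : ε = 1 ∨ ε = -1) {k : ℕ} {φ : Functional A k}
    (hφ : HasParity 𝒜 ε φ) (a : ℕ → A) :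
    (cyclicOp 𝒜 k φ).seq a = φ.seq fun l => if l = 0 then twist 𝒜 ε (a k) else a (l - 1) := by
  have hεε : ε * ε = 1 := by rcases hε with rfl | rfl <;> norm_num
  have h1 : φ.seq (fun l => if l = 0 then parityPart 𝒜 1 (a k) else koszul 𝒜 1 (a (l - 1))) =
      φ.seq (fun l => if l = 0 then -ε • parityPart 𝒜 1 (a k) else a (l - 1)) := by
    have e : φ.seq (fun l => if l = 0 then parityPart 𝒜 1 (a k) else koszul 𝒜 1 (a (l - 1))) =
        ε * φ.seq (fun l => koszul 𝒜 1
          (if l = 0 then parityPart 𝒜 1 (a k) else koszul 𝒜 1 (a (l - 1)))) := by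
      have := congrArg (Functional.seq · (fun l =>
        (if l = 0 then parityPart 𝒜 1 (a k) else koszul 𝒜 1 (a (l - 1))))) hφ
      simp only [slotMap_seq, Functional.smul_seq] at this
      rw [this, ← mul_assoc, hεε, one_mul]
    rw [e, φ.seq_smul_at 0 (Nat.zero_le _)]
    have e2 : φ.seq (fun l => koszul 𝒜 1
          (if l = 0 then parityPart 𝒜 1 (a k) else koszul 𝒜 1 (a (l - 1)))) =
        φ.seq (fun l => if l = 0 then (-1 : ℂ) • parityPart 𝒜 1 (a k) else a (l - 1)) := by
      refine φ.seq_congr fun l _ => ?_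
      split_ifs with hl
      · simp only [parityPart, LinearMap.smul_apply, map_smul, LinearMap.add_apply, map_add,
          LinearMap.id_apply, koszul_koszul, pow_one]
        module
      · exact koszul_koszul _ _ _
    rw [e2, φ.seq_smul_at 0 (Nat.zero_le _)]
    ring
  rw [cyclicOp_seq_aux, h1, ← φ.seq_add_at 0 (Nat.zero_le _)]
  simp [twist, sub_eq_add_neg]

end Seq

/-! ### The cyclic object of functionals -/

section FunctionalRelations

variable {A : Type*} [Ring A] [Algebra ℂ A]

theorem mulAt_mulAt {k i j : ℕ} (hij : i ≤ j) (hj : j ≤ k) (φ : Functional A k) :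
    mulAt (⟨j + 1, by omega⟩ : Fin (k + 2)) (mulAt (⟨i, by omega⟩ : Fin (k + 1)) φ) =
      mulAt (⟨i, by omega⟩ : Fin (k + 2)) (mulAt (⟨j, by omega⟩ : Fin (k + 1)) φ) := by
  refine Functional.ext_seq fun a => ?_
  simp only [mulAt_seq]
  refine φ.seq_congr fun l _ => ?_
  rcases lt_trichotomy l i with h | rfl | h
  · simp [h, show l < j by omega, show l < j + 1 by omega]
  · rcases hij.lt_or_eq with h | rfl
    · simp [h, show l < j + 1 by omega, show l + 1 < j + 1 by omega]
    · simp [mul_assoc]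
  · rcases lt_trichotomy l j with h' | rfl | h'
    · simp [h', show ¬ l < i by omega, show l ≠ i by omega, show l + 1 < j + 1 by omega]
    · simp [show ¬ l < i by omega, show l ≠ i by omega, show ¬ l + 1 < i by omega,
        show l + 1 ≠ i by omega]
    · simp [show ¬ l < i by omega, show l ≠ i by omega, show ¬ l + 1 < i by omega,
        show l + 1 ≠ i by omega, show ¬ l < j by omega, show l ≠ j by omega]

variable (𝒜 : ℤ → Submodule ℂ A) [GradedAlgebra 𝒜]

theorem HasParity.mulAt {ε : ℂ} {k : ℕ} {φ : Functional A k} (hφ : HasParity 𝒜 ε φ)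
    (j : Fin (k + 1)) : HasParity 𝒜 ε (mulAt j φ) := by
  refine Functional.ext_seq fun a => ?_
  rw [slotMap_seq, mulAt_seq, Functional.smul_seq, mulAt_seq, ← Functional.smul_seq, ← hφ,
    slotMap_seq]
  refine φ.seq_congr fun l _ => ?_
  split_ifs <;> simp [koszul_mul]

theorem twist_koszul (ε : ℂ) (a : A) : twist 𝒜 ε (koszul 𝒜 1 a) = koszul 𝒜 1 (twist 𝒜 ε a) := by
  simp [twist, parityPart]

theorem HasParity.cyclicOp {ε : ℂ} (hε : ε = 1 ∨ ε = -1) {k : ℕ} {φ : Functional A k}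
    (hφ : HasParity 𝒜 ε φ) : HasParity 𝒜 ε (cyclicOp 𝒜 k φ) := by
  refine Functional.ext_seq fun a => ?_
  rw [slotMap_seq, cyclicOp_seq 𝒜 hε hφ, Functional.smul_seq, cyclicOp_seq 𝒜 hε hφ,
    ← Functional.smul_seq, ← hφ, slotMap_seq]
  refine φ.seq_congr fun l _ => ?_
  split_ifs <;> simp [twist_koszul]

theorem cyclicOp_pow_seq {ε : ℂ} (hε : ε = 1 ∨ ε = -1) {k : ℕ} {φ : Functional A k}
    (hφ : HasParity 𝒜 ε φ) (n : ℕ) (hn : n ≤ k + 1) :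
    HasParity 𝒜 ε ((cyclicOp 𝒜 k ^ n) φ) ∧ ∀ a, ((cyclicOp 𝒜 k ^ n) φ : Functional A k).seq a =
      φ.seq fun l => if l < n then twist 𝒜 ε (a (k + 1 - n + l)) else a (l - n) := by
  induction n with
  | zero => exact ⟨by simpa using hφ, fun a => by simp⟩
  | succ n ih =>
    obtain ⟨h1, h2⟩ := ih (by omega)
    rw [pow_succ', Module.End.mul_apply]
    refine ⟨h1.cyclicOp 𝒜 hε, fun a => ?_⟩
    rw [cyclicOp_seq 𝒜 hε h1, h2]
    refine φ.seq_congr fun l _ => ?_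
    rcases lt_trichotomy l n with h | rfl | h
    · rw [if_pos h, if_neg (by omega), if_pos (by omega)]
      congr 2; omega
    · rw [if_neg (by omega), if_pos (by omega), if_pos (by omega)]
      congr 2; omega
    · rw [if_neg (by omega), if_neg (by omega), if_neg (by omega)]
      congr 1

theorem cyclicOp_pow {k : ℕ} (φ : Functional A k) : (cyclicOp 𝒜 k ^ (k + 1)) φ = φ := by
  induction φ using parity_induction 𝒜 with
  | hadd φ ψ h1 h2 => rw [map_add, h1, h2]
  | h ε hε φ hφ =>
    refine Functional.ext_seq fun a => ?_
    rw [(cyclicOp_pow_seq 𝒜 hε hφ (k + 1) le_rfl).2]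
    have e : φ.seq (fun l => if l < k + 1 then twist 𝒜 ε (a (k + 1 - (k + 1) + l))
        else a (l - (k + 1))) = φ.seq fun l => twist 𝒜 ε (a l) := by
      refine φ.seq_congr fun l hl => ?_
      rw [if_pos (by omega)]
      congr 2; omega
    rw [e]
    rcases hε with rfl | rfl
    · rw [twist_one]
      simpa using congrArg (Functional.seq · a) hφ
    · simp [twist_neg_one]

theorem cyclicOp_mulAt {k j : ℕ} (hj : j + 1 ≤ k) (φ : Functional A k) :
    cyclicOp 𝒜 (k + 1) (mulAt (⟨j + 1, by omega⟩ : Fin (k + 1)) φ) =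
      mulAt (⟨j, by omega⟩ : Fin (k + 1)) (cyclicOp 𝒜 k φ) := by
  induction φ using parity_induction 𝒜 with
  | hadd φ ψ h1 h2 => simp only [map_add, h1, h2]
  | h ε hε φ hφ =>
    refine Functional.ext_seq fun a => ?_
    rw [cyclicOp_seq 𝒜 hε (hφ.mulAt 𝒜 _), mulAt_seq, mulAt_seq, cyclicOp_seq 𝒜 hε hφ]
    refine φ.seq_congr fun l _ => ?_
    cases l with
    | zero => simp [show ¬ k < j by omega, show k ≠ j by omega]
    | succ l => simp

/-- The degeneracy that inserts the unit in front. -/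
def unitFront (k : ℕ) : Functional A (k + 1) →ₗ[ℂ] Functional A k :=
  insertOne k ∘ₗ cyclicOp 𝒜 (k + 1)

theorem twist_map_one {ε : ℂ} (hε : ε = 1 ∨ ε = -1) : twist 𝒜 ε 1 = 1 := by
  simp [twist_eq 𝒜 hε]

theorem unitFront_seq {k : ℕ} (φ : Functional A (k + 1)) (a : ℕ → A) :
    (unitFront 𝒜 k φ).seq a = φ.seq fun l => if l = 0 then 1 else a (l - 1) := by
  induction φ using parity_induction 𝒜 with
  | hadd φ ψ h1 h2 => simp only [map_add, Functional.add_seq, h1, h2]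
  | h ε hε φ hφ =>
    rw [unitFront, LinearMap.comp_apply, insertOne_seq, cyclicOp_seq 𝒜 hε hφ]
    refine φ.seq_congr fun l hl => ?_
    simp only [if_true, twist_map_one 𝒜 hε]
    split_ifs <;> first | rfl | omega

theorem unitFront_mulAt_zero {k : ℕ} (φ : Functional A k) : unitFront 𝒜 k (mulAt 0 φ) = φ := by
  refine Functional.ext_seq fun a => ?_
  rw [unitFront_seq, mulAt_seq]
  refine φ.seq_congr fun l hl => ?_
  cases l <;> simp

theorem unitFront_mulAt_succ {k j : ℕ} (hj : j ≤ k) (φ : Functional A (k + 1)) :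
    unitFront 𝒜 (k + 1) (mulAt (⟨j + 1, by omega⟩ : Fin (k + 2)) φ) =
      mulAt (⟨j, by omega⟩ : Fin (k + 1)) (unitFront 𝒜 k φ) := by
  refine Functional.ext_seq fun a => ?_
  simp only [unitFront_seq, mulAt_seq]
  refine φ.seq_congr fun l hl => ?_
  cases l <;> simp

/-- The operator that applies `d` in the entry `j` and `koszul c` in the entries before it. For a
derivation `d` of degree `c` these are the summands of its action on functionals. -/
def slotDer (c : ℤ) (d : A →ₗ[ℂ] A) (k j : ℕ) : Functional A k →ₗ[ℂ] Functional A k :=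
  slotMap fun l => if l < j then koszul 𝒜 c else if l = j then d else LinearMap.id

theorem slotDer_seq (c : ℤ) (d : A →ₗ[ℂ] A) {k : ℕ} (j : ℕ) (φ : Functional A k) (a : ℕ → A) :
    (slotDer 𝒜 c d k j φ).seq a =
      φ.seq fun l => if l < j then koszul 𝒜 c (a l) else if l = j then d (a l) else a l := by
  rw [slotDer, slotMap_seq]
  refine φ.seq_congr fun l hl => ?_
  split_ifs <;> rfl

/-- `d` is a graded derivation of parity `c`. -/
structure IsGradedDerivation (c : ℤ) (d : A →ₗ[ℂ] A) : Prop where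
  map_mul : ∀ a b, d (a * b) = d a * b + koszul 𝒜 c a * d b
  map_koszul : ∀ a, d (koszul 𝒜 1 a) = (c.negOnePow : ℤ) • koszul 𝒜 1 (d a)

variable {𝒜}

theorem slotDer_mulAt_lt {c : ℤ} {d : A →ₗ[ℂ] A} {k i j : ℕ}
    (hij : i < j) (hj : j ≤ k) (φ : Functional A k) :
    mulAt (⟨j, by omega⟩ : Fin (k + 1)) (slotDer 𝒜 c d k i φ) =
      slotDer 𝒜 c d (k + 1) i (mulAt (⟨j, by omega⟩ : Fin (k + 1)) φ) := by
  refine Functional.ext_seq fun a => ?_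
  simp only [slotDer_seq, mulAt_seq]
  refine φ.seq_congr fun l hl => ?_
  rcases lt_trichotomy l i with h | rfl | h
  · simp [h, show l < j by omega]
  · simp [hij]
  · simp [show ¬ l < i by omega, show l ≠ i by omega, show ¬ l + 1 < i by omega,
      show l + 1 ≠ i by omega]

theorem slotDer_mulAt_gt {c : ℤ} {d : A →ₗ[ℂ] A} {k i j : ℕ}
    (hij : j < i) (hi : i ≤ k) (φ : Functional A k) :
    mulAt (⟨j, by omega⟩ : Fin (k + 1)) (slotDer 𝒜 c d k i φ) =
      slotDer 𝒜 c d (k + 1) (i + 1) (mulAt (⟨j, by omega⟩ : Fin (k + 1)) φ) := by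
  refine Functional.ext_seq fun a => ?_
  simp only [slotDer_seq, mulAt_seq]
  refine φ.seq_congr fun l hl => ?_
  rcases lt_trichotomy l j with h | rfl | h
  · simp [h, show l < i by omega, show l < i + 1 by omega]
  · simp [hij, show l < i + 1 by omega, koszul_mul]
  · simp [show ¬ l < j by omega, show l ≠ j by omega]

theorem slotDer_mulAt_eq {c : ℤ} {d : A →ₗ[ℂ] A} (hd : IsGradedDerivation 𝒜 c d) {k j : ℕ}
    (hj : j ≤ k) (φ : Functional A k) :
    mulAt (⟨j, by omega⟩ : Fin (k + 1)) (slotDer 𝒜 c d k j φ) =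
      slotDer 𝒜 c d (k + 1) j (mulAt (⟨j, by omega⟩ : Fin (k + 1)) φ) +
      slotDer 𝒜 c d (k + 1) (j + 1) (mulAt (⟨j, by omega⟩ : Fin (k + 1)) φ) := by
  refine Functional.ext_seq fun a => ?_
  simp only [slotDer_seq, mulAt_seq, Functional.add_seq]
  have key := φ.seq_add_at j hj
    (fun l => if l < j then koszul 𝒜 c (a l) else a (l + 1)) (d (a j) * a (j + 1))
    (koszul 𝒜 c (a j) * d (a (j + 1)))
  rw [← hd.map_mul] at key
  refine Eq.trans (φ.seq_congr fun l hl => ?_)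
    (key.trans (congrArg₂ (· + ·) (φ.seq_congr fun l hl => ?_) (φ.seq_congr fun l hl => ?_)))
  all_goals
    rcases lt_trichotomy l j with h | rfl | h
    · simp [h, h.ne, show l < j + 1 by omega]
    · simp
    · simp [show ¬ l < j by omega, show l ≠ j by omega, show ¬ l + 1 < j by omega,
        show l + 1 ≠ j by omega]

theorem HasParity.slotDer {ε : ℂ} {c : ℤ} {d : A →ₗ[ℂ] A} (hd : IsGradedDerivation 𝒜 c d)
    {k j : ℕ} (hj : j ≤ k) {φ : Functional A k} (hφ : HasParity 𝒜 ε φ) :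
    HasParity 𝒜 (((c.negOnePow : ℤ) : ℂ) * ε) (slotDer 𝒜 c d k j φ) := by
  refine Functional.ext_seq fun a => ?_
  rw [slotMap_seq, slotDer_seq, Functional.smul_seq, slotDer_seq, mul_assoc,
    ← Functional.smul_seq, ← hφ, slotMap_seq]
  have := φ.seq_smul_at j hj
    (fun l => koszul 𝒜 1 (if l < j then koszul 𝒜 c (a l) else a l)) (c.negOnePow : ℤ)
    (koszul 𝒜 1 (d (a j)))
  refine Eq.trans (φ.seq_congr fun l hl => ?_)
    (this.trans (congrArg _ (φ.seq_congr fun l hl => ?_)))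
  all_goals
    rcases lt_trichotomy l j with h | rfl | h
    · simp [h, h.ne, koszul_comm]
    · simp only [lt_irrefl, if_false, if_true, hd.map_koszul, Int.cast_smul_eq_zsmul]
    · simp [show ¬ l < j by omega, show l ≠ j by omega]

theorem slotDer_cyclicOp_succ {c : ℤ} (hc : c = 0 ∨ c = 1) {d : A →ₗ[ℂ] A}
    (hd : IsGradedDerivation 𝒜 c d) {k j : ℕ} (hj : j < k) (φ : Functional A k) :
    cyclicOp 𝒜 k (slotDer 𝒜 c d k (j + 1) φ) = slotDer 𝒜 c d k j (cyclicOp 𝒜 k φ) := by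
  induction φ using parity_induction 𝒜 with
  | hadd φ ψ h1 h2 => simp only [map_add, h1, h2]
  | h ε hε φ hφ =>
    have hε' : ((c.negOnePow : ℤ) : ℂ) * ε = 1 ∨ ((c.negOnePow : ℤ) : ℂ) * ε = -1 := by
      rcases hc with rfl | rfl <;> rcases hε with rfl | rfl <;> simp
    refine Functional.ext_seq fun a => ?_
    rw [cyclicOp_seq 𝒜 hε' (hφ.slotDer hd hj), slotDer_seq, slotDer_seq, cyclicOp_seq 𝒜 hε hφ]
    refine φ.seq_congr fun l hl => ?_
    cases l with
    | zero =>
      simp only [Nat.zero_lt_succ, if_true, hj.ne', if_false, show ¬ k < j by omega]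
      rcases hc with rfl | rfl
      · simp
      · rcases hε with rfl | rfl <;> simp [twist_one, twist_neg_one, koszul_koszul]
    | succ l => simp

theorem slotDer_cyclicOp_zero {c : ℤ} (hc : c = 0 ∨ c = 1) {d : A →ₗ[ℂ] A}
    (hd : IsGradedDerivation 𝒜 c d) {k : ℕ} (φ : Functional A k) :
    cyclicOp 𝒜 k (slotDer 𝒜 c d k 0 φ) = slotDer 𝒜 c d k k (cyclicOp 𝒜 k φ) := by
  induction φ using parity_induction 𝒜 with
  | hadd φ ψ h1 h2 => simp only [map_add, h1, h2]
  | h ε hε φ hφ =>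
    have hε' : ((c.negOnePow : ℤ) : ℂ) * ε = 1 ∨ ((c.negOnePow : ℤ) : ℂ) * ε = -1 := by
      rcases hc with rfl | rfl <;> rcases hε with rfl | rfl <;> simp
    refine Functional.ext_seq fun a => ?_
    rw [cyclicOp_seq 𝒜 hε' (hφ.slotDer hd (Nat.zero_le _)), slotDer_seq, slotDer_seq,
      cyclicOp_seq 𝒜 hε hφ]
    have hk := hd.map_koszul
    rcases hc with rfl | rfl
    · refine φ.seq_congr fun l hl => ?_
      cases l with
      | zero =>
        rcases hε with rfl | rfl <;>
          simp [twist_one, twist_neg_one, hk]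
      | succ l =>
        simp only [Nat.not_lt_zero, if_false, Nat.succ_ne_zero, Nat.add_sub_cancel]
        rw [if_pos (by omega)]; simp
    · -- the automorphism in the entries `1, …, k` is moved to the entry `0` by the parity of `φ`
      have hφ' : ∀ b : ℕ → A, φ.seq (fun l => koszul 𝒜 1 (b l)) = ε * φ.seq b := fun b =>
        congrArg (Functional.seq · b) hφ
      have hεε : ε * ε = 1 := by rcases hε with rfl | rfl <;> norm_num
      have e1 : φ.seq (fun l => if l = 0 then twist 𝒜 ε (if k < k then koszul 𝒜 1 (a k)
          else if k = k then d (a k) else a k) else if l - 1 < k then koszul 𝒜 1 (a (l - 1))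
          else if l - 1 = k then d (a (l - 1)) else a (l - 1)) =
          ε * φ.seq (fun l => if l = 0 then koszul 𝒜 1 (twist 𝒜 ε (d (a k))) else a (l - 1)) := by
        rw [← hφ']
        refine φ.seq_congr fun l hl => ?_
        cases l with
        | zero => simp [koszul_koszul]
        | succ l => simp [show l < k by omega]
      rw [e1, ← φ.seq_smul_at 0 (Nat.zero_le _)]
      refine φ.seq_congr fun l hl => ?_
      cases l with
      | zero =>
        rcases hε with rfl | rfl <;>
          simp [twist_one, twist_neg_one, hk, koszul_koszul]
      | succ l => simp

theorem slotDer_unitFront {c : ℤ} {d : A →ₗ[ℂ] A} {k j : ℕ} (φ : Functional A (k + 1)) :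
    unitFront 𝒜 k (slotDer 𝒜 c d (k + 1) (j + 1) φ) =
      slotDer 𝒜 c d k j (unitFront 𝒜 k φ) := by
  refine Functional.ext_seq fun a => ?_
  simp only [slotDer_seq, unitFront_seq]
  refine φ.seq_congr fun l hl => ?_
  cases l <;> simp

theorem slotDer_unitFront_zero {c : ℤ} {d : A →ₗ[ℂ] A} (hd : d 1 = 0) {k : ℕ}
    (φ : Functional A (k + 1)) :
    unitFront 𝒜 k (slotDer 𝒜 c d (k + 1) 0 φ) = 0 := by
  refine Functional.ext_seq fun a => ?_
  simp only [slotDer_seq, unitFront_seq]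
  exact φ.seq_zero_at 0 (Nat.zero_le _) _ (by simp [hd])

end FunctionalRelations

/-! ### Abstract cyclic objects and the Cartan operators -/

/-- The structure maps of a cyclic object `X`, with signs: `lam = (-1) ^ k τ_k`, the face `j` is
`(-1) ^ j δ_j` for `j ≤ k + 1`, and `unit` is the degeneracy inserting a unit in front. -/
structure CyclicOps (X : ℕ → Type*) [∀ k, AddCommGroup (X k)] [∀ k, Module ℂ (X k)] where
  lam : ∀ k, X k →ₗ[ℂ] X k
  face : ∀ k, ℕ → (X k →ₗ[ℂ] X (k + 1))
  unit : ∀ k, X (k + 1) →ₗ[ℂ] X k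
  lam_pow : ∀ k x, (lam k ^ (k + 1)) x = x
  lam_face_succ : ∀ k j, j + 1 ≤ k → ∀ x, lam (k + 1) (face k (j + 1) x) = face k j (lam k x)
  lam_face_zero : ∀ k x, lam (k + 1) (face k 0 x) = face k (k + 1) x
  face_face : ∀ k i j, i ≤ j → j ≤ k → ∀ x,
    face (k + 1) (j + 1) (face k i x) = -face (k + 1) i (face k j x)
  unit_face_zero : ∀ k x, unit k (face k 0 x) = x
  unit_face_succ : ∀ k j, j ≤ k → ∀ x,
    unit (k + 1) (face (k + 1) (j + 1) x) = -face k j (unit k x)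

namespace CyclicOps

variable {X : ℕ → Type*} [∀ k, AddCommGroup (X k)] [∀ k, Module ℂ (X k)] (C : CyclicOps X)

/-- The Hochschild coboundary without the last face. -/
def b' (k : ℕ) : X k →ₗ[ℂ] X (k + 1) := ∑ j ∈ Finset.range (k + 1), C.face k j

/-- The Hochschild coboundary. -/
def b (k : ℕ) : X k →ₗ[ℂ] X (k + 1) := ∑ j ∈ Finset.range (k + 2), C.face k j

/-- The sum of the powers of the signed cyclic operator. -/
def norm (k : ℕ) : X k →ₗ[ℂ] X k := ∑ j ∈ Finset.range (k + 1), C.lam k ^ j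

theorem b'_apply (k : ℕ) (x : X k) : C.b' k x = ∑ j ∈ Finset.range (k + 1), C.face k j x := by
  simp [b']

theorem b_apply (k : ℕ) (x : X k) : C.b k x = ∑ j ∈ Finset.range (k + 2), C.face k j x := by
  simp [b]

theorem norm_apply (k : ℕ) (x : X k) :
    C.norm k x = ∑ j ∈ Finset.range (k + 1), (C.lam k ^ j) x := by
  simp [norm]

theorem b_eq (k : ℕ) (x : X k) : C.b k x = C.b' k x + C.face k (k + 1) x := by
  rw [b_apply, b'_apply, Finset.sum_range_succ]

theorem lam_norm (k : ℕ) (x : X k) : C.lam k (C.norm k x) = C.norm k x := by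
  simp only [norm_apply, map_sum, ← Module.End.mul_apply, ← pow_succ']
  rw [Finset.sum_range_succ, C.lam_pow, Finset.sum_range_succ', pow_zero, Module.End.one_apply]

theorem norm_lam (k : ℕ) (x : X k) : C.norm k (C.lam k x) = C.norm k x := by
  rw [norm_apply, norm_apply]
  simp only [← Module.End.mul_apply, ← pow_succ]
  rw [Finset.sum_range_succ, C.lam_pow, Finset.sum_range_succ', pow_zero, Module.End.one_apply]

theorem lam_pow_face (k n : ℕ) (hn : n ≤ k) (x : X k) :
    (C.lam (k + 1) ^ n) (C.face k n x) = C.face k 0 ((C.lam k ^ n) x) := by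
  induction n generalizing x with
  | zero => simp
  | succ n ih =>
    rw [pow_succ, Module.End.mul_apply, C.lam_face_succ k n hn, ih (by omega), pow_succ,
      Module.End.mul_apply]

/-- The last of the faces `δ_j` with `τ δ_j = δ_{j-1} τ`: here the relation follows from the
others because `τ` has finite order. -/
theorem lam_face_last (k : ℕ) (x : X k) :
    C.lam (k + 1) (C.face k (k + 1) x) = C.face k k (C.lam k x) := by
  have h := C.lam_pow_face k k le_rfl (C.lam k x)
  rw [← Module.End.mul_apply (C.lam k ^ k), ← pow_succ, C.lam_pow] at h
  rw [← C.lam_face_zero, ← h, ← Module.End.mul_apply (C.lam (k + 1)) (C.lam (k + 1) ^ k),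
    ← pow_succ',
    ← Module.End.mul_apply, ← pow_succ', C.lam_pow]

theorem lam_face (k j : ℕ) (hj : j ≤ k) (x : X k) :
    C.lam (k + 1) (C.face k (j + 1) x) = C.face k j (C.lam k x) := by
  rcases hj.lt_or_eq with h | rfl
  · exact C.lam_face_succ k j h x
  · exact C.lam_face_last j x

theorem face_face' (k i j : ℕ) (hij : i ≤ j) (hj : j ≤ k + 1) (x : X k) :
    C.face (k + 1) (j + 1) (C.face k i x) = -C.face (k + 1) i (C.face k j x) := by
  rcases hj.lt_or_eq with hj | rfl
  · exact C.face_face k i j hij (by omega) x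
  rw [← C.lam_face_zero (k + 1), ← C.lam_face_zero k]
  rcases hij.lt_or_eq with h | rfl
  · cases i with
    | zero =>
      rw [← C.lam_face (k + 1) 0 (by omega), C.face_face k 0 0 le_rfl (by omega), map_neg, neg_neg]
    | succ i =>
      rw [← C.lam_face (k + 1) _ (by omega),
        C.face_face k 0 (i + 1) (by omega) (by omega), map_neg, neg_neg]
  · rw [← C.lam_face_zero k, ← C.lam_face (k + 1) 0 (by omega), ← C.lam_face (k + 1) (k + 1) le_rfl,
      ← C.lam_face_zero (k + 1), C.face_face k 0 0 le_rfl (by omega), map_neg, map_neg]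

theorem lam_b (k : ℕ) (x : X k) :
    C.lam (k + 1) (C.b k x) = C.face k (k + 1) x + C.b' k (C.lam k x) := by
  rw [b_apply, Finset.sum_range_succ', map_add, C.lam_face_zero, map_sum, b'_apply,
    Finset.sum_congr rfl fun j hj => C.lam_face k j (by simpa [Nat.lt_succ_iff] using hj) x]
  exact add_comm _ _

/-- The relation `(1 - λ) b = b' (1 - λ)`. -/
theorem b_sub_lam (k : ℕ) (x : X k) :
    C.b k x - C.lam (k + 1) (C.b k x) = C.b' k (x - C.lam k x) := by
  rw [lam_b, b_eq, map_sub]; abel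

theorem norm_face (k j : ℕ) (hj : j ≤ k) (x : X k) :
    C.norm (k + 1) (C.face k j x) = C.norm (k + 1) (C.face k 0 ((C.lam k ^ j) x)) := by
  induction j generalizing x with
  | zero => simp
  | succ j ih =>
    rw [← C.norm_lam, C.lam_face k j (by omega), ih (by omega), pow_succ, Module.End.mul_apply]

/-- The relation `N b' = b N`. -/
theorem norm_b' (k : ℕ) (x : X k) : C.norm (k + 1) (C.b' k x) = C.b k (C.norm k x) := by
  have h : ∀ i ≤ k + 1, C.face k (k + 1 - i) (C.norm k x) =
      (C.lam (k + 1) ^ (i + 1)) (C.face k 0 (C.norm k x)) := by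
    intro i hi
    induction i with
    | zero => simp [C.lam_face_zero]
    | succ i ih =>
      rw [pow_succ', Module.End.mul_apply, ← ih (by omega),
        show k + 1 - i = k + 1 - (i + 1) + 1 by omega, C.lam_face _ _ (by omega), C.lam_norm]
  rw [b'_apply, map_sum, b_apply, ← Finset.sum_range_reflect _ (k + 2)]
  rw [Finset.sum_congr rfl fun j hj => C.norm_face k j (by simpa [Nat.lt_succ_iff] using hj) x,
    ← map_sum, ← map_sum, ← norm_apply, ← C.norm_lam, norm_apply]
  refine Finset.sum_congr rfl fun i hi => ?_
  have := Finset.mem_range.1 hi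
  rw [show k + 2 - 1 - i = k + 1 - i by omega, h i (by omega), pow_succ, Module.End.mul_apply]

/-- The insertion of a unit is a contracting homotopy for `b'`. -/
theorem unit_b' (k : ℕ) (x : X (k + 1)) :
    C.unit (k + 1) (C.b' (k + 1) x) = x - C.b' k (C.unit k x) := by
  rw [b'_apply, Finset.sum_range_succ', map_add, C.unit_face_zero, map_sum, b'_apply,
    Finset.sum_congr rfl fun j hj => C.unit_face_succ k j (by simpa [Nat.lt_succ_iff] using hj) x,
    Finset.sum_neg_distrib]
  abel

theorem unit_b'_zero (x : X 0) : C.unit 0 (C.b' 0 x) = x := by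
  simp [b'_apply, C.unit_face_zero]

/-- The cancellation of faces of faces that gives `b² = 0`. -/
theorem sum_face_face (k n : ℕ) (hn : n ≤ k + 2) (x : X k) :
    ∑ j ∈ Finset.range (n + 1), C.face (k + 1) j (∑ i ∈ Finset.range n, C.face k i x) = 0 := by
  induction n with
  | zero => simp
  | succ n ih =>
    rw [Finset.sum_range_succ _ (n + 1)]
    simp only [Finset.sum_range_succ (fun i => C.face k i x) n, map_add, Finset.sum_add_distrib]
    rw [ih (by omega), map_sum, Finset.sum_congr rfl fun i hi => C.face_face' k i n
        (by have := Finset.mem_range.1 hi; omega) (by omega) x,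
      C.face_face' k n n le_rfl (by omega), Finset.sum_neg_distrib, Finset.sum_range_succ]
    abel

theorem b_b (k : ℕ) (x : X k) : C.b (k + 1) (C.b k x) = 0 := by
  rw [b_apply, b_apply]
  exact C.sum_face_face k (k + 2) le_rfl x

theorem b'_b' (k : ℕ) (x : X k) : C.b' (k + 1) (C.b' k x) = 0 := by
  rw [b'_apply, b'_apply]
  exact C.sum_face_face k (k + 1) (by omega) x

/-- A derivation of a cyclic object: a family of operators `D j`, each acting in the entry `j`. -/
structure Der where
  D : ∀ k, ℕ → (X k →ₗ[ℂ] X k)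
  lam_succ : ∀ k j, j < k → ∀ x, C.lam k (D k (j + 1) x) = D k j (C.lam k x)
  lam_zero : ∀ k x, C.lam k (D k 0 x) = D k k (C.lam k x)
  face_lt : ∀ k i j, i < j → j ≤ k → ∀ x, C.face k j (D k i x) = D (k + 1) i (C.face k j x)
  face_gt : ∀ k i j, j < i → i ≤ k → ∀ x, C.face k j (D k i x) = D (k + 1) (i + 1) (C.face k j x)
  face_eq : ∀ k j, j ≤ k → ∀ x,
    C.face k j (D k j x) = D (k + 1) j (C.face k j x) + D (k + 1) (j + 1) (C.face k j x)
  unit_succ : ∀ k j x, C.unit k (D (k + 1) (j + 1) x) = D k j (C.unit k x)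
  unit_zero : ∀ k x, C.unit k (D (k + 1) 0 x) = 0

namespace Der

variable {C} (D : C.Der)

/-- The Lie derivative. -/
def L (k : ℕ) : X k →ₗ[ℂ] X k := ∑ j ∈ Finset.range (k + 1), D.D k j

theorem L_apply (k : ℕ) (x : X k) : D.L k x = ∑ j ∈ Finset.range (k + 1), D.D k j x := by
  simp [L]

theorem L_lam (k : ℕ) (x : X k) : D.L k (C.lam k x) = C.lam k (D.L k x) := by
  rw [L_apply, L_apply, map_sum, Finset.sum_range_succ, Finset.sum_range_succ', D.lam_zero]
  congr 1
  exact Finset.sum_congr rfl fun j hj => (D.lam_succ k j (Finset.mem_range.1 hj) x).symm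

theorem face_last (k i : ℕ) (hi : i + 1 ≤ k) (x : X k) :
    C.face k (k + 1) (D.D k (i + 1) x) = D.D (k + 1) (i + 1) (C.face k (k + 1) x) := by
  rw [← C.lam_face_zero, D.face_gt k (i + 1) 0 (by omega) hi, D.lam_succ _ _ (by omega),
    C.lam_face_zero]

theorem face_last_zero (k : ℕ) (x : X k) :
    C.face k (k + 1) (D.D k 0 x) =
      D.D (k + 1) (k + 1) (C.face k (k + 1) x) + D.D (k + 1) 0 (C.face k (k + 1) x) := by
  rw [← C.lam_face_zero, D.face_eq k 0 (by omega), map_add, D.lam_zero,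
    D.lam_succ _ _ (by omega), C.lam_face_zero]

theorem L_face_of_le (k j : ℕ) (hj : j ≤ k) (x : X k) :
    D.L (k + 1) (C.face k j x) = C.face k j (D.L k x) := by
  rw [L_apply, L_apply, map_sum]
  have h1 : ∀ n ≤ j, ∑ i ∈ Finset.range n, C.face k j (D.D k i x) =
      ∑ i ∈ Finset.range n, D.D (k + 1) i (C.face k j x) := fun n hn =>
    Finset.sum_congr rfl fun i hi => D.face_lt k i j (by have := Finset.mem_range.1 hi; omega) hj x
  have h2 : ∀ n, j ≤ n → n ≤ k → ∑ i ∈ Finset.range (n + 1), C.face k j (D.D k i x) =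
      ∑ i ∈ Finset.range (n + 2), D.D (k + 1) i (C.face k j x) := by
    intro n hjn
    induction n, hjn using Nat.le_induction with
    | base =>
      intro _
      rw [Finset.sum_range_succ, h1 j le_rfl, D.face_eq k j hj, Finset.sum_range_succ,
        Finset.sum_range_succ]
      abel
    | succ n hjn ih =>
      intro hn
      rw [Finset.sum_range_succ, ih (by omega), D.face_gt k (n + 1) j (by omega) hn,
        ← Finset.sum_range_succ]
  exact (h2 k hj le_rfl).symm

theorem L_face (k j : ℕ) (hj : j ≤ k + 1) (x : X k) :
    D.L (k + 1) (C.face k j x) = C.face k j (D.L k x) := by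
  rcases hj.lt_or_eq with h | rfl
  · exact D.L_face_of_le k j (by omega) x
  · rw [← C.lam_face_zero, L_lam, D.L_face_of_le k 0 (by omega), C.lam_face_zero]

theorem L_b (k : ℕ) (x : X k) : D.L (k + 1) (C.b k x) = C.b k (D.L k x) := by
  rw [b_apply, b_apply, map_sum]
  exact Finset.sum_congr rfl fun j hj => D.L_face k j (by have := Finset.mem_range.1 hj; omega) x

theorem L_b' (k : ℕ) (x : X k) : D.L (k + 1) (C.b' k x) = C.b' k (D.L k x) := by
  rw [b'_apply, b'_apply, map_sum]
  exact Finset.sum_congr rfl fun j hj => D.L_face k j (by have := Finset.mem_range.1 hj; omega) x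

theorem L_lam_pow (k n : ℕ) (x : X k) : D.L k ((C.lam k ^ n) x) = (C.lam k ^ n) (D.L k x) := by
  induction n with
  | zero => rfl
  | succ n ih => rw [pow_succ', Module.End.mul_apply, L_lam, ih, Module.End.mul_apply]

theorem L_norm (k : ℕ) (x : X k) : D.L k (C.norm k x) = C.norm k (D.L k x) := by
  simp only [norm_apply, map_sum, L_lam_pow]

theorem L_unit (k : ℕ) (x : X (k + 1)) : D.L k (C.unit k x) = C.unit k (D.L (k + 1) x) := by
  rw [L_apply, L_apply, map_sum,
    Finset.sum_range_succ' (fun j => C.unit k (D.D (k + 1) j x)), D.unit_zero, add_zero]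
  exact Finset.sum_congr rfl fun j _ => (D.unit_succ k j x).symm

/-! ### The components of the Cartan homotopy

In the complex of pairs `(φ, ψ)`, with the differential
`(φ, ψ) ↦ (b φ + N ψ, (1 - λ) φ - b' ψ)`, the homotopy for the Lie derivative along a derivation
is `(φ, ψ) ↦ (e₂ φ + E ψ, e₁ φ)`. -/

/-- The component of the Cartan homotopy from the first to the second entry of a pair. -/
def e₁ (k : ℕ) : X k →ₗ[ℂ] X k := C.lam k ∘ₗ D.D k 0

/-- The contraction by the derivation: `± φ(D(a_{k+1}) a₀, a₁, …, a_k)`. -/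
def e₂ (k : ℕ) : X k →ₗ[ℂ] X (k + 1) := -(D.D (k + 1) (k + 1) ∘ₗ C.face k (k + 1))

/-- The component of the Cartan homotopy from the second to the first entry of a pair. -/
def E (k : ℕ) : X k →ₗ[ℂ] X k :=
  -∑ j ∈ Finset.range (k + 1), D.D k j ∘ₗ ∑ r ∈ Finset.range j, C.lam k ^ (k - r)

theorem e₁_apply (k : ℕ) (x : X k) : D.e₁ k x = C.lam k (D.D k 0 x) := rfl

theorem e₂_apply (k : ℕ) (x : X k) :
    D.e₂ k x = -D.D (k + 1) (k + 1) (C.face k (k + 1) x) := rfl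

theorem E_apply (k : ℕ) (x : X k) : D.E k x =
    -∑ j ∈ Finset.range (k + 1), D.D k j (∑ r ∈ Finset.range j, (C.lam k ^ (k - r)) x) := by
  simp [E]

/-- The contraction by a derivation anticommutes with `b`. -/
theorem b_e₂ (k : ℕ) (x : X k) :
    C.b (k + 1) (D.e₂ k x) + D.e₂ (k + 1) (C.b k x) = 0 := by
  rw [e₂_apply, map_neg, e₂_apply, ← neg_add, neg_eq_zero, b_apply, b_apply,
    Finset.sum_range_succ, Finset.sum_range_succ, map_sum, map_sum]
  set y := C.face k (k + 1) x
  have h1 : ∑ j ∈ Finset.range (k + 1), C.face (k + 1) j (D.D (k + 1) (k + 1) y) =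
      -∑ j ∈ Finset.range (k + 1), D.D (k + 2) (k + 2) (C.face (k + 1) (k + 2) (C.face k j x)) := by
    rw [← Finset.sum_neg_distrib]
    refine Finset.sum_congr rfl fun j hj => ?_
    have := Finset.mem_range.1 hj
    rw [D.face_gt (k + 1) (k + 1) j (by omega) le_rfl, C.face_face' k j (k + 1) (by omega) le_rfl,
      map_neg, neg_neg]
  have h2 : C.face (k + 1) (k + 1) y = -C.face (k + 1) (k + 2) y := by
    rw [C.face_face' k (k + 1) (k + 1) le_rfl le_rfl, neg_neg]
  rw [h1, D.face_eq (k + 1) (k + 1) le_rfl, D.face_last (k + 1) k le_rfl,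
    Finset.sum_range_succ _ (k + 1), h2, map_neg, map_neg]
  abel

/-- The component of the homotopy formula from the first to the second entry of a pair. -/
theorem e₂_sub_lam (k : ℕ) (x : X k) :
    D.e₂ k x - C.lam (k + 1) (D.e₂ k x) - C.b' k (D.e₁ k x) + D.e₁ (k + 1) (C.b k x) = 0 := by
  have h0 : D.D (k + 1) (k + 1) (C.face k (k + 1) x) =
      C.lam (k + 1) (D.D (k + 1) 0 (C.face k 0 x)) := by
    rw [D.lam_zero, C.lam_face_zero]
  have h1 : C.b' k (D.e₁ k x) + C.lam (k + 1) (C.face k 0 (D.D k 0 x)) =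
      C.lam (k + 1) (C.b k (D.D k 0 x)) := by
    rw [lam_b, e₁_apply, C.lam_face_zero]
    exact add_comm _ _
  have h2 : C.b k (D.D k 0 x) = D.D (k + 1) 0 (C.b k x) + D.D (k + 1) 1 (C.face k 0 x) +
      D.D (k + 1) (k + 1) (C.face k (k + 1) x) := by
    rw [b_apply, b_apply, Finset.sum_range_succ, Finset.sum_range_succ', map_sum,
      Finset.sum_range_succ, Finset.sum_range_succ' (fun j => D.D (k + 1) 0 (C.face k j x)),
      D.face_last_zero, D.face_eq k 0 (by omega),
      Finset.sum_congr rfl fun j hj => D.face_lt k 0 (j + 1) (by omega)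
        (by have := Finset.mem_range.1 hj; omega) x]
    abel
  have h3 := D.face_eq k 0 (by omega) x
  rw [zero_add] at h3
  rw [e₂_apply, e₁_apply D (k + 1), ← h0.symm, map_neg, eq_sub_of_add_eq h1, h2, h3]
  simp only [map_add, h0]
  abel

theorem lam_pow_D (k j : ℕ) (hj : j ≤ k) (x : X k) :
    (C.lam k ^ (j + 1)) (D.D k 0 x) = D.D k (k - j) ((C.lam k ^ (j + 1)) x) := by
  induction j with
  | zero => simp [D.lam_zero]
  | succ j ih =>
    rw [pow_succ', Module.End.mul_apply, ih (by omega), Module.End.mul_apply,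
      show k - j = k - (j + 1) + 1 by omega, D.lam_succ _ _ (by omega)]

/-- The homotopy formula at the first entry of a pair. -/
theorem norm_e₁ (k : ℕ) (x : X k) :
    C.norm k (D.e₁ k x) + D.E k (x - C.lam k x) = D.L k x := by
  have hE : D.E k (x - C.lam k x) =
      D.L k x - ∑ j ∈ Finset.range (k + 1), D.D k j ((C.lam k ^ (k + 1 - j)) x) := by
    rw [E_apply, L_apply, ← Finset.sum_neg_distrib, ← Finset.sum_sub_distrib]
    refine Finset.sum_congr rfl fun j hj => ?_
    have hj' := Finset.mem_range.1 hj
    rw [← map_neg, ← map_sub]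
    congr 1
    clear hj
    induction j with
    | zero => simp [C.lam_pow]
    | succ j ih =>
      rw [Finset.sum_range_succ, neg_add, ih (by omega), map_sub,
          ← Module.End.mul_apply _ (C.lam k),
        ← pow_succ, show k - j + 1 = k + 1 - j by omega, show k + 1 - (j + 1) = k - j by omega]
      abel
  have hN : C.norm k (D.e₁ k x) =
      ∑ j ∈ Finset.range (k + 1), D.D k j ((C.lam k ^ (k + 1 - j)) x) := by
    rw [norm_apply, ← Finset.sum_range_reflect]
    refine Finset.sum_congr rfl fun j hj => ?_
    have := Finset.mem_range.1 hj
    rw [e₁_apply, ← Module.End.mul_apply, ← pow_succ, D.lam_pow_D _ _ (by omega)]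
    congr 3 <;> omega
  rw [hE, hN]; abel

/-- The homotopy formula at the second entry of a pair. -/
theorem e₁_norm (k : ℕ) (x : X k) :
    D.e₁ k (C.norm k x) + (D.E k x - C.lam k (D.E k x)) = D.L k x := by
  have h1 : ∀ j ≤ k, C.lam k (∑ r ∈ Finset.range (j + 1), (C.lam k ^ (k - r)) x) =
      x + ∑ r ∈ Finset.range j, (C.lam k ^ (k - r)) x := by
    intro j hj
    rw [Finset.sum_range_succ', map_add, map_sum, Nat.sub_zero, ← Module.End.mul_apply,
      ← pow_succ', C.lam_pow, add_comm]
    congr 1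
    refine Finset.sum_congr rfl fun r hr => ?_
    have := Finset.mem_range.1 hr
    rw [← Module.End.mul_apply, ← pow_succ']
    congr 2; omega
  have h2 : x + ∑ r ∈ Finset.range k, (C.lam k ^ (k - r)) x = C.norm k x := by
    rw [← h1 k le_rfl, ← C.lam_norm, norm_apply, ← Finset.sum_range_reflect]
    congr 1
    refine Finset.sum_congr rfl fun r hr => ?_
    have := Finset.mem_range.1 hr
    congr 2; omega
  have h3 : C.lam k (D.E k x) = -∑ j ∈ Finset.range k,
      D.D k j (x + ∑ r ∈ Finset.range j, (C.lam k ^ (k - r)) x) := by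
    rw [E_apply, map_neg, map_sum, Finset.sum_range_succ']
    simp only [Finset.range_zero, Finset.sum_empty, map_zero, add_zero]
    congr 1
    refine Finset.sum_congr rfl fun j hj => ?_
    have := Finset.mem_range.1 hj
    rw [D.lam_succ k j this, h1 j (by omega)]
  rw [h3, E_apply, e₁_apply, D.lam_zero, C.lam_norm, ← h2, L_apply, Finset.sum_range_succ,
    Finset.sum_range_succ (fun j => D.D k j x)]
  simp only [map_add, Finset.sum_add_distrib]
  abel

end Der

end CyclicOps

/-! ### Operators on periodic total complexes -/

section TotOperators

variable {X Y Z : ℕ → Type*} [∀ k, AddCommGroup (X k)] [∀ k, Module ℂ (X k)]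
  [∀ k, AddCommGroup (Y k)] [∀ k, Module ℂ (Y k)] [∀ k, AddCommGroup (Z k)] [∀ k, Module ℂ (Z k)]

/-- The inclusion of `X k` at the place `(k + q, q)`. -/
def place (k : ℕ) (q : ℤ) : X k →ₗ[ℂ] Tot X ℤ :=
  DirectSum.lof ℂ (ℕ × ℤ) (fun p => X p.1) (k, q)

theorem Tot.hom_ext {M : Type*} [AddCommGroup M] [Module ℂ M] {f g : Tot X ℤ →ₗ[ℂ] M}
    (h : ∀ k q x, f (place k q x) = g (place k q x)) : f = g :=
  DirectSum.linearMap_ext ℂ fun p => LinearMap.ext fun x => h p.1 p.2 x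

theorem Tot.prod_hom_ext {M : Type*} [AddCommGroup M] [Module ℂ M]
    {f g : Tot X ℤ × Tot Y ℤ →ₗ[ℂ] M} (h₁ : ∀ k q x, f (place k q x, 0) = g (place k q x, 0))
    (h₂ : ∀ k q x, f (0, place k q x) = g (0, place k q x)) : f = g :=
  LinearMap.prod_ext (Tot.hom_ext fun k q x => h₁ k q x) (Tot.hom_ext fun k q x => h₂ k q x)

/-- The operator on total complexes given by maps `X k → Y (k + 1)`, with a shift of `q`. -/
def upMap (t : ℤ) (f : ∀ k, X k →ₗ[ℂ] Y (k + 1)) : Tot X ℤ →ₗ[ℂ] Tot Y ℤ :=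
  DirectSum.toModule ℂ (ℕ × ℤ) _ fun p => place (p.1 + 1) (p.2 + t) ∘ₗ f p.1

/-- The operator on total complexes given by maps `X k → Y k`, with a shift of `q`. -/
def idMap (t : ℤ) (f : ∀ k, X k →ₗ[ℂ] Y k) : Tot X ℤ →ₗ[ℂ] Tot Y ℤ :=
  DirectSum.toModule ℂ (ℕ × ℤ) _ fun p => place p.1 (p.2 + t) ∘ₗ f p.1

/-- The operator on total complexes given by maps `X (k + 1) → Y k`, with a shift of `q`. -/
def dnMap (t : ℤ) (f : ∀ k, X (k + 1) →ₗ[ℂ] Y k) : Tot X ℤ →ₗ[ℂ] Tot Y ℤ :=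
  DirectSum.toModule ℂ (ℕ × ℤ) _ fun p =>
    match p with
    | (0, _) => 0
    | (k + 1, q) => place k (q + t) ∘ₗ f k

@[simp] theorem upMap_place (t : ℤ) (f : ∀ k, X k →ₗ[ℂ] Y (k + 1)) (k : ℕ) (q : ℤ) (x : X k) :
    upMap t f (place k q x) = place (k + 1) (q + t) (f k x) := by
  rw [upMap, place]
  exact DirectSum.toModule_lof (M := fun p : ℕ × ℤ => X p.1) ℂ (k, q) x

@[simp] theorem idMap_place (t : ℤ) (f : ∀ k, X k →ₗ[ℂ] Y k) (k : ℕ) (q : ℤ) (x : X k) :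
    idMap t f (place k q x) = place k (q + t) (f k x) := by
  rw [idMap, place]
  exact DirectSum.toModule_lof (M := fun p : ℕ × ℤ => X p.1) ℂ (k, q) x

@[simp] theorem dnMap_place_zero (t : ℤ) (f : ∀ k, X (k + 1) →ₗ[ℂ] Y k) (q : ℤ) (x : X 0) :
    dnMap t f (place 0 q x) = 0 := by
  rw [dnMap, place]
  exact DirectSum.toModule_lof (M := fun p : ℕ × ℤ => X p.1) ℂ ((0 : ℕ), q) x

@[simp] theorem dnMap_place_succ (t : ℤ) (f : ∀ k, X (k + 1) →ₗ[ℂ] Y k) (k : ℕ) (q : ℤ)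
    (x : X (k + 1)) : dnMap t f (place (k + 1) q x) = place k (q + t) (f k x) := by
  rw [dnMap, place]
  exact DirectSum.toModule_lof (M := fun p : ℕ × ℤ => X p.1) ℂ (k + 1, q) x

theorem totalD_eq (b : ∀ k, X k →ₗ[ℂ] X (k + 1)) (B : ∀ k, X (k + 1) →ₗ[ℂ] X k)
    (d : ∀ k, X k →ₗ[ℂ] X k) :
    totalD ℤ b B d = upMap 0 b + dnMap 1 B + idMap 0 (fun k => (-1 : ℂ) ^ k • d k) := by
  refine Tot.hom_ext fun k q x => ?_
  cases k with
  | zero =>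
    simp only [LinearMap.add_apply, upMap_place, dnMap_place_zero, idMap_place, add_zero, pow_zero,
      one_smul]
    exact DirectSum.toModule_lof (M := fun p : ℕ × ℤ => X p.1) ℂ ((0 : ℕ), q) x
  | succ k =>
    simp only [LinearMap.add_apply, upMap_place, dnMap_place_succ, idMap_place, add_zero,
      LinearMap.smul_apply, map_smul]
    exact DirectSum.toModule_lof (M := fun p : ℕ × ℤ => X p.1) ℂ (k + 1, q) x

end TotOperators

/-! ### The comparison with the bicomplex of a nonunital algebra

For a cyclic object `C` the complex with the differential `b + B` is compared with the complex of
pairs `(φ, ψ)`, where `ψ ∈ X k` is placed like an element of `X (k + 1)`. If `X` consists of the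
functionals on an algebra, the pairs are the normalized cochains of the algebra with a unit
adjoined, so that the complex of pairs is functorial for nonunital homomorphisms. -/

namespace CyclicOps

variable {X : ℕ → Type*} [∀ k, AddCommGroup (X k)] [∀ k, Module ℂ (X k)] (C : CyclicOps X)

/-- Connes' operator `B`. -/
def B (k : ℕ) : X (k + 1) →ₗ[ℂ] X k :=
  C.norm k ∘ₗ C.unit k ∘ₗ (LinearMap.id - C.lam (k + 1))

theorem B_apply (k : ℕ) (x : X (k + 1)) :
    C.B k x = C.norm k (C.unit k (x - C.lam (k + 1) x)) := rfl

variable {C}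

/-- The summand of the total differential that comes from a derivation of degree one. -/
def Der.signed (Δ : C.Der) (k : ℕ) : X k →ₗ[ℂ] X k := (-1 : ℂ) ^ k • Δ.L k

/-- The differential of the `(b, B)`-complex. -/
def unitalD (Δ : C.Der) : Tot X ℤ →ₗ[ℂ] Tot X ℤ :=
  upMap 0 C.b + dnMap 1 C.B + idMap 0 Δ.signed

/-- The differential of the complex of pairs. -/
def pairD (Δ : C.Der) : Tot X ℤ × Tot X ℤ →ₗ[ℂ] Tot X ℤ × Tot X ℤ :=
  LinearMap.prod
    ((upMap 0 C.b + idMap 0 Δ.signed).coprod (idMap 1 C.norm))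
    ((idMap 0 fun k => LinearMap.id - C.lam k).coprod (-upMap 0 C.b' - idMap 0 Δ.signed))

theorem pairD_apply (Δ : C.Der) (φ ψ : Tot X ℤ) : pairD Δ (φ, ψ) =
    (upMap 0 C.b φ + idMap 0 Δ.signed φ + idMap 1 C.norm ψ,
      idMap 0 (fun k => LinearMap.id - C.lam k) φ + (-upMap 0 C.b' ψ - idMap 0 Δ.signed ψ)) := rfl

/-- The derivation is a differential. -/
def Der.SquareZero (Δ : C.Der) : Prop := ∀ k x, Δ.L k (Δ.L k x) = 0

theorem Der.signed_apply (Δ : C.Der) (k : ℕ) (x : X k) : Δ.signed k x = (-1 : ℂ) ^ k • Δ.L k x :=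
  rfl

theorem pairD_pairD {Δ : C.Der} (hΔ : Δ.SquareZero) (z : Tot X ℤ × Tot X ℤ) :
    pairD Δ (pairD Δ z) = 0 := by
  suffices h : pairD Δ ∘ₗ pairD Δ = 0 from LinearMap.congr_fun h z
  refine Tot.prod_hom_ext (fun k q x => ?_) (fun k q x => ?_)
  · simp only [LinearMap.comp_apply, pairD_apply, LinearMap.zero_apply, map_zero, upMap_place,
      idMap_place, map_add, add_zero, sub_zero, neg_zero, LinearMap.sub_apply, LinearMap.id_apply,
      Prod.mk_eq_zero, Der.signed_apply]
    constructor
    · simp only [C.b_b, map_sub, map_smul, Der.L_b, hΔ k, smul_zero, map_zero, C.norm_lam,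
        pow_succ]
      module
    · rw [C.lam_b, C.b_eq]
      simp only [map_sub, map_add, map_smul, Der.L_lam]
      module
  · simp only [LinearMap.comp_apply, pairD_apply, LinearMap.zero_apply, map_zero, upMap_place,
      idMap_place, add_zero, zero_add, LinearMap.sub_apply, LinearMap.id_apply, map_neg,
      map_sub, Prod.mk_eq_zero, Der.signed_apply, C.norm_b', C.lam_norm, C.b'_b', Der.L_norm,
      map_smul, hΔ k, smul_zero, pow_succ, Der.L_b']
    constructor <;> module

/-- The map from the `(b, B)`-complex to the complex of pairs. -/
def toPair (C : CyclicOps X) : Tot X ℤ →ₗ[ℂ] Tot X ℤ × Tot X ℤ :=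
  LinearMap.prod LinearMap.id (dnMap 0 fun k => C.unit k ∘ₗ (LinearMap.id - C.lam (k + 1)))

/-- The map from the complex of pairs to the `(b, B)`-complex. -/
def ofPair (C : CyclicOps X) : Tot X ℤ × Tot X ℤ →ₗ[ℂ] Tot X ℤ :=
  LinearMap.coprod LinearMap.id (dnMap 1 fun k => C.norm k ∘ₗ C.unit k)

theorem toPair_apply (φ : Tot X ℤ) : C.toPair φ =
    (φ, dnMap 0 (fun k => C.unit k ∘ₗ (LinearMap.id - C.lam (k + 1))) φ) := rfl

theorem ofPair_apply (φ ψ : Tot X ℤ) :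
    C.ofPair (φ, ψ) = φ + dnMap 1 (fun k => C.norm k ∘ₗ C.unit k) ψ := rfl

theorem toPair_unitalD (Δ : C.Der) (c : Tot X ℤ) :
    C.toPair (unitalD Δ c) = pairD Δ (C.toPair c) := by
  suffices h : C.toPair ∘ₗ unitalD Δ = pairD Δ ∘ₗ C.toPair from LinearMap.congr_fun h c
  refine Tot.hom_ext fun k q x => ?_
  rcases k with _ | _ | k
  · simp only [unitalD, LinearMap.comp_apply, LinearMap.add_apply, toPair_apply, pairD_apply,
      upMap_place, idMap_place, dnMap_place_zero, dnMap_place_succ, map_zero, add_zero, neg_zero,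
      sub_zero, map_add, Prod.mk_add_mk, LinearMap.sub_apply, LinearMap.id_apply, C.b_sub_lam,
      C.unit_b'_zero]
  · simp only [unitalD, LinearMap.comp_apply, LinearMap.add_apply, toPair_apply, pairD_apply,
      upMap_place, idMap_place, dnMap_place_zero, dnMap_place_succ, add_zero,
      map_add, LinearMap.sub_apply, LinearMap.id_apply, C.b_sub_lam, C.unit_b', B_apply,
      Der.signed_apply, map_sub, map_smul, Der.L_lam, Der.L_unit, pow_succ, Prod.mk_add_mk,
      Prod.smul_mk, Prod.mk_sub_mk, Prod.mk.injEq]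
    constructor <;> module
  · simp only [unitalD, LinearMap.comp_apply, LinearMap.add_apply, toPair_apply, pairD_apply,
      upMap_place, idMap_place, dnMap_place_succ, add_zero,
      map_add, LinearMap.sub_apply, LinearMap.id_apply, C.b_sub_lam, C.unit_b', B_apply,
      C.lam_norm, sub_self, map_zero, Prod.mk_add_mk, Prod.smul_mk, Prod.mk_sub_mk,
      Der.signed_apply, map_sub, map_smul, Der.L_lam, Der.L_unit, pow_succ, Prod.mk.injEq]
    constructor <;> module

theorem ofPair_pairD (Δ : C.Der) (z : Tot X ℤ × Tot X ℤ) :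
    C.ofPair (pairD Δ z) = unitalD Δ (C.ofPair z) := by
  suffices h : C.ofPair ∘ₗ pairD Δ = unitalD Δ ∘ₗ C.ofPair from LinearMap.congr_fun h z
  refine Tot.prod_hom_ext (fun k q x => ?_) (fun k q x => ?_)
  · rcases k with _ | k
    all_goals
    simp only [unitalD, LinearMap.comp_apply, LinearMap.add_apply, ofPair_apply, pairD_apply,
      upMap_place, idMap_place, dnMap_place_succ, dnMap_place_zero, add_zero, map_zero, neg_zero,
      LinearMap.sub_apply, LinearMap.id_apply, B_apply, sub_zero, map_sub]
    all_goals module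
  · rcases k with _ | k
    · simp only [unitalD, LinearMap.comp_apply, ofPair_apply, pairD_apply,
        upMap_place, idMap_place, dnMap_place_succ, dnMap_place_zero, add_zero, map_zero,
        map_add, sub_zero, map_sub, map_neg,
        C.unit_b'_zero]
      module
    · simp only [unitalD, LinearMap.comp_apply, LinearMap.add_apply, ofPair_apply, pairD_apply,
        upMap_place, idMap_place, dnMap_place_succ, add_zero, map_zero,
        map_sub, map_neg,
        C.unit_b', C.norm_b', Der.signed_apply, map_smul, Der.L_norm, Der.L_unit, zero_add,
        pow_succ]
      rcases k with _ | k
      · simp only [dnMap_place_zero]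
        module
      · simp only [dnMap_place_succ, B_apply, C.lam_norm, sub_self, map_zero]
        module

/-- The composition of the two comparison maps is unipotent. -/
theorem ofPair_toPair_eq {c e : Tot X ℤ} (h : C.ofPair (C.toPair c) = e) :
    c = e - dnMap 1 (fun k => C.norm k ∘ₗ C.unit k)
      (dnMap 0 (fun k => C.unit k ∘ₗ (LinearMap.id - C.lam (k + 1))) e) := by
  set R : Tot X ℤ →ₗ[ℂ] Tot X ℤ := dnMap 1 (fun k => C.norm k ∘ₗ C.unit k) ∘ₗ
    dnMap 0 (fun k => C.unit k ∘ₗ (LinearMap.id - C.lam (k + 1))) with hR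
  have hRR : R ∘ₗ R = 0 := by
    refine Tot.hom_ext fun k q x => ?_
    rcases k with _ | _ | _ | k <;>
      simp [hR, C.lam_norm]
  have h1 : c + R c = e := h
  change c = e - R e
  rw [← h1, map_add, show R (R c) = 0 from LinearMap.congr_fun hRR c]
  abel

theorem unitalD_unitalD {Δ : C.Der} (hΔ : Δ.SquareZero) (c : Tot X ℤ) :
    unitalD Δ (unitalD Δ c) = 0 := by
  have h : C.toPair (unitalD Δ (unitalD Δ c)) = 0 := by
    rw [toPair_unitalD, toPair_unitalD, pairD_pairD hΔ]
  exact congrArg Prod.fst h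

/-! ### The Cartan homotopy formula -/

/-- The Lie derivative on pairs. -/
def pairL (D : C.Der) : Tot X ℤ × Tot X ℤ →ₗ[ℂ] Tot X ℤ × Tot X ℤ :=
  LinearMap.prodMap (idMap 0 D.L) (idMap 0 D.L)

/-- The Cartan homotopy on pairs. -/
def pairH (D : C.Der) : Tot X ℤ × Tot X ℤ →ₗ[ℂ] Tot X ℤ × Tot X ℤ :=
  LinearMap.prod ((upMap (-1) D.e₂).coprod (idMap 0 D.E)) (idMap (-1) D.e₁ ∘ₗ LinearMap.fst _ _ _)

theorem pairL_apply (D : C.Der) (φ ψ : Tot X ℤ) :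
    pairL D (φ, ψ) = (idMap 0 D.L φ, idMap 0 D.L ψ) := rfl

theorem pairH_apply (D : C.Der) (φ ψ : Tot X ℤ) :
    pairH D (φ, ψ) = (upMap (-1) D.e₂ φ + idMap 0 D.E ψ, idMap (-1) D.e₁ φ) := rfl

/-- The error term of the homotopy formula. It maps a pair to a component on which it vanishes, so
that its square is zero, and need not be known further. -/
def pairQ (D : C.Der) : Tot X ℤ × Tot X ℤ →ₗ[ℂ] Tot X ℤ × Tot X ℤ :=
  LinearMap.inl _ _ _ ∘ₗ (upMap (-1) D.e₂ ∘ₗ idMap 1 C.norm + upMap 0 C.b ∘ₗ idMap 0 D.E -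
    idMap 0 D.E ∘ₗ upMap 0 C.b') ∘ₗ LinearMap.snd _ _ _

theorem pairQ_pairQ (D : C.Der) (z : Tot X ℤ × Tot X ℤ) : pairQ D (pairQ D z) = 0 := by
  simp [pairQ]

/-- The derivations commute in every pair of entries. -/
def Der.Commutes (D Δ : C.Der) : Prop :=
  ∀ k i j x, D.D k i (Δ.D k j x) = Δ.D k j (D.D k i x)

namespace Der

variable {D Δ : C.Der}

theorem Commutes.D_L (h : D.Commutes Δ) (k i : ℕ) (x : X k) :
    D.D k i (Δ.L k x) = Δ.L k (D.D k i x) := by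
  simp only [L_apply, map_sum, h k i]

theorem Commutes.e₁_L (h : D.Commutes Δ) (k : ℕ) (x : X k) :
    D.e₁ k (Δ.L k x) = Δ.L k (D.e₁ k x) := by
  simp only [e₁_apply, h.D_L, L_lam]

theorem Commutes.e₂_L (h : D.Commutes Δ) (k : ℕ) (x : X k) :
    D.e₂ k (Δ.L k x) = Δ.L (k + 1) (D.e₂ k x) := by
  simp only [e₂_apply, ← L_face Δ k (k + 1) le_rfl, h.D_L, map_neg]

theorem Commutes.E_L (h : D.Commutes Δ) (k : ℕ) (x : X k) :
    D.E k (Δ.L k x) = Δ.L k (D.E k x) := by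
  simp only [E_apply, ← L_lam_pow, ← map_sum, h.D_L, map_neg]

end Der

/-- The Cartan homotopy formula on pairs, up to an error term of square zero. -/
theorem pairD_pairH {D Δ : C.Der} (h : D.Commutes Δ) (z : Tot X ℤ × Tot X ℤ) :
    pairD Δ (pairH D z) + pairH D (pairD Δ z) = pairL D z + pairQ D z := by
  suffices h : pairD Δ ∘ₗ pairH D + pairH D ∘ₗ pairD Δ = pairL D + pairQ D from
    LinearMap.congr_fun h z
  refine Tot.prod_hom_ext (fun k q x => ?_) (fun k q x => ?_)
  · have h1 := D.b_e₂ k x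
    have h2 := D.e₂_sub_lam k x
    have h3 := D.norm_e₁ k x
    simp only [LinearMap.comp_apply, LinearMap.add_apply, pairD_apply, pairH_apply, pairL_apply,
      pairQ, LinearMap.sub_apply, LinearMap.id_apply, LinearMap.snd_apply,
      upMap_place, idMap_place, map_zero, map_add, add_zero, Der.signed_apply, map_smul, sub_zero,
      h.e₁_L, h.e₂_L, Prod.mk_add_mk, Prod.mk.injEq, pow_succ, neg_add_cancel_right,
      map_sub] at h1 h2 h3 ⊢
    rw [← h3, eq_neg_of_add_eq_zero_left h1, eq_neg_of_add_eq_zero_right h2]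
    simp only [map_add, map_neg, map_sub, map_zero, neg_zero]
    constructor <;> module
  · have h4 := D.e₁_norm k x
    simp only [LinearMap.comp_apply, LinearMap.add_apply, pairD_apply, pairH_apply, pairL_apply,
      pairQ, LinearMap.sub_apply, LinearMap.id_apply, LinearMap.inl_apply, LinearMap.snd_apply,
      upMap_place, idMap_place, map_zero, map_add, add_zero, zero_add, Der.signed_apply, map_smul,
      map_neg, add_neg_cancel_right,
      sub_zero, h.E_L, Prod.mk_add_mk,
      map_sub] at h4 ⊢
    rw [← h4]
    simp only [map_add, map_sub, Prod.mk_add_mk, Prod.mk_sub_mk, Prod.mk.injEq]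
    constructor <;> module

theorem pairD_pairL (D Δ : C.Der) (h : D.Commutes Δ) (z : Tot X ℤ × Tot X ℤ) :
    pairD Δ (pairL D z) = pairL D (pairD Δ z) := by
  suffices h : pairD Δ ∘ₗ pairL D = pairL D ∘ₗ pairD Δ from LinearMap.congr_fun h z
  have hL : ∀ k x, D.L k (Δ.L k x) = Δ.L k (D.L k x) := fun k x => by
    rw [D.L_apply, D.L_apply, map_sum]
    exact Finset.sum_congr rfl fun j _ => h.D_L k j x
  refine Tot.prod_hom_ext (fun k q x => ?_) (fun k q x => ?_) <;>
  simp only [LinearMap.comp_apply, pairD_apply, pairL_apply, LinearMap.sub_apply,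
    LinearMap.id_apply, upMap_place, idMap_place, map_zero, map_add, map_neg, map_sub, add_zero,
    Der.signed_apply, map_smul, Der.L_b, Der.L_b', Der.L_norm, Der.L_lam, hL]

theorem pairL_pairQ (D : C.Der) (h : D.Commutes D) (z : Tot X ℤ × Tot X ℤ) :
    pairL D (pairQ D z) = pairQ D (pairL D z) := by
  suffices h : pairL D ∘ₗ pairQ D = pairQ D ∘ₗ pairL D from LinearMap.congr_fun h z
  refine Tot.prod_hom_ext (fun k q x => ?_) (fun k q x => ?_)
  · simp [pairQ, pairL_apply]
  · simp only [LinearMap.comp_apply, LinearMap.add_apply, pairL_apply,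
      pairQ, LinearMap.sub_apply, LinearMap.inl_apply, LinearMap.snd_apply,
      upMap_place, idMap_place, map_zero, map_add, add_zero, map_sub, h.E_L, Der.L_b]
    simp only [← Der.L_norm, ← Der.L_b', h.E_L, h.e₂_L]

/-- A cocycle in the image of the square of the Lie derivative is a coboundary. -/
theorem pairL_pairL_eq_pairD {D Δ : C.Der} (hΔ : Δ.SquareZero) (h : D.Commutes Δ)
    (h' : D.Commutes D) {y : Tot X ℤ × Tot X ℤ} (hy : pairD Δ y = 0) :
    pairL D (pairL D y) = pairD Δ (pairH D (pairL D y - pairQ D y)) := by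
  have hL : pairD Δ (pairL D y) = 0 := by rw [pairD_pairL D Δ h, hy, map_zero]
  have h1 := pairD_pairH h y
  rw [hy, map_zero, add_zero] at h1
  have hQ : pairD Δ (pairQ D y) = 0 := by
    rw [← sub_eq_of_eq_add' h1, map_sub, pairD_pairD hΔ, hL, sub_zero]
  have h2 := pairD_pairH h (pairL D y)
  have h3 := pairD_pairH h (pairQ D y)
  rw [hL, map_zero, add_zero] at h2
  rw [hQ, map_zero, add_zero, pairQ_pairQ, add_zero] at h3
  rw [map_sub, map_sub, h2, h3, pairL_pairQ D h']
  abel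

end CyclicOps

/-! ### The periodic complex of a graded algebra as a cyclic object -/

section FunctionalOps

variable {A : Type*} [Ring A] [Algebra ℂ A] (𝒜 : ℤ → Submodule ℂ A) [GradedAlgebra 𝒜]

/-- The signed faces of the cyclic object of functionals. -/
def signedFace (k j : ℕ) : Functional A k →ₗ[ℂ] Functional A (k + 1) :=
  if h : j < k + 1 then (-1 : ℂ) ^ j • mulAt ⟨j, h⟩
  else (-1 : ℂ) ^ (k + 1) • (cyclicOp 𝒜 (k + 1) ∘ₗ mulAt 0)

theorem signedFace_of_le {k j : ℕ} (h : j ≤ k) (φ : Functional A k) :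
    signedFace 𝒜 k j φ = (-1 : ℂ) ^ j • mulAt (⟨j, Nat.lt_succ_iff.2 h⟩ : Fin (k + 1)) φ := by
  rw [signedFace, dif_pos (Nat.lt_succ_iff.2 h), LinearMap.smul_apply]

theorem signedFace_last (k : ℕ) (φ : Functional A k) :
    signedFace 𝒜 k (k + 1) φ = (-1 : ℂ) ^ (k + 1) • cyclicOp 𝒜 (k + 1) (mulAt 0 φ) := by
  rw [signedFace, dif_neg (by omega), LinearMap.smul_apply, LinearMap.comp_apply]

/-- The cyclic object of functionals on a graded algebra. -/
def functionalOps : CyclicOps (Functional A) where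
  lam k := (-1 : ℂ) ^ k • cyclicOp 𝒜 k
  face := signedFace 𝒜
  unit := unitFront 𝒜
  lam_pow k φ := by
    rw [smul_pow, LinearMap.smul_apply, cyclicOp_pow, ← pow_mul,
      (Nat.even_mul_succ_self k).neg_one_pow, one_smul]
  lam_face_succ k j hj φ := by
    rw [signedFace_of_le 𝒜 hj, signedFace_of_le 𝒜 (by omega), LinearMap.smul_apply, map_smul,
      cyclicOp_mulAt 𝒜 hj, LinearMap.smul_apply, map_smul, smul_smul, smul_smul, ← pow_add,
      ← pow_add, show k + 1 + (j + 1) = j + k + 2 by ring, pow_add _ _ 2]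
    norm_num
  lam_face_zero k φ := by
    rw [signedFace_of_le 𝒜 (Nat.zero_le _), signedFace_last, pow_zero, one_smul]; rfl
  face_face k i j hij hj φ := by
    rw [signedFace_of_le 𝒜 (hij.trans hj), signedFace_of_le 𝒜 hj,
      signedFace_of_le 𝒜 (Nat.succ_le_succ hj), signedFace_of_le 𝒜 (by omega), map_smul, map_smul,
      mulAt_mulAt hij hj, smul_smul, smul_smul, pow_succ]
    module
  unit_face_zero k φ := by
    rw [signedFace_of_le 𝒜 (Nat.zero_le _), pow_zero, one_smul]
    exact unitFront_mulAt_zero 𝒜 φ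
  unit_face_succ k j hj φ := by
    rw [signedFace_of_le 𝒜 hj, signedFace_of_le 𝒜 (Nat.succ_le_succ hj), map_smul,
      unitFront_mulAt_succ 𝒜 hj, pow_succ]
    module

variable {𝒜}

/-- The action of a graded derivation on functionals. -/
def functionalDer {c : ℤ} (hc : c = 0 ∨ c = 1) {d : A →ₗ[ℂ] A} (hd : IsGradedDerivation 𝒜 c d)
    (h1 : d 1 = 0) : (functionalOps 𝒜).Der where
  D := slotDer 𝒜 c d
  lam_succ k j hj φ := by
    change ((-1 : ℂ) ^ k • cyclicOp 𝒜 k) _ = slotDer 𝒜 c d k j (((-1 : ℂ) ^ k • cyclicOp 𝒜 k) φ)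
    rw [LinearMap.smul_apply, slotDer_cyclicOp_succ hc hd hj, LinearMap.smul_apply, map_smul]
  lam_zero k φ := by
    change ((-1 : ℂ) ^ k • cyclicOp 𝒜 k) _ = slotDer 𝒜 c d k k (((-1 : ℂ) ^ k • cyclicOp 𝒜 k) φ)
    rw [LinearMap.smul_apply, slotDer_cyclicOp_zero hc hd, LinearMap.smul_apply, map_smul]
  face_lt k i j hij hj φ := by
    change signedFace 𝒜 k j _ = slotDer 𝒜 c d _ _ (signedFace 𝒜 k j φ)
    rw [signedFace_of_le 𝒜 hj, signedFace_of_le 𝒜 hj, slotDer_mulAt_lt hij hj, map_smul]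
  face_gt k i j hij hi φ := by
    change signedFace 𝒜 k j _ = slotDer 𝒜 c d _ _ (signedFace 𝒜 k j φ)
    rw [signedFace_of_le 𝒜 (hij.le.trans hi), signedFace_of_le 𝒜 (hij.le.trans hi),
      slotDer_mulAt_gt hij hi, map_smul]
  face_eq k j hj φ := by
    change signedFace 𝒜 k j _ = slotDer 𝒜 c d _ _ (signedFace 𝒜 k j φ) +
      slotDer 𝒜 c d _ _ (signedFace 𝒜 k j φ)
    rw [signedFace_of_le 𝒜 hj, signedFace_of_le 𝒜 hj, slotDer_mulAt_eq hd hj, map_smul, map_smul,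
      smul_add]
  unit_succ k j φ := slotDer_unitFront φ
  unit_zero k φ := slotDer_unitFront_zero h1 φ

theorem IsDGAlgebra.isGradedDerivation {d : A →ₗ[ℂ] A} (hd : IsDGAlgebra 𝒜 d) :
    IsGradedDerivation 𝒜 1 d where
  map_mul := hd.d_mul 𝒜
  map_koszul := hd.d_koszul 𝒜 1

/-- The derivation of the cyclic object given by the differential of a DG algebra. -/
def diffDer {d : A →ₗ[ℂ] A} (hd : IsDGAlgebra 𝒜 d) : (functionalOps 𝒜).Der :=
  functionalDer (Or.inr rfl) hd.isGradedDerivation (hd.d_one 𝒜)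

theorem functionalb_eq (k : ℕ) : functionalb 𝒜 k = (functionalOps 𝒜).b k := by
  rw [CyclicOps.b, Finset.sum_range_succ, Finset.sum_range, functionalb]
  refine congrArg₂ (· + ·) (Finset.sum_congr rfl fun j _ => ?_) ?_
  · refine LinearMap.ext fun φ => ?_
    exact (signedFace_of_le 𝒜 (Nat.lt_succ_iff.1 j.2) φ).symm
  · refine LinearMap.ext fun φ => ?_
    exact (signedFace_last 𝒜 k φ).symm

theorem connesB_eq (k : ℕ) :
    connesB (cyclicOp 𝒜) insertOne k = (functionalOps 𝒜).B k := by
  rw [connesB, CyclicOps.B, CyclicOps.norm]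
  congr 1
  refine Finset.sum_congr rfl fun j _ => ?_
  change _ = ((-1 : ℂ) ^ k • cyclicOp 𝒜 k) ^ j
  rw [smul_pow, ← pow_mul, mul_comm]

theorem functionald_eq {d : A →ₗ[ℂ] A} (hd : IsDGAlgebra 𝒜 d) (k : ℕ) :
    functionald 𝒜 d k = (diffDer hd).L k := by
  rw [CyclicOps.Der.L, Finset.sum_range, functionald]
  refine Finset.sum_congr rfl fun j _ => LinearMap.ext fun φ => Functional.ext_seq fun a => ?_
  change _ = (slotDer 𝒜 1 d k j φ).seq a
  rw [slotDer_seq]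
  refine φ.congr_arg (funext fun l => ?_)
  simp only [Fin.lt_def, Fin.ext_iff]
  split_ifs <;> rfl

theorem periodicD_eq {d : A →ₗ[ℂ] A} (hd : IsDGAlgebra 𝒜 d) :
    periodicD 𝒜 d = CyclicOps.unitalD (diffDer hd) := by
  have hb : functionalb 𝒜 = (functionalOps 𝒜).b := funext functionalb_eq
  have hB : connesB (cyclicOp 𝒜) insertOne = (functionalOps 𝒜).B := funext connesB_eq
  have hs : (fun k => (-1 : ℂ) ^ k • functionald 𝒜 d k) = (diffDer hd).signed :=
    funext fun k => by rw [functionald_eq hd]; rfl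
  rw [periodicD, totalD_eq, hb, hB, hs]; rfl

theorem slotDer_comm {c : ℤ} {d d' : A →ₗ[ℂ] A} (hd : ∀ a, d (koszul 𝒜 c a) = koszul 𝒜 c (d a))
    (hdd' : ∀ a, d (d' a) = d' (d a)) (k i j : ℕ) (φ : Functional A k) :
    slotDer 𝒜 0 d k i (slotDer 𝒜 c d' k j φ) = slotDer 𝒜 c d' k j (slotDer 𝒜 0 d k i φ) := by
  refine Functional.ext_seq fun a => ?_
  simp only [slotDer_seq, koszul_zero, LinearMap.id_apply]
  refine φ.seq_congr fun l _ => ?_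
  split_ifs <;> first | rfl | omega | simp [hd, hdd']

theorem diffDer_squareZero {d : A →ₗ[ℂ] A} (hd : IsDGAlgebra 𝒜 d) : (diffDer hd).SquareZero := by
  intro k φ
  have hlt : ∀ i j, i < j → j ≤ k → slotDer 𝒜 1 d k j (slotDer 𝒜 1 d k i φ) =
      -slotDer 𝒜 1 d k i (slotDer 𝒜 1 d k j φ) := by
    intro i j hij hj
    refine Functional.ext_seq fun a => ?_
    simp only [slotDer_seq, Functional.neg_seq]
    have h := φ.seq_smul_at i (by omega) (fun l => if l < i then a l else
      if l < j then koszul 𝒜 1 (a l) else if l = j then d (a l) else a l) (-1)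
      (koszul 𝒜 1 (d (a i)))
    rw [neg_one_mul] at h
    refine Eq.trans (φ.seq_congr fun l _ => ?_) (h.trans (congrArg _ (φ.seq_congr fun l _ => ?_)))
    all_goals
      rcases lt_trichotomy l i with h | rfl | h
      · simp [h, h.ne, h.trans hij, koszul_koszul]
      · simp [hij, hd.d_koszul 𝒜 1]
      · simp [show ¬ l < i by omega, show l ≠ i by omega]
  have heq : ∀ i ≤ k, slotDer 𝒜 1 d k i (slotDer 𝒜 1 d k i φ) = 0 := by
    intro i hi
    refine Functional.ext_seq fun a => ?_
    simp only [slotDer_seq]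
    exact φ.seq_zero_at i hi _ (by simp [hd.d_d])
  have hn : ∀ n ≤ k + 1, ∑ i ∈ Finset.range n, slotDer 𝒜 1 d k i
      (∑ j ∈ Finset.range n, slotDer 𝒜 1 d k j φ) = 0 := by
    intro n hn
    induction n with
    | zero => simp
    | succ n ih =>
      simp only [Finset.sum_range_succ (fun j => slotDer 𝒜 1 d k j φ) n, map_add,
        Finset.sum_add_distrib]
      rw [Finset.sum_range_succ, Finset.sum_range_succ, ih (by omega), heq n (by omega), map_sum,
        Finset.sum_congr rfl fun i hi => hlt i n (Finset.mem_range.1 hi) (by omega),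
        Finset.sum_neg_distrib]
      abel
  rw [CyclicOps.Der.L_apply, CyclicOps.Der.L_apply]
  exact hn (k + 1) le_rfl

end FunctionalOps

/-! ### Graded subspaces of total complexes -/

section GradedSub

variable {X Y : ℕ → Type*} [∀ k, AddCommGroup (X k)] [∀ k, Module ℂ (X k)]
  [∀ k, AddCommGroup (Y k)] [∀ k, Module ℂ (Y k)]

/-- The cochains of total degree `j` whose component at the place `(k + q, q)` lies in
`𝒱 m k`, where `m = k + 2 q - j` is its weight. -/
def gradedSub (𝒱 : ℤ → ∀ k, Submodule ℂ (X k)) (j : ℤ) : Submodule ℂ (Tot X ℤ) :=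
  ⨅ p : ℕ × ℤ, (𝒱 (p.1 + 2 * p.2 - j) p.1).comap
    (DirectSum.component ℂ (ℕ × ℤ) (fun p => X p.1) p)

variable {𝒱 𝒱₁ 𝒱₂ : ℤ → ∀ k, Submodule ℂ (X k)} {𝒲 : ℤ → ∀ k, Submodule ℂ (Y k)}

theorem mem_gradedSub {j : ℤ} {c : Tot X ℤ} :
    c ∈ gradedSub 𝒱 j ↔ ∀ (k : ℕ) (q : ℤ), c (k, q) ∈ 𝒱 (k + 2 * q - j) k := by
  simp only [gradedSub, Submodule.mem_iInf, Submodule.mem_comap, Prod.forall]; rfl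

theorem place_mem_gradedSub {j : ℤ} {k : ℕ} {q : ℤ} {x : X k} (hx : x ∈ 𝒱 (k + 2 * q - j) k) :
    place k q x ∈ gradedSub 𝒱 j := by
  rw [mem_gradedSub]
  intro k' q'
  by_cases h : (k, q) = (k', q')
  · cases h
    rw [place, DirectSum.lof_eq_of, DirectSum.of_eq_same]
    exact hx
  · rw [place, DirectSum.lof_eq_of, DirectSum.of_eq_of_ne _ _ _ (Ne.symm h)]
    exact Submodule.zero_mem _

/-- A linear condition on the cochains of degree `j` may be checked at every place. -/
theorem mem_of_mem_gradedSub {M : Type*} [AddCommGroup M] [Module ℂ M] {f : Tot X ℤ →ₗ[ℂ] M}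
    {N : Submodule ℂ M} {j : ℤ}
    (h : ∀ (k : ℕ) (q : ℤ), ∀ x ∈ 𝒱 (k + 2 * q - j) k, f (place k q x) ∈ N) {c : Tot X ℤ}
    (hc : c ∈ gradedSub 𝒱 j) : f c ∈ N := by
  classical
  rw [mem_gradedSub] at hc
  rw [← DirectSum.sum_support_of c, map_sum]
  exact Submodule.sum_mem _ fun p _ => h p.1 p.2 _ (hc p.1 p.2)

theorem upMap_mem {r t j j' : ℤ} {f : ∀ k, X k →ₗ[ℂ] Y (k + 1)}
    (hf : ∀ m k, ∀ x ∈ 𝒱 m k, f k x ∈ 𝒲 (m + r) (k + 1)) (hj : j' = j + 1 + 2 * t - r)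
    {c : Tot X ℤ} (hc : c ∈ gradedSub 𝒱 j) : upMap t f c ∈ gradedSub 𝒲 j' := by
  refine mem_of_mem_gradedSub (fun k q x hx => ?_) hc
  rw [upMap_place]
  refine place_mem_gradedSub ?_
  convert hf _ k x hx using 1
  push_cast
  congr 1
  linarith

theorem idMap_mem {r t j j' : ℤ} {f : ∀ k, X k →ₗ[ℂ] Y k}
    (hf : ∀ m k, ∀ x ∈ 𝒱 m k, f k x ∈ 𝒲 (m + r) k) (hj : j' = j + 2 * t - r)
    {c : Tot X ℤ} (hc : c ∈ gradedSub 𝒱 j) : idMap t f c ∈ gradedSub 𝒲 j' := by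
  refine mem_of_mem_gradedSub (fun k q x hx => ?_) hc
  rw [idMap_place]
  refine place_mem_gradedSub ?_
  convert hf _ k x hx using 1
  congr 1
  linarith

theorem dnMap_mem {r t j j' : ℤ} {f : ∀ k, X (k + 1) →ₗ[ℂ] Y k}
    (hf : ∀ m k, ∀ x ∈ 𝒱 m (k + 1), f k x ∈ 𝒲 (m + r) k) (hj : j' = j - 1 + 2 * t - r)
    {c : Tot X ℤ} (hc : c ∈ gradedSub 𝒱 j) : dnMap t f c ∈ gradedSub 𝒲 j' := by
  refine mem_of_mem_gradedSub (fun k q x hx => ?_) hc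
  cases k with
  | zero =>
    rw [dnMap_place_zero]
    exact Submodule.zero_mem _
  | succ k =>
    rw [dnMap_place_succ]
    refine place_mem_gradedSub ?_
    convert hf _ k x hx using 1
    push_cast
    congr 1
    linarith

theorem gradedSub_mono (h : ∀ m k, 𝒱₁ m k ≤ 𝒱₂ m k) (j : ℤ) :
    gradedSub 𝒱₁ j ≤ gradedSub 𝒱₂ j := fun _ hc =>
  mem_gradedSub.2 fun k q => h _ _ (mem_gradedSub.1 hc k q)

theorem exists_add_of_mem_gradedSub (h : ∀ m k, 𝒱 m k ≤ 𝒱₁ m k ⊔ 𝒱₂ m k) {j : ℤ} {c : Tot X ℤ}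
    (hc : c ∈ gradedSub 𝒱 j) : ∃ c₁ ∈ gradedSub 𝒱₁ j, ∃ c₂ ∈ gradedSub 𝒱₂ j, c₁ + c₂ = c := by
  rw [← Submodule.mem_sup]
  refine mem_of_mem_gradedSub (f := LinearMap.id) (fun k q x hx => ?_) hc
  obtain ⟨x₁, h₁, x₂, h₂, rfl⟩ := Submodule.mem_sup.1 (h _ _ hx)
  rw [map_add, map_add]
  exact Submodule.add_mem_sup (place_mem_gradedSub h₁) (place_mem_gradedSub h₂)

theorem eq_zero_of_mem_gradedSub (h : ∀ m k, ∀ x ∈ 𝒱₁ m k, x ∈ 𝒱₂ m k → x = 0) {j : ℤ}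
    {c : Tot X ℤ} (h₁ : c ∈ gradedSub 𝒱₁ j) (h₂ : c ∈ gradedSub 𝒱₂ j) : c = 0 :=
  DFinsupp.ext fun p => h _ _ _ (mem_gradedSub.1 h₁ p.1 p.2) (mem_gradedSub.1 h₂ p.1 p.2)

/-- The part of a graded family whose weight lies in `s`. -/
def weightIn (𝒱 : ℤ → ∀ k, Submodule ℂ (X k)) (s : Set ℤ) (m : ℤ) (k : ℕ) : Submodule ℂ (X k) where
  carrier := {x | x ∈ 𝒱 m k ∧ (m ∉ s → x = 0)}
  zero_mem' := ⟨Submodule.zero_mem _, fun _ => rfl⟩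
  add_mem' hx hy := ⟨Submodule.add_mem _ hx.1 hy.1, fun hm => by rw [hx.2 hm, hy.2 hm, add_zero]⟩
  smul_mem' c _ hx := ⟨Submodule.smul_mem _ _ hx.1, fun hm => by rw [hx.2 hm, smul_zero]⟩

/-- The weights of the components of a finite cochain are bounded above. -/
theorem exists_bound_of_mem_gradedSub {j : ℤ} {c : Tot X ℤ} (hc : c ∈ gradedSub 𝒱 j) :
    ∃ M : ℕ, c ∈ gradedSub (weightIn 𝒱 (Set.Iic (M : ℤ))) j := by
  classical
  obtain ⟨M, hM⟩ := (c.support.image fun p => (p.1 + 2 * p.2 - j : ℤ).natAbs).exists_le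
  refine ⟨M, mem_gradedSub.2 fun k q => ⟨mem_gradedSub.1 hc k q, fun h => ?_⟩⟩
  by_contra h0
  have h1 := hM _ (Finset.mem_image_of_mem _ (DFinsupp.mem_support_iff.2 h0))
  rw [Set.mem_Iic] at h
  simp only at h1
  omega

end GradedSub

namespace CyclicOps

variable {X : ℕ → Type*} [∀ k, AddCommGroup (X k)] [∀ k, Module ℂ (X k)] {C : CyclicOps X}

/-- The graded family `𝒱` is stable under the operators of a cyclic object. -/
structure Stable (C : CyclicOps X) (𝒱 : ℤ → ∀ k, Submodule ℂ (X k)) : Prop where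
  lam_mem : ∀ m k, ∀ x ∈ 𝒱 m k, C.lam k x ∈ 𝒱 m k
  face_mem : ∀ m k, ∀ j ≤ k + 1, ∀ x ∈ 𝒱 m k, C.face k j x ∈ 𝒱 m (k + 1)
  unit_mem : ∀ m k, ∀ x ∈ 𝒱 m (k + 1), C.unit k x ∈ 𝒱 m k

/-- The derivation shifts the weights by `r`. -/
def Der.Shifts (D : C.Der) (𝒱 : ℤ → ∀ k, Submodule ℂ (X k)) (r : ℤ) : Prop :=
  ∀ m k, ∀ j ≤ k, ∀ x ∈ 𝒱 m k, D.D k j x ∈ 𝒱 (m + r) k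

variable {𝒱 : ℤ → ∀ k, Submodule ℂ (X k)}

theorem Der.Shifts.L_mem {D : C.Der} {r : ℤ} (hD : D.Shifts 𝒱 r) {m : ℤ} {k : ℕ} {x : X k}
    (hx : x ∈ 𝒱 m k) : D.L k x ∈ 𝒱 (m + r) k := by
  rw [Der.L_apply]
  exact Submodule.sum_mem _ fun n hn =>
    hD _ _ _ (Nat.lt_succ_iff.1 (Finset.mem_range.1 hn)) _ hx

namespace Stable

variable (h : C.Stable 𝒱)
include h

theorem inWeights (s : Set ℤ) : C.Stable (weightIn 𝒱 s) where
  lam_mem m k x hx := ⟨h.lam_mem m k x hx.1, fun hm => by rw [hx.2 hm, map_zero]⟩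
  face_mem m k j hj x hx := ⟨h.face_mem m k j hj x hx.1, fun hm => by rw [hx.2 hm, map_zero]⟩
  unit_mem m k x hx := ⟨h.unit_mem m k x hx.1, fun hm => by rw [hx.2 hm, map_zero]⟩

theorem lam_pow_mem {m : ℤ} {k : ℕ} (n : ℕ) {x : X k} (hx : x ∈ 𝒱 m k) :
    (C.lam k ^ n) x ∈ 𝒱 m k := by
  induction n with
  | zero => exact hx
  | succ n ih =>
    rw [pow_succ', Module.End.mul_apply]
    exact h.lam_mem _ _ _ ih

theorem norm_mem {m : ℤ} {k : ℕ} {x : X k} (hx : x ∈ 𝒱 m k) : C.norm k x ∈ 𝒱 m k := by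
  rw [norm_apply]
  exact Submodule.sum_mem _ fun n _ => h.lam_pow_mem n hx

theorem b'_mem {m : ℤ} {k : ℕ} {x : X k} (hx : x ∈ 𝒱 m k) : C.b' k x ∈ 𝒱 m (k + 1) := by
  rw [b'_apply]
  exact Submodule.sum_mem _ fun n hn => h.face_mem _ _ _ (Finset.mem_range.1 hn).le _ hx

theorem b_mem {m : ℤ} {k : ℕ} {x : X k} (hx : x ∈ 𝒱 m k) : C.b k x ∈ 𝒱 m (k + 1) := by
  rw [b_apply]
  exact Submodule.sum_mem _ fun n hn =>
    h.face_mem _ _ _ (Nat.lt_succ_iff.1 (Finset.mem_range.1 hn)) _ hx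

theorem sub_lam_mem {m : ℤ} {k : ℕ} {x : X k} (hx : x ∈ 𝒱 m k) : x - C.lam k x ∈ 𝒱 m k :=
  Submodule.sub_mem _ hx (h.lam_mem _ _ _ hx)

theorem B_mem {m : ℤ} {k : ℕ} {x : X (k + 1)} (hx : x ∈ 𝒱 m (k + 1)) : C.B k x ∈ 𝒱 m k :=
  h.norm_mem (h.unit_mem _ _ _ (h.sub_lam_mem hx))

theorem unitalD_mem {Δ : C.Der} (hΔ : Δ.Shifts 𝒱 (-1)) {j j' : ℤ} (hj : j' = j + 1) {c : Tot X ℤ}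
    (hc : c ∈ gradedSub 𝒱 j) : unitalD Δ c ∈ gradedSub 𝒱 j' := by
  refine Submodule.add_mem _ (Submodule.add_mem _ ?_ ?_) ?_
  · exact upMap_mem (r := 0) (fun m k x hx => by rw [add_zero]; exact h.b_mem hx) (by omega) hc
  · exact dnMap_mem (r := 0) (fun m k x hx => by rw [add_zero]; exact h.B_mem hx) (by omega) hc
  · exact idMap_mem (f := Δ.signed) (fun m k x hx => Submodule.smul_mem _ _ (hΔ.L_mem hx))
      (by omega) hc

end Stable

/-- The pairs of total degree `j`. -/
def pairSub (𝒱 : ℤ → ∀ k, Submodule ℂ (X k)) (j : ℤ) : Submodule ℂ (Tot X ℤ × Tot X ℤ) :=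
  (gradedSub 𝒱 j).prod (gradedSub 𝒱 (j - 1))

theorem Der.Shifts.pairL_mem {D : C.Der} (hD : D.Shifts 𝒱 0) {j : ℤ} {z : Tot X ℤ × Tot X ℤ}
    (hz : z ∈ pairSub 𝒱 j) : pairL D z ∈ pairSub 𝒱 j :=
  ⟨idMap_mem (fun m k x hx => hD.L_mem hx) (by omega) hz.1,
    idMap_mem (fun m k x hx => hD.L_mem hx) (by omega) hz.2⟩

namespace Stable

variable (h : C.Stable 𝒱)
include h

theorem toPair_mem {j : ℤ} {c : Tot X ℤ} (hc : c ∈ gradedSub 𝒱 j) : C.toPair c ∈ pairSub 𝒱 j :=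
  ⟨hc, dnMap_mem (r := 0) (fun m k x hx => by
    rw [add_zero]; exact h.unit_mem _ _ _ (h.sub_lam_mem hx)) (by omega) hc⟩

theorem ofPair_mem {j : ℤ} {z : Tot X ℤ × Tot X ℤ} (hz : z ∈ pairSub 𝒱 j) :
    C.ofPair z ∈ gradedSub 𝒱 j := by
  obtain ⟨φ, ψ⟩ := z
  exact Submodule.add_mem _ hz.1 (dnMap_mem (r := 0) (fun m k x hx => by
    rw [add_zero]; exact h.norm_mem (h.unit_mem _ _ _ hx)) (by omega) hz.2)

theorem e₁_mem {D : C.Der} (hD : D.Shifts 𝒱 0) {m : ℤ} {k : ℕ} {x : X k} (hx : x ∈ 𝒱 m k) :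
    D.e₁ k x ∈ 𝒱 (m + 0) k :=
  h.lam_mem _ _ _ (hD _ _ _ (Nat.zero_le _) _ hx)

theorem e₂_mem {D : C.Der} (hD : D.Shifts 𝒱 0) {m : ℤ} {k : ℕ} {x : X k} (hx : x ∈ 𝒱 m k) :
    D.e₂ k x ∈ 𝒱 (m + 0) (k + 1) :=
  Submodule.neg_mem _ (hD _ _ _ le_rfl _ (h.face_mem _ _ _ le_rfl _ hx))

theorem E_mem {D : C.Der} (hD : D.Shifts 𝒱 0) {m : ℤ} {k : ℕ} {x : X k} (hx : x ∈ 𝒱 m k) :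
    D.E k x ∈ 𝒱 (m + 0) k := by
  rw [Der.E_apply]
  refine Submodule.neg_mem _ (Submodule.sum_mem _ fun n hn => ?_)
  refine hD _ _ _ (Nat.lt_succ_iff.1 (Finset.mem_range.1 hn)) _ (Submodule.sum_mem _ fun i _ => ?_)
  exact h.lam_pow_mem _ hx

theorem pairH_mem {D : C.Der} (hD : D.Shifts 𝒱 0) {j : ℤ} {z : Tot X ℤ × Tot X ℤ}
    (hz : z ∈ pairSub 𝒱 j) : pairH D z ∈ pairSub 𝒱 (j - 1) := by
  obtain ⟨φ, ψ⟩ := z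
  refine ⟨Submodule.add_mem _ ?_ ?_, ?_⟩
  · exact upMap_mem (fun m k x hx => h.e₂_mem hD hx) (by omega) hz.1
  · exact idMap_mem (fun m k x hx => h.E_mem hD hx) (by omega) hz.2
  · exact idMap_mem (fun m k x hx => h.e₁_mem hD hx) (by omega) hz.1

theorem pairQ_mem {D : C.Der} (hD : D.Shifts 𝒱 0) {j : ℤ} {z : Tot X ℤ × Tot X ℤ}
    (hz : z ∈ pairSub 𝒱 j) : pairQ D z ∈ pairSub 𝒱 j := by
  obtain ⟨φ, ψ⟩ := z
  refine ⟨Submodule.sub_mem _ (Submodule.add_mem _ ?_ ?_) ?_, Submodule.zero_mem _⟩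
  · exact upMap_mem (fun m k x hx => h.e₂_mem hD hx) (by omega)
      (idMap_mem (r := 0) (j' := j + 1) (fun m k x hx => by rw [add_zero]; exact h.norm_mem hx)
        (by omega) hz.2)
  · exact upMap_mem (r := 0) (fun m k x hx => by rw [add_zero]; exact h.b_mem hx) (by omega)
      (idMap_mem (j' := j - 1) (fun m k x hx => h.E_mem hD hx) (by omega) hz.2)
  · exact idMap_mem (fun m k x hx => h.E_mem hD hx) (by omega)
      (upMap_mem (r := 0) (j' := j) (fun m k x hx => by rw [add_zero]; exact h.b'_mem hx)
        (by omega) hz.2)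

end Stable

end CyclicOps

/-! ### Reduction to weight zero -/

namespace CyclicOps

variable {X : ℕ → Type*} [∀ k, AddCommGroup (X k)] [∀ k, Module ℂ (X k)] {C : CyclicOps X}

/-- The zero derivation. -/
def zeroDer (C : CyclicOps X) : C.Der where
  D _ _ := 0
  lam_succ _ _ _ _ := by simp
  lam_zero _ _ := by simp
  face_lt _ _ _ _ _ _ := by simp
  face_gt _ _ _ _ _ _ := by simp
  face_eq _ _ _ _ := by simp
  unit_succ _ _ _ := by simp
  unit_zero _ _ := by simp

theorem zeroDer_L (k : ℕ) (x : X k) : C.zeroDer.L k x = 0 := by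
  rw [Der.L_apply]
  exact Finset.sum_eq_zero fun _ _ => rfl

theorem zeroDer_squareZero : C.zeroDer.SquareZero := fun k _ => zeroDer_L k _

theorem commutes_zeroDer (D : C.Der) : D.Commutes C.zeroDer := fun _ _ _ _ => map_zero _

theorem zeroDer_shifts (𝒱 : ℤ → ∀ k, Submodule ℂ (X k)) (r : ℤ) : C.zeroDer.Shifts 𝒱 r :=
  fun _ _ _ _ _ _ => Submodule.zero_mem _

/-- The total differential is the sum of `b + B` and the part that comes from the derivation. -/
theorem unitalD_eq_add (Δ : C.Der) (c : Tot X ℤ) :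
    unitalD Δ c = unitalD C.zeroDer c + idMap 0 Δ.signed c := by
  have h : idMap 0 C.zeroDer.signed c = 0 := by
    have : C.zeroDer.signed = fun _ => 0 := funext fun k => LinearMap.ext fun x => by
      rw [Der.signed_apply, zeroDer_L, smul_zero]; rfl
    rw [this]
    suffices h : idMap 0 (fun k => (0 : X k →ₗ[ℂ] X k)) = 0 from LinearMap.congr_fun h c
    exact Tot.hom_ext fun k q x => by simp
  simp only [unitalD, LinearMap.add_apply, h, add_zero]

variable {𝒱 : ℤ → ∀ k, Submodule ℂ (X k)}

/-- A cochain is a coboundary if its image in the complex of pairs is one. -/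
theorem Stable.mem_map_unitalD (h : C.Stable 𝒱) {Δ : C.Der} {j : ℤ} {c : Tot X ℤ}
    {w : Tot X ℤ × Tot X ℤ} (hw : w ∈ pairSub 𝒱 j) (hc : C.toPair c = pairD Δ w) :
    c ∈ (gradedSub 𝒱 j).map (unitalD Δ) := by
  have hz := h.ofPair_mem hw
  set z := C.ofPair w with hzdef
  refine ⟨z + (z - C.ofPair (C.toPair z)),
    Submodule.add_mem _ hz (Submodule.sub_mem _ hz (h.ofPair_mem (h.toPair_mem hz))), ?_⟩
  have h1 : C.ofPair (C.toPair c) = unitalD Δ z := by rw [hc, ofPair_pairD]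
  have h2 := ofPair_toPair_eq h1
  rw [map_add, map_sub, ← ofPair_pairD Δ (C.toPair z), ← toPair_unitalD]
  conv_rhs => rw [h2]
  rw [toPair_apply, ofPair_apply]
  abel

variable {D Δ : C.Der}

/-- Cocycles of a nonzero weight are coboundaries, by the homotopy formula for the derivation that
multiplies by the weight. -/
theorem Stable.mem_map_unitalD_of_weight (h : C.Stable 𝒱) (hD : D.Shifts 𝒱 0)
    (hDD : D.Commutes D) {M : ℤ} (hM : M ≠ 0)
    (hL : ∀ k, ∀ x ∈ 𝒱 M k, D.L k x = (M : ℂ) • x) {j : ℤ} {c : Tot X ℤ}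
    (hc : c ∈ gradedSub (weightIn 𝒱 {M}) j) (hdc : unitalD C.zeroDer c = 0) :
    c ∈ (gradedSub (weightIn 𝒱 {M}) (j - 1)).map (unitalD C.zeroDer) := by
  have hS := h.inWeights {M}
  have hD' : D.Shifts (weightIn 𝒱 {M}) 0 := fun m k i hi x hx =>
    ⟨hD m k i hi x hx.1, fun hm => by rw [hx.2 (by rwa [add_zero] at hm), map_zero]⟩
  have hidL : ∀ {i : ℤ} {e : Tot X ℤ}, e ∈ gradedSub (weightIn 𝒱 {M}) i →
      idMap 0 D.L e = (M : ℂ) • e := by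
    intro i e he
    refine sub_eq_zero.1 (mem_of_mem_gradedSub (f := idMap 0 D.L - (M : ℂ) • LinearMap.id)
      (N := ⊥) (fun k q x hx => ?_) he)
    rw [Submodule.mem_bot, LinearMap.sub_apply, idMap_place, LinearMap.smul_apply,
      LinearMap.id_apply, add_zero]
    by_cases hm : (k + 2 * q - i : ℤ) ∈ ({M} : Set ℤ)
    · rw [hL k x (by rw [← Set.mem_singleton_iff.1 hm]; exact hx.1), map_smul, sub_self]
    · rw [hx.2 hm, map_zero, map_zero, smul_zero, sub_zero]
  have hy := hS.toPair_mem hc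
  have hLy : ∀ {y}, y ∈ pairSub (weightIn 𝒱 {M}) j → pairL D y = (M : ℂ) • y := fun {y} hy =>
    Prod.ext (hidL hy.1) (hidL hy.2)
  have hdy : pairD C.zeroDer (C.toPair c) = 0 := by rw [← toPair_unitalD, hdc, map_zero]
  have key := pairL_pairL_eq_pairD zeroDer_squareZero (commutes_zeroDer D) hDD hdy
  rw [hLy hy, map_smul, hLy hy, smul_smul] at key
  refine hS.mem_map_unitalD (w := ((M : ℂ) * M)⁻¹ • pairH D ((M : ℂ) • C.toPair c -
    pairQ D (C.toPair c))) (Submodule.smul_mem _ _ (hS.pairH_mem hD'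
      (Submodule.sub_mem _ (Submodule.smul_mem _ _ hy) (hS.pairQ_mem hD' hy)))) ?_
  rw [map_smul, ← key, inv_smul_smul₀]
  exact mul_ne_zero (Int.cast_ne_zero.2 hM) (Int.cast_ne_zero.2 hM)

theorem weightIn_mono {s t : Set ℤ} (h : s ⊆ t) {j : ℤ} {c : Tot X ℤ}
    (hc : c ∈ gradedSub (weightIn 𝒱 s) j) : c ∈ gradedSub (weightIn 𝒱 t) j :=
  gradedSub_mono (𝒱₁ := weightIn 𝒱 s)
    (𝒱₂ := weightIn 𝒱 t) (fun _ _ _ hx => ⟨hx.1, fun hm => hx.2 fun h' => hm (h h')⟩) j hc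

theorem weightIn_le {s : Set ℤ} {j : ℤ} {c : Tot X ℤ}
    (hc : c ∈ gradedSub (weightIn 𝒱 s) j) : c ∈ gradedSub 𝒱 j :=
  gradedSub_mono (𝒱₁ := weightIn 𝒱 s) (fun _ _ _ hx => hx.1) j hc

/-- If the differential of a cochain has no component of positive weight, then the components of
positive weight of the cochain can be removed by adding a coboundary. -/
theorem Stable.exists_weight_nonpos (h : C.Stable 𝒱) (hD : D.Shifts 𝒱 0) (hDD : D.Commutes D)
    (hL : ∀ m k, ∀ x ∈ 𝒱 m k, D.L k x = (m : ℂ) • x) (hΔ : Δ.Shifts 𝒱 (-1))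
    (hΔΔ : Δ.SquareZero) {j : ℤ} {c : Tot X ℤ} (hc : c ∈ gradedSub 𝒱 j)
    (hdc : unitalD Δ c ∈ gradedSub (weightIn 𝒱 (Set.Iic 0)) (j + 1)) :
    ∃ z ∈ gradedSub 𝒱 (j - 1), c - unitalD Δ z ∈ gradedSub (weightIn 𝒱 (Set.Iic 0)) j := by
  -- The induction is on a bound `M` for the weights.
  obtain ⟨M, hM⟩ := exists_bound_of_mem_gradedSub hc
  clear hc
  induction M generalizing c with
  | zero => exact ⟨0, Submodule.zero_mem _, by rw [map_zero, sub_zero]; exact hM⟩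
  | succ M ih =>
    have hsplit : ∀ m k, weightIn 𝒱 (Set.Iic ((M + 1 : ℕ) : ℤ)) m k ≤
        weightIn 𝒱 {((M + 1 : ℕ) : ℤ)} m k ⊔ weightIn 𝒱 (Set.Iic (M : ℤ)) m k := by
      intro m k x hx
      by_cases hm : m = ((M + 1 : ℕ) : ℤ)
      · exact Submodule.mem_sup_left ⟨hx.1, fun h => (h hm).elim⟩
      · refine Submodule.mem_sup_right ⟨hx.1, fun h => hx.2 fun h' => h ?_⟩
        rw [Set.mem_Iic] at h' ⊢
        push_cast at h' hm
        omega
    obtain ⟨c₁, h₁, c₂, h₂, rfl⟩ := exists_add_of_mem_gradedSub hsplit hM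
    have hshift : ∀ N : ℤ, Δ.Shifts (weightIn 𝒱 (Set.Iic N)) (-1) := fun N m k i hi x hx =>
      ⟨hΔ m k i hi x hx.1, fun hm => by
        rw [hx.2 fun h' => hm (by rw [Set.mem_Iic] at h' ⊢; omega), map_zero]⟩
    -- The derivation lowers the weight, so that on cochains of weight `M + 1` the total differential
    -- agrees with `b + B` up to terms of weight at most `M`.
    have hd : ∀ {i i' : ℤ} {e : Tot X ℤ}, i' = i + 1 →
        e ∈ gradedSub (weightIn 𝒱 {((M + 1 : ℕ) : ℤ)}) i →
        idMap 0 Δ.signed e ∈ gradedSub (weightIn 𝒱 (Set.Iic (M : ℤ))) i' := by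
      intro i i' e hi he
      refine idMap_mem (𝒱 := weightIn 𝒱 {((M + 1 : ℕ) : ℤ)}) (r := -1) (fun m k x hx => ?_)
        (by omega) he
      refine Submodule.smul_mem _ _ ⟨hΔ.L_mem hx.1, fun hm => ?_⟩
      rw [hx.2 fun h' => hm ?_, map_zero]
      rw [Set.mem_Iic, Set.mem_singleton_iff.1 h']
      push_cast
      omega
    -- The component of weight `M + 1` of the total differential of `c₁ + c₂` is zero.
    have hc₁ : unitalD C.zeroDer c₁ = 0 := by
      refine eq_zero_of_mem_gradedSub (𝒱₁ := weightIn 𝒱 {((M + 1 : ℕ) : ℤ)})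
        (𝒱₂ := weightIn 𝒱 (Set.Iic (M : ℤ))) (j := j + 1) (fun m k x hx hx' => ?_)
        ((h.inWeights _).unitalD_mem (zeroDer_shifts _ _) rfl h₁) ?_
      · by_cases hm : m = ((M + 1 : ℕ) : ℤ)
        · refine hx'.2 ?_
          rw [hm, Set.mem_Iic]
          push_cast
          omega
        · exact hx.2 hm
      · have h3 := weightIn_mono (t := Set.Iic (M : ℤ)) (Set.Iic_subset_Iic.2 (by omega)) hdc
        rw [map_add, unitalD_eq_add Δ c₁, add_assoc] at h3
        refine (Submodule.add_mem_iff_left _ (Submodule.add_mem _ (hd rfl h₁) ?_)).1 h3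
        exact (h.inWeights _).unitalD_mem (hshift _) rfl h₂
    obtain ⟨z, hz, hz'⟩ := h.mem_map_unitalD_of_weight hD hDD (M := ((M + 1 : ℕ) : ℤ)) (by omega)
      (hL _) h₁ hc₁
    have hz0 := weightIn_le hz
    obtain ⟨z', hz'0, h'⟩ := ih (c := c₁ + c₂ - unitalD Δ z) (by
      rw [map_sub, unitalD_unitalD hΔΔ, sub_zero]; exact hdc) (by
      rw [unitalD_eq_add, hz', add_sub_add_left_eq_sub]
      exact Submodule.sub_mem _ h₂ (hd (by omega) hz))
    exact ⟨z + z', Submodule.add_mem _ hz0 hz'0, by rwa [map_add, ← sub_sub]⟩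

end CyclicOps

/-! ### Weights and continuity of functionals -/

section Weights

variable {A A' : Type*} [Ring A] [Algebra ℂ A] [Ring A'] [Algebra ℂ A']
  {𝒜 : ℤ → Submodule ℂ A} {𝒜' : ℤ → Submodule ℂ A'}

theorem slotMap_mem_weightPart {k : ℕ} {f : ℕ → A →ₗ[ℂ] A'} {r : ℕ → ℤ}
    (hf : ∀ l ≤ k, ∀ i, ∀ a ∈ 𝒜 i, f l a ∈ 𝒜' (i + r l)) {m m' : ℤ}
    (hm : m' = m - ∑ l ∈ Finset.range (k + 1), r l) {φ : Functional A' k}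
    (hφ : φ ∈ weightPart 𝒜' k m) : slotMap f φ ∈ weightPart 𝒜 k m' := by
  intro n a ha hn
  refine hφ (fun i => n i + r i) _ (fun i => hf i (Nat.lt_succ_iff.1 i.2) _ _ (ha i)) ?_
  rw [Finset.sum_add_distrib, ← Finset.sum_range]
  intro h
  exact hn (by rw [hm, ← h]; ring)

theorem sum_contractNth {k : ℕ} (j : Fin (k + 1)) (n : Fin (k + 2) → ℤ) :
    ∑ i, Fin.contractNth j.castSucc (· + ·) n i = ∑ i, n i := by
  have h : ∀ i, Fin.contractNth j.castSucc (· + ·) n i =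
      n (j.succ.succAbove i) + if i = j then n j.succ else 0 := by
    intro i
    simp only [Fin.contractNth, Fin.succAbove, Fin.lt_def, Fin.val_castSucc, Fin.val_succ,
      Fin.ext_iff]
    split_ifs with h1 h2 h3 h3 h3
    all_goals first | omega | (obtain rfl : i = j := Fin.ext h3; simp)
  rw [Finset.sum_congr rfl fun i _ => h i, Finset.sum_add_distrib, Fin.sum_univ_succAbove n j.succ,
    Finset.sum_ite_eq' Finset.univ j]
  simp [add_comm]

variable [GradedAlgebra 𝒜]

theorem mulAt_mem_weightPart {k : ℕ} (j : Fin (k + 1)) {m : ℤ} {φ : Functional A k}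
    (hφ : φ ∈ weightPart 𝒜 k m) : mulAt j φ ∈ weightPart 𝒜 (k + 1) m := by
  intro n a ha hn
  refine hφ (Fin.contractNth j.castSucc (· + ·) n) _ (fun i => ?_) (by rwa [sum_contractNth])
  simp only [Fin.contractNth]
  split_ifs
  · exact ha _
  · exact SetLike.mul_mem_graded (ha _) (ha _)
  · exact ha _

theorem insertOne_mem_weightPart {k : ℕ} {m : ℤ} {φ : Functional A (k + 1)}
    (hφ : φ ∈ weightPart 𝒜 (k + 1) m) : insertOne k φ ∈ weightPart 𝒜 k m := by
  intro n a ha hn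
  refine hφ (Fin.insertNth (α := fun _ => ℤ) (Fin.last (k + 1)) 0 n)
    (Fin.insertNth (α := fun _ => A) (Fin.last (k + 1)) 1 a) (fun i => ?_) ?_
  · induction i using Fin.succAboveCases (Fin.last (k + 1)) with
    | x => simpa using SetLike.one_mem_graded 𝒜
    | p i => simpa using ha i
  · rwa [Fin.sum_univ_succAbove _ (Fin.last (k + 1)), Fin.insertNth_apply_same, zero_add,
      Finset.sum_congr rfl fun i _ => Fin.insertNth_apply_succAbove (α := fun _ => ℤ) _ _ _ _]

theorem parityPart_mem (s : ℕ) {i : ℤ} {a : A} (ha : a ∈ 𝒜 i) : parityPart 𝒜 s a ∈ 𝒜 i := by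
  simp only [parityPart, LinearMap.smul_apply, LinearMap.add_apply, LinearMap.id_apply]
  exact Submodule.smul_mem _ _ (Submodule.add_mem _ ha
    (Submodule.smul_mem _ _ (koszul_mem 𝒜 1 ha)))

theorem cyclicOp_mem_weightPart {k : ℕ} {m : ℤ} {φ : Functional A k}
    (hφ : φ ∈ weightPart 𝒜 k m) : cyclicOp 𝒜 k φ ∈ weightPart 𝒜 k m := by
  change (∑ s ∈ Finset.range 2, (φ.domDomCongr (finRotate (k + 1)).symm).compLinearMap
    (fun i => if i = Fin.last k then parityPart 𝒜 s else koszul 𝒜 s)) ∈ _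
  refine Submodule.sum_mem _ fun s _ => ?_
  intro n a ha hn
  refine hφ (fun i => n ((finRotate (k + 1)).symm i)) _ (fun i => ?_)
    (by rwa [Equiv.sum_comp])
  dsimp only
  split_ifs
  · exact parityPart_mem s (ha _)
  · exact koszul_mem 𝒜 s (ha _)

end Weights

section Continuity

variable {A A' : Type*} [Ring A] [Algebra ℂ A] [Ring A'] [Algebra ℂ A']
  {𝒜 : ℤ → Submodule ℂ A} [GradedAlgebra 𝒜] [TopologicalSpace A] [TopologicalSpace A']

theorem slotMap_mem_continuousPart {k : ℕ} {f : ℕ → A →ₗ[ℂ] A'} (hf : ∀ l ≤ k, Continuous (f l))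
    {φ : Functional A' k} (hφ : φ ∈ continuousPart A' k) : slotMap f φ ∈ continuousPart A k :=
  hφ.comp (continuous_pi fun i => (hf i (Nat.lt_succ_iff.1 i.2)).comp (continuous_apply i))

theorem mulAt_mem_continuousPart [ContinuousMul A] {k : ℕ} (j : Fin (k + 1)) {φ : Functional A k}
    (hφ : φ ∈ continuousPart A k) : mulAt j φ ∈ continuousPart A (k + 1) := by
  refine hφ.comp (continuous_pi fun i => ?_)
  simp only [Fin.contractNth]
  split_ifs
  · exact continuous_apply _
  · exact (continuous_apply _).mul (continuous_apply _)
  · exact continuous_apply _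

theorem insertOne_mem_continuousPart {k : ℕ} {φ : Functional A (k + 1)}
    (hφ : φ ∈ continuousPart A (k + 1)) : insertOne k φ ∈ continuousPart A k :=
  hφ.comp (continuous_const.finInsertNth _ continuous_id)

theorem continuous_koszul (hγ : Continuous (koszul 𝒜 1)) (i : ℤ) : Continuous (koszul 𝒜 i) := by
  rcases Int.even_or_odd i with hi | hi
  · rw [koszul_of_even 𝒜 hi]
    exact continuous_id
  · rwa [koszul_of_odd 𝒜 hi]

/-- No topology on the scalars is involved: multiplication by a scalar is multiplication by an
element of the ring. -/
theorem continuous_const_smul_of_ring [ContinuousMul A] (c : ℂ) :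
    Continuous fun a : A => c • a := by
  have : (fun a : A => c • a) = fun a => algebraMap ℂ A c * a :=
    funext fun a => Algebra.smul_def c a
  rw [this]
  exact continuous_const.mul continuous_id

theorem continuous_parityPart [IsTopologicalRing A] (hγ : Continuous (koszul 𝒜 1)) (s : ℕ) :
    Continuous (parityPart 𝒜 s) :=
  (continuous_const_smul_of_ring _).comp
    (continuous_id.add ((continuous_const_smul_of_ring _).comp hγ))

theorem cyclicOp_mem_continuousPart [IsTopologicalRing A] (hγ : Continuous (koszul 𝒜 1)) {k : ℕ}
    {φ : Functional A k} (hφ : φ ∈ continuousPart A k) :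
    cyclicOp 𝒜 k φ ∈ continuousPart A k := by
  change (∑ s ∈ Finset.range 2, (φ.domDomCongr (finRotate (k + 1)).symm).compLinearMap
    (fun i => if i = Fin.last k then parityPart 𝒜 s else koszul 𝒜 s)) ∈ _
  refine Submodule.sum_mem _ fun s _ => ?_
  refine hφ.comp (continuous_pi fun i => ?_)
  dsimp only
  split_ifs
  · exact (continuous_parityPart hγ s).comp (continuous_apply _)
  · exact (continuous_koszul hγ s).comp (continuous_apply _)

end Continuity

section ContWeight

variable {A : Type*} [Ring A] [Algebra ℂ A] (𝒜 : ℤ → Submodule ℂ A) [TopologicalSpace A]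

/-- Continuous functionals of weight `m`. -/
def contWeight (m : ℤ) (k : ℕ) : Submodule ℂ (Functional A k) :=
  weightPart 𝒜 k m ⊓ continuousPart A k

theorem periodicCochains_eq (j : ℤ) : periodicCochains 𝒜 j = gradedSub (contWeight 𝒜) j := rfl

variable {𝒜} [GradedAlgebra 𝒜] [IsTopologicalRing A]

theorem functionalOps_stable (hγ : Continuous (koszul 𝒜 1)) :
    (functionalOps 𝒜).Stable (contWeight 𝒜) where
  lam_mem m k φ hφ := Submodule.smul_mem _ _
    ⟨cyclicOp_mem_weightPart hφ.1, cyclicOp_mem_continuousPart hγ hφ.2⟩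
  face_mem m k j _ φ hφ := by
    change signedFace 𝒜 k j φ ∈ _
    rw [signedFace]
    split_ifs with h
    · exact Submodule.smul_mem _ _
        ⟨mulAt_mem_weightPart _ hφ.1, mulAt_mem_continuousPart _ hφ.2⟩
    · exact Submodule.smul_mem _ _
        ⟨cyclicOp_mem_weightPart (mulAt_mem_weightPart _ hφ.1),
          cyclicOp_mem_continuousPart hγ (mulAt_mem_continuousPart _ hφ.2)⟩
  unit_mem m k φ hφ :=
    ⟨insertOne_mem_weightPart (cyclicOp_mem_weightPart hφ.1),
      insertOne_mem_continuousPart (cyclicOp_mem_continuousPart hγ hφ.2)⟩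

omit [IsTopologicalRing A] in
theorem slotDer_mem_contWeight (hγ : Continuous (koszul 𝒜 1)) {c r : ℤ} {d : A →ₗ[ℂ] A}
    (hd : Continuous d) (hdr : ∀ i, ∀ a ∈ 𝒜 i, d a ∈ 𝒜 (i + r)) {m : ℤ} {k j : ℕ} (hj : j ≤ k)
    {φ : Functional A k} (hφ : φ ∈ contWeight 𝒜 m k) :
    slotDer 𝒜 c d k j φ ∈ contWeight 𝒜 (m + -r) k := by
  refine ⟨slotMap_mem_weightPart (r := fun l => if l = j then r else 0) (fun l _ i a ha => ?_) ?_
    hφ.1, slotMap_mem_continuousPart (fun l _ => ?_) hφ.2⟩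
  · split_ifs with h1 h2 h2
    · omega
    · exact hdr i a ha
    · rw [add_zero]; exact koszul_mem 𝒜 c ha
    · rw [add_zero]; exact ha
  · rw [Finset.sum_ite_eq' (Finset.range (k + 1)), if_pos (Finset.mem_range.2 (by omega))]
    ring
  · split_ifs
    · exact continuous_koszul hγ c
    · exact hd
    · exact continuous_id

omit [IsTopologicalRing A] in
theorem diffDer_shifts (hγ : Continuous (koszul 𝒜 1)) {d : A →ₗ[ℂ] A} (hd : IsDGAlgebra 𝒜 d)
    (hdc : Continuous d) : (diffDer hd).Shifts (contWeight 𝒜) (-1) := fun _ _ _ hj _ hφ =>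
  slotDer_mem_contWeight hγ hdc hd.d_mem hj hφ

end ContWeight

/-! ### The topology of componentwise convergence

The parity automorphism of a topological graded algebra with continuous projections need not be
continuous, since the algebra is only the algebraic direct sum of its components. It becomes
continuous for the coarsest topology that makes the projections to the given topological space
continuous, and for a nonnegative grading this change of the topology does not affect the
continuous functionals of a given weight. -/

section ComponentTopology

variable {A : Type*} [Ring A] [Algebra ℂ A] (𝒜 : ℤ → Submodule ℂ A) [GradedAlgebra 𝒜]

theorem proj_of_mem (n : ℤ) {i : ℤ} {a : A} (ha : a ∈ 𝒜 i) :
    GradedAlgebra.proj 𝒜 n a = if i = n then a else 0 := by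
  rw [GradedAlgebra.proj_apply]
  split_ifs with h
  · subst h
    exact DirectSum.decompose_of_mem_same 𝒜 ha
  · exact DirectSum.decompose_of_mem_ne 𝒜 ha h

theorem proj_mem (n : ℤ) (a : A) : GradedAlgebra.proj 𝒜 n a ∈ 𝒜 n :=
  (DirectSum.decompose 𝒜 a n).2

/-- The derivation that multiplies an element of degree `n` by `n`. -/
def degDer : A →ₗ[ℂ] A :=
  DirectSum.toModule ℂ ℤ A (fun j => j • (𝒜 j).subtype) ∘ₗ
    (DirectSum.decomposeLinearEquiv 𝒜).toLinearMap

theorem degDer_of_mem {i : ℤ} {a : A} (ha : a ∈ 𝒜 i) : degDer 𝒜 a = i • a := by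
  simp only [degDer, LinearMap.comp_apply, LinearEquiv.coe_coe,
    DirectSum.decomposeLinearEquiv_apply, DirectSum.decompose_of_mem 𝒜 ha]
  erw [DirectSum.toModule_lof]
  simp

theorem degDer_mem (i : ℤ) (a : A) (ha : a ∈ 𝒜 i) : degDer 𝒜 a ∈ 𝒜 (i + 0) := by
  rw [degDer_of_mem 𝒜 ha, add_zero]
  exact zsmul_mem ha _

theorem degDer_isGradedDerivation : IsGradedDerivation 𝒜 0 (degDer 𝒜) where
  map_mul a b := by
    have : (LinearMap.mul ℂ A).compr₂ (degDer 𝒜) = (LinearMap.mul ℂ A).compl₁₂ (degDer 𝒜)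
        LinearMap.id + (LinearMap.mul ℂ A).compl₁₂ (koszul 𝒜 0) (degDer 𝒜) := by
      refine linearMap_ext_homogeneous 𝒜 fun m a ha => linearMap_ext_homogeneous 𝒜 fun n b hb => ?_
      simp [degDer_of_mem 𝒜 ha, degDer_of_mem 𝒜 hb,
        degDer_of_mem 𝒜 (SetLike.mul_mem_graded ha hb), add_smul, -zsmul_eq_mul]
    exact LinearMap.congr_fun₂ this a b
  map_koszul a := by
    have : degDer 𝒜 ∘ₗ koszul 𝒜 1 = koszul 𝒜 1 ∘ₗ degDer 𝒜 := by
      refine linearMap_ext_homogeneous 𝒜 fun m a ha => ?_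
      simp only [LinearMap.comp_apply, koszul_of_mem 𝒜 1 ha, degDer_of_mem 𝒜 ha, map_zsmul]
      rw [smul_comm]
    simpa using LinearMap.congr_fun this a

theorem degDer_one : degDer 𝒜 1 = 0 := by
  rw [degDer_of_mem 𝒜 (SetLike.one_mem_graded 𝒜), zero_smul]

theorem proj_degDer (n : ℤ) (a : A) :
    GradedAlgebra.proj 𝒜 n (degDer 𝒜 a) = (n : ℂ) • GradedAlgebra.proj 𝒜 n a := by
  have : GradedAlgebra.proj 𝒜 n ∘ₗ degDer 𝒜 = (n : ℂ) • GradedAlgebra.proj 𝒜 n := by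
    refine linearMap_ext_homogeneous 𝒜 fun m a ha => ?_
    simp only [LinearMap.comp_apply, LinearMap.smul_apply, degDer_of_mem 𝒜 ha, map_zsmul,
      proj_of_mem 𝒜 n ha]
    split_ifs with h
    · rw [h, Int.cast_smul_eq_zsmul]
    · simp
  exact LinearMap.congr_fun this a

theorem proj_koszul (n i : ℤ) (a : A) : GradedAlgebra.proj 𝒜 n (koszul 𝒜 i a) =
    (((i * n).negOnePow : ℤ) : ℂ) • GradedAlgebra.proj 𝒜 n a := by
  have : GradedAlgebra.proj 𝒜 n ∘ₗ koszul 𝒜 i =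
      (((i * n).negOnePow : ℤ) : ℂ) • GradedAlgebra.proj 𝒜 n := by
    refine linearMap_ext_homogeneous 𝒜 fun m a ha => ?_
    simp only [LinearMap.comp_apply, LinearMap.smul_apply, koszul_of_mem 𝒜 i ha, map_zsmul,
      proj_of_mem 𝒜 n ha]
    split_ifs with h
    · rw [h, Int.cast_smul_eq_zsmul]
    · simp
  exact LinearMap.congr_fun this a

theorem proj_map {r : ℤ} {f : A →ₗ[ℂ] A} (hf : ∀ i, ∀ a ∈ 𝒜 i, f a ∈ 𝒜 (i + r)) (n : ℤ) (a : A) :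
    GradedAlgebra.proj 𝒜 n (f a) = f (GradedAlgebra.proj 𝒜 (n - r) a) := by
  have : GradedAlgebra.proj 𝒜 n ∘ₗ f = f ∘ₗ GradedAlgebra.proj 𝒜 (n - r) := by
    refine linearMap_ext_homogeneous 𝒜 fun m a ha => ?_
    simp only [LinearMap.comp_apply, proj_of_mem 𝒜 _ ha, proj_of_mem 𝒜 _ (hf m a ha)]
    split_ifs <;> first | rfl | omega | simp
  exact LinearMap.congr_fun this a

/-- For a nonnegative grading, the components of a product are sums over an index set that does
not depend on the factors. -/
theorem proj_mul (hA : ∀ n < 0, 𝒜 n = ⊥) (n : ℤ) (a b : A) : GradedAlgebra.proj 𝒜 n (a * b) =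
    ∑ i ∈ Finset.Icc 0 n, GradedAlgebra.proj 𝒜 i a * GradedAlgebra.proj 𝒜 (n - i) b := by
  have : (LinearMap.mul ℂ A).compr₂ (GradedAlgebra.proj 𝒜 n) = ∑ i ∈ Finset.Icc 0 n,
      (LinearMap.mul ℂ A).compl₁₂ (GradedAlgebra.proj 𝒜 i) (GradedAlgebra.proj 𝒜 (n - i)) := by
    refine linearMap_ext_homogeneous 𝒜 fun p a ha => linearMap_ext_homogeneous 𝒜 fun r b hb => ?_
    simp only [LinearMap.compr₂_apply, LinearMap.mul_apply', LinearMap.sum_apply,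
      LinearMap.compl₁₂_apply, proj_of_mem 𝒜 _ ha, proj_of_mem 𝒜 _ hb,
      proj_of_mem 𝒜 _ (SetLike.mul_mem_graded ha hb), ite_mul, zero_mul]
    rw [Finset.sum_ite_eq]
    by_cases hp : p < 0
    · rw [hA p hp, Submodule.mem_bot] at ha
      simp [ha]
    by_cases hr : r < 0
    · rw [hA r hr, Submodule.mem_bot] at hb
      simp [hb]
    simp only [Finset.mem_Icc, mul_ite, mul_zero]
    split_ifs <;> first | rfl | omega
  have := LinearMap.congr_fun₂ this a b
  simpa [LinearMap.sum_apply] using this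

variable [TopologicalSpace A]

/-- The coarsest topology for which the projections to the components are continuous. -/
abbrev componentTopology : TopologicalSpace A :=
  TopologicalSpace.induced (fun a n => GradedAlgebra.proj 𝒜 n a)
    (inferInstance : TopologicalSpace (ℤ → A))

variable {𝒜}

theorem continuous_component_iff {X : Type*} [TopologicalSpace X] {f : X → A} :
    @Continuous X A _ (componentTopology 𝒜) f ↔
      ∀ n, Continuous fun x => GradedAlgebra.proj 𝒜 n (f x) := by
  rw [componentTopology, continuous_induced_rng, continuous_pi_iff]
  rfl

theorem continuous_component_proj (n : ℤ) :
    @Continuous A A (componentTopology 𝒜) _ (GradedAlgebra.proj 𝒜 n) := by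
  exact (@continuous_component_iff A _ _ 𝒜 _ _ A (componentTopology 𝒜) _).1
    (@continuous_id A (componentTopology 𝒜)) n

variable [IsTopologicalRing A]

theorem component_isTopologicalRing (hA : ∀ n < 0, 𝒜 n = ⊥) :
    @IsTopologicalRing A (componentTopology 𝒜) _ := by
  have hadd : ∀ {X : Type _} [TopologicalSpace X] {f g : X → A},
      @Continuous X A _ (componentTopology 𝒜) f → @Continuous X A _ (componentTopology 𝒜) g →
      @Continuous X A _ (componentTopology 𝒜) (fun x => f x + g x) := by
    intro X _ f g hf hg
    rw [continuous_component_iff] at hf hg ⊢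
    intro n
    simp only [map_add]
    exact (hf n).add (hg n)
  have hmul : ∀ {X : Type _} [TopologicalSpace X] {f g : X → A},
      @Continuous X A _ (componentTopology 𝒜) f → @Continuous X A _ (componentTopology 𝒜) g →
      @Continuous X A _ (componentTopology 𝒜) (fun x => f x * g x) := by
    intro X _ f g hf hg
    rw [continuous_component_iff] at hf hg ⊢
    intro n
    simp only [proj_mul 𝒜 hA]
    exact continuous_finsetSum _ fun i _ => (hf i).mul (hg _)
  have hneg : ∀ {X : Type _} [TopologicalSpace X] {f : X → A},
      @Continuous X A _ (componentTopology 𝒜) f →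
      @Continuous X A _ (componentTopology 𝒜) (fun x => -f x) := by
    intro X _ f hf
    rw [continuous_component_iff] at hf ⊢
    intro n
    simp only [map_neg]
    exact (hf n).neg
  let _ := componentTopology 𝒜
  exact { continuous_add := hadd continuous_fst continuous_snd
          continuous_mul := hmul continuous_fst continuous_snd
          continuous_neg := hneg continuous_id }

theorem component_continuous_koszul (i : ℤ) :
    @Continuous A A (componentTopology 𝒜) (componentTopology 𝒜) (koszul 𝒜 i) := by
  refine (@continuous_component_iff A _ _ 𝒜 _ _ A (componentTopology 𝒜) _).2 fun n => ?_
  simp only [proj_koszul]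
  exact @Continuous.comp A A A (componentTopology 𝒜) _ _ _ _ (continuous_const_smul_of_ring _)
    (continuous_component_proj n)

theorem component_continuous_degDer :
    @Continuous A A (componentTopology 𝒜) (componentTopology 𝒜) (degDer 𝒜) := by
  refine (@continuous_component_iff A _ _ 𝒜 _ _ A (componentTopology 𝒜) _).2 fun n => ?_
  simp only [proj_degDer]
  exact @Continuous.comp A A A (componentTopology 𝒜) _ _ _ _ (continuous_const_smul_of_ring _)
    (continuous_component_proj n)

omit [IsTopologicalRing A] in
theorem component_continuous_map {r : ℤ} {f : A →ₗ[ℂ] A} (hf : ∀ i, ∀ a ∈ 𝒜 i, f a ∈ 𝒜 (i + r))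
    (hfc : Continuous f) :
    @Continuous A A (componentTopology 𝒜) (componentTopology 𝒜) f := by
  refine (@continuous_component_iff A _ _ 𝒜 _ _ A (componentTopology 𝒜) _).2 fun n => ?_
  simp only [proj_map 𝒜 hf]
  exact @Continuous.comp A A A (componentTopology 𝒜) _ _ _ _ hfc (continuous_component_proj _)

omit [TopologicalSpace A] [IsTopologicalRing A] in
/-- A functional of weight `m` depends on finitely many components of its arguments. -/
theorem apply_eq_sum_proj (hA : ∀ n < 0, 𝒜 n = ⊥) {m : ℤ} {k : ℕ} {φ : Functional A k}
    (hφ : φ ∈ weightPart 𝒜 k m) (a : Fin (k + 1) → A) :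
    φ a = ∑ n ∈ Fintype.piFinset fun _ : Fin (k + 1) => Finset.Icc 0 m,
      φ fun i => GradedAlgebra.proj 𝒜 (n i) (a i) := by
  classical
  set s : Finset ℤ := Finset.Icc 0 m ∪
    Finset.univ.biUnion fun i => (DirectSum.decompose 𝒜 (a i)).support with hs
  have ha : ∀ i, a i = ∑ n ∈ s, GradedAlgebra.proj 𝒜 n (a i) := by
    intro i
    conv_lhs => rw [← DirectSum.sum_support_decompose 𝒜 (a i)]
    refine Finset.sum_subset (fun n hn => ?_) fun n _ hn => ?_
    · exact Finset.mem_union_right _ (Finset.mem_biUnion.2 ⟨i, Finset.mem_univ _, hn⟩)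
    · change ((DirectSum.decompose 𝒜 (a i)) n : A) = 0
      rw [DFinsupp.notMem_support_iff.1 hn]
      rfl
  have h1 : φ a = ∑ n ∈ Fintype.piFinset fun _ : Fin (k + 1) => s,
      φ fun i => GradedAlgebra.proj 𝒜 (n i) (a i) := by
    rw [← φ.map_sum_finset (fun i n => GradedAlgebra.proj 𝒜 n (a i)) fun _ => s]
    exact congrArg φ (funext ha)
  rw [h1]
  symm
  refine Finset.sum_subset (Fintype.piFinset_subset _ _ fun _ => Finset.subset_union_left)
    fun n _ hn => ?_
  by_cases hneg : ∃ i, n i < 0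
  · obtain ⟨i, hi⟩ := hneg
    refine φ.map_coord_zero i ?_
    have := proj_mem 𝒜 (n i) (a i)
    rwa [hA _ hi, Submodule.mem_bot] at this
  · push Not at hneg
    refine hφ n _ (fun i => proj_mem 𝒜 _ _) fun hsum => hn ?_
    rw [Fintype.mem_piFinset]
    intro i
    rw [Finset.mem_Icc, ← hsum]
    exact ⟨hneg i, Finset.single_le_sum (fun j _ => hneg j) (Finset.mem_univ i)⟩

omit [IsTopologicalRing A] in
theorem continuous_of_weight (hA : ∀ n < 0, 𝒜 n = ⊥) {m : ℤ} {k : ℕ} {φ : Functional A k}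
    (hφ : φ ∈ contWeight 𝒜 m k) {X : Type*} [TopologicalSpace X] {u : X → A}
    (hu : ∀ n, Continuous fun x => GradedAlgebra.proj 𝒜 n (u x)) :
    Continuous fun x : Fin (k + 1) → X => φ fun i => u (x i) := by
  have hc : Continuous φ := hφ.2
  rw [funext fun x : Fin (k + 1) → X => apply_eq_sum_proj hA hφ.1 fun i => u (x i)]
  exact continuous_finsetSum _ fun n _ =>
    hc.comp (continuous_pi fun i => (hu (n i)).comp (continuous_apply i))

omit [IsTopologicalRing A] in
/-- The topology of componentwise convergence has the same continuous functionals of a given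
weight. -/
theorem contWeight_component (hA : ∀ n < 0, 𝒜 n = ⊥)
    (hproj : ∀ n, Continuous (GradedAlgebra.proj 𝒜 n)) :
    @contWeight A _ _ 𝒜 (componentTopology 𝒜) = contWeight 𝒜 := by
  funext m k
  refine le_antisymm (fun φ hφ => ⟨hφ.1, ?_⟩) (fun φ hφ => ⟨hφ.1, ?_⟩)
  · exact @continuous_of_weight A _ _ 𝒜 _ _ hA m k φ hφ A (componentTopology 𝒜) id fun n =>
      continuous_component_proj n
  · refine @continuous_of_weight A _ _ 𝒜 _ (componentTopology 𝒜) hA m k φ hφ A _ id fun n => ?_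
    refine continuous_component_iff.2 fun i => ?_
    by_cases hi : n = i
    · subst hi
      simp only [proj_of_mem 𝒜 _ (proj_mem 𝒜 _ _), if_true]
      exact hproj n
    · simp only [proj_of_mem 𝒜 _ (proj_mem 𝒜 _ _), if_neg hi]
      exact continuous_const

end ComponentTopology

/-! ### Functoriality -/

namespace CyclicOps

variable {X Y : ℕ → Type*} [∀ k, AddCommGroup (X k)] [∀ k, Module ℂ (X k)]
  [∀ k, AddCommGroup (Y k)] [∀ k, Module ℂ (Y k)] {C : CyclicOps X} {C' : CyclicOps Y}
  {f : ∀ k, X k →ₗ[ℂ] Y k}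

/-- The maps `f` commute with the cyclic operators and the faces. -/
structure Map (C : CyclicOps X) (C' : CyclicOps Y) (f : ∀ k, X k →ₗ[ℂ] Y k) : Prop where
  map_lam : ∀ k x, f k (C.lam k x) = C'.lam k (f k x)
  map_face : ∀ k, ∀ j ≤ k + 1, ∀ x, f (k + 1) (C.face k j x) = C'.face k j (f k x)

namespace Map

theorem map_b (h : Map C C' f) (k : ℕ) (x : X k) : f (k + 1) (C.b k x) = C'.b k (f k x) := by
  rw [b_apply, b_apply, map_sum]
  exact Finset.sum_congr rfl fun j hj =>
    h.map_face k j (Nat.lt_succ_iff.1 (Finset.mem_range.1 hj)) x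

theorem map_b' (h : Map C C' f) (k : ℕ) (x : X k) : f (k + 1) (C.b' k x) = C'.b' k (f k x) := by
  rw [b'_apply, b'_apply, map_sum]
  exact Finset.sum_congr rfl fun j hj => h.map_face k j (Finset.mem_range.1 hj).le x

theorem map_norm (h : Map C C' f) (k : ℕ) (x : X k) : f k (C.norm k x) = C'.norm k (f k x) := by
  have hpow : ∀ n : ℕ, f k ((C.lam k ^ n) x) = (C'.lam k ^ n) (f k x) := by
    intro n
    induction n with
    | zero => rfl
    | succ n ih => rw [pow_succ', pow_succ', Module.End.mul_apply, Module.End.mul_apply,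
        h.map_lam, ih]
  rw [norm_apply, norm_apply, map_sum]
  exact Finset.sum_congr rfl fun n _ => hpow n

end Map

/-- A map of cyclic objects that commutes with the derivations, but not necessarily with the
degeneracies, is a map of complexes of pairs. -/
theorem Map.pairD (h : Map C C' f) {Δ : C.Der} {Δ' : C'.Der}
    (hΔ : ∀ k j x, f k (Δ.D k j x) = Δ'.D k j (f k x)) (z : Tot X ℤ × Tot X ℤ) :
    (idMap 0 f).prodMap (idMap 0 f) (pairD Δ z) =
      pairD Δ' ((idMap 0 f).prodMap (idMap 0 f) z) := by
  suffices h : (idMap 0 f).prodMap (idMap 0 f) ∘ₗ CyclicOps.pairD Δ =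
    CyclicOps.pairD Δ' ∘ₗ (idMap 0 f).prodMap (idMap 0 f) from LinearMap.congr_fun h z
  have hL : ∀ k x, f k (Δ.L k x) = Δ'.L k (f k x) := fun k x => by
    rw [Der.L_apply, Der.L_apply, map_sum]
    exact Finset.sum_congr rfl fun j _ => hΔ k j x
  refine Tot.prod_hom_ext (fun k q x => ?_) (fun k q x => ?_) <;>
  simp only [LinearMap.comp_apply, LinearMap.prodMap_apply, pairD_apply, LinearMap.sub_apply,
    LinearMap.id_apply, upMap_place, idMap_place, map_zero, map_add, map_neg, map_sub, add_zero,
    Der.signed_apply, map_smul, h.map_b, h.map_b', h.map_norm, h.map_lam, hL]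

theorem Map.unitalD (h : Map C C' f) (hu : ∀ k x, f k (C.unit k x) = C'.unit k (f (k + 1) x))
    {Δ : C.Der} {Δ' : C'.Der} (hΔ : ∀ k j x, f k (Δ.D k j x) = Δ'.D k j (f k x)) (c : Tot X ℤ) :
    idMap 0 f (unitalD Δ c) = CyclicOps.unitalD Δ' (idMap 0 f c) := by
  suffices h : idMap 0 f ∘ₗ CyclicOps.unitalD Δ = CyclicOps.unitalD Δ' ∘ₗ idMap 0 f from
    LinearMap.congr_fun h c
  have hL : ∀ k x, f k (Δ.L k x) = Δ'.L k (f k x) := fun k x => by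
    rw [Der.L_apply, Der.L_apply, map_sum]
    exact Finset.sum_congr rfl fun j _ => hΔ k j x
  refine Tot.hom_ext fun k q x => ?_
  cases k <;>
  simp only [LinearMap.comp_apply, CyclicOps.unitalD, LinearMap.add_apply, upMap_place,
    idMap_place, dnMap_place_zero, dnMap_place_succ, map_add, Der.signed_apply, map_smul,
    h.map_b, B_apply, h.map_norm, hu, map_sub, h.map_lam, hL, add_zero]

end CyclicOps

section Pullback

variable {A A' : Type*} [Ring A] [Algebra ℂ A] [Ring A'] [Algebra ℂ A']
  {𝒜 : ℤ → Submodule ℂ A} [GradedAlgebra 𝒜] {𝒜' : ℤ → Submodule ℂ A'} [GradedAlgebra 𝒜']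

/-- The pullback of functionals along a linear map. -/
def pull (f : A →ₗ[ℂ] A') (k : ℕ) : Functional A' k →ₗ[ℂ] Functional A k :=
  slotMap fun _ => f

@[simp] theorem pull_seq (f : A →ₗ[ℂ] A') {k : ℕ} (φ : Functional A' k) (a : ℕ → A) :
    (pull f k φ).seq a = φ.seq fun l => f (a l) := slotMap_seq _ φ a

theorem pull_mulAt {f : A →ₗ[ℂ] A'} (hf : ∀ a b, f (a * b) = f a * f b) {k : ℕ} (j : Fin (k + 1))
    (φ : Functional A' k) : pull f (k + 1) (mulAt j φ) = mulAt j (pull f k φ) := by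
  refine Functional.ext_seq fun a => ?_
  simp only [pull_seq, mulAt_seq]
  refine φ.seq_congr fun l _ => ?_
  split_ifs <;> simp [hf]

theorem pull_cyclicOp {f : A →ₗ[ℂ] A'} (hf : ∀ a, f (koszul 𝒜 1 a) = koszul 𝒜' 1 (f a)) (k : ℕ)
    (φ : Functional A' k) : pull f k (cyclicOp 𝒜' k φ) = cyclicOp 𝒜 k (pull f k φ) := by
  have hk : ∀ s : ℕ, f ∘ₗ koszul 𝒜 s = koszul 𝒜' s ∘ₗ f := by
    intro s
    rcases Nat.even_or_odd s with hs | hs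
    · rw [koszul_of_even 𝒜 (by exact_mod_cast hs), koszul_of_even 𝒜' (by exact_mod_cast hs)]; rfl
    · rw [koszul_of_odd 𝒜 (by exact_mod_cast hs), koszul_of_odd 𝒜' (by exact_mod_cast hs)]
      exact LinearMap.ext hf
  have hp : ∀ s : ℕ, f ∘ₗ parityPart 𝒜 s = parityPart 𝒜' s ∘ₗ f := by
    intro s
    refine LinearMap.ext fun a => ?_
    simp [parityPart, hf]
  change pull f k (∑ s ∈ Finset.range 2, (φ.domDomCongr (finRotate (k + 1)).symm).compLinearMap
    (fun i => if i = Fin.last k then parityPart 𝒜' s else koszul 𝒜' s)) =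
    ∑ s ∈ Finset.range 2, ((pull f k φ).domDomCongr (finRotate (k + 1)).symm).compLinearMap
    (fun i => if i = Fin.last k then parityPart 𝒜 s else koszul 𝒜 s)
  rw [map_sum]
  refine Finset.sum_congr rfl fun s _ => MultilinearMap.ext fun a => ?_
  refine φ.congr_arg (funext fun i => ?_)
  dsimp only
  split_ifs
  · exact (LinearMap.congr_fun (hp s) _).symm
  · exact (LinearMap.congr_fun (hk s) _).symm

theorem pull_insertOne {f : A →ₗ[ℂ] A'} (hf : f 1 = 1) (k : ℕ) (φ : Functional A' (k + 1)) :
    pull f k (insertOne k φ) = insertOne k (pull f (k + 1) φ) := by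
  refine Functional.ext_seq fun a => ?_
  simp only [pull_seq, insertOne_seq]
  refine φ.seq_congr fun l _ => ?_
  split_ifs <;> simp [hf]

theorem pull_map {f : A →ₗ[ℂ] A'} (hf : ∀ a b, f (a * b) = f a * f b)
    (hγ : ∀ a, f (koszul 𝒜 1 a) = koszul 𝒜' 1 (f a)) :
    CyclicOps.Map (functionalOps 𝒜') (functionalOps 𝒜) (pull f) where
  map_lam k φ := by
    change pull f k ((-1 : ℂ) ^ k • cyclicOp 𝒜' k φ) = (-1 : ℂ) ^ k • cyclicOp 𝒜 k (pull f k φ)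
    rw [map_smul, pull_cyclicOp hγ]
  map_face k j _ φ := by
    change pull f (k + 1) (signedFace 𝒜' k j φ) = signedFace 𝒜 k j (pull f k φ)
    rw [signedFace, signedFace]
    split_ifs
    · simp only [LinearMap.smul_apply, map_smul, pull_mulAt hf]
    · simp only [LinearMap.smul_apply, LinearMap.comp_apply, map_smul, pull_cyclicOp hγ,
        pull_mulAt hf]

theorem pull_unit {f : A →ₗ[ℂ] A'} (h1 : f 1 = 1)
    (hγ : ∀ a, f (koszul 𝒜 1 a) = koszul 𝒜' 1 (f a)) (k : ℕ) (φ : Functional A' (k + 1)) :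
    pull f k ((functionalOps 𝒜').unit k φ) = (functionalOps 𝒜).unit k (pull f (k + 1) φ) := by
  change pull f k (insertOne k (cyclicOp 𝒜' (k + 1) φ)) =
    insertOne k (cyclicOp 𝒜 (k + 1) (pull f (k + 1) φ))
  rw [pull_insertOne h1, pull_cyclicOp hγ]

theorem pull_slotDer {c : ℤ} {f : A →ₗ[ℂ] A'} (hγ : ∀ a, f (koszul 𝒜 c a) = koszul 𝒜' c (f a))
    {d : A →ₗ[ℂ] A} {d' : A' →ₗ[ℂ] A'} (hd : ∀ a, f (d a) = d' (f a)) (k j : ℕ)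
    (φ : Functional A' k) : pull f k (slotDer 𝒜' c d' k j φ) = slotDer 𝒜 c d k j (pull f k φ) := by
  refine Functional.ext_seq fun a => ?_
  simp only [pull_seq, slotDer_seq]
  refine φ.seq_congr fun l _ => ?_
  split_ifs <;> simp [hγ, hd]

theorem periodicD_pull {f : A →ₗ[ℂ] A'} (h1 : f 1 = 1) (hf : ∀ a b, f (a * b) = f a * f b)
    (hγ : ∀ a, f (koszul 𝒜 1 a) = koszul 𝒜' 1 (f a)) {d : A →ₗ[ℂ] A} {d' : A' →ₗ[ℂ] A'}
    (hdA : IsDGAlgebra 𝒜 d) (hdA' : IsDGAlgebra 𝒜' d') (hd : ∀ a, f (d a) = d' (f a))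
    (c : Tot (Functional A') ℤ) :
    idMap 0 (pull f) (periodicD 𝒜' d' c) = periodicD 𝒜 d (idMap 0 (pull f) c) := by
  rw [periodicD_eq hdA, periodicD_eq hdA']
  exact (pull_map hf hγ).unitalD (pull_unit h1 hγ) (fun k j φ => pull_slotDer hγ hd k j φ) c

omit [GradedAlgebra 𝒜] [GradedAlgebra 𝒜'] in
theorem pull_mem_contWeight [TopologicalSpace A] [TopologicalSpace A'] {f : A →ₗ[ℂ] A'}
    (hf : ∀ i, ∀ a ∈ 𝒜 i, f a ∈ 𝒜' i) (hfc : Continuous f) {m : ℤ} {k : ℕ}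
    {φ : Functional A' k} (hφ : φ ∈ contWeight 𝒜' m k) : pull f k φ ∈ contWeight 𝒜 m k :=
  ⟨slotMap_mem_weightPart (r := fun _ => 0) (fun _ _ i a ha => by rw [add_zero]; exact hf i a ha)
    (by simp) hφ.1, slotMap_mem_continuousPart (fun _ _ => hfc) hφ.2⟩

end Pullback

/-! ### Periodic cyclic cohomology of a DG algebra and of its part of degree zero -/

section DegreeZero

variable {A : Type*} [Ring A] [Algebra ℂ A] {𝒜 : ℤ → Submodule ℂ A} [GradedAlgebra 𝒜]

theorem extendByZero_eq : extendByZero 𝒜 = idMap 0 (pull (projZero 𝒜)) := by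
  refine Tot.hom_ext fun k q φ => ?_
  rw [idMap_place, add_zero]
  exact DirectSum.toModule_lof (M := fun p : ℕ × ℤ => Functional ↥(𝒜 0) p.1) ℂ (k, q) φ

theorem coe_projZero (a : A) : (projZero 𝒜 a : A) = GradedAlgebra.proj 𝒜 0 a := rfl

theorem projZero_coe (a : ↥(𝒜 0)) : projZero 𝒜 a = a :=
  Subtype.ext (by rw [coe_projZero, proj_of_mem 𝒜 0 a.2, if_pos rfl])

theorem projZero_one : projZero 𝒜 1 = 1 :=
  Subtype.ext (by
    rw [coe_projZero, proj_of_mem 𝒜 0 (SetLike.one_mem_graded 𝒜), if_pos rfl]; rfl)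

/-- The projection to the part of degree zero is a homomorphism, because the grading is
nonnegative. -/
theorem projZero_mul (hA : ∀ n < 0, 𝒜 n = ⊥) (a b : A) :
    projZero 𝒜 (a * b) = projZero 𝒜 a * projZero 𝒜 b :=
  Subtype.ext (by
    rw [coe_projZero, proj_mul 𝒜 hA]
    simp [coe_projZero])

theorem koszul_trivialGrading {A : Type*} [Ring A] [Algebra ℂ A] (i : ℤ) (a : A) :
    koszul (trivialGrading A) i a = a := by
  rw [koszul_of_mem _ i (mem_trivialGrading_zero a)]
  simp

theorem projZero_koszul (a : A) :
    projZero 𝒜 (koszul 𝒜 1 a) = koszul (trivialGrading ↥(𝒜 0)) 1 (projZero 𝒜 a) := by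
  rw [koszul_trivialGrading]
  exact Subtype.ext (by rw [coe_projZero, coe_projZero, proj_koszul]; simp)

theorem isDGAlgebra_zero {A : Type*} [Ring A] [Algebra ℂ A] (𝒜 : ℤ → Submodule ℂ A)
    [GradedAlgebra 𝒜] : IsDGAlgebra 𝒜 0 where
  d_mem _ _ _ := Submodule.zero_mem _
  d_d _ := rfl
  leibniz _ _ _ _ := by simp

variable {d : A →ₗ[ℂ] A} (hd : IsDGAlgebra 𝒜 d) (hA : ∀ n < 0, 𝒜 n = ⊥)
include hd hA

theorem projZero_d (a : A) : projZero 𝒜 (d a) = 0 :=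
  Subtype.ext (by
    have h := proj_mem 𝒜 (0 - 1) a
    rw [hA _ (by norm_num), Submodule.mem_bot] at h
    rw [coe_projZero, proj_map 𝒜 hd.d_mem, h, map_zero]; rfl)

theorem periodicD_extendByZero (c : Tot (Functional ↥(𝒜 0)) ℤ) :
    periodicD 𝒜 d (extendByZero 𝒜 c) =
      extendByZero 𝒜 (periodicD (trivialGrading ↥(𝒜 0)) 0 c) := by
  rw [extendByZero_eq]
  exact (periodicD_pull projZero_one (projZero_mul hA) projZero_koszul hd (isDGAlgebra_zero _)
    (fun a => projZero_d hd hA a) c).symm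

omit hd in
/-- The cochains of nonpositive weight are the extensions by zero of the cochains of the part of
degree zero. -/
theorem exists_extendByZero [TopologicalSpace A] {j : ℤ} {c : Tot (Functional A) ℤ}
    (hc : c ∈ gradedSub (weightIn (contWeight 𝒜) (Set.Iic 0)) j) :
    ∃ u ∈ periodicCochains (trivialGrading ↥(𝒜 0)) j, extendByZero 𝒜 u = c := by
  have hmem : ∀ i, ∀ a ∈ trivialGrading ↥(𝒜 0) i, (𝒜 0).subtype a ∈ 𝒜 i := by
    intro i a ha
    by_cases hi : i = 0
    · subst hi
      exact a.2
    · rw [eq_zero_of_mem_trivialGrading hi ha, map_zero]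
      exact Submodule.zero_mem _
  refine ⟨idMap 0 (pull (𝒜 0).subtype) c, ?_, ?_⟩
  · rw [periodicCochains_eq]
    refine idMap_mem (𝒱 := weightIn (contWeight 𝒜) (Set.Iic 0))
      (𝒲 := contWeight (trivialGrading ↥(𝒜 0))) (r := 0) (fun m k φ hφ => ?_) (by omega) hc
    rw [add_zero]
    exact pull_mem_contWeight hmem continuous_subtype_val hφ.1
  · rw [extendByZero_eq]
    refine sub_eq_zero.1 (mem_of_mem_gradedSub
      (f := idMap 0 (pull (projZero 𝒜)) ∘ₗ idMap 0 (pull (𝒜 0).subtype) - LinearMap.id)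
      (N := ⊥) (fun k q φ hφ => ?_) hc)
    simp only [LinearMap.sub_apply, LinearMap.comp_apply, idMap_place, LinearMap.id_apply,
      add_zero, Submodule.mem_bot, ← map_sub]
    suffices h : pull (projZero 𝒜) k (pull (𝒜 0).subtype k φ) = φ by rw [h, sub_self, map_zero]
    refine MultilinearMap.ext fun a => ?_
    change φ (fun i => GradedAlgebra.proj 𝒜 0 (a i)) = φ a
    -- The functionals of negative weight vanish, those of weight zero depend only on the components
    -- of degree zero, and positive weights do not occur.
    rcases lt_trichotomy (k + 2 * q - j : ℤ) 0 with hm | hm | hm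
    · rw [apply_eq_sum_proj hA hφ.1.1, apply_eq_sum_proj hA hφ.1.1, Finset.Icc_eq_empty (by omega),
        Fintype.piFinset_empty, Finset.sum_empty, Finset.sum_empty]
    · rw [apply_eq_sum_proj hA hφ.1.1 a, hm, Finset.Icc_self, Fintype.piFinset_singleton,
        Finset.sum_singleton]
    · rw [hφ.2 (by simpa using hm)]
      rfl

omit hA hd in
theorem pull_projZero_mem [TopologicalSpace A] (hproj : ∀ n, Continuous (GradedAlgebra.proj 𝒜 n))
    {m : ℤ} {k : ℕ} {φ : Functional ↥(𝒜 0) k}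
    (hφ : φ ∈ contWeight (trivialGrading ↥(𝒜 0)) m k) :
    pull (projZero 𝒜) k φ ∈ weightIn (contWeight 𝒜) (Set.Iic 0) m k := by
  refine ⟨pull_mem_contWeight (fun i a ha => ?_) ((hproj 0).subtype_mk _) hφ, fun hm => ?_⟩
  · by_cases hi : i = 0
    · subst hi
      exact mem_trivialGrading_zero _
    · rw [show projZero 𝒜 a = 0 from Subtype.ext (by
        rw [coe_projZero, proj_of_mem 𝒜 0 ha, if_neg hi]; rfl)]
      exact Submodule.zero_mem _
  · refine MultilinearMap.ext fun a => hφ.1 (fun _ => 0) _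
      (fun i => mem_trivialGrading_zero _) ?_
    rw [Finset.sum_const_zero]
    rintro rfl
    exact hm Set.self_mem_Iic

omit hA hd in
theorem extendByZero_mem [TopologicalSpace A] (hproj : ∀ n, Continuous (GradedAlgebra.proj 𝒜 n))
    {j : ℤ} {u : Tot (Functional ↥(𝒜 0)) ℤ}
    (hu : u ∈ periodicCochains (trivialGrading ↥(𝒜 0)) j) :
    extendByZero 𝒜 u ∈ gradedSub (weightIn (contWeight 𝒜) (Set.Iic 0)) j := by
  rw [periodicCochains_eq] at hu
  rw [extendByZero_eq]
  refine idMap_mem (𝒱 := contWeight (trivialGrading ↥(𝒜 0)))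
    (𝒲 := weightIn (contWeight 𝒜) (Set.Iic 0)) (r := 0) (fun m k φ hφ => ?_) (by omega) hu
  rw [add_zero]
  exact pull_projZero_mem hproj hφ

omit hA hd in
theorem extendByZero_injective : Function.Injective (extendByZero 𝒜) := by
  have h : idMap 0 (pull (𝒜 0).subtype) ∘ₗ extendByZero 𝒜 = LinearMap.id := by
    rw [extendByZero_eq]
    refine Tot.hom_ext fun k q φ => ?_
    simp only [LinearMap.comp_apply, idMap_place, add_zero, LinearMap.id_apply]
    refine congrArg _ (Functional.ext_seq fun a => ?_)
    simp only [pull_seq, Submodule.subtype_apply, projZero_coe]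
  exact Function.LeftInverse.injective (g := idMap 0 (pull (𝒜 0).subtype))
    (fun c => LinearMap.congr_fun h c)

omit hd in
theorem weight_ext {m : ℤ} {k : ℕ} {φ ψ : Functional A k} (hφ : φ ∈ weightPart 𝒜 k m)
    (hψ : ψ ∈ weightPart 𝒜 k m) (h : ∀ (n : Fin (k + 1) → ℤ) (a : Fin (k + 1) → A),
      (∀ i, a i ∈ 𝒜 (n i)) → ∑ i, n i = m → φ a = ψ a) : φ = ψ := by
  refine MultilinearMap.ext fun a => ?_
  rw [apply_eq_sum_proj hA hφ, apply_eq_sum_proj hA hψ]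
  refine Finset.sum_congr rfl fun n _ => ?_
  by_cases hn : ∑ i, n i = m
  · exact h n _ (fun i => proj_mem 𝒜 _ _) hn
  · rw [hφ n _ (fun i => proj_mem 𝒜 _ _) hn, hψ n _ (fun i => proj_mem 𝒜 _ _) hn]

omit hd hA in
variable (𝒜) in
/-- The derivation of the cyclic object of functionals given by the degree. -/
def weightDer : (functionalOps 𝒜).Der :=
  functionalDer (Or.inl rfl) (degDer_isGradedDerivation 𝒜) (degDer_one 𝒜)

omit hd in
/-- The Lie derivative along the degree derivation multiplies a functional by its weight. -/
theorem weightDer_L {m : ℤ} {k : ℕ} {φ : Functional A k} (hφ : φ ∈ weightPart 𝒜 k m) :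
    (weightDer 𝒜).L k φ = (m : ℂ) • φ := by
  have hslot : ∀ j ≤ k, slotDer 𝒜 0 (degDer 𝒜) k j φ ∈ weightPart 𝒜 k m := fun j _ =>
    slotMap_mem_weightPart (r := fun _ => 0) (fun l _ i a ha => by
      split_ifs
      · rw [add_zero]; exact koszul_mem 𝒜 0 ha
      · exact degDer_mem 𝒜 i a ha
      · rw [add_zero]; exact ha) (by simp) hφ
  rw [CyclicOps.Der.L_apply]
  refine weight_ext hA (Submodule.sum_mem _ fun j hj =>
    hslot j (Nat.lt_succ_iff.1 (Finset.mem_range.1 hj))) (Submodule.smul_mem _ _ hφ)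
    fun n a ha hn => ?_
  rw [_root_.smul_apply, ← hn, Finset.sum_range, _root_.sum_apply, Int.cast_sum,
    smul_eq_mul, Finset.sum_mul]
  refine Finset.sum_congr rfl fun j _ => ?_
  have hj : (fun i : Fin (k + 1) => (if (i : ℕ) < j then koszul 𝒜 0 else
      if (i : ℕ) = j then degDer 𝒜 else LinearMap.id) (a i)) =
      Function.update a j ((n j : ℂ) • a j) := by
    funext i
    rcases eq_or_ne i j with rfl | hij
    · simp [degDer_of_mem 𝒜 (ha i), Int.cast_smul_eq_zsmul]
    · simp [hij, Fin.val_ne_of_ne hij]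
  change φ (fun i : Fin (k + 1) => (if (i : ℕ) < j then koszul 𝒜 0 else
      if (i : ℕ) = j then degDer 𝒜 else LinearMap.id) (a i)) = _
  rw [hj, φ.map_update_smul, Function.update_eq_self, smul_eq_mul]

omit hd hA in
theorem weightDer_commutes : (weightDer 𝒜).Commutes (weightDer 𝒜) := fun k i j φ =>
  slotDer_comm (c := 0) (fun a => by rw [koszul_zero]; rfl) (fun _ => rfl) k i j φ

end DegreeZero

section Comparison

variable {A : Type*} [Ring A] [Algebra ℂ A] {𝒜 : ℤ → Submodule ℂ A} [GradedAlgebra 𝒜]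
  [TopologicalSpace A] [IsTopologicalRing A] (hA : ∀ n < 0, 𝒜 n = ⊥)
  (hproj : ∀ n, Continuous (GradedAlgebra.proj 𝒜 n))
include hA hproj

/-- The parity automorphism need not be continuous for the given topology, but it is for the topology
of componentwise convergence, which has the same continuous functionals of a given weight. -/
theorem contWeight_stable : (functionalOps 𝒜).Stable (contWeight 𝒜) := by
  rw [← contWeight_component hA hproj]
  exact @functionalOps_stable A _ _ 𝒜 (componentTopology 𝒜) _ (component_isTopologicalRing hA)
    (component_continuous_koszul 1)

theorem weightDer_shifts : (weightDer 𝒜).Shifts (contWeight 𝒜) 0 := by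
  rw [← contWeight_component hA hproj]
  intro m k j hj φ hφ
  exact @slotDer_mem_contWeight A _ _ 𝒜 (componentTopology 𝒜) _ (component_continuous_koszul 1)
    0 0 _ component_continuous_degDer (degDer_mem 𝒜) m k j hj φ hφ

variable {d : A →ₗ[ℂ] A} (hd : IsDGAlgebra 𝒜 d) (hdc : Continuous d)
include hdc

omit [IsTopologicalRing A] in
theorem contWeight_diffDer_shifts [IsTopologicalRing A] :
    (diffDer hd).Shifts (contWeight 𝒜) (-1) := by
  rw [← contWeight_component hA hproj]
  exact @diffDer_shifts A _ _ 𝒜 (componentTopology 𝒜) _ (component_continuous_koszul 1) d hd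
    (component_continuous_map hd.d_mem hdc)

include hd

/-- If the differential of a cochain is supported in weight zero, then so is the cochain, up to a
coboundary. -/
theorem exists_sub_periodicD_eq_extendByZero {j : ℤ} {c : Tot (Functional A) ℤ}
    (hc : c ∈ periodicCochains 𝒜 j) {u : Tot (Functional ↥(𝒜 0)) ℤ}
    (hu : u ∈ periodicCochains (trivialGrading ↥(𝒜 0)) (j + 1))
    (hdc' : periodicD 𝒜 d c = extendByZero 𝒜 u) :
    ∃ z ∈ periodicCochains 𝒜 (j - 1), ∃ y ∈ periodicCochains (trivialGrading ↥(𝒜 0)) j,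
      extendByZero 𝒜 y = c - periodicD 𝒜 d z := by
  rw [periodicD_eq hd] at hdc' ⊢
  have h0 : CyclicOps.unitalD (diffDer hd) c ∈
      gradedSub (weightIn (contWeight 𝒜) (Set.Iic 0)) (j + 1) := by
    rw [hdc']
    exact extendByZero_mem hproj hu
  have hS := contWeight_stable hA hproj
  have hD := weightDer_shifts hA hproj
  have hL : ∀ m k, ∀ φ ∈ contWeight 𝒜 m k, (weightDer 𝒜).L k φ = (m : ℂ) • φ :=
    fun m k φ hφ => weightDer_L hA hφ.1
  rw [periodicCochains_eq] at hc
  obtain ⟨z, hz, h⟩ := hS.exists_weight_nonpos hD weightDer_commutes hL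
    (contWeight_diffDer_shifts hA hproj hd hdc) (diffDer_squareZero hd) hc h0
  obtain ⟨y, hy, hyc⟩ := exists_extendByZero hA h
  exact ⟨z, hz, y, hy, hyc⟩

/-- Every cocycle is cohomologous to the extension by zero of a cocycle of `𝒜 0`. -/
theorem exists_extendByZero_sub_mem {j : ℤ} {c : Tot (Functional A) ℤ}
    (hc : c ∈ periodicCocycles 𝒜 d j) :
    ∃ y ∈ periodicCocycles (trivialGrading ↥(𝒜 0)) 0 j,
      extendByZero 𝒜 y - c ∈ periodicCoboundaries 𝒜 d j := by
  obtain ⟨z, hz, y, hy, hyc⟩ := exists_sub_periodicD_eq_extendByZero hA hproj hd hdc hc.1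
    (Submodule.zero_mem _) (hc.2.trans (map_zero _).symm)
  refine ⟨y, ⟨hy, extendByZero_injective ?_⟩, -z, Submodule.neg_mem _ hz, ?_⟩
  · rw [← periodicD_extendByZero hd hA, hyc, map_sub, show periodicD 𝒜 d c = 0 from hc.2,
      periodicD_eq hd, CyclicOps.unitalD_unitalD (diffDer_squareZero hd), sub_zero, map_zero]
  · rw [hyc, map_neg]
    abel

/-- A cocycle of `𝒜 0` is a coboundary if its extension by zero is. -/
theorem mem_periodicCoboundaries_of_extendByZero {j : ℤ} {y : Tot (Functional ↥(𝒜 0)) ℤ}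
    (hy : y ∈ periodicCochains (trivialGrading ↥(𝒜 0)) j)
    (h : extendByZero 𝒜 y ∈ periodicCoboundaries 𝒜 d j) :
    y ∈ periodicCoboundaries (trivialGrading ↥(𝒜 0)) 0 j := by
  obtain ⟨w, hw, hwy⟩ := h
  obtain ⟨z, hz, u, hu, huw⟩ := exists_sub_periodicD_eq_extendByZero hA hproj hd hdc hw
    (by rwa [sub_add_cancel]) hwy
  refine ⟨u, hu, extendByZero_injective ?_⟩
  rw [← periodicD_extendByZero hd hA, huw, map_sub, hwy, periodicD_eq hd,
    CyclicOps.unitalD_unitalD (diffDer_squareZero hd), sub_zero]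

end Comparison

/-! ### Tensor powers of a graded coalgebra -/

section TensorPower

variable {H : Type*} [Ring H] [Algebra ℂ H]

variable (H) in
/-- The generator of the tensor power with no factors. -/
def nil : TPow H 0 := PiTensorProduct.tprod ℂ Fin.elim0

theorem cons_tprod {k : ℕ} (h : H) (v : Fin k → H) :
    cons k (h ⊗ₜ[ℂ] PiTensorProduct.tprod ℂ v) =
      PiTensorProduct.tprod ℂ (Fin.cons h v : Fin (k + 1) → H) := by
  exact PiTensorProduct.lift.tprod (φ := (PiTensorProduct.tprod ℂ
    (s := fun _ : Fin (k + 1) => H)).curryLeft h) v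

theorem uncons_tprod {k : ℕ} (v : Fin (k + 1) → H) :
    uncons k (PiTensorProduct.tprod ℂ v) = v 0 ⊗ₜ[ℂ] PiTensorProduct.tprod ℂ (Fin.tail v) := by
  simp [uncons]

theorem tprod_eq_cons {k : ℕ} (v : Fin (k + 1) → H) :
    PiTensorProduct.tprod ℂ v = cons k (v 0 ⊗ₜ[ℂ] PiTensorProduct.tprod ℂ (Fin.tail v)) := by
  rw [cons_tprod, Fin.cons_self_tail]

theorem tprod_zero (v : Fin 0 → H) : PiTensorProduct.tprod ℂ v = nil H := by
  rw [nil, Subsingleton.elim v Fin.elim0]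

@[simp] theorem uncons_cons {k : ℕ} (t : H ⊗[ℂ] TPow H k) : uncons k (cons k t) = t := by
  suffices h : uncons k ∘ₗ cons k = (LinearMap.id : H ⊗[ℂ] TPow H k →ₗ[ℂ] _) from
    LinearMap.congr_fun h t
  refine TensorProduct.ext (LinearMap.ext fun h => PiTensorProduct.ext ?_)
  ext v
  simp [cons_tprod, uncons_tprod]

section Ext

variable {M : Type*} [AddCommGroup M] [Module ℂ M]

theorem TPow.ext_zero {f g : TPow H 0 →ₗ[ℂ] M} (h : f (nil H) = g (nil H)) : f = g :=
  PiTensorProduct.ext (MultilinearMap.ext fun v => by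
    simpa only [LinearMap.compMultilinearMap_apply, tprod_zero] using h)

theorem TPow.ext_cons {k : ℕ} {f g : TPow H (k + 1) →ₗ[ℂ] M}
    (h : ∀ u x, f (cons k (u ⊗ₜ x)) = g (cons k (u ⊗ₜ x))) : f = g :=
  PiTensorProduct.ext (MultilinearMap.ext fun v => by
    simpa only [LinearMap.compMultilinearMap_apply, tprod_eq_cons] using h _ _)

theorem TPow.ext_cons_of_mem (ℋ : ℤ → Submodule ℂ H) [GradedAlgebra ℋ] {k : ℕ}
    {f g : TPow H (k + 1) →ₗ[ℂ] M}
    (h : ∀ n, ∀ u ∈ ℋ n, ∀ x, f (cons k (u ⊗ₜ x)) = g (cons k (u ⊗ₜ x))) : f = g := by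
  refine TPow.ext_cons fun u x => ?_
  have : f ∘ₗ cons k ∘ₗ (TensorProduct.mk ℂ H (TPow H k)).flip x =
      g ∘ₗ cons k ∘ₗ (TensorProduct.mk ℂ H (TPow H k)).flip x :=
    linearMap_ext_homogeneous ℋ fun n u hu => h n u hu x
  exact LinearMap.congr_fun this u

end Ext

theorem snoc_nil (g : H) : snoc 0 g (nil H) = cons 0 (g ⊗ₜ nil H) := by
  rw [nil, snoc, PiTensorProduct.lift.tprod, cons_tprod, MultilinearMap.curryMid_apply_apply]
  refine congrArg _ (funext fun i => ?_)
  fin_cases i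
  rfl

theorem snoc_cons {k : ℕ} (g h : H) (x : TPow H k) :
    snoc (k + 1) g (cons k (h ⊗ₜ x)) = cons (k + 1) (h ⊗ₜ snoc k g x) := by
  suffices e : snoc (k + 1) g ∘ₗ cons k ∘ₗ TensorProduct.mk ℂ H (TPow H k) h =
      cons (k + 1) ∘ₗ TensorProduct.mk ℂ H (TPow H (k + 1)) h ∘ₗ snoc k g from
    LinearMap.congr_fun e x
  refine PiTensorProduct.ext (MultilinearMap.ext fun v => ?_)
  simp only [LinearMap.compMultilinearMap_apply, LinearMap.comp_apply, TensorProduct.mk_apply,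
    cons_tprod, snoc, PiTensorProduct.lift.tprod, MultilinearMap.curryMid_apply_apply,
    Fin.insertNth_last']
  rw [Fin.cons_snoc_eq_snoc_cons]

variable (ℋ : ℤ → Submodule ℂ H) [GradedAlgebra ℋ]

/-- The operator multiplying a tensor of weight `w` by `(-1) ^ (i * w)`. -/
abbrev tensorKoszul (k : ℕ) (i : ℤ) : TPow H k →ₗ[ℂ] TPow H k :=
  PiTensorProduct.map fun _ => koszul ℋ i

theorem tensorKoszul_nil (i : ℤ) : tensorKoszul ℋ 0 i (nil H) = nil H := by
  rw [nil, tensorKoszul, PiTensorProduct.map_tprod, tprod_zero, ← nil]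

theorem tensorKoszul_cons {k : ℕ} (i : ℤ) (h : H) (x : TPow H k) :
    tensorKoszul ℋ (k + 1) i (cons k (h ⊗ₜ x)) =
      cons k (koszul ℋ i h ⊗ₜ tensorKoszul ℋ k i x) := by
  suffices e : tensorKoszul ℋ (k + 1) i ∘ₗ cons k ∘ₗ TensorProduct.mk ℂ H (TPow H k) h =
      cons k ∘ₗ TensorProduct.mk ℂ H (TPow H k) (koszul ℋ i h) ∘ₗ tensorKoszul ℋ k i from
    LinearMap.congr_fun e x
  refine PiTensorProduct.ext (MultilinearMap.ext fun v => ?_)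
  simp only [LinearMap.compMultilinearMap_apply, LinearMap.comp_apply, TensorProduct.mk_apply,
    cons_tprod, PiTensorProduct.map_tprod]
  refine congrArg _ (funext fun l => ?_)
  refine Fin.cases ?_ (fun l => ?_) l <;> simp

theorem tensorKoszul_map_cons {k : ℕ} (i : ℤ) (t : H ⊗[ℂ] TPow H k) :
    tensorKoszul ℋ (k + 1) i (cons k t) =
      cons k (TensorProduct.map (koszul ℋ i) (tensorKoszul ℋ k i) t) := by
  suffices e : tensorKoszul ℋ (k + 1) i ∘ₗ cons k =
      cons k ∘ₗ TensorProduct.map (koszul ℋ i) (tensorKoszul ℋ k i) from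
    LinearMap.congr_fun e t
  exact TensorProduct.ext' fun h x => tensorKoszul_cons ℋ i h x

theorem tensorKoszul_add (k : ℕ) (i j : ℤ) (x : TPow H k) :
    tensorKoszul ℋ k (i + j) x = tensorKoszul ℋ k i (tensorKoszul ℋ k j x) := by
  rw [tensorKoszul, tensorKoszul, tensorKoszul, ← LinearMap.comp_apply, ← PiTensorProduct.map_comp,
    koszul_add]

theorem tensorKoszul_self (k : ℕ) (i : ℤ) (x : TPow H k) :
    tensorKoszul ℋ k i (tensorKoszul ℋ k i x) = x := by
  rw [← tensorKoszul_add, tensorKoszul, koszul_of_even ℋ ⟨i, rfl⟩, PiTensorProduct.map_id,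
    LinearMap.id_apply]

theorem tensorKoszul_snoc {g : H} (hg : g ∈ ℋ 0) (i : ℤ) : (k : ℕ) → (x : TPow H k) →
    tensorKoszul ℋ (k + 1) i (snoc k g x) = snoc k g (tensorKoszul ℋ k i x)
  | 0, x => by
    suffices e : tensorKoszul ℋ 1 i ∘ₗ snoc 0 g = snoc 0 g ∘ₗ tensorKoszul ℋ 0 i from
      LinearMap.congr_fun e x
    refine TPow.ext_zero ?_
    rw [LinearMap.comp_apply, LinearMap.comp_apply, tensorKoszul_nil, snoc_nil, tensorKoszul_cons,
      tensorKoszul_nil, koszul_of_mem ℋ i hg]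
    simp
  | k + 1, x => by
    suffices e : tensorKoszul ℋ (k + 2) i ∘ₗ snoc (k + 1) g =
        snoc (k + 1) g ∘ₗ tensorKoszul ℋ (k + 1) i from LinearMap.congr_fun e x
    refine TPow.ext_cons fun h x => ?_
    rw [LinearMap.comp_apply, LinearMap.comp_apply, snoc_cons, tensorKoszul_cons,
      tensorKoszul_snoc hg i k x, tensorKoszul_cons, snoc_cons]

theorem hopfd_zero (d : H →ₗ[ℂ] H) (x : TPow H 0) : hopfd ℋ d 0 x = 0 := by
  simp [hopfd]

theorem hopfd_cons {k : ℕ} (d : H →ₗ[ℂ] H) (h : H) (x : TPow H k) :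
    hopfd ℋ d (k + 1) (cons k (h ⊗ₜ x)) =
      cons k (d h ⊗ₜ x) + cons k (koszul ℋ 1 h ⊗ₜ hopfd ℋ d k x) := by
  suffices e : hopfd ℋ d (k + 1) ∘ₗ cons k ∘ₗ TensorProduct.mk ℂ H (TPow H k) h =
      cons k ∘ₗ TensorProduct.mk ℂ H (TPow H k) (d h) +
        cons k ∘ₗ TensorProduct.mk ℂ H (TPow H k) (koszul ℋ 1 h) ∘ₗ hopfd ℋ d k from
    LinearMap.congr_fun e x
  refine PiTensorProduct.ext (MultilinearMap.ext fun v => ?_)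
  simp only [LinearMap.compMultilinearMap_apply, LinearMap.comp_apply, TensorProduct.mk_apply,
    cons_tprod, hopfd, LinearMap.sum_apply, PiTensorProduct.map_tprod, LinearMap.add_apply,
    Fin.sum_univ_succ, map_sum]
  refine congrArg₂ (· + ·) (congrArg _ (funext fun l => ?_))
    (Finset.sum_congr rfl fun j _ => ?_)
  · refine Fin.cases ?_ (fun l => ?_) l <;> simp [Fin.succ_ne_zero]
  · refine congrArg _ (funext fun l => ?_)
    refine Fin.cases ?_ (fun l => ?_) l <;> simp [Fin.succ_pos]

variable [Coalgebra ℂ H]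

open Coalgebra (comul counit)

omit [GradedAlgebra ℋ] in
theorem counitLast_zero (h : H) (x : TPow H 0) :
    counitLast 0 (cons 0 (h ⊗ₜ x)) = counit (R := ℂ) h • x := by
  suffices e : counitLast 0 ∘ₗ cons 0 ∘ₗ TensorProduct.mk ℂ H (TPow H 0) h =
      counit (R := ℂ) h • LinearMap.id from LinearMap.congr_fun e x
  refine TPow.ext_zero ?_
  simp only [LinearMap.comp_apply, TensorProduct.mk_apply, nil, cons_tprod, counitLast,
    PiTensorProduct.lift.tprod, LinearMap.smul_apply, LinearMap.id_apply]
  simp [tprod_zero]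

omit [GradedAlgebra ℋ] in
theorem counitLast_cons {k : ℕ} (h : H) (x : TPow H (k + 1)) :
    counitLast (k + 1) (cons (k + 1) (h ⊗ₜ x)) = cons k (h ⊗ₜ counitLast k x) := by
  suffices e : counitLast (k + 1) ∘ₗ cons (k + 1) ∘ₗ TensorProduct.mk ℂ H (TPow H (k + 1)) h =
      cons k ∘ₗ TensorProduct.mk ℂ H (TPow H k) h ∘ₗ counitLast k from LinearMap.congr_fun e x
  refine PiTensorProduct.ext (MultilinearMap.ext fun v => ?_)
  simp only [LinearMap.compMultilinearMap_apply, LinearMap.comp_apply, TensorProduct.mk_apply,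
    cons_tprod, counitLast, PiTensorProduct.lift.tprod]
  rw [LinearMap.uncurryMid_apply, LinearMap.uncurryMid_apply, LinearMap.smulRight_apply,
    LinearMap.smulRight_apply, smul_apply, smul_apply, TensorProduct.tmul_smul, map_smul,
    cons_tprod, ← Fin.succ_last, Fin.cons_succ]
  refine congrArg _ (congrArg _ (funext fun l => ?_))
  refine Fin.cases ?_ (fun l => ?_) l
  · simp [Fin.removeNth]
  · simp [Fin.removeNth, Fin.init]

omit [GradedAlgebra ℋ] in
theorem comulAt_zero_cons {k : ℕ} (h : H) (x : TPow H k) :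
    comulAt (k + 1) 0 (cons k (h ⊗ₜ x)) = cons (k + 1) (TensorProduct.map LinearMap.id
      (cons k ∘ₗ (TensorProduct.mk ℂ H (TPow H k)).flip x) (comul h)) := by
  have e : (cons (k + 1) ∘ₗ TensorProduct.map LinearMap.id (cons k) ∘ₗ
      (TensorProduct.assoc ℂ H H (TPow H k)).toLinearMap) ∘ₗ
      (TensorProduct.mk ℂ (H ⊗[ℂ] H) (TPow H k)).flip x =
      cons (k + 1) ∘ₗ TensorProduct.map LinearMap.id
        (cons k ∘ₗ (TensorProduct.mk ℂ H (TPow H k)).flip x) :=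
    TensorProduct.ext' fun g h => by simp
  change cons (k + 1) (TensorProduct.map LinearMap.id (cons k) (TensorProduct.assoc ℂ H H (TPow H k)
    (TensorProduct.map comul LinearMap.id (uncons k (cons k (h ⊗ₜ x)))))) = _
  rw [uncons_cons]
  exact LinearMap.congr_fun e (comul h)

omit [GradedAlgebra ℋ] in
theorem comulAt_succ_cons {k : ℕ} (j : Fin k) (h : H) (x : TPow H k) :
    comulAt (k + 1) j.succ (cons k (h ⊗ₜ x)) = cons (k + 1) (h ⊗ₜ comulAt k j x) := by
  change cons (k + 1) (TensorProduct.map LinearMap.id (comulAt k j)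
    (uncons k (cons k (h ⊗ₜ x)))) = _
  rw [uncons_cons, TensorProduct.map_tmul, LinearMap.id_apply]

theorem diagAct_cons {k : ℕ} {m : ℤ} {g : H} (hg : g ∈ ℋ m) (h : H) (x : TPow H k) :
    diagAct ℋ (k + 1) h (cons k (g ⊗ₜ x)) = cons k (TensorProduct.map (LinearMap.mulRight ℂ g)
      ((diagAct ℋ k).flip x ∘ₗ koszul ℋ m) (comul h)) := by
  have e : ∀ s : ℕ, ∀ t : H ⊗[ℂ] H,
      TensorProduct.homTensorHomMap (RingHom.id ℂ) H (TPow H k) H (TPow H k)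
      (TensorProduct.map ((LinearMap.mul ℂ H).compl₂ (parityPart ℋ s))
        (diagAct ℋ k ∘ₗ koszul ℋ s) t) (g ⊗ₜ x) =
      TensorProduct.map (LinearMap.mulRight ℂ (parityPart ℋ s g))
        ((diagAct ℋ k).flip x ∘ₗ koszul ℋ s) t := by
    intro s t
    induction t with
    | zero => simp
    | tmul u v => simp
    | add u v hu hv => simp only [map_add, LinearMap.add_apply, hu, hv]
  change (∑ s ∈ Finset.range 2, cons k ∘ₗ
    TensorProduct.homTensorHomMap (RingHom.id ℂ) H (TPow H k) H (TPow H k)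
    (TensorProduct.map ((LinearMap.mul ℂ H).compl₂ (parityPart ℋ s))
      (diagAct ℋ k ∘ₗ koszul ℋ s) (comul h)) ∘ₗ uncons k) (cons k (g ⊗ₜ x)) = _
  simp only [LinearMap.sum_apply, LinearMap.comp_apply, uncons_cons, e]
  rw [sum_parityPart ℋ (fun s u => cons k (TensorProduct.map (LinearMap.mulRight ℂ u)
    ((diagAct ℋ k).flip x ∘ₗ koszul ℋ s) (comul h))) (fun s => ?_) hg, koszul_parity]
  have h0 : LinearMap.mulRight ℂ (0 : H) = 0 := LinearMap.ext fun _ => mul_zero _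
  rw [h0, TensorProduct.map_zero_left, LinearMap.zero_apply, map_zero]

theorem hopfCyclic_cons {k : ℕ} (S : H →ₗ[ℂ] H) (δ : H →ₐ[ℂ] ℂ) (σ h : H) (x : TPow H k) :
    hopfCyclic ℋ S δ σ (k + 1) (cons k (h ⊗ₜ x)) =
      diagAct ℋ (k + 1) (twistedAntipode S δ h) (snoc k σ x) := by
  rw [hopfCyclic, LinearMap.comp_apply, uncons_cons]
  rfl

/-! ### Degrees in a DG Hopf algebra -/

section Degrees

variable {ℋ} {d S : H →ₗ[ℂ] H} (hH : IsDGHopfAlgebra ℋ d S)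
include hH

theorem comul_koszul (i : ℤ) (h : H) :
    comul (R := ℂ) (koszul ℋ i h) = TensorProduct.map (koszul ℋ i) (koszul ℋ i) (comul h) := by
  suffices e : comul (R := ℂ) ∘ₗ koszul ℋ i =
      TensorProduct.map (koszul ℋ i) (koszul ℋ i) ∘ₗ comul from LinearMap.congr_fun e h
  refine linearMap_ext_homogeneous ℋ fun n h hh => ?_
  rw [LinearMap.comp_apply, LinearMap.comp_apply, koszul_of_mem ℋ i hh, map_zsmul]
  symm
  have hle : (⨆ a : ℤ, Submodule.map₂ (TensorProduct.mk ℂ H H) (ℋ a) (ℋ (n - a))) ≤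
      LinearMap.ker (TensorProduct.map (koszul ℋ i) (koszul ℋ i) -
        (((i * n).negOnePow : ℤ) : ℂ) • LinearMap.id) := by
    refine iSup_le fun a => Submodule.map₂_le.2 fun u hu v hv => ?_
    rw [LinearMap.mem_ker, TensorProduct.mk_apply, LinearMap.sub_apply, TensorProduct.map_tmul,
      koszul_of_mem ℋ i hu, koszul_of_mem ℋ i hv, LinearMap.smul_apply, LinearMap.id_apply,
      ← Int.cast_smul_eq_zsmul ℂ, ← Int.cast_smul_eq_zsmul ℂ, TensorProduct.smul_tmul_smul,
      ← Int.cast_mul, ← Units.val_mul, ← Int.negOnePow_add, sub_eq_zero]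
    congr 4
    ring
  have := hle (hH.comul_mem n h hh)
  rwa [LinearMap.mem_ker, LinearMap.sub_apply, sub_eq_zero, LinearMap.smul_apply,
    LinearMap.id_apply, Int.cast_smul_eq_zsmul] at this

theorem counit_koszul (i : ℤ) (h : H) : counit (R := ℂ) (koszul ℋ i h) = counit (R := ℂ) h := by
  suffices e : counit (R := ℂ) ∘ₗ koszul ℋ i = counit from LinearMap.congr_fun e h
  refine linearMap_ext_homogeneous ℋ fun n h hh => ?_
  rw [LinearMap.comp_apply, koszul_of_mem ℋ i hh, map_zsmul]
  by_cases hn : n = 0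
  · simp [hn]
  · simp [hH.counit_of_ne n hn h hh]

theorem tensorKoszul_counitLast (i : ℤ) : (k : ℕ) → (x : TPow H (k + 1)) →
    tensorKoszul ℋ k i (counitLast k x) = counitLast k (tensorKoszul ℋ (k + 1) i x)
  | 0, x => by
    suffices e : tensorKoszul ℋ 0 i ∘ₗ counitLast 0 =
        counitLast 0 ∘ₗ tensorKoszul ℋ 1 i from LinearMap.congr_fun e x
    refine TPow.ext_cons fun h x => ?_
    rw [LinearMap.comp_apply, LinearMap.comp_apply, tensorKoszul_cons, counitLast_zero,
      counitLast_zero, counit_koszul hH, map_smul]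
  | k + 1, x => by
    suffices e : tensorKoszul ℋ (k + 1) i ∘ₗ counitLast (k + 1) =
        counitLast (k + 1) ∘ₗ tensorKoszul ℋ (k + 2) i from LinearMap.congr_fun e x
    refine TPow.ext_cons fun h x => ?_
    rw [LinearMap.comp_apply, LinearMap.comp_apply, tensorKoszul_cons, counitLast_cons,
      counitLast_cons, tensorKoszul_cons, tensorKoszul_counitLast i k x]

theorem antipode_koszul (i : ℤ) (h : H) : S (koszul ℋ i h) = koszul ℋ i (S h) := by
  suffices e : S ∘ₗ koszul ℋ i = koszul ℋ i ∘ₗ S from LinearMap.congr_fun e h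
  refine linearMap_ext_homogeneous ℋ fun n h hh => ?_
  rw [LinearMap.comp_apply, LinearMap.comp_apply, koszul_of_mem ℋ i hh, map_zsmul,
    koszul_of_mem ℋ i (hH.antipode_mem n h hh)]

theorem tensorKoszul_comulAt (i : ℤ) : (k : ℕ) → (j : Fin k) → (x : TPow H k) →
    tensorKoszul ℋ (k + 1) i (comulAt k j x) = comulAt k j (tensorKoszul ℋ k i x)
  | k + 1, j, x => by
    suffices e : tensorKoszul ℋ (k + 2) i ∘ₗ comulAt (k + 1) j =
        comulAt (k + 1) j ∘ₗ tensorKoszul ℋ (k + 1) i from LinearMap.congr_fun e x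
    refine TPow.ext_cons fun h x => ?_
    rw [LinearMap.comp_apply, LinearMap.comp_apply, tensorKoszul_cons]
    refine Fin.cases ?_ (fun j => ?_) j
    · rw [comulAt_zero_cons, comulAt_zero_cons, tensorKoszul_map_cons, comul_koszul hH]
      have e : TensorProduct.map (koszul ℋ i) (tensorKoszul ℋ (k + 1) i) ∘ₗ
          TensorProduct.map LinearMap.id (cons k ∘ₗ (TensorProduct.mk ℂ H (TPow H k)).flip x) =
          TensorProduct.map LinearMap.id (cons k ∘ₗ
            (TensorProduct.mk ℂ H (TPow H k)).flip (tensorKoszul ℋ k i x)) ∘ₗ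
          TensorProduct.map (koszul ℋ i) (koszul ℋ i) :=
        TensorProduct.ext' fun u v => by
          simp only [LinearMap.comp_apply, TensorProduct.map_tmul, LinearMap.id_apply,
            LinearMap.flip_apply, TensorProduct.mk_apply, tensorKoszul_cons]
      exact congrArg _ (LinearMap.congr_fun e (comul h))
    · rw [comulAt_succ_cons, comulAt_succ_cons, tensorKoszul_cons, tensorKoszul_comulAt i k j x]

theorem diagAct_koszul (i : ℤ) : (k : ℕ) → (h : H) → (x : TPow H k) →
    tensorKoszul ℋ k i (diagAct ℋ k h x) = diagAct ℋ k (koszul ℋ i h) (tensorKoszul ℋ k i x)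
  | 0, h, x => by
    change tensorKoszul ℋ 0 i (counit (R := ℂ) h • x) =
      counit (R := ℂ) (koszul ℋ i h) • tensorKoszul ℋ 0 i x
    rw [map_smul, counit_koszul hH]
  | k + 1, h, x => by
    suffices e : tensorKoszul ℋ (k + 1) i ∘ₗ diagAct ℋ (k + 1) h =
        diagAct ℋ (k + 1) (koszul ℋ i h) ∘ₗ tensorKoszul ℋ (k + 1) i from LinearMap.congr_fun e x
    refine TPow.ext_cons_of_mem ℋ fun m g hg x => ?_
    rw [LinearMap.comp_apply, LinearMap.comp_apply, tensorKoszul_cons,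
      diagAct_cons ℋ (koszul_mem ℋ i hg), diagAct_cons ℋ hg, tensorKoszul_map_cons,
      comul_koszul hH]
    have e : TensorProduct.map (koszul ℋ i) (tensorKoszul ℋ k i) ∘ₗ
        TensorProduct.map (LinearMap.mulRight ℂ g) ((diagAct ℋ k).flip x ∘ₗ koszul ℋ m) =
        TensorProduct.map (LinearMap.mulRight ℂ (koszul ℋ i g))
          ((diagAct ℋ k).flip (tensorKoszul ℋ k i x) ∘ₗ koszul ℋ m) ∘ₗ
        TensorProduct.map (koszul ℋ i) (koszul ℋ i) :=
      TensorProduct.ext' fun u v => by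
        simp only [LinearMap.comp_apply, TensorProduct.map_tmul, LinearMap.mulRight_apply,
          LinearMap.flip_apply, koszul_mul, diagAct_koszul i k, koszul_comm ℋ m i]
    exact congrArg _ (LinearMap.congr_fun e (comul h))

variable {δ : H →ₐ[ℂ] ℂ} {σ : H} (hδ : IsModularPair ℋ d S δ σ)
include hδ

theorem twistedAntipode_koszul (i : ℤ) (h : H) :
    twistedAntipode S δ (koszul ℋ i h) = koszul ℋ i (twistedAntipode S δ h) := by
  have hc : ∀ u, δ (koszul ℋ i u) = δ u := by
    intro u
    suffices e : δ.toLinearMap ∘ₗ koszul ℋ i = δ.toLinearMap from LinearMap.congr_fun e u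
    refine linearMap_ext_homogeneous ℋ fun n u hu => ?_
    rw [LinearMap.comp_apply, koszul_of_mem ℋ i hu, map_zsmul]
    by_cases hn : n = 0
    · simp [hn]
    · simp [hδ.char_of_ne n hn u hu]
  simp only [twistedAntipode, LinearMap.comp_apply, comul_koszul hH]
  have e : ((TensorProduct.lid ℂ H).toLinearMap ∘ₗ TensorProduct.map δ.toLinearMap S) ∘ₗ
      TensorProduct.map (koszul ℋ i) (koszul ℋ i) =
      koszul ℋ i ∘ₗ (TensorProduct.lid ℂ H).toLinearMap ∘ₗ TensorProduct.map δ.toLinearMap S :=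
    TensorProduct.ext' fun u v => by
      simp [hc, antipode_koszul hH]
  exact LinearMap.congr_fun e (comul h)

end Degrees

end TensorPower

/-! ### Evaluation of tensors on homogeneous arguments -/

section Eval

variable {H : Type*} [Ring H] [Algebra ℂ H] {ℋ : ℤ → Submodule ℂ H} [GradedAlgebra ℋ]
  {Ω : Type*} [Ring Ω] [Algebra ℂ Ω] {𝒜 : ℤ → Submodule ℂ Ω} [GradedAlgebra 𝒜]
  {π : H →ₗ[ℂ] Ω →ₗ[ℂ] Ω}

/-- All entries of a tuple are homogeneous. -/
def Homogeneous (𝒜 : ℤ → Submodule ℂ Ω) {k : ℕ} (a : Fin k → Ω) : Prop := ∀ i, ∃ n, a i ∈ 𝒜 n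

omit [GradedAlgebra 𝒜] in
theorem Homogeneous.tail {k : ℕ} {a : Fin (k + 1) → Ω} (ha : Homogeneous 𝒜 a) :
    Homogeneous 𝒜 (Fin.tail a) := fun i => ha i.succ

/-- Functionals that agree on homogeneous arguments are equal. -/
theorem ext_of_homogeneous {k : ℕ} {φ ψ : Functional Ω k}
    (h : ∀ a, Homogeneous 𝒜 a → φ a = ψ a) : φ = ψ := by
  classical
  refine MultilinearMap.ext fun a => ?_
  have ha : a = fun i => ∑ n ∈ (DirectSum.decompose 𝒜 (a i)).support,
      (DirectSum.decompose 𝒜 (a i) n : Ω) :=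
    funext fun i => (DirectSum.sum_support_decompose 𝒜 (a i)).symm
  rw [ha, MultilinearMap.map_sum_finset, MultilinearMap.map_sum_finset]
  exact Finset.sum_congr rfl fun n _ => h _ fun i => ⟨n i, (DirectSum.decompose 𝒜 (a i) (n i)).2⟩

theorem evalTail_nil (a : Fin 0 → Ω) : evalTail ℋ 𝒜 π 0 a (nil H) = 1 := by
  simp [evalTail, nil]

theorem evalTail_map_cons {k : ℕ} {a : Fin (k + 1) → Ω} {l : ℤ} (ha : a 0 ∈ 𝒜 l)
    (t : H ⊗[ℂ] TPow H k) : evalTail ℋ 𝒜 π (k + 1) a (cons k t) =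
      LinearMap.mul' ℂ Ω (TensorProduct.map (π.flip (a 0))
        (evalTail ℋ 𝒜 π k (Fin.tail a) ∘ₗ tensorKoszul ℋ k l) t) := by
  simp only [evalTail, LinearMap.sum_apply, LinearMap.comp_apply, uncons_cons]
  rw [sum_parityPart 𝒜 (fun s u => LinearMap.mul' ℂ Ω (TensorProduct.map (π.flip u)
    (evalTail ℋ 𝒜 π k (Fin.tail a) ∘ₗ PiTensorProduct.map fun _ => koszul ℋ s) t))
    (fun s => ?_) ha, koszul_parity]
  rw [map_zero, TensorProduct.map_zero_left, LinearMap.zero_apply, map_zero]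

theorem evalTail_cons {k : ℕ} {a : Fin (k + 1) → Ω} {l : ℤ} (ha : a 0 ∈ 𝒜 l)
    (h : H) (x : TPow H k) : evalTail ℋ 𝒜 π (k + 1) a (cons k (h ⊗ₜ x)) =
      π h (a 0) * evalTail ℋ 𝒜 π k (Fin.tail a) (tensorKoszul ℋ k l x) :=
  evalTail_map_cons ha _

theorem evalAll_of_mem {k : ℕ} {a : Fin (k + 1) → Ω} {l : ℤ} (ha : a 0 ∈ 𝒜 l) (x : TPow H k) :
    evalAll ℋ 𝒜 π k a x = a 0 * evalTail ℋ 𝒜 π k (Fin.tail a) (tensorKoszul ℋ k l x) := by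
  simp only [evalAll, LinearMap.sum_apply, LinearMap.comp_apply, LinearMap.mulLeft_apply]
  rw [sum_parityPart 𝒜 (fun s u => u * evalTail ℋ 𝒜 π k (Fin.tail a)
    (PiTensorProduct.map (fun _ => koszul ℋ s) x)) (fun s => zero_mul _) ha, koszul_parity]

theorem charMap_apply {T : Ω →ₗ[ℂ] ℂ} {k : ℕ} {a : Fin (k + 1) → Ω} {l : ℤ} (ha : a 0 ∈ 𝒜 l)
    (x : TPow H k) : charMap ℋ 𝒜 π T k x a =
      T (a 0 * evalTail ℋ 𝒜 π k (Fin.tail a) (tensorKoszul ℋ k l x)) := by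
  rw [← evalAll_of_mem ha]
  rfl

open Coalgebra (comul counit)

variable [Coalgebra ℂ H] {dH : H →ₗ[ℂ] H} {dΩ : Ω →ₗ[ℂ] Ω} (hπ : IsDGAction ℋ 𝒜 dH dΩ π)
include hπ

theorem IsDGAction.koszul_act (i : ℤ) (h : H) (a : Ω) :
    koszul 𝒜 i (π h a) = π (koszul ℋ i h) (koszul 𝒜 i a) := by
  have e : π.compr₂ (koszul 𝒜 i) = π.compl₁₂ (koszul ℋ i) (koszul 𝒜 i) := by
    refine linearMap_ext_homogeneous ℋ fun n h hh => linearMap_ext_homogeneous 𝒜 fun m a ha => ?_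
    simp only [LinearMap.compr₂_apply, LinearMap.compl₁₂_apply, koszul_of_mem ℋ i hh,
      koszul_of_mem 𝒜 i ha, koszul_of_mem 𝒜 i (hπ.act_mem n m h hh a ha), map_zsmul,
      LinearMap.smul_apply, smul_smul, mul_add, Int.negOnePow_add, Units.val_mul]
    rw [mul_comm]
  exact LinearMap.congr_fun₂ e h a

omit [GradedAlgebra 𝒜] in
theorem IsDGAction.d_act' (h : H) (a : Ω) :
    dΩ (π h a) = π (dH h) a + π (koszul ℋ 1 h) (dΩ a) := by
  have e : π.compr₂ dΩ = π ∘ₗ dH + (π ∘ₗ koszul ℋ 1).compl₂ dΩ := by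
    refine linearMap_ext_homogeneous ℋ fun n h hh => LinearMap.ext fun a => ?_
    simp only [LinearMap.compr₂_apply, LinearMap.add_apply, LinearMap.comp_apply,
      LinearMap.compl₂_apply, koszul_of_mem ℋ 1 hh, hπ.d_act n h hh a, map_zsmul, one_mul,
      LinearMap.smul_apply]
  exact LinearMap.congr_fun₂ e h a

theorem evalTail_koszul (i : ℤ) : (k : ℕ) → (a : Fin k → Ω) → Homogeneous 𝒜 a → (x : TPow H k) →
    koszul 𝒜 i (evalTail ℋ 𝒜 π k a x) =
      evalTail ℋ 𝒜 π k (fun l => koszul 𝒜 i (a l)) (tensorKoszul ℋ k i x)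
  | 0, a, _, x => by
    suffices e : koszul 𝒜 i ∘ₗ evalTail ℋ 𝒜 π 0 a =
        evalTail ℋ 𝒜 π 0 (fun l => koszul 𝒜 i (a l)) ∘ₗ tensorKoszul ℋ 0 i from
      LinearMap.congr_fun e x
    refine TPow.ext_zero ?_
    rw [LinearMap.comp_apply, LinearMap.comp_apply, tensorKoszul_nil, evalTail_nil, evalTail_nil,
      koszul_one]
  | k + 1, a, ha, x => by
    suffices e : koszul 𝒜 i ∘ₗ evalTail ℋ 𝒜 π (k + 1) a =
        evalTail ℋ 𝒜 π (k + 1) (fun l => koszul 𝒜 i (a l)) ∘ₗ tensorKoszul ℋ (k + 1) i from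
      LinearMap.congr_fun e x
    obtain ⟨n, hn⟩ := ha 0
    refine TPow.ext_cons fun h x => ?_
    rw [LinearMap.comp_apply, LinearMap.comp_apply, tensorKoszul_cons, evalTail_cons hn,
      evalTail_cons (koszul_mem 𝒜 i hn), koszul_mul, hπ.koszul_act,
      evalTail_koszul i k _ ha.tail, ← tensorKoszul_add, ← tensorKoszul_add, add_comm i n]
    rfl

variable {S : H →ₗ[ℂ] H} (hH : IsDGHopfAlgebra ℋ dH S)
include hH

/-- The face that comultiplies a factor corresponds to the product of two neighbours. -/
theorem evalTail_comulAt : (k : ℕ) → (j : Fin k) → (a : Fin (k + 1) → Ω) → Homogeneous 𝒜 a →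
    (x : TPow H k) → evalTail ℋ 𝒜 π (k + 1) a (comulAt k j x) =
      evalTail ℋ 𝒜 π k (Fin.contractNth j.castSucc (· * ·) a) x
  | k + 1, j, a, ha, x => by
    suffices e : evalTail ℋ 𝒜 π (k + 2) a ∘ₗ comulAt (k + 1) j =
        evalTail ℋ 𝒜 π (k + 1) (Fin.contractNth j.castSucc (· * ·) a) from LinearMap.congr_fun e x
    obtain ⟨n, hn⟩ := ha 0
    obtain ⟨m, hm⟩ := ha 1
    refine TPow.ext_cons fun h x => ?_
    rw [LinearMap.comp_apply]
    revert j
    refine Fin.cases ?_ fun j => ?_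
    · have h0 : Fin.contractNth (Fin.castSucc (0 : Fin (k + 1))) (· * ·) a 0 = a 0 * a 1 := by
        simp [Fin.contractNth]
      have ht : Fin.tail (Fin.contractNth (Fin.castSucc (0 : Fin (k + 1))) (· * ·) a) =
          Fin.tail (Fin.tail a) := by
        funext i
        simp [Fin.tail, Fin.contractNth]
      rw [comulAt_zero_cons, evalTail_map_cons hn,
        evalTail_cons (by rw [h0]; exact SetLike.mul_mem_graded hn hm), h0, ht, hπ.act_mul h n _ hn]
      have e : LinearMap.mul' ℂ Ω ∘ₗ TensorProduct.map (π.flip (a 0))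
          (evalTail ℋ 𝒜 π (k + 1) (Fin.tail a) ∘ₗ tensorKoszul ℋ (k + 1) n) ∘ₗ
          TensorProduct.map LinearMap.id (cons k ∘ₗ (TensorProduct.mk ℂ H (TPow H k)).flip x) =
          LinearMap.mulRight ℂ
            (evalTail ℋ 𝒜 π k (Fin.tail (Fin.tail a)) (tensorKoszul ℋ k (n + m) x)) ∘ₗ
          LinearMap.mul' ℂ Ω ∘ₗ
            TensorProduct.map (π.flip (a 0)) (π.flip (a 1) ∘ₗ koszul ℋ n) :=
        TensorProduct.ext' fun u v => by
          simp only [LinearMap.comp_apply, TensorProduct.map_tmul, LinearMap.id_apply,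
            LinearMap.flip_apply, TensorProduct.mk_apply, tensorKoszul_cons,
            LinearMap.mul'_apply, LinearMap.mulRight_apply]
          rw [evalTail_cons (a := Fin.tail a) hm, ← tensorKoszul_add, add_comm m n, mul_assoc]
          rfl
      exact LinearMap.congr_fun e (comul h)
    · have h0 : Fin.contractNth j.succ.castSucc (· * ·) a 0 = a 0 := by
        simp [Fin.contractNth]
      have ht : Fin.tail (Fin.contractNth j.succ.castSucc (· * ·) a) =
          Fin.contractNth j.castSucc (· * ·) (Fin.tail a) := by
        funext i
        simp [Fin.tail, Fin.contractNth]
      rw [comulAt_succ_cons, evalTail_cons hn, evalTail_cons (by rw [h0]; exact hn), h0, ht,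
        tensorKoszul_comulAt hH, evalTail_comulAt k j _ ha.tail]

/-- The diagonal action corresponds to the action on the product. -/
theorem evalTail_diagAct : (k : ℕ) → (a : Fin k → Ω) → Homogeneous 𝒜 a → (h : H) →
    (x : TPow H k) → evalTail ℋ 𝒜 π k a (diagAct ℋ k h x) = π h (evalTail ℋ 𝒜 π k a x)
  | 0, a, _, h, x => by
    suffices e : evalTail ℋ 𝒜 π 0 a ∘ₗ diagAct ℋ 0 h = π h ∘ₗ evalTail ℋ 𝒜 π 0 a from
      LinearMap.congr_fun e x
    refine TPow.ext_zero ?_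
    change evalTail ℋ 𝒜 π 0 a (counit (R := ℂ) h • nil H) = π h (evalTail ℋ 𝒜 π 0 a (nil H))
    rw [map_smul, evalTail_nil, hπ.act_one, Algebra.smul_def, mul_one]
  | k + 1, a, ha, h, x => by
    suffices e : evalTail ℋ 𝒜 π (k + 1) a ∘ₗ diagAct ℋ (k + 1) h =
        π h ∘ₗ evalTail ℋ 𝒜 π (k + 1) a from LinearMap.congr_fun e x
    obtain ⟨n, hn⟩ := ha 0
    refine TPow.ext_cons_of_mem ℋ fun m g hg x => ?_
    rw [LinearMap.comp_apply, LinearMap.comp_apply, diagAct_cons ℋ hg, evalTail_map_cons hn,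
      evalTail_cons hn, hπ.act_mul h (m + n) _ (hπ.act_mem m n g hg _ hn)]
    have e : LinearMap.mul' ℂ Ω ∘ₗ TensorProduct.map (π.flip (a 0))
        (evalTail ℋ 𝒜 π k (Fin.tail a) ∘ₗ tensorKoszul ℋ k n) ∘ₗ
        TensorProduct.map (LinearMap.mulRight ℂ g) ((diagAct ℋ k).flip x ∘ₗ koszul ℋ m) =
        LinearMap.mul' ℂ Ω ∘ₗ TensorProduct.map (π.flip (π g (a 0)))
          (π.flip (evalTail ℋ 𝒜 π k (Fin.tail a) (tensorKoszul ℋ k n x)) ∘ₗ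
            koszul ℋ (m + n)) :=
      TensorProduct.ext' fun u v => by
        simp only [LinearMap.comp_apply, TensorProduct.map_tmul, LinearMap.flip_apply,
          LinearMap.mul'_apply, LinearMap.mulRight_apply, hπ.mul_act, diagAct_koszul hH,
          evalTail_diagAct k _ ha.tail, koszul_add, koszul_comm ℋ m n]
    exact LinearMap.congr_fun e (comul h)

omit hπ hH [Coalgebra ℂ H] in
/-- Appending `σ` to a tensor multiplies its value by `π σ` of a further argument. -/
theorem evalTail_snoc {σ : H} (hσ : σ ∈ ℋ 0) : (k : ℕ) → (a : Fin (k + 1) → Ω) →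
    Homogeneous 𝒜 a → (x : TPow H k) → evalTail ℋ 𝒜 π (k + 1) a (snoc k σ x) =
      evalTail ℋ 𝒜 π k (Fin.init a) x * π σ (a (Fin.last k))
  | 0, a, ha, x => by
    suffices e : evalTail ℋ 𝒜 π 1 a ∘ₗ snoc 0 σ =
        LinearMap.mulRight ℂ (π σ (a (Fin.last 0))) ∘ₗ evalTail ℋ 𝒜 π 0 (Fin.init a) from
      LinearMap.congr_fun e x
    obtain ⟨n, hn⟩ := ha 0
    refine TPow.ext_zero ?_
    rw [LinearMap.comp_apply, LinearMap.comp_apply, snoc_nil, evalTail_cons hn, tensorKoszul_nil,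
      evalTail_nil, evalTail_nil, LinearMap.mulRight_apply, one_mul, mul_one]
    rfl
  | k + 1, a, ha, x => by
    suffices e : evalTail ℋ 𝒜 π (k + 2) a ∘ₗ snoc (k + 1) σ =
        LinearMap.mulRight ℂ (π σ (a (Fin.last (k + 1)))) ∘ₗ
          evalTail ℋ 𝒜 π (k + 1) (Fin.init a) from LinearMap.congr_fun e x
    obtain ⟨n, hn⟩ := ha 0
    refine TPow.ext_cons fun h x => ?_
    rw [LinearMap.comp_apply, LinearMap.comp_apply, snoc_cons, evalTail_cons hn,
      evalTail_cons (a := Fin.init a) hn, LinearMap.mulRight_apply, tensorKoszul_snoc ℋ hσ,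
      evalTail_snoc hσ k _ ha.tail, mul_assoc]
    rfl

/-- Applying the counit to the last factor corresponds to a unit as the last argument. -/
theorem evalTail_counitLast :
    (k : ℕ) → (a : Fin k → Ω) → Homogeneous 𝒜 a → (x : TPow H (k + 1)) →
    evalTail ℋ 𝒜 π (k + 1) (Fin.snoc (α := fun _ => Ω) a 1) x =
      evalTail ℋ 𝒜 π k a (counitLast k x)
  | 0, a, ha, x => by
    suffices e : evalTail ℋ 𝒜 π 1 (Fin.snoc (α := fun _ => Ω) a 1) =
        evalTail ℋ 𝒜 π 0 a ∘ₗ counitLast 0 from LinearMap.congr_fun e x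
    have h1 : (Fin.snoc (α := fun _ => Ω) a 1 : Fin 1 → Ω) 0 ∈ 𝒜 0 := by
      rw [show (0 : Fin 1) = Fin.last 0 from rfl, Fin.snoc_last]
      exact SetLike.one_mem_graded 𝒜
    refine TPow.ext_cons fun h x => ?_
    rw [LinearMap.comp_apply, evalTail_cons h1, counitLast_zero, map_smul]
    rw [show (0 : Fin 1) = Fin.last 0 from rfl, Fin.snoc_last, hπ.act_one, Algebra.smul_def,
      tensorKoszul, koszul_zero, PiTensorProduct.map_id, LinearMap.id_apply]
    rfl
  | k + 1, a, ha, x => by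
    suffices e : evalTail ℋ 𝒜 π (k + 2) (Fin.snoc (α := fun _ => Ω) a 1) =
        evalTail ℋ 𝒜 π (k + 1) a ∘ₗ counitLast (k + 1) from LinearMap.congr_fun e x
    obtain ⟨n, hn⟩ := ha 0
    have h0 : (Fin.snoc (α := fun _ => Ω) a 1 : Fin (k + 2) → Ω) 0 = a 0 :=
      Fin.snoc_castSucc (α := fun _ => Ω) 1 a 0
    have ht : Fin.tail (Fin.snoc (α := fun _ => Ω) a 1 : Fin (k + 2) → Ω) =
        Fin.snoc (α := fun _ => Ω) (Fin.tail a) 1 := by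
      funext i
      simp only [Fin.tail, Fin.snoc, Fin.val_succ, add_lt_add_iff_right]
      split_ifs <;> rfl
    refine TPow.ext_cons fun h x => ?_
    rw [LinearMap.comp_apply, evalTail_cons (by rw [h0]; exact hn), counitLast_cons,
      evalTail_cons hn, h0, ht, evalTail_counitLast k _ ha.tail, tensorKoszul_counitLast hH]

omit hH [Coalgebra ℂ H] hπ in
theorem hopfd_tensorKoszul (hHd : IsDGAlgebra ℋ dH) (i : ℤ) : (k : ℕ) → (x : TPow H k) →
    hopfd ℋ dH k (tensorKoszul ℋ k i x) =
      ((i.negOnePow : ℤ) : ℂ) • tensorKoszul ℋ k i (hopfd ℋ dH k x)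
  | 0, x => by rw [hopfd_zero, hopfd_zero, map_zero, smul_zero]
  | k + 1, x => by
    suffices e : hopfd ℋ dH (k + 1) ∘ₗ tensorKoszul ℋ (k + 1) i =
        ((i.negOnePow : ℤ) : ℂ) • (tensorKoszul ℋ (k + 1) i ∘ₗ hopfd ℋ dH (k + 1)) from
      LinearMap.congr_fun e x
    refine TPow.ext_cons fun h x => ?_
    rw [LinearMap.comp_apply, LinearMap.smul_apply, LinearMap.comp_apply, tensorKoszul_cons,
      hopfd_cons, hopfd_cons, map_add, tensorKoszul_cons, tensorKoszul_cons,
      hopfd_tensorKoszul hHd i k x, hHd.d_koszul, koszul_comm ℋ 1 i, smul_add,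
      ← Int.cast_smul_eq_zsmul ℂ,
      TensorProduct.tmul_smul, map_smul, ← TensorProduct.smul_tmul', map_smul]

variable (𝒜 dΩ) in
/-- The entry `j` of a tuple is differentiated, with the Koszul sign for passing the entries in
front of it. -/
def slots {k : ℕ} (a : Fin k → Ω) (j : Fin k) : Fin k → Ω := fun i =>
  (if i < j then koszul 𝒜 1 else if i = j then dΩ else LinearMap.id) (a i)

omit [Coalgebra ℂ H] hπ hH in
theorem slots_zero {k : ℕ} (a : Fin (k + 1) → Ω) :
    slots 𝒜 dΩ a 0 0 = dΩ (a 0) ∧ Fin.tail (slots 𝒜 dΩ a 0) = Fin.tail a :=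
  ⟨by simp [slots], funext fun i => by simp [slots, Fin.tail, Fin.succ_ne_zero]⟩

omit [Coalgebra ℂ H] hπ hH in
theorem slots_succ {k : ℕ} (a : Fin (k + 1) → Ω) (j : Fin k) :
    slots 𝒜 dΩ a j.succ 0 = koszul 𝒜 1 (a 0) ∧
      Fin.tail (slots 𝒜 dΩ a j.succ) = slots 𝒜 dΩ (Fin.tail a) j :=
  ⟨by simp [slots], funext fun i => by simp [slots, Fin.tail]⟩

omit hH in
/-- The differential of the value of a tensor. -/
theorem d_evalTail (hΩ : IsDGAlgebra 𝒜 dΩ) (hHd : IsDGAlgebra ℋ dH) : (k : ℕ) →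
    (a : Fin k → Ω) → Homogeneous 𝒜 a → (x : TPow H k) → dΩ (evalTail ℋ 𝒜 π k a x) =
      evalTail ℋ 𝒜 π k a (hopfd ℋ dH k x) +
        ∑ j, evalTail ℋ 𝒜 π k (slots 𝒜 dΩ a j) (tensorKoszul ℋ k 1 x)
  | 0, a, _, x => by
    suffices e : dΩ ∘ₗ evalTail ℋ 𝒜 π 0 a = 0 by
      rw [hopfd_zero, map_zero, Finset.univ_eq_empty, Finset.sum_empty, add_zero]
      exact LinearMap.congr_fun e x
    refine TPow.ext_zero ?_
    rw [LinearMap.comp_apply, evalTail_nil, hΩ.d_one]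
    rfl
  | k + 1, a, ha, x => by
    suffices e : dΩ ∘ₗ evalTail ℋ 𝒜 π (k + 1) a = evalTail ℋ 𝒜 π (k + 1) a ∘ₗ hopfd ℋ dH (k + 1) +
        ∑ j, evalTail ℋ 𝒜 π (k + 1) (slots 𝒜 dΩ a j) ∘ₗ tensorKoszul ℋ (k + 1) 1 by
      simpa only [LinearMap.comp_apply, LinearMap.add_apply, LinearMap.sum_apply] using
        LinearMap.congr_fun e x
    obtain ⟨n, hn⟩ := ha 0
    refine TPow.ext_cons fun h x => ?_
    have h0 : evalTail ℋ 𝒜 π (k + 1) (slots 𝒜 dΩ a 0)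
        (tensorKoszul ℋ (k + 1) 1 (cons k (h ⊗ₜ x))) =
        π (koszul ℋ 1 h) (dΩ (a 0)) *
          evalTail ℋ 𝒜 π k (Fin.tail a) (tensorKoszul ℋ k n x) := by
      rw [tensorKoszul_cons, evalTail_cons (l := n + 1) (by
        rw [(slots_zero a).1]; exact hΩ.d_mem n _ hn), (slots_zero a).1, (slots_zero a).2,
        tensorKoszul_add, tensorKoszul_self]
    have hs : ∀ j : Fin k, evalTail ℋ 𝒜 π (k + 1) (slots 𝒜 dΩ a j.succ)
        (tensorKoszul ℋ (k + 1) 1 (cons k (h ⊗ₜ x))) =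
        π (koszul ℋ 1 h) (koszul 𝒜 1 (a 0)) * evalTail ℋ 𝒜 π k (slots 𝒜 dΩ (Fin.tail a) j)
          (tensorKoszul ℋ k 1 (tensorKoszul ℋ k n x)) := by
      intro j
      rw [tensorKoszul_cons, evalTail_cons (l := n) (by
        rw [(slots_succ a j).1]; exact koszul_mem 𝒜 1 hn), (slots_succ a j).1, (slots_succ a j).2,
        ← tensorKoszul_add, ← tensorKoszul_add, add_comm n 1]
    have hk : π (koszul ℋ 1 h) (koszul 𝒜 1 (a 0)) * evalTail ℋ 𝒜 π k (Fin.tail a)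
        (hopfd ℋ dH k (tensorKoszul ℋ k n x)) = π (koszul ℋ 1 h) (a 0) *
          evalTail ℋ 𝒜 π k (Fin.tail a) (tensorKoszul ℋ k n (hopfd ℋ dH k x)) := by
      rw [hopfd_tensorKoszul hHd, koszul_of_mem 𝒜 1 hn, one_mul, ← Int.cast_smul_eq_zsmul ℂ,
        map_smul, map_smul, smul_mul_smul_comm, ← Int.cast_mul, ← Units.val_mul,
        ← Int.negOnePow_add, Int.negOnePow_even _ ⟨n, rfl⟩,
        Units.val_one, Int.cast_one, one_smul]
    rw [LinearMap.comp_apply, LinearMap.add_apply, LinearMap.sum_apply, Fin.sum_univ_succ]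
    simp only [LinearMap.comp_apply, h0, hs]
    rw [evalTail_cons hn, hΩ.d_mul 𝒜, hπ.d_act', hπ.koszul_act, d_evalTail hΩ hHd k _ ha.tail,
      mul_add, hk, hopfd_cons, map_add, evalTail_cons hn, evalTail_cons hn, Finset.mul_sum]
    noncomm_ring

end Eval

/-! ### The characteristic map and the cyclic structures -/

theorem cyclicOp_apply {A : Type*} [Ring A] [Algebra ℂ A] (𝒜 : ℤ → Submodule ℂ A)
    [GradedAlgebra 𝒜] {k : ℕ} {a : Fin (k + 1) → A} {i : ℤ} (ha : a (Fin.last k) ∈ 𝒜 i)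
    (φ : Functional A k) : cyclicOp 𝒜 k φ a =
      φ (Fin.cons (a (Fin.last k)) fun l => koszul 𝒜 i (a l.castSucc) : Fin (k + 1) → A) := by
  have e : ∀ s : ℕ, ((φ.domDomCongr (finRotate (k + 1)).symm).compLinearMap
      (fun i => if i = Fin.last k then parityPart 𝒜 s else koszul 𝒜 s)) a =
      φ (Fin.cons (parityPart 𝒜 s (a (Fin.last k))) fun l => koszul 𝒜 s (a l.castSucc) :
        Fin (k + 1) → A) := by
    intro s
    rw [MultilinearMap.compLinearMap_apply, MultilinearMap.domDomCongr_apply]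
    refine congrArg φ (funext fun l => ?_)
    induction l using Fin.cases with
    | zero =>
      have : (finRotate (k + 1)).symm 0 = Fin.last k := by
        rw [Equiv.symm_apply_eq, finRotate_last]
      rw [this, if_pos rfl, Fin.cons_zero]
    | succ l =>
      have : (finRotate (k + 1)).symm l.succ = l.castSucc := by
        rw [Equiv.symm_apply_eq, finRotate_apply, Fin.coeSucc_eq_succ]
      rw [this, if_neg (Fin.castSucc_ne_last l), Fin.cons_succ]
  simp only [cyclicOp, LinearMap.coe_mk, AddHom.coe_mk, sum_apply, e]
  rw [sum_parityPart 𝒜 (fun s u => φ (Fin.cons u fun l => koszul 𝒜 s (a l.castSucc) :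
    Fin (k + 1) → A)) (fun s => φ.map_coord_zero 0 rfl) ha]
  simp only [koszul_parity]

section CharMap

open Coalgebra (comul counit)

variable {H : Type*} [Ring H] [Algebra ℂ H] [Coalgebra ℂ H] {ℋ : ℤ → Submodule ℂ H}
  [GradedAlgebra ℋ] {Ω : Type*} [Ring Ω] [Algebra ℂ Ω] {𝒜 : ℤ → Submodule ℂ Ω} [GradedAlgebra 𝒜]
  {π : H →ₗ[ℂ] Ω →ₗ[ℂ] Ω} {dH S : H →ₗ[ℂ] H} {dΩ : Ω →ₗ[ℂ] Ω} {δ : H →ₐ[ℂ] ℂ} {σ : H}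
  {T : Ω →ₗ[ℂ] ℂ}

omit [GradedAlgebra ℋ] in
theorem IsInvariantTrace.trace' (hT : IsInvariantTrace ℋ 𝒜 S δ σ π T) {i : ℤ} {a : Ω}
    (ha : a ∈ 𝒜 i) (b : Ω) : T (a * koszul 𝒜 i b) = T (b * π σ a) := by
  suffices e : T ∘ₗ LinearMap.mulLeft ℂ a ∘ₗ koszul 𝒜 i = T ∘ₗ LinearMap.mulRight ℂ (π σ a) from
    LinearMap.congr_fun e b
  refine linearMap_ext_homogeneous 𝒜 fun j b hb => ?_
  simp only [LinearMap.comp_apply, LinearMap.mulLeft_apply, LinearMap.mulRight_apply]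
  rw [koszul_of_mem 𝒜 i hb, mul_smul_comm, map_zsmul, hT.trace i j a ha b hb, smul_smul,
    Int.units_coe_mul_self, one_smul]

omit [GradedAlgebra 𝒜] in
theorem IsInvariantTrace.invariant' (hT : IsInvariantTrace ℋ 𝒜 S δ σ π T) {i : ℤ} {a : Ω}
    (ha : a ∈ 𝒜 i) (h : H) (b : Ω) :
    T (π h a * b) = T (a * π (twistedAntipode S δ (koszul ℋ i h)) b) := by
  suffices e : T ∘ₗ LinearMap.mulRight ℂ b ∘ₗ π.flip a =
      T ∘ₗ LinearMap.mulLeft ℂ a ∘ₗ π.flip b ∘ₗ twistedAntipode S δ ∘ₗ koszul ℋ i from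
    LinearMap.congr_fun e h
  refine linearMap_ext_homogeneous ℋ fun n h hh => ?_
  simp only [LinearMap.comp_apply, LinearMap.mulLeft_apply, LinearMap.mulRight_apply,
    LinearMap.flip_apply]
  rw [koszul_of_mem ℋ i hh, map_zsmul, map_zsmul, LinearMap.smul_apply, mul_smul_comm, map_zsmul,
    hT.invariant n i h hh a ha, mul_comm n i]

section Faces

variable (hπ : IsDGAction ℋ 𝒜 dH dΩ π)
include hπ

/-- The characteristic map is compatible with the first face. -/
theorem charMap_cons_one (k : ℕ) (x : TPow H k) :
    charMap ℋ 𝒜 π T (k + 1) (cons k (1 ⊗ₜ x)) = mulAt 0 (charMap ℋ 𝒜 π T k x) := by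
  refine ext_of_homogeneous (𝒜 := 𝒜) fun a ha => ?_
  obtain ⟨l, hl⟩ := ha 0
  obtain ⟨m, hm⟩ := ha 1
  have h0 : Fin.contractNth (Fin.castSucc (0 : Fin (k + 1))) (· * ·) a 0 = a 0 * a 1 := by
    simp [Fin.contractNth]
  have ht : Fin.tail (Fin.contractNth (Fin.castSucc (0 : Fin (k + 1))) (· * ·) a) =
      Fin.tail (Fin.tail a) := by
    funext i
    simp [Fin.tail, Fin.contractNth]
  change _ = charMap ℋ 𝒜 π T k x (Fin.contractNth (Fin.castSucc (0 : Fin (k + 1))) (· * ·) a)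
  rw [charMap_apply hl, charMap_apply (l := l + m) (by
    rw [h0]; exact SetLike.mul_mem_graded hl hm), h0, ht, tensorKoszul_cons, koszul_one,
    evalTail_cons (a := Fin.tail a) hm, hπ.one_act, ← tensorKoszul_add, add_comm m l, mul_assoc]
  rfl

/-- The characteristic map is compatible with the inner faces. -/
theorem charMap_comulAt (hH : IsDGHopfAlgebra ℋ dH S) (k : ℕ) (j : Fin k) (x : TPow H k) :
    charMap ℋ 𝒜 π T (k + 1) (comulAt k j x) = mulAt j.succ (charMap ℋ 𝒜 π T k x) := by
  refine ext_of_homogeneous (𝒜 := 𝒜) fun a ha => ?_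
  obtain ⟨l, hl⟩ := ha 0
  have h0 : Fin.contractNth j.succ.castSucc (· * ·) a 0 = a 0 := by
    simp [Fin.contractNth]
  have ht : Fin.tail (Fin.contractNth j.succ.castSucc (· * ·) a) =
      Fin.contractNth j.castSucc (· * ·) (Fin.tail a) := by
    funext i
    simp [Fin.tail, Fin.contractNth]
  change _ = charMap ℋ 𝒜 π T k x (Fin.contractNth j.succ.castSucc (· * ·) a)
  rw [charMap_apply hl, charMap_apply (l := l) (by rw [h0]; exact hl), h0, ht,
    tensorKoszul_comulAt hH, evalTail_comulAt hπ hH k j _ ha.tail]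

variable (hT : IsInvariantTrace ℋ 𝒜 S δ σ π T)
include hT

/-- The characteristic map is compatible with the last face, because the functional is a
`σ`-trace. -/
theorem charMap_snoc (hσ : σ ∈ ℋ 0) (k : ℕ) (x : TPow H k) :
    charMap ℋ 𝒜 π T (k + 1) (snoc k σ x) = cyclicOp 𝒜 (k + 1) (mulAt 0 (charMap ℋ 𝒜 π T k x)) := by
  refine ext_of_homogeneous (𝒜 := 𝒜) fun a ha => ?_
  obtain ⟨l, hl⟩ := ha 0
  obtain ⟨i, hi⟩ := ha (Fin.last (k + 1))
  rw [cyclicOp_apply 𝒜 hi]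
  set a' : Fin (k + 2) → Ω :=
    Fin.cons (a (Fin.last (k + 1))) fun l => koszul 𝒜 i (a l.castSucc) with ha'
  change _ = charMap ℋ 𝒜 π T k x (Fin.contractNth (Fin.castSucc (0 : Fin (k + 1))) (· * ·) a')
  have h0 : Fin.contractNth (Fin.castSucc (0 : Fin (k + 1))) (· * ·) a' 0 =
      a (Fin.last (k + 1)) * koszul 𝒜 i (a 0) := by
    simp [Fin.contractNth, ha']
  have ht : Fin.tail (Fin.contractNth (Fin.castSucc (0 : Fin (k + 1))) (· * ·) a') =
      fun j => koszul 𝒜 i (Fin.init (Fin.tail a) j) := by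
    funext j
    simp [Fin.tail, Fin.contractNth, Fin.init, ha']
  rw [charMap_apply hl, charMap_apply (l := i + l) (by
    rw [h0]; exact SetLike.mul_mem_graded hi (koszul_mem 𝒜 i hl)), h0, ht, tensorKoszul_snoc ℋ hσ,
    evalTail_snoc hσ k _ ha.tail, tensorKoszul_add,
    ← evalTail_koszul hπ i k (Fin.init (Fin.tail a)) (fun j => ha.tail j.castSucc), mul_assoc,
    ← koszul_mul,
    hT.trace' hi, mul_assoc]
  rfl

/-- The characteristic map is compatible with the cyclic operators, because the functional is a
`δ`-invariant `σ`-trace. -/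
theorem charMap_hopfCyclic (hH : IsDGHopfAlgebra ℋ dH S) (hδσ : IsModularPair ℋ dH S δ σ) :
    (k : ℕ) → (x : TPow H k) → charMap ℋ 𝒜 π T k (hopfCyclic ℋ S δ σ k x) =
      cyclicOp 𝒜 k (charMap ℋ 𝒜 π T k x)
  | 0, x => by
    refine ext_of_homogeneous (𝒜 := 𝒜) fun a ha => ?_
    obtain ⟨i, hi⟩ := ha (Fin.last 0)
    rw [cyclicOp_apply 𝒜 hi]
    refine congrArg _ (funext fun j => ?_)
    fin_cases j
    rfl
  | k + 1, x => by
    suffices e : charMap ℋ 𝒜 π T (k + 1) ∘ₗ hopfCyclic ℋ S δ σ (k + 1) =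
        cyclicOp 𝒜 (k + 1) ∘ₗ charMap ℋ 𝒜 π T (k + 1) from LinearMap.congr_fun e x
    refine TPow.ext_cons fun h x => ext_of_homogeneous (𝒜 := 𝒜) fun a ha => ?_
    obtain ⟨l, hl⟩ := ha 0
    obtain ⟨i, hi⟩ := ha (Fin.last (k + 1))
    have hh : Homogeneous 𝒜 (Fin.init a) := fun j => ha j.castSucc
    rw [LinearMap.comp_apply, LinearMap.comp_apply, cyclicOp_apply 𝒜 hi,
      charMap_apply (a := Fin.cons (a (Fin.last (k + 1))) fun l => koszul 𝒜 i (a l.castSucc)) hi,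
      charMap_apply hl, hopfCyclic_cons, diagAct_koszul hH, evalTail_diagAct hπ hH _ _ ha.tail,
      ← twistedAntipode_koszul hH hδσ, ← hT.invariant' hl, tensorKoszul_snoc ℋ hδσ.mem_zero,
      evalTail_snoc hδσ.mem_zero _ _ ha.tail, ← mul_assoc, Fin.tail_cons]
    have e := evalTail_koszul hπ i (k + 1) _ hh (cons k (h ⊗ₜ x))
    rw [evalTail_cons (a := Fin.init a) hl] at e
    refine Eq.trans ?_ ((hT.trace' hi _).symm.trans (congrArg (fun u => T (_ * u)) e))
    rfl

end Faces

theorem charMap_counitLast (hπ : IsDGAction ℋ 𝒜 dH dΩ π) (hH : IsDGHopfAlgebra ℋ dH S) (k : ℕ)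
    (x : TPow H (k + 1)) :
    charMap ℋ 𝒜 π T k (counitLast k x) = insertOne k (charMap ℋ 𝒜 π T (k + 1) x) := by
  refine ext_of_homogeneous (𝒜 := 𝒜) fun a ha => ?_
  obtain ⟨l, hl⟩ := ha 0
  change _ = charMap ℋ 𝒜 π T (k + 1) x (Fin.insertNth (Fin.last (k + 1)) 1 a)
  have hs : (Fin.insertNth (Fin.last (k + 1)) 1 a : Fin (k + 2) → Ω) =
      Fin.snoc (α := fun _ => Ω) a 1 := Fin.insertNth_last' 1 a
  have h0 : (Fin.snoc (α := fun _ => Ω) a 1 : Fin (k + 2) → Ω) 0 = a 0 :=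
    Fin.snoc_castSucc (α := fun _ => Ω) 1 a 0
  have ht : Fin.tail (Fin.snoc (α := fun _ => Ω) a 1 : Fin (k + 2) → Ω) =
      Fin.snoc (α := fun _ => Ω) (Fin.tail a) 1 := by
    funext i
    simp only [Fin.tail, Fin.snoc, Fin.val_succ, add_lt_add_iff_right]
    split_ifs <;> rfl
  rw [hs, charMap_apply hl, charMap_apply (l := l) (by rw [h0]; exact hl), h0, ht,
    evalTail_counitLast hπ hH k _ ha.tail, tensorKoszul_counitLast hH]

theorem charMap_hopfb (hπ : IsDGAction ℋ 𝒜 dH dΩ π) (hT : IsInvariantTrace ℋ 𝒜 S δ σ π T)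
    (hH : IsDGHopfAlgebra ℋ dH S) (hσ : σ ∈ ℋ 0) (k : ℕ) (x : TPow H k) :
    charMap ℋ 𝒜 π T (k + 1) (hopfb σ k x) = functionalb 𝒜 k (charMap ℋ 𝒜 π T k x) := by
  simp only [hopfb, functionalb, LinearMap.add_apply, LinearMap.comp_apply, LinearMap.sum_apply,
    LinearMap.smul_apply, map_add, map_sum, map_smul, TensorProduct.mk_apply,
    charMap_cons_one hπ, charMap_comulAt hπ hH, charMap_snoc hπ hT hσ, Fin.sum_univ_succ,
    Fin.val_zero, pow_zero, one_smul, Fin.val_succ]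

theorem charMap_connesB (hπ : IsDGAction ℋ 𝒜 dH dΩ π) (hT : IsInvariantTrace ℋ 𝒜 S δ σ π T)
    (hH : IsDGHopfAlgebra ℋ dH S) (hδσ : IsModularPair ℋ dH S δ σ) (k : ℕ) (x : TPow H (k + 1)) :
    charMap ℋ 𝒜 π T k (connesB (hopfCyclic ℋ S δ σ) counitLast k x) =
      connesB (cyclicOp 𝒜) insertOne k (charMap ℋ 𝒜 π T (k + 1) x) := by
  have hp : ∀ (n : ℕ) (x : TPow H k), charMap ℋ 𝒜 π T k ((hopfCyclic ℋ S δ σ k ^ n) x) =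
      (cyclicOp 𝒜 k ^ n) (charMap ℋ 𝒜 π T k x) := by
    intro n
    induction n with
    | zero => exact fun x => rfl
    | succ n ih =>
      intro x
      rw [pow_succ, Module.End.mul_apply, ih, charMap_hopfCyclic hπ hT hH hδσ, pow_succ,
        Module.End.mul_apply]
  simp only [connesB, LinearMap.comp_apply, LinearMap.sum_apply, LinearMap.smul_apply, map_sum,
    map_smul, LinearMap.sub_apply, LinearMap.id_apply, hp, charMap_counitLast hπ hH,
    charMap_hopfCyclic hπ hT hH hδσ, map_sub]

/-- The characteristic map anticommutes with the differentials, up to the sign operator. -/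
theorem functionald_charMap (hπ : IsDGAction ℋ 𝒜 dH dΩ π) (hΩ : IsDGAlgebra 𝒜 dΩ)
    (hHd : IsDGAlgebra ℋ dH) (hT : ∀ a, T (dΩ a) = 0) (k : ℕ) (x : TPow H k) :
    functionald 𝒜 dΩ k (charMap ℋ 𝒜 π T k (tensorKoszul ℋ k 1 x)) =
      -charMap ℋ 𝒜 π T k (hopfd ℋ dH k x) := by
  refine ext_of_homogeneous (𝒜 := 𝒜) fun a ha => ?_
  obtain ⟨l, hl⟩ := ha 0
  have e : functionald 𝒜 dΩ k (charMap ℋ 𝒜 π T k (tensorKoszul ℋ k 1 x)) a =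
      ∑ j, charMap ℋ 𝒜 π T k (tensorKoszul ℋ k 1 x) (slots 𝒜 dΩ a j) := by
    rw [functionald, LinearMap.sum_apply, sum_apply]
    rfl
  have h0 : charMap ℋ 𝒜 π T k (tensorKoszul ℋ k 1 x) (slots 𝒜 dΩ a 0) =
      T (dΩ (a 0) * evalTail ℋ 𝒜 π k (Fin.tail a) (tensorKoszul ℋ k l x)) := by
    rw [charMap_apply (l := l + 1) (by rw [(slots_zero a).1]; exact hΩ.d_mem l _ hl),
      (slots_zero a).1, (slots_zero a).2, tensorKoszul_add, tensorKoszul_self]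
  have hs : ∀ j : Fin k, charMap ℋ 𝒜 π T k (tensorKoszul ℋ k 1 x) (slots 𝒜 dΩ a j.succ) =
      T (koszul 𝒜 1 (a 0) * evalTail ℋ 𝒜 π k (slots 𝒜 dΩ (Fin.tail a) j)
        (tensorKoszul ℋ k 1 (tensorKoszul ℋ k l x))) := fun j => by
    rw [charMap_apply (l := l) (by rw [(slots_succ a j).1]; exact koszul_mem 𝒜 1 hl),
      (slots_succ a j).1, (slots_succ a j).2, ← tensorKoszul_add, ← tensorKoszul_add, add_comm l]
  have hk : koszul 𝒜 1 (a 0) * evalTail ℋ 𝒜 π k (Fin.tail a)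
      (hopfd ℋ dH k (tensorKoszul ℋ k l x)) =
      a 0 * evalTail ℋ 𝒜 π k (Fin.tail a) (tensorKoszul ℋ k l (hopfd ℋ dH k x)) := by
    rw [hopfd_tensorKoszul hHd, koszul_of_mem 𝒜 1 hl, one_mul, ← Int.cast_smul_eq_zsmul ℂ,
      map_smul, smul_mul_smul_comm, ← Int.cast_mul, ← Units.val_mul, ← Int.negOnePow_add,
      Int.negOnePow_even _ ⟨l, rfl⟩, Units.val_one, Int.cast_one, one_smul]
  have hz := hT (a 0 * evalTail ℋ 𝒜 π k (Fin.tail a) (tensorKoszul ℋ k l x))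
  rw [hΩ.d_mul 𝒜, d_evalTail hπ hΩ hHd k _ ha.tail, mul_add, hk, Finset.mul_sum, map_add, map_add,
    map_sum, ← h0] at hz
  simp only [← hs] at hz
  rw [e, Fin.sum_univ_succ, neg_apply, charMap_apply hl]
  linear_combination hz

end CharMap

/-! ### Weights and continuity of the characteristic map -/

section CharWeights

variable {H : Type*} [Ring H] [Algebra ℂ H] {ℋ : ℤ → Submodule ℂ H} [GradedAlgebra ℋ]
  {Ω : Type*} [Ring Ω] [Algebra ℂ Ω] {𝒜 : ℤ → Submodule ℂ Ω} [GradedAlgebra 𝒜]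
  {π : H →ₗ[ℂ] Ω →ₗ[ℂ] Ω} {T : Ω →ₗ[ℂ] ℂ}

theorem tensorKoszul_tprod {k : ℕ} (i : ℤ) (h : Fin k → H) :
    tensorKoszul ℋ k i (PiTensorProduct.tprod ℂ h) =
      PiTensorProduct.tprod ℂ fun l => koszul ℋ i (h l) :=
  PiTensorProduct.map_tprod _ _

theorem tensorKoszul_of_mem {k : ℕ} (i : ℤ) {w : ℤ} {x : TPow H k} (hx : x ∈ tensorWeight ℋ k w) :
    tensorKoszul ℋ k i x = (((i * w).negOnePow : ℤ) : ℂ) • x := by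
  suffices h : tensorWeight ℋ k w ≤
      LinearMap.eqLocus (tensorKoszul ℋ k i) ((((i * w).negOnePow : ℤ) : ℂ) • LinearMap.id) from
    h hx
  refine Submodule.span_le.2 ?_
  rintro x ⟨n, h, hh, hn, rfl⟩
  have e : ∀ l, koszul ℋ i (h l) = (((i * n l).negOnePow : ℤ) : ℂ) • h l := fun l => by
    rw [koszul_of_mem ℋ i (hh l), Int.cast_smul_eq_zsmul]
  have hp : ∀ s : Finset (Fin k), ∏ l ∈ s, (((i * n l).negOnePow : ℤ) : ℂ) =
      (((i * ∑ l ∈ s, n l).negOnePow : ℤ) : ℂ) := by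
    intro s
    classical
    induction s using Finset.induction_on with
    | empty => simp
    | insert l s hl ih => rw [Finset.prod_insert hl, Finset.sum_insert hl, ih, mul_add,
        Int.negOnePow_add, Units.val_mul, Int.cast_mul]
  rw [SetLike.mem_coe, LinearMap.mem_eqLocus, tensorKoszul_tprod, funext e,
    MultilinearMap.map_smul_univ, hp, hn]
  rfl

theorem evalTail_mem (hπ : ∀ n i, ∀ h ∈ ℋ n, ∀ a ∈ 𝒜 i, π h a ∈ 𝒜 (n + i)) : (k : ℕ) →
    (m n : Fin k → ℤ) → (a : Fin k → Ω) → (∀ i, a i ∈ 𝒜 (m i)) → (h : Fin k → H) →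
    (∀ i, h i ∈ ℋ (n i)) →
    evalTail ℋ 𝒜 π k a (PiTensorProduct.tprod ℂ h) ∈ 𝒜 (∑ i, m i + ∑ i, n i)
  | 0, m, n, a, _, h, _ => by
    rw [tprod_zero, evalTail_nil, Finset.univ_eq_empty, Finset.sum_empty, Finset.sum_empty,
      add_zero]
    exact SetLike.one_mem_graded 𝒜
  | k + 1, m, n, a, ha, h, hh => by
    rw [tprod_eq_cons, evalTail_cons (ha 0), tensorKoszul_tprod, Fin.sum_univ_succ,
      Fin.sum_univ_succ, show m 0 + ∑ i : Fin k, m i.succ + (n 0 + ∑ i : Fin k, n i.succ) =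
        n 0 + m 0 + (∑ i : Fin k, m i.succ + ∑ i : Fin k, n i.succ) by ring]
    exact SetLike.mul_mem_graded (hπ _ _ _ (hh 0) _ (ha 0))
      (evalTail_mem hπ k (fun i => m i.succ) (fun i => n i.succ) _ (fun i => ha i.succ) _
        fun i => koszul_mem ℋ _ (hh i.succ))

variable {q : ℤ} (hT : ∀ n : ℤ, n ≠ q → ∀ a ∈ 𝒜 n, T a = 0)
include hT

theorem charMap_tprod_of_ne (hπ : ∀ n i, ∀ h ∈ ℋ n, ∀ a ∈ 𝒜 i, π h a ∈ 𝒜 (n + i)) {k : ℕ}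
    {m : Fin (k + 1) → ℤ} {n : Fin k → ℤ} {a : Fin (k + 1) → Ω} (ha : ∀ i, a i ∈ 𝒜 (m i))
    {h : Fin k → H} (hh : ∀ i, h i ∈ ℋ (n i)) (hq : ∑ i, m i + ∑ i, n i ≠ q) :
    charMap ℋ 𝒜 π T k (PiTensorProduct.tprod ℂ h) a = 0 := by
  rw [charMap_apply (ha 0), tensorKoszul_tprod]
  refine hT _ ?_ _ (SetLike.mul_mem_graded (ha 0) (evalTail_mem hπ k _ n _
    (fun i => ha i.succ) _ fun i => koszul_mem ℋ _ (hh i)))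
  rwa [Fin.sum_univ_succ, add_assoc] at hq

theorem charMap_mem_weightPart (hπ : ∀ n i, ∀ h ∈ ℋ n, ∀ a ∈ 𝒜 i, π h a ∈ 𝒜 (n + i)) {k : ℕ}
    {w : ℤ} {x : TPow H k} (hx : x ∈ tensorWeight ℋ k w) :
    charMap ℋ 𝒜 π T k x ∈ weightPart 𝒜 k (q - w) := by
  suffices h : tensorWeight ℋ k w ≤ (weightPart 𝒜 k (q - w)).comap (charMap ℋ 𝒜 π T k) from h hx
  refine Submodule.span_le.2 ?_
  rintro x ⟨n, h, hh, hn, rfl⟩ m a ha hm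
  exact charMap_tprod_of_ne hT hπ ha hh (by omega)

/-- The integrand has at least the weight of the tensor, hence is in a degree in which the
functional vanishes. -/
theorem charMap_eq_zero (hA : ∀ n < 0, 𝒜 n = ⊥)
    (hπ : ∀ n i, ∀ h ∈ ℋ n, ∀ a ∈ 𝒜 i, π h a ∈ 𝒜 (n + i)) {k : ℕ} {x : TPow H k}
    (hx : x ∈ tensorFiltration ℋ k (q + 1)) : charMap ℋ 𝒜 π T k x = 0 := by
  suffices h : tensorFiltration ℋ k (q + 1) ≤ LinearMap.ker (charMap ℋ 𝒜 π T k) from h hx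
  refine Submodule.span_le.2 ?_
  rintro x ⟨n, h, hh, hn, rfl⟩
  refine ext_of_homogeneous (𝒜 := 𝒜) fun a ha => ?_
  choose m hm using ha
  by_cases h0 : ∃ i, m i < 0
  · obtain ⟨i, hi⟩ := h0
    have := hm i
    rw [hA _ hi, Submodule.mem_bot] at this
    rw [MultilinearMap.map_coord_zero _ i this]
    rfl
  · push Not at h0
    have : 0 ≤ ∑ i, m i := Finset.sum_nonneg fun i _ => h0 i
    exact charMap_tprod_of_ne hT hπ hm hh (by omega)

omit hT in
theorem continuous_evalTail [TopologicalSpace Ω] [IsTopologicalRing Ω]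
    (hγ : Continuous (koszul 𝒜 1)) (hπ : ∀ n, ∀ h ∈ ℋ n, Continuous (π h)) : (k : ℕ) →
    (n : Fin k → ℤ) → (h : Fin k → H) → (∀ i, h i ∈ ℋ (n i)) →
    Continuous fun a => evalTail ℋ 𝒜 π k a (PiTensorProduct.tprod ℂ h)
  | 0, _, _, _ => by
    simp only [tprod_zero, evalTail_nil]
    exact continuous_const
  | k + 1, n, h, hh => by
    have e : ∀ a, evalTail ℋ 𝒜 π (k + 1) a (PiTensorProduct.tprod ℂ h) =
        ∑ s ∈ Finset.range 2, π (h 0) (parityPart 𝒜 s (a 0)) *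
          evalTail ℋ 𝒜 π k (Fin.tail a)
            (PiTensorProduct.tprod ℂ fun i => koszul ℋ s (h i.succ)) := fun a => by
      simp only [evalTail, LinearMap.sum_apply, LinearMap.comp_apply, uncons_tprod,
        TensorProduct.map_tmul, PiTensorProduct.map_tprod, LinearMap.mul'_apply,
        LinearMap.flip_apply]
      rfl
    simp only [e]
    refine continuous_finsetSum _ fun s _ => ?_
    exact ((hπ _ _ (hh 0)).comp ((continuous_parityPart hγ s).comp (continuous_apply 0))).mul
      ((continuous_evalTail hγ hπ k _ _ fun i => koszul_mem ℋ s (hh i.succ)).comp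
        (continuous_pi fun i => continuous_apply i.succ))

omit hT in
theorem charMap_mem_continuousPart [TopologicalSpace Ω] [IsTopologicalRing Ω]
    (hγ : Continuous (koszul 𝒜 1)) (hπ : ∀ n, ∀ h ∈ ℋ n, Continuous (π h)) (hTc : Continuous T)
    {k : ℕ} {w : ℤ} {x : TPow H k} (hx : x ∈ tensorWeight ℋ k w) :
    charMap ℋ 𝒜 π T k x ∈ continuousPart Ω k := by
  suffices h : tensorWeight ℋ k w ≤ (continuousPart Ω k).comap (charMap ℋ 𝒜 π T k) from h hx
  refine Submodule.span_le.2 ?_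
  rintro x ⟨n, h, hh, hn, rfl⟩
  have e : ∀ a, charMap ℋ 𝒜 π T k (PiTensorProduct.tprod ℂ h) a =
      T (∑ s ∈ Finset.range 2, parityPart 𝒜 s (a 0) * evalTail ℋ 𝒜 π k (Fin.tail a)
        (PiTensorProduct.tprod ℂ fun i => koszul ℋ s (h i))) := fun a => by
    change T (evalAll ℋ 𝒜 π k a _) = _
    simp only [evalAll, LinearMap.sum_apply, LinearMap.comp_apply, PiTensorProduct.map_tprod,
      LinearMap.mulLeft_apply]
  change Continuous fun a => charMap ℋ 𝒜 π T k (PiTensorProduct.tprod ℂ h) a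
  simp only [e]
  refine hTc.comp (continuous_finsetSum _ fun s _ => ?_)
  exact ((continuous_parityPart hγ s).comp (continuous_apply 0)).mul
    ((continuous_evalTail hγ hπ k _ _ fun i => koszul_mem ℋ s (hh i)).comp
      (continuous_pi fun i => continuous_apply i.succ))

theorem component_continuous_functional [TopologicalSpace Ω] (hTc : Continuous T) :
    @Continuous Ω ℂ (componentTopology 𝒜) _ T := by
  have hTq : ⇑T = fun a => T (GradedAlgebra.proj 𝒜 q a) := by
    have : T = T ∘ₗ GradedAlgebra.proj 𝒜 q := by
      refine linearMap_ext_homogeneous 𝒜 fun n a ha => ?_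
      rw [LinearMap.comp_apply, proj_of_mem 𝒜 q ha]
      split_ifs with h
      · rfl
      · rw [hT n h a ha, map_zero]
    exact congrArg DFunLike.coe this
  rw [hTq]
  exact @Continuous.comp Ω Ω ℂ (componentTopology 𝒜) _ _ _ _ hTc (continuous_component_proj q)

theorem charMap_mem_contWeight [TopologicalSpace Ω] [IsTopologicalRing Ω]
    (hA : ∀ n < 0, 𝒜 n = ⊥) (hproj : ∀ n, Continuous (GradedAlgebra.proj 𝒜 n))
    (hπ : ∀ n i, ∀ h ∈ ℋ n, ∀ a ∈ 𝒜 i, π h a ∈ 𝒜 (n + i)) (hπc : ∀ h, Continuous (π h))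
    (hTc : Continuous T) {k : ℕ} {w : ℤ} {x : TPow H k} (hx : x ∈ tensorWeight ℋ k w) :
    charMap ℋ 𝒜 π T k x ∈ contWeight 𝒜 (q - w) k := by
  rw [← contWeight_component hA hproj]
  refine ⟨charMap_mem_weightPart hT hπ hx, ?_⟩
  refine @charMap_mem_continuousPart H _ _ ℋ _ Ω _ _ 𝒜 _ π T (componentTopology 𝒜)
    (component_isTopologicalRing hA) (component_continuous_koszul 1) (fun n h hh =>
      component_continuous_map (r := n) (fun i a ha => by
        rw [add_comm]; exact hπ n i h hh a ha) (hπc h)) 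
    (component_continuous_functional hT hTc) k w x hx

end CharWeights

/-! ### The characteristic map on total complexes -/

section CharTotal

theorem totalD_lof_zero {X : ℕ → Type*} [∀ k, AddCommGroup (X k)] [∀ k, Module ℂ (X k)]
    {ι : Type*} [AddMonoidWithOne ι] [DecidableEq ι] (b : ∀ k, X k →ₗ[ℂ] X (k + 1))
    (B : ∀ k, X (k + 1) →ₗ[ℂ] X k) (d : ∀ k, X k →ₗ[ℂ] X k) (r : ι) (x : X 0) :
    totalD ι b B d (DirectSum.lof ℂ (ℕ × ι) (fun p => X p.1) (0, r) x) =
      DirectSum.lof ℂ (ℕ × ι) (fun p => X p.1) (1, r) (b 0 x) +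
        DirectSum.lof ℂ (ℕ × ι) (fun p => X p.1) (0, r) (d 0 x) :=
  DirectSum.toModule_lof (M := fun p : ℕ × ι => X p.1) ℂ (0, r) x

theorem totalD_lof_succ {X : ℕ → Type*} [∀ k, AddCommGroup (X k)] [∀ k, Module ℂ (X k)]
    {ι : Type*} [AddMonoidWithOne ι] [DecidableEq ι] (b : ∀ k, X k →ₗ[ℂ] X (k + 1))
    (B : ∀ k, X (k + 1) →ₗ[ℂ] X k) (d : ∀ k, X k →ₗ[ℂ] X k) (k : ℕ) (r : ι) (x : X (k + 1)) :
    totalD ι b B d (DirectSum.lof ℂ (ℕ × ι) (fun p => X p.1) (k + 1, r) x) =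
      DirectSum.lof ℂ (ℕ × ι) (fun p => X p.1) (k + 2, r) (b (k + 1) x) +
        DirectSum.lof ℂ (ℕ × ι) (fun p => X p.1) (k, r + 1) (B k x) +
        (-1 : ℂ) ^ (k + 1) •
          DirectSum.lof ℂ (ℕ × ι) (fun p => X p.1) (k + 1, r) (d (k + 1) x) :=
  DirectSum.toModule_lof (M := fun p : ℕ × ι => X p.1) ℂ (k + 1, r) x

theorem totalD_place_zero {X : ℕ → Type*} [∀ k, AddCommGroup (X k)] [∀ k, Module ℂ (X k)]
    (b : ∀ k, X k →ₗ[ℂ] X (k + 1)) (B : ∀ k, X (k + 1) →ₗ[ℂ] X k) (d : ∀ k, X k →ₗ[ℂ] X k)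
    (r : ℤ) (x : X 0) :
    totalD ℤ b B d (place 0 r x) = place 1 r (b 0 x) + place 0 r (d 0 x) :=
  totalD_lof_zero b B d r x

theorem totalD_place_succ {X : ℕ → Type*} [∀ k, AddCommGroup (X k)] [∀ k, Module ℂ (X k)]
    (b : ∀ k, X k →ₗ[ℂ] X (k + 1)) (B : ∀ k, X (k + 1) →ₗ[ℂ] X k) (d : ∀ k, X k →ₗ[ℂ] X k)
    (k : ℕ) (r : ℤ) (x : X (k + 1)) :
    totalD ℤ b B d (place (k + 1) r x) = place (k + 2) r (b (k + 1) x) +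
      place k (r + 1) (B k x) + (-1 : ℂ) ^ (k + 1) • place (k + 1) r (d (k + 1) x) :=
  totalD_lof_succ b B d k r x

variable {H : Type*} [Ring H] [Algebra ℂ H] {ℋ : ℤ → Submodule ℂ H}
  [GradedAlgebra ℋ] {Ω : Type*} [Ring Ω] [Algebra ℂ Ω] {𝒜 : ℤ → Submodule ℂ Ω} [GradedAlgebra 𝒜]
  {π : H →ₗ[ℂ] Ω →ₗ[ℂ] Ω} {T : Ω →ₗ[ℂ] ℂ}

/-- The sign `(-1) ^ (w (w + 1) / 2)`. -/
def charSign (w : ℤ) : ℤ := ((w * (w + 1) / 2).negOnePow : ℤ)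

theorem charSign_succ (w : ℤ) : charSign (w + 1) = ((w + 1).negOnePow : ℤ) * charSign w := by
  have h : (w + 1) * (w + 1 + 1) / 2 = (w + 1) + w * (w + 1) / 2 := by
    rw [show (w + 1) * (w + 1 + 1) = w * (w + 1) + (w + 1) * 2 by ring,
      Int.add_mul_ediv_right _ _ two_ne_zero, add_comm]
  rw [charSign, charSign, h, Int.negOnePow_add, Units.val_mul]

theorem charTotal_lof (i : ℤ) (k r : ℕ) (x : TPow H k) :
    charTotal ℋ 𝒜 π T i (DirectSum.lof ℂ (ℕ × ℕ) (fun p => TPow H p.1) (k, r) x) =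
      charSign (i - k - 2 * r) • place k (r : ℤ) (charMap ℋ 𝒜 π T k x) :=
  DirectSum.toModule_lof (M := fun p : ℕ × ℕ => TPow H p.1) ℂ (k, r) x

omit [GradedAlgebra ℋ] in
/-- A property of the total complex of the tensor powers that holds at every place holds for all
cochains of a given degree. -/
theorem mem_of_mem_iInf {M : Type*} [AddCommGroup M] [Module ℂ M]
    {f : Tot (TPow H) ℕ →ₗ[ℂ] M} {N : Submodule ℂ M} {𝒱 : ∀ p : ℕ × ℕ, Submodule ℂ (TPow H p.1)}
    (h : ∀ (k r : ℕ), ∀ x ∈ 𝒱 (k, r),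
      f (DirectSum.lof ℂ (ℕ × ℕ) (fun p => TPow H p.1) (k, r) x) ∈ N) {c : Tot (TPow H) ℕ}
    (hc : c ∈ ⨅ p : ℕ × ℕ, (𝒱 p).comap
      (DirectSum.component ℂ (ℕ × ℕ) (fun p => TPow H p.1) p)) : f c ∈ N := by
  classical
  simp only [Submodule.mem_iInf, Submodule.mem_comap] at hc
  rw [← DirectSum.sum_support_of c, map_sum]
  exact Submodule.sum_mem _ fun p _ => h p.1 p.2 _ (hc p)

variable {q : ℤ} (hT : ∀ n : ℤ, n ≠ q → ∀ a ∈ 𝒜 n, T a = 0)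
  (hA : ∀ n < 0, 𝒜 n = ⊥) (hπ : ∀ n i, ∀ h ∈ ℋ n, ∀ a ∈ 𝒜 i, π h a ∈ 𝒜 (n + i))
include hT hA hπ

theorem charTotal_eq_zero (i : ℤ) {x : Tot (TPow H) ℕ} (hx : x ∈ hopfFiltration ℋ (q + 1)) :
    charTotal ℋ 𝒜 π T i x = 0 := by
  rw [← Submodule.mem_bot ℂ]
  refine mem_of_mem_iInf (𝒱 := fun p => tensorFiltration ℋ p.1 (q + 1)) (fun k r x hx => ?_) hx
  rw [charTotal_lof, charMap_eq_zero hT hA hπ hx, map_zero, smul_zero]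
  exact Submodule.zero_mem _

omit hT hA hπ in
theorem charTotal_mem_gradedSub {𝒱 : ℤ → ∀ k, Submodule ℂ (Functional Ω k)} {q : ℤ}
    (h : ∀ k w, ∀ x ∈ tensorWeight ℋ k w, charMap ℋ 𝒜 π T k x ∈ 𝒱 (q - w) k) {i : ℤ}
    {x : Tot (TPow H) ℕ} (hx : x ∈ hopfCochains ℋ i) :
    charTotal ℋ 𝒜 π T i x ∈ gradedSub 𝒱 (i - q) := by
  refine mem_of_mem_iInf (𝒱 := fun p => tensorWeight ℋ p.1 (i - p.1 - 2 * p.2))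
    (fun k r x hx => ?_) hx
  rw [charTotal_lof]
  refine zsmul_mem (place_mem_gradedSub ?_) _
  rw [show (k : ℤ) + 2 * (r : ℤ) - (i - q) = q - (i - k - 2 * r) by ring]
  exact h k _ x hx

theorem charTotal_mem [TopologicalSpace Ω] [IsTopologicalRing Ω]
    (hproj : ∀ n, Continuous (GradedAlgebra.proj 𝒜 n)) (hπc : ∀ h, Continuous (π h))
    (hTc : Continuous T) {i : ℤ} {x : Tot (TPow H) ℕ} (hx : x ∈ hopfCochains ℋ i) :
    charTotal ℋ 𝒜 π T i x ∈ periodicCochains 𝒜 (i - q) :=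
  charTotal_mem_gradedSub (fun _ _ _ hx => charMap_mem_contWeight hT hA hproj hπ hπc hTc hx) hx

omit hπ hA hT q

variable [Coalgebra ℂ H] {dH S : H →ₗ[ℂ] H} {dΩ : Ω →ₗ[ℂ] Ω} {δ : H →ₐ[ℂ] ℂ} {σ : H}

/-- The characteristic map commutes with the total differentials. -/
theorem charTotal_hopfD (hπ : IsDGAction ℋ 𝒜 dH dΩ π) (hT : IsInvariantTrace ℋ 𝒜 S δ σ π T)
    (hH : IsDGHopfAlgebra ℋ dH S) (hδσ : IsModularPair ℋ dH S δ σ) (hΩ : IsDGAlgebra 𝒜 dΩ)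
    (hTd : ∀ a, T (dΩ a) = 0) {i : ℤ} {x : Tot (TPow H) ℕ} (hx : x ∈ hopfCochains ℋ i) :
    charTotal ℋ 𝒜 π T (i + 1) (hopfD ℋ dH S δ σ x) =
      periodicD 𝒜 dΩ (charTotal ℋ 𝒜 π T i x) := by
  rw [← sub_eq_zero, ← Submodule.mem_bot ℂ]
  change (charTotal ℋ 𝒜 π T (i + 1) ∘ₗ hopfD ℋ dH S δ σ - periodicD 𝒜 dΩ ∘ₗ charTotal ℋ 𝒜 π T i) x
    ∈ _
  refine mem_of_mem_iInf (𝒱 := fun p => tensorWeight ℋ p.1 (i - p.1 - 2 * p.2))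
    (fun k r x hx => ?_) hx
  -- The sign in the characteristic map turns the anticommutation with `d` into a commutation.
  have hd : charSign (i - k - 2 * r + 1) • charMap ℋ 𝒜 π T k (hopfd ℋ dH k x) =
      charSign (i - k - 2 * r) • functionald 𝒜 dΩ k (charMap ℋ 𝒜 π T k x) := by
    have := functionald_charMap hπ hΩ hH.isDGAlgebra hTd k x
    rw [tensorKoszul_of_mem 1 hx, map_smul, map_smul, one_mul, Int.cast_smul_eq_zsmul] at this
    rw [charSign_succ, ← neg_eq_iff_eq_neg.2 this, Int.negOnePow_succ, Units.val_neg, smul_neg,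
      smul_smul, neg_mul, neg_mul, neg_smul, neg_neg, mul_right_comm, Int.units_coe_mul_self,
      one_mul]
  rw [Submodule.mem_bot, LinearMap.sub_apply, sub_eq_zero, LinearMap.comp_apply,
    LinearMap.comp_apply, charTotal_lof, map_zsmul]
  cases k with
  | zero =>
    rw [hopfD, totalD_lof_zero, map_add, charTotal_lof, charTotal_lof, periodicD,
      totalD_place_zero, charMap_hopfb hπ hT hH hδσ.mem_zero, smul_add,
      show i + 1 - ((0 : ℕ) : ℤ) - 2 * (r : ℤ) = i - ((0 : ℕ) : ℤ) - 2 * r + 1 by ring,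
      ← map_zsmul, ← map_zsmul _ _ (functionald 𝒜 dΩ 0 _), ← hd,
      show i + 1 - ((1 : ℕ) : ℤ) - 2 * (r : ℤ) = i - ((0 : ℕ) : ℤ) - 2 * r by push_cast; ring]
    simp only [map_zsmul]
  | succ k =>
    rw [hopfD, totalD_lof_succ, map_add, map_add, map_smul, charTotal_lof, charTotal_lof,
      charTotal_lof, periodicD,
      totalD_place_succ, charMap_hopfb hπ hT hH hδσ.mem_zero, charMap_connesB hπ hT hH hδσ,
      smul_add, smul_add, smul_comm (charSign _) ((-1 : ℂ) ^ (k + 1)),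
      ← map_zsmul _ _ (functionald 𝒜 dΩ (k + 1) _), ← hd,
      show i + 1 - ((k + 1 : ℕ) : ℤ) - 2 * (r : ℤ) = i - ((k + 1 : ℕ) : ℤ) - 2 * r + 1 by ring,
      show i + 1 - ((k + 2 : ℕ) : ℤ) - 2 * (r : ℤ) = i - ((k + 1 : ℕ) : ℤ) - 2 * r by
        push_cast; ring,
      show i + 1 - (k : ℤ) - 2 * ((r + 1 : ℕ) : ℤ) = i - ((k + 1 : ℕ) : ℤ) - 2 * r by
        push_cast; ring]
    simp only [map_zsmul]
    rfl

end CharTotal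

/-! ### Convolution and twisted actions -/

section Convolution

open Coalgebra (comul counit)
open WithConv

variable {H : Type*} [Ring H] [Algebra ℂ H] [Coalgebra ℂ H] {ℋ : ℤ → Submodule ℂ H}
  [GradedAlgebra ℋ] {B : Type*} [Ring B] [Algebra ℂ B]

/-- The convolution product of linear maps from a coalgebra to an algebra. -/
def conv (u v : H →ₗ[ℂ] B) : H →ₗ[ℂ] B := LinearMap.mul' ℂ B ∘ₗ TensorProduct.map u v ∘ₗ comul

variable (H B) in
/-- The unit for the convolution product. -/
def convOne : H →ₗ[ℂ] B := Algebra.linearMap ℂ B ∘ₗ counit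

theorem conv_apply (u v : H →ₗ[ℂ] B) (h : H) :
    conv u v h = LinearMap.mul' ℂ B (TensorProduct.map u v (comul h)) := rfl

theorem convOne_apply (h : H) : convOne H B h = algebraMap ℂ B (counit h) := rfl

theorem conv_assoc (u v w : H →ₗ[ℂ] B) : conv (conv u v) w = conv u (conv v w) :=
  congrArg ofConv (mul_assoc (toConv u) (toConv v) (toConv w))

@[simp] theorem convOne_conv (u : H →ₗ[ℂ] B) : conv (convOne H B) u = u :=
  congrArg ofConv (one_mul (toConv u))

@[simp] theorem conv_convOne (u : H →ₗ[ℂ] B) : conv u (convOne H B) = u :=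
  congrArg ofConv (mul_one (toConv u))

theorem conv_add (u v w : H →ₗ[ℂ] B) : conv u (v + w) = conv u v + conv u w := by
  simp only [conv, TensorProduct.map_add_right, LinearMap.add_comp, LinearMap.comp_add]

theorem add_conv (u v w : H →ₗ[ℂ] B) : conv (u + v) w = conv u w + conv v w := by
  simp only [conv, TensorProduct.map_add_left, LinearMap.add_comp, LinearMap.comp_add]

theorem conv_smul (c : ℂ) (u v : H →ₗ[ℂ] B) : conv u (c • v) = c • conv u v := by
  simp only [conv, TensorProduct.map_smul_right, LinearMap.smul_comp, LinearMap.comp_smul]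

theorem smul_conv (c : ℂ) (u v : H →ₗ[ℂ] B) : conv (c • u) v = c • conv u v := by
  simp only [conv, TensorProduct.map_smul_left, LinearMap.smul_comp, LinearMap.comp_smul]

/-- Convolution products agree if the integrands agree. -/
theorem conv_congr {B' : Type*} [Ring B'] [Algebra ℂ B'] {V : Type*} [AddCommGroup V] [Module ℂ V]
    {u v : H →ₗ[ℂ] B} {u' v' : H →ₗ[ℂ] B'}
    (f : B →ₗ[ℂ] V) (f' : B' →ₗ[ℂ] V) (h : ∀ x y, f (u x * v y) = f' (u' x * v' y)) (x : H) :
    f (conv u v x) = f' (conv u' v' x) := by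
  have e : f ∘ₗ LinearMap.mul' ℂ B ∘ₗ TensorProduct.map u v =
      f' ∘ₗ LinearMap.mul' ℂ B' ∘ₗ TensorProduct.map u' v' := TensorProduct.ext' fun x y => by
    simpa using h x y
  exact LinearMap.congr_fun e (comul x)

variable {dH S : H →ₗ[ℂ] H} (hH : IsDGHopfAlgebra ℋ dH S)
include hH

theorem conv_one (u v : H →ₗ[ℂ] B) : conv u v 1 = u 1 * v 1 := by
  rw [conv_apply, hH.comul_one, TensorProduct.map_tmul, LinearMap.mul'_apply]

theorem conv_koszul (u v : H →ₗ[ℂ] B) (i : ℤ) :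
    conv u v ∘ₗ koszul ℋ i = conv (u ∘ₗ koszul ℋ i) (v ∘ₗ koszul ℋ i) := by
  refine LinearMap.ext fun h => ?_
  rw [LinearMap.comp_apply, conv_apply, conv_apply, comul_koszul hH, TensorProduct.map_map]

theorem convOne_koszul (i : ℤ) : convOne H B ∘ₗ koszul ℋ i = convOne H B := by
  refine LinearMap.ext fun h => ?_
  rw [LinearMap.comp_apply, convOne_apply, convOne_apply, counit_koszul hH]

/-- The convolution product of two maps that shift the degrees by `r` and by `s` shifts them by
`r + s`. -/
theorem conv_mem {ℬ : ℤ → Submodule ℂ B} [GradedAlgebra ℬ] {u v : H →ₗ[ℂ] B} {r s : ℤ}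
    (hu : ∀ n, ∀ h ∈ ℋ n, u h ∈ ℬ (n + r)) (hv : ∀ n, ∀ h ∈ ℋ n, v h ∈ ℬ (n + s)) {n : ℤ} {h : H}
    (hh : h ∈ ℋ n) : conv u v h ∈ ℬ (n + (r + s)) := by
  suffices e : (⨆ i : ℤ, Submodule.map₂ (TensorProduct.mk ℂ H H) (ℋ i) (ℋ (n - i))) ≤
      (ℬ (n + (r + s))).comap (LinearMap.mul' ℂ B ∘ₗ TensorProduct.map u v) from
    e (hH.comul_mem n h hh)
  refine iSup_le fun i => Submodule.map₂_le.2 fun x hx y hy => ?_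
  rw [Submodule.mem_comap, LinearMap.comp_apply, TensorProduct.mk_apply, TensorProduct.map_tmul,
    LinearMap.mul'_apply]
  have := SetLike.mul_mem_graded (hu i x hx) (hv (n - i) y hy)
  rwa [show i + r + (n - i + s) = n + (r + s) by ring] at this

/-- The value of a convolution product at a product `g h`, as a sum over the comultiplication
of `h`. -/
theorem conv_mul_apply (u v : H →ₗ[ℂ] B) (g h : H) (Γ : H ⊗[ℂ] H →ₗ[ℂ] B)
    (hΓ : ∀ n m : ℤ, ∀ x ∈ ℋ n, ∀ y ∈ ℋ m, Γ (x ⊗ₜ y) =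
      conv (u ∘ₗ LinearMap.mulRight ℂ x) (v ∘ₗ LinearMap.mulRight ℂ y ∘ₗ koszul ℋ n) g) :
    conv u v (g * h) = Γ (comul h) := by
  have key : ∀ n m : ℤ, ∀ x ∈ ℋ n, ∀ y ∈ ℋ m, ∀ t : H ⊗[ℂ] H,
      (GradedTensorProduct.of ℂ ℋ ℋ).symm (GradedTensorProduct.of ℂ ℋ ℋ t *
        GradedTensorProduct.of ℂ ℋ ℋ (x ⊗ₜ y)) =
      TensorProduct.map (LinearMap.mulRight ℂ x) (LinearMap.mulRight ℂ y ∘ₗ koszul ℋ n) t := by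
    intro n m x hx y hy t
    induction t with
    | zero => simp
    | add s t hs ht => rw [map_add, add_mul, map_add, hs, ht, map_add]
    | tmul p q =>
      induction q using DirectSum.Decomposition.inductionOn ℋ with
      | zero => simp
      | add q q' hq hq' => rw [TensorProduct.tmul_add, map_add, add_mul, map_add, hq, hq', map_add]
      | @homogeneous j q =>
        have := GradedTensorProduct.tmul_coe_mul_coe_tmul ℋ ℋ p q ⟨x, hx⟩ y
        rw [TensorProduct.map_tmul, LinearMap.comp_apply, koszul_of_mem ℋ n q.2]
        change (GradedTensorProduct.of ℂ ℋ ℋ).symm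
          (GradedTensorProduct.tmul ℂ p (q : H) * GradedTensorProduct.tmul ℂ x y) = _
        have hs : (-1 : ℤˣ) ^ (j * n) = (n * j).negOnePow := by
          rw [mul_comm, Int.negOnePow_def]
        rw [this, hs, Units.smul_def, map_zsmul, map_zsmul, TensorProduct.tmul_smul]
        rfl
  set s := GradedTensorProduct.of ℂ ℋ ℋ (comul g) with hs
  have e : (LinearMap.mul' ℂ B ∘ₗ TensorProduct.map u v) ∘ₗ
      (GradedTensorProduct.of ℂ ℋ ℋ).symm.toLinearMap ∘ₗ GradedTensorProduct.mulHom ℋ ℋ s ∘ₗ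
        (GradedTensorProduct.of ℂ ℋ ℋ).toLinearMap = Γ := by
    refine TensorProduct.ext (linearMap_ext_homogeneous ℋ fun n x hx =>
      linearMap_ext_homogeneous ℋ fun m y hy => ?_)
    change LinearMap.mul' ℂ B (TensorProduct.map u v ((GradedTensorProduct.of ℂ ℋ ℋ).symm
      (s * GradedTensorProduct.of ℂ ℋ ℋ (x ⊗ₜ y)))) = Γ (x ⊗ₜ y)
    rw [hΓ n m x hx y hy, hs, key n m x hx y hy, TensorProduct.map_map]
    rfl
  rw [← e, conv_apply, ← LinearEquiv.symm_apply_apply (GradedTensorProduct.of ℂ ℋ ℋ)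
    (comul (g * h)), hH.comul_mul]
  rfl

end Convolution

section Twist

open Coalgebra (comul counit)

variable {H : Type*} [Ring H] [Algebra ℂ H] [Coalgebra ℂ H] {ℋ : ℤ → Submodule ℂ H}
  [GradedAlgebra ℋ] {Ω : Type*} [Ring Ω] [Algebra ℂ Ω] {𝒜 : ℤ → Submodule ℂ Ω} [GradedAlgebra 𝒜]

variable (ℋ 𝒜) in
/-- `h ↦ (a ↦ ∑ (-1) ^ (deg h₁ deg a) f(h₀)(a) m(h₁))`. -/
def rightTwist (f : H →ₗ[ℂ] Ω →ₗ[ℂ] Ω) (m : H →ₗ[ℂ] Ω) : H →ₗ[ℂ] Ω →ₗ[ℂ] Ω :=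
  LinearMap.flip
    { toFun := fun a => ∑ s ∈ Finset.range 2, conv (f.flip (parityPart 𝒜 s a)) (m ∘ₗ koszul ℋ s)
      map_add' := fun a b => by simp only [map_add, add_conv, Finset.sum_add_distrib]
      map_smul' := fun c a => by simp only [map_smul, smul_conv, Finset.smul_sum,
        RingHom.id_apply] }

omit [GradedAlgebra 𝒜] [GradedAlgebra ℋ] in
/-- `h ↦ (a ↦ ∑ p(h₀) f(h₁)(a))`. -/
def leftTwist (p : H →ₗ[ℂ] Ω) (f : H →ₗ[ℂ] Ω →ₗ[ℂ] Ω) : H →ₗ[ℂ] Ω →ₗ[ℂ] Ω :=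
  LinearMap.flip
    { toFun := fun a => conv p (f.flip a)
      map_add' := fun a b => by simp only [map_add, conv_add]
      map_smul' := fun c a => by simp only [map_smul, conv_smul, RingHom.id_apply] }

theorem rightTwist_flip (f : H →ₗ[ℂ] Ω →ₗ[ℂ] Ω) (m : H →ₗ[ℂ] Ω) {i : ℤ} {a : Ω} (ha : a ∈ 𝒜 i) :
    (rightTwist ℋ 𝒜 f m).flip a = conv (f.flip a) (m ∘ₗ koszul ℋ i) := by
  change ∑ s ∈ Finset.range 2, conv (f.flip (parityPart 𝒜 s a)) (m ∘ₗ koszul ℋ s) = _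
  rw [sum_parityPart 𝒜 (fun s u => conv (f.flip u) (m ∘ₗ koszul ℋ s)) (fun s => ?_) ha,
    koszul_parity]
  rw [map_zero, ← zero_smul ℂ (0 : H →ₗ[ℂ] Ω), smul_conv, zero_smul, zero_smul]

theorem leftTwist_flip (p : H →ₗ[ℂ] Ω) (f : H →ₗ[ℂ] Ω →ₗ[ℂ] Ω) (a : Ω) :
    (leftTwist p f).flip a = conv p (f.flip a) := rfl

variable (ℋ 𝒜) in
/-- The maps `h ↦ (a ↦ ∑ (-1) ^ (deg h₂ deg a) p(h₀) π(h₁)(a) m(h₂))`. -/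
def twistedAct (π : H →ₗ[ℂ] Ω →ₗ[ℂ] Ω) (p m : H →ₗ[ℂ] Ω) : H →ₗ[ℂ] Ω →ₗ[ℂ] Ω :=
  leftTwist p (rightTwist ℋ 𝒜 π m)

theorem twist_flip (π : H →ₗ[ℂ] Ω →ₗ[ℂ] Ω) (p m : H →ₗ[ℂ] Ω) {i : ℤ} {a : Ω} (ha : a ∈ 𝒜 i) :
    (twistedAct ℋ 𝒜 π p m).flip a = conv p (conv (π.flip a) (m ∘ₗ koszul ℋ i)) := by
  rw [twistedAct, leftTwist_flip, rightTwist_flip π m ha]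

theorem IsTwist.eq_twist {π π' : H →ₗ[ℂ] Ω →ₗ[ℂ] Ω} {p m : H →ₗ[ℂ] Ω}
    (h : IsTwist ℋ 𝒜 π π' p m) : π' = twistedAct ℋ 𝒜 π p m := by
  refine LinearMap.ext fun x => linearMap_ext_homogeneous 𝒜 fun i a ha => ?_
  rw [h x i a ha, ← LinearMap.flip_apply (twistedAct ℋ 𝒜 π p m), twist_flip π p m ha, conv_apply]
  rw [← LinearMap.comp_apply (TensorProduct.map p _), ← TensorProduct.map_comp]
  rfl

variable {π : H →ₗ[ℂ] Ω →ₗ[ℂ] Ω} {dH S : H →ₗ[ℂ] H} {dΩ : Ω →ₗ[ℂ] Ω} {σ : H}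
  {p m r : H →ₗ[ℂ] Ω} (hH : IsDGHopfAlgebra ℋ dH S) (hπ : IsDGAction ℋ 𝒜 dH dΩ π)

include hπ in
omit [GradedAlgebra 𝒜] in
theorem IsDGAction.flip_one : π.flip 1 = convOne H Ω :=
  LinearMap.ext fun h => hπ.act_one h

include hπ in
omit [GradedAlgebra 𝒜] in
theorem IsDGAction.flip_mul {i : ℤ} {a : Ω} (ha : a ∈ 𝒜 i) (b : Ω) :
    π.flip (a * b) = conv (π.flip a) (π.flip b ∘ₗ koszul ℋ i) :=
  LinearMap.ext fun h => hπ.act_mul h i a ha b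

include hπ in
omit [GradedAlgebra 𝒜] in
theorem IsDGAction.flip_mulRight (h : H) (a : Ω) :
    π.flip a ∘ₗ LinearMap.mulRight ℂ h = π.flip (π h a) :=
  LinearMap.ext fun g => hπ.mul_act g h a

include hH hπ

/-- The Leibniz rule of a twisted action, which may involve two more twists. -/
theorem twist_flip_mul {p' m' : H →ₗ[ℂ] Ω} (hr : conv m p' = convOne H Ω) {i : ℤ} {a : Ω}
    (ha : a ∈ 𝒜 i) (b : Ω) : (twistedAct ℋ 𝒜 π p m').flip (a * b) =
      conv ((twistedAct ℋ 𝒜 π p m).flip a) ((twistedAct ℋ 𝒜 π p' m').flip b ∘ₗ koszul ℋ i) := by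
  suffices e : (twistedAct ℋ 𝒜 π p m').flip ∘ₗ LinearMap.mulLeft ℂ a =
      { toFun := fun b => conv ((twistedAct ℋ 𝒜 π p m).flip a)
          ((twistedAct ℋ 𝒜 π p' m').flip b ∘ₗ koszul ℋ i)
        map_add' := fun b c => by simp only [map_add, LinearMap.add_comp, conv_add]
        map_smul' := fun c b => by
          simp only [map_smul, LinearMap.smul_comp, conv_smul, RingHom.id_apply] } from
    LinearMap.congr_fun e b
  refine linearMap_ext_homogeneous 𝒜 fun j b hb => ?_
  change (twistedAct ℋ 𝒜 π p m').flip (a * b) =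
      conv ((twistedAct ℋ 𝒜 π p m).flip a) ((twistedAct ℋ 𝒜 π p' m').flip b ∘ₗ koszul ℋ i)
  have hm : conv (m ∘ₗ koszul ℋ i) (p' ∘ₗ koszul ℋ i) = convOne H Ω := by
    rw [← conv_koszul hH, hr, convOne_koszul hH]
  rw [twist_flip _ _ _ ha, twist_flip _ _ _ hb, twist_flip _ _ _ (SetLike.mul_mem_graded ha hb),
    hπ.flip_mul ha, conv_koszul hH, conv_koszul hH, LinearMap.comp_assoc, ← koszul_add,
    add_comm j i]
  simp only [conv_assoc]
  rw [← conv_assoc (m ∘ₗ koszul ℋ i), hm, convOne_conv]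

omit hH in
theorem twist_flip_one (hr : conv p m = convOne H Ω) :
    (twistedAct ℋ 𝒜 π p m).flip 1 = convOne H Ω := by
  rw [twist_flip _ _ _ (SetLike.one_mem_graded 𝒜), koszul_zero, LinearMap.comp_id, hπ.flip_one,
    convOne_conv, hr]

theorem rightTwist_flip_mul {i : ℤ} {a : Ω} (ha : a ∈ 𝒜 i) (b : Ω) :
    (rightTwist ℋ 𝒜 π m).flip (a * b) =
      conv (π.flip a) ((rightTwist ℋ 𝒜 π m).flip b ∘ₗ koszul ℋ i) := by
  suffices e : (rightTwist ℋ 𝒜 π m).flip ∘ₗ LinearMap.mulLeft ℂ a =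
      { toFun := fun b => conv (π.flip a) ((rightTwist ℋ 𝒜 π m).flip b ∘ₗ koszul ℋ i)
        map_add' := fun b c => by simp only [map_add, LinearMap.add_comp, conv_add]
        map_smul' := fun c b => by
          simp only [map_smul, LinearMap.smul_comp, conv_smul, RingHom.id_apply] } from
    LinearMap.congr_fun e b
  refine linearMap_ext_homogeneous 𝒜 fun j b hb => ?_
  change (rightTwist ℋ 𝒜 π m).flip (a * b) =
      conv (π.flip a) ((rightTwist ℋ 𝒜 π m).flip b ∘ₗ koszul ℋ i)
  rw [rightTwist_flip _ _ hb, rightTwist_flip _ _ (SetLike.mul_mem_graded ha hb),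
    hπ.flip_mul ha, conv_koszul hH, LinearMap.comp_assoc, ← koszul_add, add_comm j i, conv_assoc]

/-- The right twist of an action is compatible with products in the Hopf algebra. -/
theorem rightTwist_mul (hm : ∀ n, ∀ h ∈ ℋ n, m h ∈ 𝒜 n)
    (hmul : ∀ j, ∀ g ∈ ℋ j, m ∘ₗ LinearMap.mulRight ℂ g = conv (π.flip (m g)) (m ∘ₗ koszul ℋ j))
    (g h : H) (a : Ω) :
    rightTwist ℋ 𝒜 π m (g * h) a = rightTwist ℋ 𝒜 π m g (rightTwist ℋ 𝒜 π m h a) := by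
  suffices e : (rightTwist ℋ 𝒜 π m) (g * h) = rightTwist ℋ 𝒜 π m g ∘ₗ rightTwist ℋ 𝒜 π m h from
    LinearMap.congr_fun e a
  refine linearMap_ext_homogeneous 𝒜 fun i a ha => ?_
  have hf : ∀ x, rightTwist ℋ 𝒜 π m x a = conv (π.flip a) (m ∘ₗ koszul ℋ i) x := fun x =>
    LinearMap.congr_fun (rightTwist_flip π m ha) x
  rw [LinearMap.comp_apply, hf, hf]
  refine conv_mul_apply hH _ _ g h ((rightTwist ℋ 𝒜 π m g) ∘ₗ
    LinearMap.mul' ℂ Ω ∘ₗ TensorProduct.map (π.flip a) (m ∘ₗ koszul ℋ i)) fun n k x hx y hy => ?_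
  have hxa := hπ.act_mem n i x hx a ha
  have e : (m ∘ₗ koszul ℋ i) ∘ₗ LinearMap.mulRight ℂ y ∘ₗ koszul ℋ n =
      conv (π.flip (m (koszul ℋ i y)) ∘ₗ koszul ℋ (n + i)) (m ∘ₗ koszul ℋ (k + (n + i))) := by
    have : (m ∘ₗ koszul ℋ i) ∘ₗ LinearMap.mulRight ℂ y ∘ₗ koszul ℋ n =
        (m ∘ₗ LinearMap.mulRight ℂ (koszul ℋ i y)) ∘ₗ koszul ℋ (n + i) := by
      refine LinearMap.ext fun z => ?_
      simp only [LinearMap.comp_apply, LinearMap.mulRight_apply, koszul_mul, koszul_add]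
      rw [koszul_comm]
    rw [this, hmul k _ (koszul_mem ℋ i hy), conv_koszul hH, LinearMap.comp_assoc, ← koszul_add]
  have hmy := hm k _ (koszul_mem ℋ i hy)
  rw [e, hπ.flip_mulRight, ← conv_assoc, ← hπ.flip_mul hxa, add_comm k (n + i),
    ← rightTwist_flip π m (SetLike.mul_mem_graded hxa hmy)]
  rfl

theorem twist_mul (hm : ∀ n, ∀ h ∈ ℋ n, m h ∈ 𝒜 n) (hp : ∀ n, ∀ h ∈ ℋ n, p h ∈ 𝒜 n)
    (hmul : ∀ j, ∀ g ∈ ℋ j, m ∘ₗ LinearMap.mulRight ℂ g = conv (π.flip (m g)) (m ∘ₗ koszul ℋ j))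
    (hpul : ∀ g, p ∘ₗ LinearMap.mulRight ℂ g = conv p (π.flip (p g))) (g h : H) (a : Ω) :
    twistedAct ℋ 𝒜 π p m (g * h) a = twistedAct ℋ 𝒜 π p m g (twistedAct ℋ 𝒜 π p m h a) := by
  have hf : ∀ x, twistedAct ℋ 𝒜 π p m x a = conv p ((rightTwist ℋ 𝒜 π m).flip a) x := fun x => rfl
  rw [hf (g * h), hf h]
  refine conv_mul_apply hH _ _ g h ((twistedAct ℋ 𝒜 π p m g) ∘ₗ
    LinearMap.mul' ℂ Ω ∘ₗ TensorProduct.map p ((rightTwist ℋ 𝒜 π m).flip a)) fun n k x hx y hy => ?_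
  have e : (rightTwist ℋ 𝒜 π m).flip a ∘ₗ LinearMap.mulRight ℂ y =
      (rightTwist ℋ 𝒜 π m).flip (rightTwist ℋ 𝒜 π m y a) :=
    LinearMap.ext fun z => rightTwist_mul hH hπ hm hmul z y a
  rw [← LinearMap.comp_assoc (koszul ℋ n) (LinearMap.mulRight ℂ y), e, hpul, conv_assoc,
    ← rightTwist_flip_mul hH hπ (hp n x hx)]
  rfl

omit hπ in
theorem twist_mem (hm : ∀ n, ∀ h ∈ ℋ n, m h ∈ 𝒜 n) (hp : ∀ n, ∀ h ∈ ℋ n, p h ∈ 𝒜 n)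
    (hπ : ∀ n i, ∀ h ∈ ℋ n, ∀ a ∈ 𝒜 i, π h a ∈ 𝒜 (n + i)) {n i : ℤ} {h : H} (hh : h ∈ ℋ n) {a : Ω}
    (ha : a ∈ 𝒜 i) : twistedAct ℋ 𝒜 π p m h a ∈ 𝒜 (n + i) := by
  rw [← LinearMap.flip_apply (twistedAct ℋ 𝒜 π p m), twist_flip _ _ _ ha]
  have h2 : ∀ n, ∀ h ∈ ℋ n, conv (π.flip a) (m ∘ₗ koszul ℋ i) h ∈ 𝒜 (n + (i + 0)) :=
    fun n h hh => conv_mem hH (fun n h hh => hπ n i h hh a ha)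
      (fun n h hh => by rw [add_zero]; exact hm n _ (koszul_mem ℋ i hh)) hh
  have := conv_mem hH (r := 0) (fun n h hh => by rw [add_zero]; exact hp n h hh) h2 hh
  rwa [add_zero, zero_add] at this

theorem d_twist (hΩ : IsDGAlgebra 𝒜 dΩ) (hp : ∀ n, ∀ h ∈ ℋ n, p h ∈ 𝒜 n)
    (hmd : ∀ h, m (dH h) = dΩ (m h)) (hpd : ∀ h, p (dH h) = dΩ (p h)) (h : H) (a : Ω) :
    dΩ (twistedAct ℋ 𝒜 π p m h a) =
      twistedAct ℋ 𝒜 π p m (dH h) a + twistedAct ℋ 𝒜 π p m (koszul ℋ 1 h) (dΩ a) := by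
  suffices e : dΩ ∘ₗ twistedAct ℋ 𝒜 π p m h =
      twistedAct ℋ 𝒜 π p m (dH h) + twistedAct ℋ 𝒜 π p m (koszul ℋ 1 h) ∘ₗ dΩ from
    LinearMap.congr_fun e a
  refine linearMap_ext_homogeneous 𝒜 fun i a ha => ?_
  have hda := hΩ.d_mem i a ha
  set v : H →ₗ[ℂ] Ω := conv (π.flip a) (m ∘ₗ koszul ℋ i) with hv
  set v' : H →ₗ[ℂ] Ω := conv (π.flip (dΩ a)) (m ∘ₗ koszul ℋ (i + 1)) with hv'
  have hd : ∀ (u w : H →ₗ[ℂ] Ω) (x : H), conv u w (dH x) =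
      conv (u ∘ₗ dH) w x + conv (u ∘ₗ koszul ℋ 1) (w ∘ₗ dH) x := fun u w x => by
    rw [conv_apply, hH.comul_d, map_add, map_add, TensorProduct.map_map, TensorProduct.map_map]
    rfl
  have hdc : ∀ (u w : H →ₗ[ℂ] Ω) (x : H), dΩ (conv u w x) =
      conv (dΩ ∘ₗ u) w x + conv (koszul 𝒜 1 ∘ₗ u) (dΩ ∘ₗ w) x := fun u w x => by
    suffices e : dΩ ∘ₗ LinearMap.mul' ℂ Ω ∘ₗ TensorProduct.map u w =
        LinearMap.mul' ℂ Ω ∘ₗ TensorProduct.map (dΩ ∘ₗ u) w +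
          LinearMap.mul' ℂ Ω ∘ₗ TensorProduct.map (koszul 𝒜 1 ∘ₗ u) (dΩ ∘ₗ w) from
      LinearMap.congr_fun e (comul x)
    exact TensorProduct.ext' fun y z => by simp [hΩ.d_mul 𝒜]
  have h1 : dΩ ∘ₗ π.flip a = π.flip a ∘ₗ dH + π.flip (dΩ a) ∘ₗ koszul ℋ 1 :=
    LinearMap.ext fun x => hπ.d_act' x a
  have h2 : koszul 𝒜 1 ∘ₗ π.flip a = (((i.negOnePow : ℤ) : ℂ)) • (π.flip a ∘ₗ koszul ℋ 1) :=
    LinearMap.ext fun x => by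
      rw [LinearMap.comp_apply, LinearMap.flip_apply, hπ.koszul_act, koszul_of_mem 𝒜 1 ha, one_mul,
        map_zsmul, LinearMap.smul_apply, Int.cast_smul_eq_zsmul]
      rfl
  have h3 : dΩ ∘ₗ m ∘ₗ koszul ℋ i = (((i.negOnePow : ℤ) : ℂ)) • ((m ∘ₗ koszul ℋ i) ∘ₗ dH) :=
    LinearMap.ext fun x => by
      rw [LinearMap.comp_apply, LinearMap.comp_apply, ← hmd, hH.isDGAlgebra.d_koszul ℋ, map_zsmul,
        LinearMap.smul_apply, Int.cast_smul_eq_zsmul]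
      rfl
  have hdv : dΩ ∘ₗ v = v ∘ₗ dH + v' ∘ₗ koszul ℋ 1 := by
    refine LinearMap.ext fun x => ?_
    rw [LinearMap.comp_apply, LinearMap.add_apply, LinearMap.comp_apply, hv, hdc, hd, hv',
      conv_koszul hH, h1, h2, h3, add_conv, smul_conv, conv_smul, smul_smul, ← Int.cast_mul,
      Int.units_coe_mul_self, Int.cast_one, one_smul, LinearMap.add_apply,
      LinearMap.comp_assoc (koszul ℋ 1) (koszul ℋ (i + 1)) m, ← koszul_add, add_assoc i,
      koszul_add, koszul_of_even ℋ (i := 1 + 1) ⟨1, rfl⟩, LinearMap.comp_id]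
    abel
  have hpk : koszul 𝒜 1 ∘ₗ p = p ∘ₗ koszul ℋ 1 := by
    refine linearMap_ext_homogeneous ℋ fun n x hx => ?_
    rw [LinearMap.comp_apply, LinearMap.comp_apply, koszul_of_mem ℋ 1 hx,
      koszul_of_mem 𝒜 1 (hp n x hx), map_zsmul]
  have hf : ∀ x, twistedAct ℋ 𝒜 π p m x a = conv p v x := fun x =>
    LinearMap.congr_fun (twist_flip π p m ha) x
  have hf' : ∀ x, twistedAct ℋ 𝒜 π p m x (dΩ a) = conv p v' x := fun x =>
    LinearMap.congr_fun (twist_flip π p m hda) x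
  rw [LinearMap.comp_apply, LinearMap.add_apply, LinearMap.comp_apply, hf, hf, hf', hdc, hd, hdv,
    hpk, show dΩ ∘ₗ p = p ∘ₗ dH from LinearMap.ext fun x => (hpd x).symm,
    ← LinearMap.comp_apply (conv p v'), conv_koszul hH p v', conv_add, LinearMap.add_apply]
  abel

end Twist

/-! ### Invariance of functionals under an action -/

section Invariance

open Coalgebra (comul counit)

variable {H : Type*} [Ring H] [Algebra ℂ H] [Coalgebra ℂ H] {ℋ : ℤ → Submodule ℂ H}
  [GradedAlgebra ℋ] {Ω : Type*} [Ring Ω] [Algebra ℂ Ω] {𝒜 : ℤ → Submodule ℂ Ω} [GradedAlgebra 𝒜]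
  {π : H →ₗ[ℂ] Ω →ₗ[ℂ] Ω} {dH S : H →ₗ[ℂ] H} {dΩ : Ω →ₗ[ℂ] Ω} {δ : H →ₐ[ℂ] ℂ} {σ : H}
  {T : Ω →ₗ[ℂ] ℂ} (hH : IsDGHopfAlgebra ℋ dH S) (hδσ : IsModularPair ℋ dH S δ σ)
include hH

theorem counit_antipode (h : H) : counit (R := ℂ) (S h) = counit (R := ℂ) h := by
  have h1 : convOne H ℂ = counit := LinearMap.ext fun x => rfl
  have h2 : conv (counit (R := ℂ)) (counit (R := ℂ) ∘ₗ S) h = counit (R := ℂ) h := by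
    have := conv_congr (u := counit (R := ℂ) (A := H)) (v := counit (R := ℂ) ∘ₗ S)
      (u' := LinearMap.id) (v' := S) (LinearMap.id : ℂ →ₗ[ℂ] ℂ) (counit (R := ℂ) (A := H))
      (fun x y => (hH.counit_mul _ _).symm) h
    rw [LinearMap.id_apply] at this
    rw [this, conv_apply, hH.antipode_right, Algebra.algebraMap_eq_smul_one, map_smul,
      hH.counit_one, smul_eq_mul, mul_one]
  rwa [← h1, convOne_conv, h1] at h2

theorem counit_twistedAntipode (h : H) : counit (R := ℂ) (twistedAntipode S δ h) = δ h := by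
  have h1 : convOne H ℂ = counit := LinearMap.ext fun x => rfl
  suffices e : counit (R := ℂ) ∘ₗ (TensorProduct.lid ℂ H).toLinearMap ∘ₗ
      TensorProduct.map δ.toLinearMap S =
        LinearMap.mul' ℂ ℂ ∘ₗ TensorProduct.map δ.toLinearMap counit by
    have h2 := LinearMap.congr_fun (conv_convOne δ.toLinearMap) h
    rw [h1] at h2
    exact (LinearMap.congr_fun e (comul h)).trans h2
  exact TensorProduct.ext' fun x y => by simp [counit_antipode hH]

include hδσ

omit hH in
theorem IsModularPair.char_koszul (i : ℤ) (h : H) : δ (koszul ℋ i h) = δ h := by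
  suffices e : δ.toLinearMap ∘ₗ koszul ℋ i = δ.toLinearMap from LinearMap.congr_fun e h
  refine linearMap_ext_homogeneous ℋ fun n h hh => ?_
  rw [LinearMap.comp_apply, koszul_of_mem ℋ i hh, map_zsmul]
  by_cases hn : n = 0
  · rw [hn, mul_zero, Int.negOnePow_zero, Units.val_one, one_smul]
  · rw [AlgHom.toLinearMap_apply, hδσ.char_of_ne n hn h hh, smul_zero]

/-- A `δ`-invariant functional is an eigenvector for the action. -/
theorem IsInvariantTrace.apply_act (hT : IsInvariantTrace ℋ 𝒜 S δ σ π T)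
    (h1 : π.flip 1 = convOne H Ω) (h : H) (a : Ω) : T (π h a) = δ h * T a := by
  suffices e : T ∘ₗ π h = δ h • T from LinearMap.congr_fun e a
  refine linearMap_ext_homogeneous 𝒜 fun i a ha => ?_
  have := hT.invariant' ha h 1
  rw [← LinearMap.flip_apply π, ← LinearMap.flip_apply π, h1, convOne_apply,
    counit_twistedAntipode hH, hδσ.char_koszul, mul_one, ← Algebra.commutes, ← Algebra.smul_def,
    map_smul] at this
  exact this

omit [GradedAlgebra 𝒜] in
/-- A functional that is an eigenvector for the action, with eigenvalue `δ`, is `δ`-invariant. -/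
theorem IsDGAction.invariant_of_apply_act (hπ : IsDGAction ℋ 𝒜 dH dΩ π)
    (hT : ∀ h a, T (π h a) = δ h * T a) {i : ℤ} {a : Ω} (ha : a ∈ 𝒜 i) (h : H) (b : Ω) :
    T (π h a * b) = T (a * π (twistedAntipode S δ (koszul ℋ i h)) b) := by
  -- All products are taken in the convolution algebra of the maps from `H` to the endomorphisms
  -- of `Ω`, where `Λ` is the map `h ↦ (c ↦ π h a * c)` and `l` is the map `h ↦ (c ↦ ε h • (a * c))`.
  let P : H →ₗ[ℂ] Module.End ℂ Ω := π
  let Q : H →ₗ[ℂ] Module.End ℂ Ω := π ∘ₗ S ∘ₗ koszul ℋ i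
  let Λ : H →ₗ[ℂ] Module.End ℂ Ω := LinearMap.mul ℂ Ω ∘ₗ π.flip a
  let l : H →ₗ[ℂ] Module.End ℂ Ω := (counit (R := ℂ)).smulRight (LinearMap.mulLeft ℂ a)
  -- The Leibniz rule for `π h (a * c)`.
  have hA : conv P l = conv Λ (P ∘ₗ koszul ℋ i) := by
    refine LinearMap.ext fun x => LinearMap.ext fun c => ?_
    have e1 : conv P l x = P x * LinearMap.mulLeft ℂ a := by
      have := conv_congr (u := P) (v := l) (u' := P) (v' := convOne H _) LinearMap.id
        (LinearMap.mulRight ℂ (LinearMap.mulLeft ℂ a)) (fun x y => by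
          change P x * (counit (R := ℂ) y • LinearMap.mulLeft ℂ a) =
            P x * (algebraMap ℂ (Module.End ℂ Ω) (counit y)) * LinearMap.mulLeft ℂ a
          rw [mul_assoc, ← Algebra.smul_def]) x
      rw [conv_convOne] at this
      exact this
    have e2 := conv_congr (u := Λ) (v := P ∘ₗ koszul ℋ i) (u' := π.flip a)
      (v' := π.flip c ∘ₗ koszul ℋ i) (LinearMap.applyₗ c) LinearMap.id (fun x y => rfl) x
    refine Eq.trans ?_ (hπ.act_mul x i a ha c |>.trans e2.symm)
    rw [e1]
    rfl
  -- The defining property of the antipode.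
  have hB : conv (P ∘ₗ koszul ℋ i) Q = convOne H _ := by
    refine LinearMap.ext fun x => ?_
    have := conv_congr (u := P ∘ₗ koszul ℋ i) (v := Q) (u' := koszul ℋ i)
      (v' := S ∘ₗ koszul ℋ i) LinearMap.id P (fun x y => LinearMap.ext fun c => by
        simp only [LinearMap.id_apply, LinearMap.comp_apply]
        exact (hπ.mul_act _ _ c).symm) x
    rw [LinearMap.id_apply] at this
    have h2 : conv (koszul ℋ i) (S ∘ₗ koszul ℋ i) x = algebraMap ℂ H (counit x) := by
      have := LinearMap.congr_fun (conv_koszul hH LinearMap.id S i) x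
      rw [LinearMap.comp_apply, conv_apply, hH.antipode_right, counit_koszul hH] at this
      exact this.symm
    rw [this, h2, Algebra.algebraMap_eq_smul_one, map_smul, convOne_apply,
      Algebra.algebraMap_eq_smul_one]
    exact congrArg _ (LinearMap.ext hπ.one_act)
  -- Therefore `π h a * c` is the sum of the elements `π h₀ (a * π (S h₁) c)`, up to signs.
  have hC : Λ = conv P (conv l Q) := by
    rw [← conv_assoc, hA, conv_assoc, hB, conv_convOne]
  have e3 : conv l Q = (LinearMap.mulLeft ℂ (LinearMap.mulLeft ℂ a : Module.End ℂ Ω)) ∘ₗ Q := by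
    refine LinearMap.ext fun x => ?_
    have := conv_congr (u := l) (v := Q) (u' := convOne H _) (v' := Q) LinearMap.id
      (LinearMap.mulLeft ℂ (LinearMap.mulLeft ℂ a : Module.End ℂ Ω)) (fun x y => by
        change (counit (R := ℂ) x • LinearMap.mulLeft ℂ a : Module.End ℂ Ω) * Q y =
          LinearMap.mulLeft ℂ a * (algebraMap ℂ (Module.End ℂ Ω) (counit x) * Q y)
        rw [← Algebra.smul_def, smul_mul_assoc, mul_smul_comm]) x
    rw [convOne_conv] at this
    exact this
  -- The functional turns the outer action of `h₀` into the factor `δ h₀`.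
  have e4 : (T ∘ₗ LinearMap.applyₗ b) ∘ₗ LinearMap.mul' ℂ (Module.End ℂ Ω) ∘ₗ
      TensorProduct.map P (conv l Q) = (T ∘ₗ LinearMap.mulLeft ℂ a ∘ₗ π.flip b) ∘ₗ
        (TensorProduct.lid ℂ H).toLinearMap ∘ₗ
          TensorProduct.map δ.toLinearMap (S ∘ₗ koszul ℋ i) := TensorProduct.ext' fun x y => by
    rw [e3]
    simp only [LinearMap.comp_apply, TensorProduct.map_tmul, LinearMap.mul'_apply,
      LinearEquiv.coe_coe, TensorProduct.lid_tmul, map_smul, smul_eq_mul]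
    exact hT x _
  have e5 : twistedAntipode S δ (koszul ℋ i h) = (TensorProduct.lid ℂ H)
      (TensorProduct.map δ.toLinearMap (S ∘ₗ koszul ℋ i) (comul h)) := by
    have hδ : δ.toLinearMap ∘ₗ koszul ℋ i = δ.toLinearMap :=
      LinearMap.ext fun x => hδσ.char_koszul i x
    change TensorProduct.lid ℂ H (TensorProduct.map δ.toLinearMap S (comul (koszul ℋ i h))) = _
    rw [comul_koszul hH, TensorProduct.map_map, hδ]
  rw [e5]
  refine Eq.trans ?_ (LinearMap.congr_fun e4 (comul h))
  change T (Λ h b) = T (conv P (conv l Q) h b)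
  rw [← hC]

/-- The units of the convolution algebra form a cocycle pair. -/
theorem isCocyclePair_convOne (hπ : IsDGAction ℋ 𝒜 dH dΩ π) (hΩ : IsDGAlgebra 𝒜 dΩ) :
    IsCocyclePair ℋ 𝒜 dH dΩ σ π (convOne H Ω) (convOne H Ω) := by
  have hm : ∀ n, ∀ h ∈ ℋ n, convOne H Ω h ∈ 𝒜 n := fun n h hh => by
    rw [convOne_apply]
    by_cases hn : n = 0
    · subst hn
      exact SetLike.algebraMap_mem_graded 𝒜 _
    · rw [hH.counit_of_ne n hn h hh, map_zero]
      exact Submodule.zero_mem _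
  have hd : ∀ h, convOne H Ω (dH h) = dΩ (convOne H Ω h) := fun h => by
    rw [convOne_apply, convOne_apply, hH.counit_d, map_zero, Algebra.algebraMap_eq_smul_one,
      map_smul, hΩ.d_one, smul_zero]
  have h1 : convOne H Ω 1 = 1 := by rw [convOne_apply, hH.counit_one, map_one]
  have hs : convOne H Ω σ = 1 := by
    rw [convOne_apply, hδσ.groupLike.counit_eq_one, map_one]
  have hmul : ∀ h, π.flip (convOne H Ω h) = counit (R := ℂ) h • convOne H Ω := fun h => by
    rw [convOne_apply, Algebra.algebraMap_eq_smul_one, map_smul, hπ.flip_one]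
  have hg : ∀ g h, convOne H Ω (h * g) = counit (R := ℂ) g • convOne H Ω h := fun g h => by
    rw [convOne_apply, hH.counit_mul, mul_comm, map_mul, ← Algebra.smul_def]
    rfl
  refine ⟨hm, hm, hd, hd, ?_, ?_, ?_, ?_, h1, h1, hs, hs⟩
  · exact fun h => LinearMap.congr_fun (convOne_conv (convOne H Ω)) h
  · exact fun h => LinearMap.congr_fun (convOne_conv (convOne H Ω)) h
  · intro h g
    rw [hmul, hg, ← conv_apply, conv_smul, conv_convOne]
    rfl
  · intro h j g _
    rw [hmul, hg, convOne_koszul hH, ← conv_apply, smul_conv, conv_convOne]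
    rfl

omit hδσ in
theorem twistedAct_convOne (h : H) (a : Ω) :
    twistedAct ℋ 𝒜 π (convOne H Ω) (convOne H Ω) h a = π h a := by
  suffices e : (twistedAct ℋ 𝒜 π (convOne H Ω) (convOne H Ω)).flip = π.flip from
    LinearMap.congr_fun₂ e a h
  refine linearMap_ext_homogeneous 𝒜 fun i a ha => ?_
  rw [twist_flip _ _ _ ha, convOne_koszul hH, convOne_conv, conv_convOne]

end Invariance

/-! ### Matrices over a DG algebra -/

section Matrices

variable {Ω : Type*} [Ring Ω] [Algebra ℂ Ω] (𝒜 : ℤ → Submodule ℂ Ω) [GradedAlgebra 𝒜]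
  (ι : Type*) [Fintype ι] [DecidableEq ι]

omit [GradedAlgebra 𝒜] [Fintype ι] [DecidableEq ι] in
/-- The grading of the algebra of matrices over a graded algebra by the degrees of the entries. -/
def matGrading (n : ℤ) : Submodule ℂ (Matrix ι ι Ω) where
  carrier := {m | ∀ i j, m i j ∈ 𝒜 n}
  zero_mem' _ _ := Submodule.zero_mem _
  add_mem' hm hm' i j := Submodule.add_mem _ (hm i j) (hm' i j)
  smul_mem' c _ hm i j := Submodule.smul_mem _ c (hm i j)

variable {𝒜 ι}

omit [GradedAlgebra 𝒜] [Fintype ι] in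
theorem single_mem_matGrading {n : ℤ} (i j : ι) {a : Ω} (ha : a ∈ 𝒜 n) :
    Matrix.single i j a ∈ matGrading 𝒜 ι n := fun i' j' => by
  rw [Matrix.single_apply]
  split_ifs
  · exact ha
  · exact Submodule.zero_mem _

variable (𝒜 ι) in
/-- The homogeneous components of a matrix with a single nonzero entry. -/
def decomposeSingle (i j : ι) : (⨁ n, 𝒜 n) →ₗ[ℂ] ⨁ n, matGrading 𝒜 ι n :=
  DirectSum.toModule ℂ ℤ _ fun n => DirectSum.lof ℂ ℤ (fun n => matGrading 𝒜 ι n) n ∘ₗ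
    LinearMap.restrict (Matrix.singleLinearMap ℂ i j) fun _ ha => single_mem_matGrading i j ha

instance : GradedAlgebra (matGrading 𝒜 ι) where
  one_mem i j := by
    rw [Matrix.one_apply]
    split_ifs
    · exact SetLike.one_mem_graded 𝒜
    · exact Submodule.zero_mem _
  mul_mem n n' m m' hm hm' i j := by
    rw [Matrix.mul_apply]
    exact Submodule.sum_mem _ fun k _ => SetLike.mul_mem_graded (hm i k) (hm' k j)
  decompose' m := ∑ i, ∑ j, decomposeSingle 𝒜 ι i j (DirectSum.decompose 𝒜 (m i j))
  left_inv m := by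
    have e : ∀ i j, (DirectSum.coeLinearMap (matGrading 𝒜 ι)) ∘ₗ decomposeSingle 𝒜 ι i j =
        (Matrix.singleLinearMap ℂ i j) ∘ₗ DirectSum.coeLinearMap 𝒜 := fun i j =>
      DirectSum.linearMap_ext ℂ fun n => LinearMap.ext fun a => by
        simp [decomposeSingle]
        rfl
    have e' : ∀ i j, DirectSum.coeAddMonoidHom (matGrading 𝒜 ι)
        (decomposeSingle 𝒜 ι i j (DirectSum.decompose 𝒜 (m i j))) = Matrix.single i j (m i j) := by
      intro i j
      refine (LinearMap.congr_fun (e i j) _).trans ?_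
      change Matrix.single i j (DirectSum.coeAddMonoidHom 𝒜 (DirectSum.decompose 𝒜 (m i j))) = _
      exact congrArg _ (DirectSum.Decomposition.left_inv (m i j))
    rw [map_sum]
    simp only [map_sum, e']
    exact (Matrix.matrix_eq_sum_single m).symm
  right_inv x := by
    induction x using DirectSum.induction_on with
    | zero => simp
    | add x y hx hy =>
      rw [map_add]
      simp only [Matrix.add_apply, DirectSum.decompose_add, map_add, Finset.sum_add_distrib, hx, hy]
    | of n m =>
      obtain ⟨m, hm⟩ := m
      rw [DirectSum.coeAddMonoidHom_of]
      have e : ∀ i j, decomposeSingle 𝒜 ι i j (DirectSum.decompose 𝒜 (m i j)) =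
          DirectSum.lof ℂ ℤ (fun n => matGrading 𝒜 ι n) n
            ⟨Matrix.single i j (m i j), single_mem_matGrading i j (hm i j)⟩ := fun i j => by
        rw [DirectSum.decompose_of_mem 𝒜 (hm i j)]
        exact DirectSum.toModule_lof ℂ n _
      simp only [e, ← map_sum]
      refine congrArg (DirectSum.lof ℂ ℤ (fun n => matGrading 𝒜 ι n) n) (Subtype.ext ?_)
      simp only [AddSubmonoidClass.coe_finsetSum]
      exact (Matrix.matrix_eq_sum_single m).symm

theorem matrix_koszul_apply (n : ℤ) (m : Matrix ι ι Ω) (i j : ι) :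
    koszul (matGrading 𝒜 ι) n m i j = koszul 𝒜 n (m i j) := by
  suffices e : Matrix.entryLinearMap ℂ Ω i j ∘ₗ koszul (matGrading 𝒜 ι) n =
      koszul 𝒜 n ∘ₗ Matrix.entryLinearMap ℂ Ω i j from LinearMap.congr_fun e m
  refine linearMap_ext_homogeneous (matGrading 𝒜 ι) fun k m hm => ?_
  rw [LinearMap.comp_apply, LinearMap.comp_apply, koszul_of_mem _ n hm,
    Matrix.entryLinearMap_apply, Matrix.entryLinearMap_apply, koszul_of_mem 𝒜 n (hm i j)]
  rfl

omit [GradedAlgebra 𝒜] in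
theorem isDGAlgebra_matrix {d : Ω →ₗ[ℂ] Ω} (hd : IsDGAlgebra 𝒜 d) :
    IsDGAlgebra (matGrading 𝒜 ι) (d.mapMatrix : Matrix ι ι Ω →ₗ[ℂ] Matrix ι ι Ω) where
  d_mem n m hm i j := hd.d_mem n _ (hm i j)
  d_d m := by
    ext i j
    exact hd.d_d _
  leibniz n m hm m' := by
    ext i j
    simp only [LinearMap.mapMatrix_apply, Matrix.map_apply, Matrix.mul_apply, map_sum,
      hd.leibniz n _ (hm i _), Finset.sum_add_distrib, Matrix.add_apply, Matrix.smul_apply,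
      Finset.smul_sum]

end Matrices

section MatrixAction

open Coalgebra (comul counit)

variable {H : Type*} [Ring H] [Algebra ℂ H] [Coalgebra ℂ H] {ℋ : ℤ → Submodule ℂ H}
  [GradedAlgebra ℋ] {Ω : Type*} [Ring Ω] [Algebra ℂ Ω] {𝒜 : ℤ → Submodule ℂ Ω} [GradedAlgebra 𝒜]
  {ι : Type*} [Fintype ι] [DecidableEq ι] {π : H →ₗ[ℂ] Ω →ₗ[ℂ] Ω} {dH S : H →ₗ[ℂ] H}
  {dΩ : Ω →ₗ[ℂ] Ω} {δ : H →ₐ[ℂ] ℂ} {σ : H} {T : Ω →ₗ[ℂ] ℂ} {P Q : ι → H →ₗ[ℂ] Ω}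

variable (ℋ 𝒜) in
/-- The action on matrices that is twisted by `P i` on the left in the row `i` and by `Q j` on the
right in the column `j`. -/
def matrixAct (π : H →ₗ[ℂ] Ω →ₗ[ℂ] Ω) (P Q : ι → H →ₗ[ℂ] Ω) :
    H →ₗ[ℂ] Matrix ι ι Ω →ₗ[ℂ] Matrix ι ι Ω :=
  LinearMap.mk₂ ℂ (fun h m => Matrix.of fun i j => twistedAct ℋ 𝒜 π (P i) (Q j) h (m i j))
    (fun _ _ _ => by ext; simp) (fun _ _ _ => by ext; simp) (fun _ _ _ => by ext; simp)
    (fun _ _ _ => by ext; simp)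

omit [Fintype ι] [DecidableEq ι] in
theorem matrixAct_apply (h : H) (m : Matrix ι ι Ω) (i j : ι) :
    matrixAct ℋ 𝒜 π P Q h m i j = twistedAct ℋ 𝒜 π (P i) (Q j) h (m i j) := rfl

theorem conv_matrix_apply (u v : H →ₗ[ℂ] Matrix ι ι Ω) (h : H) (i j : ι) :
    conv u v h i j = ∑ k, conv (Matrix.entryLinearMap ℂ Ω i k ∘ₗ u)
      (Matrix.entryLinearMap ℂ Ω k j ∘ₗ v) h := by
  suffices e : Matrix.entryLinearMap ℂ Ω i j ∘ₗ LinearMap.mul' ℂ (Matrix ι ι Ω) ∘ₗ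
      TensorProduct.map u v = ∑ k, LinearMap.mul' ℂ Ω ∘ₗ TensorProduct.map
        (Matrix.entryLinearMap ℂ Ω i k ∘ₗ u) (Matrix.entryLinearMap ℂ Ω k j ∘ₗ v) by
    have := LinearMap.congr_fun e (comul h)
    rw [LinearMap.sum_apply] at this
    exact this
  exact TensorProduct.ext' fun x y => by simp [Matrix.mul_apply]

variable (hH : IsDGHopfAlgebra ℋ dH S) (hπ : IsDGAction ℋ 𝒜 dH dΩ π)
  (hPQ : ∀ i, IsCocyclePair ℋ 𝒜 dH dΩ σ π (P i) (Q i))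
include hH hπ hPQ

omit hPQ in
theorem twistedAct_one {p m : H →ₗ[ℂ] Ω} (hp : p 1 = 1) (hm : m 1 = 1) (a : Ω) :
    twistedAct ℋ 𝒜 π p m 1 a = a := by
  suffices e : twistedAct ℋ 𝒜 π p m 1 = LinearMap.id from LinearMap.congr_fun e _
  refine linearMap_ext_homogeneous 𝒜 fun n a ha => ?_
  rw [← LinearMap.flip_apply, twist_flip _ _ _ ha, conv_one hH, conv_one hH,
    LinearMap.comp_apply, koszul_one, hp, hm, one_mul, mul_one]
  exact hπ.one_act a

omit hPQ in
/-- A twisted action is an action. -/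
theorem twistedAct_isDGAction {p m : H →ₗ[ℂ] Ω} (hpm : IsCocyclePair ℋ 𝒜 dH dΩ σ π p m)
    (hΩ : IsDGAlgebra 𝒜 dΩ) : IsDGAction ℋ 𝒜 dH dΩ (twistedAct ℋ 𝒜 π p m) where
  one_act a := twistedAct_one hH hπ hpm.plus_one hpm.minus_one a
  mul_act g h a := twist_mul hH hπ hpm.minus_mem hpm.plus_mem
    (fun n x hx => LinearMap.ext fun y => hpm.minus_mul y n x hx)
    (fun x => LinearMap.ext fun y => hpm.plus_mul y x) g h _
  act_one h := LinearMap.congr_fun (twist_flip_one hπ (LinearMap.ext hpm.plus_minus)) h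
  act_mul h n a ha b := LinearMap.congr_fun
    (twist_flip_mul hH hπ (LinearMap.ext hpm.minus_plus) ha b) h
  act_mem n k h hh a ha := twist_mem hH hpm.minus_mem hpm.plus_mem hπ.act_mem hh ha
  d_act n h hh a := by
    refine (d_twist hH hπ hΩ hpm.plus_mem hpm.minus_d hpm.plus_d h a).trans ?_
    rw [koszul_of_mem ℋ 1 hh, one_mul, map_zsmul]
    rfl

/-- The twisted action on matrices is an action. -/
theorem matrixAct_isDGAction (hΩ : IsDGAlgebra 𝒜 dΩ) :
    IsDGAction ℋ (matGrading 𝒜 ι) dH dΩ.mapMatrix (matrixAct ℋ 𝒜 π P Q) where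
  one_act m := by
    ext i j
    exact twistedAct_one hH hπ (hPQ i).plus_one (hPQ j).minus_one _
  mul_act g h m := by
    ext i j
    exact twist_mul hH hπ (hPQ j).minus_mem (hPQ i).plus_mem
      (fun n x hx => LinearMap.ext fun y => (hPQ j).minus_mul y n x hx)
      (fun x => LinearMap.ext fun y => (hPQ i).plus_mul y x) g h _
  act_one h := by
    ext i j
    rw [matrixAct_apply, Matrix.algebraMap_matrix_apply, Matrix.one_apply]
    split_ifs with hij
    · subst hij
      exact LinearMap.congr_fun (twist_flip_one hπ (LinearMap.ext (hPQ i).plus_minus)) h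
    · rw [map_zero]
  act_mul h n a ha b := by
    ext i j
    rw [← conv_apply, conv_matrix_apply, matrixAct_apply, Matrix.mul_apply, map_sum]
    refine Finset.sum_congr rfl fun k _ => ?_
    exact LinearMap.congr_fun
      (twist_flip_mul hH hπ (LinearMap.ext (hPQ k).minus_plus) (ha i k) (b k j)) h
  act_mem n k h hh a ha i j :=
    twist_mem hH (hPQ j).minus_mem (hPQ i).plus_mem hπ.act_mem hh (ha i j)
  d_act n h hh a := by
    ext i j
    refine (d_twist hH hπ hΩ (hPQ i).plus_mem (hPQ j).minus_d (hPQ i).plus_d h (a i j)).trans ?_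
    rw [koszul_of_mem ℋ 1 hh, one_mul, map_zsmul]
    rfl

variable (T ι) in
omit hH hπ hPQ in
/-- The composition of a functional with the trace of matrices. -/
def traceFunctional : Matrix ι ι Ω →ₗ[ℂ] ℂ := T ∘ₗ Matrix.traceLinearMap ι ℂ Ω

omit [DecidableEq ι] hH hπ hPQ in
theorem traceFunctional_apply (m : Matrix ι ι Ω) : traceFunctional ι T m = ∑ i, T (m i i) := by
  rw [traceFunctional, LinearMap.comp_apply, Matrix.traceLinearMap_apply, Matrix.trace, map_sum]
  rfl

omit [Fintype ι] [DecidableEq ι] hH hπ in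
theorem twistedAct_sigma (hδσ : IsModularPair ℋ dH S δ σ) (i j : ι) (a : Ω) :
    twistedAct ℋ 𝒜 π (P i) (Q j) σ a = π σ a := by
  suffices e : twistedAct ℋ 𝒜 π (P i) (Q j) σ = π σ from LinearMap.congr_fun e _
  refine linearMap_ext_homogeneous 𝒜 fun n a ha => ?_
  rw [← LinearMap.flip_apply, twist_flip _ _ _ ha, conv_apply, hδσ.groupLike.comul_eq_tmul_self,
    TensorProduct.map_tmul, LinearMap.mul'_apply, conv_apply, hδσ.groupLike.comul_eq_tmul_self,
    TensorProduct.map_tmul, LinearMap.mul'_apply, (hPQ i).plus_sigma, LinearMap.comp_apply,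
    koszul_of_mem ℋ n hδσ.mem_zero, mul_zero, Int.negOnePow_zero, Units.val_one, one_smul,
    (hPQ j).minus_sigma, one_mul, mul_one, LinearMap.flip_apply]

/-- If a functional is an invariant trace for the twists of an action, then its composition with
the trace of matrices is an invariant trace for the twisted action on matrices. -/
theorem traceFunctional_isInvariantTrace (hδσ : IsModularPair ℋ dH S δ σ)
    (hΩ : IsDGAlgebra 𝒜 dΩ) (hTπ : IsInvariantTrace ℋ 𝒜 S δ σ π T)
    (hT : ∀ i, IsInvariantTrace ℋ 𝒜 S δ σ (twistedAct ℋ 𝒜 π (P i) (Q i)) T) :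
    IsInvariantTrace ℋ (matGrading 𝒜 ι) S δ σ (matrixAct ℋ 𝒜 π P Q) (traceFunctional ι T) where
  invariant n k h hh a ha b := by
    rw [(matrixAct_isDGAction hH hπ hPQ hΩ).invariant_of_apply_act hH hδσ (fun h a => ?_) ha h b,
      koszul_of_mem ℋ k hh, map_zsmul, map_zsmul, LinearMap.smul_apply, mul_smul_comm, map_zsmul,
      mul_comm n k]
    rw [traceFunctional_apply, traceFunctional_apply, Finset.mul_sum]
    exact Finset.sum_congr rfl fun i _ => (hT i).apply_act hH hδσ
      (twist_flip_one hπ (LinearMap.ext (hPQ i).plus_minus)) h _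
  trace n k a ha b hb := by
    simp only [traceFunctional_apply, Matrix.mul_apply, map_sum, Finset.smul_sum, matrixAct_apply,
      twistedAct_sigma hPQ hδσ]
    rw [Finset.sum_comm]
    exact Finset.sum_congr rfl fun i _ => Finset.sum_congr rfl fun j _ =>
      hTπ.trace n k _ (ha j i) _ (hb i j)

end MatrixAction

/-! ### The homotopy for the automorphism generated by a derivation with eigenvalues `0` and `±1` -/

section Conjugation

open Polynomial

/-- A polynomial `P` with `l ^ 2 * P l = 1 - (-1) ^ l` for all integers `l` with `|l| ≤ n`. -/
def parityPoly (n : ℕ) : ℂ[X] :=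
  Lagrange.interpolate (Finset.Icc (-n : ℤ) n) (fun l : ℤ => (l : ℂ))
    fun l => (1 - (l.negOnePow : ℤ)) / (l : ℂ) ^ 2

theorem parityPoly_eval {n : ℕ} {l : ℤ} (hl : l ∈ Finset.Icc (-n : ℤ) n) :
    (parityPoly n).eval (l : ℂ) = (1 - (l.negOnePow : ℤ)) / (l : ℂ) ^ 2 :=
  Lagrange.eval_interpolate_at_node _ Int.cast_injective.injOn hl

theorem sq_mul_parityPoly_eval {n : ℕ} {l : ℤ} (hl : l ∈ Finset.Icc (-n : ℤ) n) :
    (l : ℂ) * (l * (parityPoly n).eval (l : ℂ)) = 1 - (l.negOnePow : ℤ) := by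
  rw [parityPoly_eval hl]
  by_cases h : l = 0
  · subst h
    simp
  · have : (l : ℂ) ≠ 0 := Int.cast_ne_zero.2 h
    field_simp

theorem aeval_intertwine {V W : Type*} [AddCommGroup V] [Module ℂ V] [AddCommGroup W] [Module ℂ W]
    {f : V →ₗ[ℂ] W} {L : V →ₗ[ℂ] V} {L' : W →ₗ[ℂ] W} (h : ∀ x, f (L x) = L' (f x)) (R : ℂ[X])
    (x : V) : f (aeval (R := ℂ) (A := Module.End ℂ V) L R x) =
      aeval (R := ℂ) (A := Module.End ℂ W) L' R (f x) := by
  induction R using Polynomial.induction_on' with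
  | add p q hp hq => simp only [map_add, LinearMap.add_apply, hp, hq]
  | monomial n c =>
    have hn : f ((L ^ n) x) = (L' ^ n) (f x) := by
      induction n with
      | zero => rfl
      | succ n ih => rw [pow_succ', Module.End.mul_apply, h, ih, pow_succ', Module.End.mul_apply]
    simp only [aeval_monomial, Module.End.mul_apply, Module.algebraMap_end_apply, map_smul, hn]

theorem aeval_mem {V : Type*} [AddCommGroup V] [Module ℂ V] {L : V →ₗ[ℂ] V} {N : Submodule ℂ V}
    (h : ∀ x ∈ N, L x ∈ N) (R : ℂ[X]) {x : V} (hx : x ∈ N) :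
    aeval (R := ℂ) (A := Module.End ℂ V) L R x ∈ N := by
  have := aeval_intertwine (f := N.subtype) (L := L.restrict h) (L' := L) (fun _ => rfl) R ⟨x, hx⟩
  rw [Submodule.subtype_apply, Submodule.subtype_apply] at this
  exact this ▸ Subtype.property _

variable {A : Type*} [Ring A] [Algebra ℂ A] {𝒜 : ℤ → Submodule ℂ A} [GradedAlgebra 𝒜]
  {D : A →ₗ[ℂ] A}

/-- Functionals that agree on the eigenvectors of `D` are equal. -/
theorem ext_of_eigenvectors (hD3 : ∀ a, D (D (D a)) = D a) {k : ℕ} {φ ψ : Functional A k}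
    (h : ∀ (a : ℕ → A) (e : ℕ → ℤ), (∀ l, D (a l) = (e l : ℂ) • a l) → (∀ l, |e l| ≤ 1) →
      φ.seq a = ψ.seq a) : φ = ψ := by
  have hspan : Submodule.span ℂ (Set.range fun a : {a : A // ∃ e : ℤ, D a = (e : ℂ) • a ∧ |e| ≤ 1}
      => (a : A)) = ⊤ := by
    rw [eq_top_iff]
    intro a _
    have e : a = (1 / 2 : ℂ) • (D (D a) + D a) + (1 / 2 : ℂ) • (D (D a) - D a) + (a - D (D a)) := by
      module
    rw [e]
    refine Submodule.add_mem _ (Submodule.add_mem _ (Submodule.smul_mem _ _ ?_)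
      (Submodule.smul_mem _ _ ?_)) ?_
    · exact Submodule.subset_span ⟨⟨_, 1, by simp [hD3, add_comm], by simp⟩, rfl⟩
    · exact Submodule.subset_span ⟨⟨_, -1, by simp [hD3], by simp⟩, rfl⟩
    · exact Submodule.subset_span ⟨⟨_, 0, by simp [hD3], by simp⟩, rfl⟩
  refine MultilinearMap.ext_of_span_eq_top (fun _ => hspan) fun v => ?_
  have := h (fun n => if hn : n < k + 1 then (v ⟨n, hn⟩ : A) else 0)
    (fun n => if hn : n < k + 1 then (v ⟨n, hn⟩).2.choose else 0) (fun l => ?_) (fun l => ?_)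
  · simpa [Functional.seq, Fin.is_le] using this
  · by_cases hl : l < k + 1
    · simp only [hl, dif_pos]
      exact (v ⟨l, hl⟩).2.choose_spec.1
    · simp [hl]
  · by_cases hl : l < k + 1
    · simp only [hl, dif_pos]
      exact (v ⟨l, hl⟩).2.choose_spec.2
    · simp [hl]

variable (hD : IsGradedDerivation 𝒜 0 D) (h1 : D 1 = 0)

theorem functionalDer_L_seq {k : ℕ} (φ : Functional A k) {a : ℕ → A} {e : ℕ → ℤ}
    (ha : ∀ l, D (a l) = (e l : ℂ) • a l) :
    ((functionalDer (Or.inl rfl) hD h1).L k φ).seq a =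
      ((∑ l ∈ Finset.range (k + 1), e l : ℤ) : ℂ) * φ.seq a := by
  rw [CyclicOps.Der.L_apply, Functional.sum_seq, Int.cast_sum, Finset.sum_mul]
  refine Finset.sum_congr rfl fun j hj => ?_
  change (slotDer 𝒜 0 D k j φ).seq a = _
  have h := φ.seq_smul_at j (Nat.lt_succ_iff.1 (Finset.mem_range.1 hj)) a (e j) (a j)
  rw [show (fun l => if l = j then a j else a l) = a from
    funext fun l => by split_ifs with hl <;> simp [hl]] at h
  rw [slotDer_seq, ← h]
  refine φ.seq_congr fun l _ => ?_
  rcases lt_trichotomy l j with h | rfl | h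
  · simp [h, h.ne]
  · simp [ha]
  · simp [h.not_gt, h.ne']

theorem aeval_functionalDer_seq (R : ℂ[X]) {k : ℕ} (φ : Functional A k) {a : ℕ → A} {e : ℕ → ℤ}
    (ha : ∀ l, D (a l) = (e l : ℂ) • a l) :
    (aeval (R := ℂ) (A := Module.End ℂ (Functional A k))
      ((functionalDer (Or.inl rfl) hD h1).L k) R φ : Functional A k).seq a =
      R.eval ((∑ l ∈ Finset.range (k + 1), e l : ℤ) : ℂ) * φ.seq a := by
  induction R using Polynomial.induction_on' with
  | add p q hp hq => simp only [map_add, LinearMap.add_apply, Functional.add_seq, hp, hq, eval_add,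
      add_mul]
  | monomial n c =>
    rw [aeval_monomial, Module.End.mul_apply, Module.algebraMap_end_apply, Functional.smul_seq,
      eval_monomial, mul_assoc]
    congr 1
    induction n with
    | zero => simp
    | succ n ih =>
      rw [pow_succ', Module.End.mul_apply, functionalDer_L_seq hD h1 _ ha, ih, pow_succ]
      ring

variable (D) in
/-- The automorphism `exp (π i D)` for a derivation `D` with eigenvalues `0` and `±1`. -/
def conjMap : A →ₗ[ℂ] A := LinearMap.id - (2 : ℂ) • D ∘ₗ D

/-- The operator with `L² K = 1 - w`, where `w` is the automorphism `exp (π i L)`. -/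
def conjK (k : ℕ) : Functional A k →ₗ[ℂ] Functional A k :=
  aeval (R := ℂ) (A := Module.End ℂ (Functional A k)) ((functionalDer (Or.inl rfl) hD h1).L k)
    (parityPoly (k + 1))

theorem sum_mem_Icc {k : ℕ} {e : ℕ → ℤ} (he : ∀ l, |e l| ≤ 1) {n : ℕ} (hn : k ≤ n) :
    ∑ l ∈ Finset.range k, e l ∈ Finset.Icc (-n : ℤ) n := by
  rw [Finset.mem_Icc, ← abs_le]
  refine (Finset.abs_sum_le_sum_abs _ _).trans
    ((Finset.sum_le_card_nsmul _ _ 1 fun l _ => he l).trans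
    ?_)
  simpa using hn

variable (hD3 : ∀ a, D (D (D a)) = D a)
include hD3

theorem aeval_congr {R R' : ℂ[X]} {k : ℕ}
    (h : ∀ l ∈ Finset.Icc (-(k + 1 : ℕ) : ℤ) (k + 1 : ℕ), R.eval (l : ℂ) = R'.eval (l : ℂ))
    (φ : Functional A k) :
    aeval (R := ℂ) (A := Module.End ℂ (Functional A k))
      ((functionalDer (Or.inl rfl) hD h1).L k) R φ =
    aeval (R := ℂ) (A := Module.End ℂ (Functional A k))
      ((functionalDer (Or.inl rfl) hD h1).L k) R' φ :=
  ext_of_eigenvectors hD3 fun a e ha he => by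
    rw [aeval_functionalDer_seq hD h1 _ _ ha, aeval_functionalDer_seq hD h1 _ _ ha,
      h _ (sum_mem_Icc he le_rfl)]

/-- The operators `K` on functionals of different arity are different polynomials in the Lie
derivative, but the polynomials agree at the eigenvalues that occur. -/
theorem conjK_map : CyclicOps.Map (functionalOps 𝒜) (functionalOps 𝒜) (conjK hD h1) where
  map_lam k φ := (aeval_intertwine
    (fun x => ((functionalDer (Or.inl rfl) hD h1).L_lam k x).symm) _ φ).symm
  map_face k j hj φ := by
    refine (aeval_intertwine
      (fun x => ((functionalDer (Or.inl rfl) hD h1).L_face k j hj x).symm) _ φ).symm.trans ?_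
    refine congrArg _ (aeval_congr hD h1 hD3 (fun l hl => ?_) φ)
    rw [parityPoly_eval hl, parityPoly_eval]
    rw [Finset.mem_Icc] at hl ⊢
    push_cast at hl ⊢
    omega

theorem L_L_conjK {k : ℕ} (φ : Functional A k) :
    (functionalDer (Or.inl rfl) hD h1).L k ((functionalDer (Or.inl rfl) hD h1).L k
      (conjK hD h1 k φ)) = φ - pull (conjMap D) k φ := by
  refine ext_of_eigenvectors hD3 fun a e ha he => ?_
  have hw : ∀ l, conjMap D (a l) = (((e l).negOnePow : ℤ) : ℂ) • a l := by
    intro l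
    have : e l = -1 ∨ e l = 0 ∨ e l = 1 := by
      have := abs_le.1 (he l)
      omega
    simp only [conjMap, LinearMap.sub_apply, LinearMap.id_apply, LinearMap.smul_apply,
      LinearMap.comp_apply, ha, map_smul]
    rcases this with h | h | h <;> simp [h] <;> module
  have hpull : (pull (conjMap D) k φ).seq a =
      ((∑ l ∈ Finset.range (k + 1), e l).negOnePow : ℤ) * φ.seq a := by
    rw [pull_seq, φ.seq_congr fun l _ => hw l]
    refine (φ.map_smul_univ (fun i => (((e i).negOnePow : ℤ) : ℂ)) fun i => a i).trans ?_
    rw [← Finset.prod_range (fun l => (((e l).negOnePow : ℤ) : ℂ)), smul_eq_mul]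
    refine congrArg (· * _) ?_
    generalize k + 1 = n
    induction n with
    | zero => simp
    | succ n ih => rw [Finset.prod_range_succ, ih, Finset.sum_range_succ, Int.negOnePow_add,
        Units.val_mul, Int.cast_mul]
  rw [functionalDer_L_seq hD h1 _ ha, functionalDer_L_seq hD h1 _ ha, conjK,
    aeval_functionalDer_seq hD h1 _ _ ha, sub_eq_add_neg, Functional.add_seq, Functional.neg_seq,
    hpull]
  linear_combination φ.seq a * sq_mul_parityPoly_eval (sum_mem_Icc he (le_refl (k + 1)))

variable {d : A →ₗ[ℂ] A} (hd : IsDGAlgebra 𝒜 d) (hDd : ∀ a, D (d a) = d (D a))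
include hD h1 hDd

/-- The automorphism `exp (π i D)` acts trivially on the cohomology of the complex of pairs. -/
theorem exists_sub_conjMap_eq_pairD [TopologicalSpace A] [IsTopologicalRing A]
    (hγ : Continuous (koszul 𝒜 1)) (hDc : Continuous D) (hDm : ∀ i, ∀ a ∈ 𝒜 i, D a ∈ 𝒜 i) {j : ℤ}
    {z : Tot (Functional A) ℤ × Tot (Functional A) ℤ}
    (hz : z ∈ CyclicOps.pairSub (contWeight 𝒜) j) (hdz : CyclicOps.pairD (diffDer hd) z = 0) :
    ∃ u ∈ CyclicOps.pairSub (contWeight 𝒜) (j - 1),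
      z - (idMap 0 (pull (conjMap D))).prodMap (idMap 0 (pull (conjMap D))) z =
        CyclicOps.pairD (diffDer hd) u := by
  set 𝒟 := functionalDer (Or.inl rfl) hD h1
  have hs := functionalOps_stable hγ
  have h𝒟 : 𝒟.Shifts (contWeight 𝒜) 0 := fun m k j hj φ hφ => by
    have := slotDer_mem_contWeight (c := 0) (r := 0) hγ hDc
      (fun i a ha => by rw [add_zero]; exact hDm i a ha) hj hφ
    rwa [neg_zero] at this
  have hdd : 𝒟.Commutes (diffDer hd) := fun k i j φ =>
    slotDer_comm (fun a => by simpa using hD.map_koszul a) hDd k i j φ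
  have hDD : 𝒟.Commutes 𝒟 := fun k i j φ =>
    slotDer_comm (c := 0) (fun a => by simp) (fun _ => rfl) k i j φ
  have hK := conjK_map hD h1 hD3
  -- The operator `K` is a polynomial in the Lie derivative, hence it commutes with the differential
  -- and preserves the cochains, and `z - w z = L² (K z)` is in the image of `L²`.
  set y := (idMap 0 (conjK hD h1)).prodMap (idMap 0 (conjK hD h1)) z with hy
  have hL0 : ∀ m k, ∀ x ∈ contWeight 𝒜 m k, 𝒟.L k x ∈ contWeight 𝒜 m k := fun m k x hx => by
    have := h𝒟.L_mem hx
    rwa [add_zero] at this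
  have hKm : ∀ m k, ∀ x ∈ contWeight 𝒜 m k, conjK hD h1 k x ∈ contWeight 𝒜 (m + 0) k :=
    fun m k x hx => by
      rw [add_zero]
      exact aeval_mem (hL0 m k) _ hx
  have hym : y ∈ CyclicOps.pairSub (contWeight 𝒜) j :=
    ⟨idMap_mem hKm (by omega) hz.1, idMap_mem hKm (by omega) hz.2⟩
  have hdy : CyclicOps.pairD (diffDer hd) y = 0 := by
    rw [hy, ← hK.pairD (fun k j φ => (aeval_intertwine
      (fun x => ?_) _ φ).symm), hdz, map_zero]
    rw [CyclicOps.Der.L_apply, CyclicOps.Der.L_apply, map_sum]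
    exact Finset.sum_congr rfl fun i _ => (hdd k i j x).symm
  refine ⟨_, hs.pairH_mem h𝒟 (Submodule.sub_mem _ (h𝒟.pairL_mem hym) (hs.pairQ_mem h𝒟 hym)), ?_⟩
  rw [← CyclicOps.pairL_pairL_eq_pairD (diffDer_squareZero hd) hdd hDD hdy]
  have e : ∀ c : Tot (Functional A) ℤ, c - idMap 0 (pull (conjMap D)) c =
      idMap 0 𝒟.L (idMap 0 𝒟.L (idMap 0 (conjK hD h1) c)) := by
    intro c
    suffices e : LinearMap.id - idMap 0 (pull (conjMap D)) =
      idMap 0 𝒟.L ∘ₗ idMap 0 𝒟.L ∘ₗ idMap 0 (conjK hD h1) from LinearMap.congr_fun e c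
    refine Tot.hom_ext fun k q φ => ?_
    simp only [LinearMap.sub_apply, LinearMap.comp_apply, LinearMap.id_apply, idMap_place, add_zero]
    rw [L_L_conjK hD h1 hD3, map_sub]
  exact Prod.ext (e z.1) (e z.2)

end Conjugation

section InnerDerivation

variable {A : Type*} [Ring A] [Algebra ℂ A] {𝒜 : ℤ → Submodule ℂ A} [GradedAlgebra 𝒜] {F : A}

/-- Half the commutator with `F`. -/
def halfAd (F : A) : A →ₗ[ℂ] A := (1 / 2 : ℂ) • (LinearMap.mulLeft ℂ F - LinearMap.mulRight ℂ F)

theorem halfAd_apply (a : A) : halfAd F a = (1 / 2 : ℂ) • (F * a - a * F) := rfl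

theorem halfAd_one : halfAd F 1 = 0 := by
  simp [halfAd_apply]

theorem halfAd_isGradedDerivation (hF : F ∈ 𝒜 0) : IsGradedDerivation 𝒜 0 (halfAd F) where
  map_mul a b := by
    rw [koszul_zero, LinearMap.id_apply, halfAd_apply, halfAd_apply, halfAd_apply, smul_mul_assoc,
      mul_smul_comm, ← smul_add]
    congr 1
    noncomm_ring
  map_koszul a := by
    have hk : koszul 𝒜 1 F = F := by
      rw [koszul_of_mem 𝒜 1 hF]
      simp
    simp [halfAd_apply, koszul_mul, hk]

theorem halfAd_mem (hF : F ∈ 𝒜 0) (i : ℤ) (a : A) (ha : a ∈ 𝒜 i) : halfAd F a ∈ 𝒜 i := by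
  refine Submodule.smul_mem _ _ (Submodule.sub_mem _ ?_ ?_)
  · exact zero_add i ▸ SetLike.mul_mem_graded hF ha
  · exact (add_zero i).symm ▸ SetLike.mul_mem_graded ha hF

theorem d_halfAd {d : A →ₗ[ℂ] A} (hd : IsDGAlgebra 𝒜 d) (hF : F ∈ 𝒜 0) (hdF : d F = 0) (a : A) :
    halfAd F (d a) = d (halfAd F a) := by
  have hk : koszul 𝒜 1 F = F := by
    rw [koszul_of_mem 𝒜 1 hF]
    simp
  simp [halfAd_apply, hd.d_mul 𝒜, hk, hdF]

theorem continuous_halfAd [TopologicalSpace A] [IsTopologicalRing A] :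
    Continuous (halfAd F) :=
  (continuous_const_smul_of_ring _).comp
    ((continuous_const.mul continuous_id).sub (continuous_id.mul continuous_const))

variable (hFF : F * F = 1)
include hFF

theorem halfAd_halfAd (a : A) : halfAd F (halfAd F a) = (1 / 2 : ℂ) • (a - F * a * F) := by
  have h1 : F * (F * a) = a := by rw [← mul_assoc, hFF, one_mul]
  have h2 : a * F * F = a := by rw [mul_assoc, hFF, mul_one]
  simp only [halfAd_apply, mul_smul_comm, smul_mul_assoc, mul_sub, sub_mul, h1, h2, mul_assoc]
  module

theorem halfAd_pow_three (a : A) : halfAd F (halfAd F (halfAd F a)) = halfAd F a := by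
  rw [halfAd_halfAd hFF, halfAd_apply]
  have h1 : F * (F * a) = a := by rw [← mul_assoc, hFF, one_mul]
  simp only [mul_smul_comm, smul_mul_assoc, mul_sub, sub_mul, h1, ← mul_assoc]
  simp only [mul_assoc, hFF, mul_one]
  module

theorem conjMap_halfAd (a : A) : conjMap (halfAd F) a = F * a * F := by
  rw [conjMap, LinearMap.sub_apply, LinearMap.smul_apply, LinearMap.comp_apply, halfAd_halfAd hFF,
    LinearMap.id_apply]
  module

end InnerDerivation

/-! ### The characteristic map and nonunital homomorphisms -/

theorem unitFront_apply {A : Type*} [Ring A] [Algebra ℂ A] {𝒜 : ℤ → Submodule ℂ A}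
    [GradedAlgebra 𝒜] {k : ℕ} (φ : Functional A (k + 1)) (a : Fin (k + 1) → A) :
    unitFront 𝒜 k φ a = φ (Fin.cons 1 a) := by
  have h := unitFront_seq 𝒜 φ fun n => if hn : n < k + 1 then a ⟨n, hn⟩ else 0
  simp only [Functional.seq, Fin.is_lt, dif_pos] at h
  refine h.trans (congrArg φ (funext fun i => ?_))
  induction i using Fin.cases with
  | zero => simp
  | succ i => simp [i.is_le.not_gt]

section Corner

variable {H : Type*} [Ring H] [Algebra ℂ H] {ℋ : ℤ → Submodule ℂ H} [GradedAlgebra ℋ]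
  {Ω Ω' : Type*} [Ring Ω] [Algebra ℂ Ω] {𝒜 : ℤ → Submodule ℂ Ω} [GradedAlgebra 𝒜]
  [Ring Ω'] [Algebra ℂ Ω'] {𝒜' : ℤ → Submodule ℂ Ω'} [GradedAlgebra 𝒜']
  {π : H →ₗ[ℂ] Ω →ₗ[ℂ] Ω} {π' : H →ₗ[ℂ] Ω' →ₗ[ℂ] Ω'} {T : Ω →ₗ[ℂ] ℂ} {T' : Ω' →ₗ[ℂ] ℂ}
  {f : Ω →ₗ[ℂ] Ω'} (hf : ∀ a b, f (a * b) = f a * f b) (hfm : ∀ i, ∀ a ∈ 𝒜 i, f a ∈ 𝒜' i)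
  (hfπ : ∀ h a, π' h (f a) = f (π h a)) (hfT : ∀ a, T' (f a) = T a)
include hf hfm hfπ

/-- An equivariant nonunital homomorphism need not map `1` to `1`, but the unit is absorbed by any
factor in its image. -/
theorem mul_evalTail_comp : (k : ℕ) → (a : Fin k → Ω) → Homogeneous 𝒜 a → (x : TPow H k) →
    (u : Ω) → f u * evalTail ℋ 𝒜' π' k (fun i => f (a i)) x = f (u * evalTail ℋ 𝒜 π k a x)
  | 0, a, _, x, u => by
    suffices e : LinearMap.mulLeft ℂ (f u) ∘ₗ evalTail ℋ 𝒜' π' 0 (fun i => f (a i)) =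
        f ∘ₗ LinearMap.mulLeft ℂ u ∘ₗ evalTail ℋ 𝒜 π 0 a from LinearMap.congr_fun e x
    refine TPow.ext_zero ?_
    have h0 : evalTail ℋ 𝒜' π' 0 (fun i => f (a i)) (nil H) = 1 := evalTail_nil _
    simp only [LinearMap.comp_apply, LinearMap.mulLeft_apply, h0, evalTail_nil, mul_one]
  | k + 1, a, ha, x, u => by
    suffices e : LinearMap.mulLeft ℂ (f u) ∘ₗ evalTail ℋ 𝒜' π' (k + 1) (fun i => f (a i)) =
        f ∘ₗ LinearMap.mulLeft ℂ u ∘ₗ evalTail ℋ 𝒜 π (k + 1) a from LinearMap.congr_fun e x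
    obtain ⟨n, hn⟩ := ha 0
    refine TPow.ext_cons fun h x => ?_
    simp only [LinearMap.comp_apply, LinearMap.mulLeft_apply]
    rw [evalTail_cons hn, evalTail_cons (a := fun i => f (a i)) (hfm n _ hn), hfπ, ← mul_assoc,
      ← hf, ← mul_assoc]
    exact mul_evalTail_comp k _ ha.tail _ _

include hfT

theorem pull_charMap (k : ℕ) (x : TPow H k) :
    pull f k (charMap ℋ 𝒜' π' T' k x) = charMap ℋ 𝒜 π T k x := by
  refine ext_of_homogeneous (𝒜 := 𝒜) fun a ha => ?_
  obtain ⟨n, hn⟩ := ha 0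
  change charMap ℋ 𝒜' π' T' k x (fun i => f (a i)) = _
  rw [charMap_apply (a := fun i => f (a i)) (hfm n _ hn), charMap_apply hn, ← hfT,
    ← mul_evalTail_comp hf hfm hfπ k _ ha.tail]
  rfl

/-- The values of the characteristic map at arguments beginning with `1` are natural, although the
homomorphism need not preserve the unit. -/
theorem pull_unitFront_charMap (k : ℕ) (x : TPow H (k + 1)) :
    pull f k (unitFront 𝒜' k (charMap ℋ 𝒜' π' T' (k + 1) x)) =
      unitFront 𝒜 k (charMap ℋ 𝒜 π T (k + 1) x) := by
  refine ext_of_homogeneous (𝒜 := 𝒜) fun a ha => ?_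
  obtain ⟨n, hn⟩ := ha 0
  have h1 : (pull f k (unitFront 𝒜' k (charMap ℋ 𝒜' π' T' (k + 1) x))) a =
      charMap ℋ 𝒜' π' T' (k + 1) x (Fin.cons 1 fun i => f (a i)) := unitFront_apply _ _
  rw [h1, unitFront_apply, charMap_apply (l := 0) (SetLike.one_mem_graded 𝒜'),
    charMap_apply (l := 0) (SetLike.one_mem_graded 𝒜), Fin.tail_cons, Fin.tail_cons, Fin.cons_zero,
    Fin.cons_zero, one_mul, one_mul]
  generalize tensorKoszul ℋ (k + 1) 0 x = y
  suffices e : T' ∘ₗ evalTail ℋ 𝒜' π' (k + 1) (fun i => f (a i)) =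
      T ∘ₗ evalTail ℋ 𝒜 π (k + 1) a from LinearMap.congr_fun e y
  refine TPow.ext_cons fun h x => ?_
  rw [LinearMap.comp_apply, LinearMap.comp_apply, evalTail_cons hn,
    evalTail_cons (a := fun i => f (a i)) (hfm n _ hn), hfπ, ← hfT,
    ← mul_evalTail_comp hf hfm hfπ k _ ha.tail]
  rfl

variable [Coalgebra ℂ H] {dH S : H →ₗ[ℂ] H} {dΩ : Ω →ₗ[ℂ] Ω} {dΩ' : Ω' →ₗ[ℂ] Ω'}
  {δ : H →ₐ[ℂ] ℂ} {σ : H}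

/-- The characteristic maps to the complexes of pairs are natural for nonunital homomorphisms. -/
theorem pull_toPair_charTotal (hH : IsDGHopfAlgebra ℋ dH S) (hδσ : IsModularPair ℋ dH S δ σ)
    (hπ : IsDGAction ℋ 𝒜 dH dΩ π) (hT : IsInvariantTrace ℋ 𝒜 S δ σ π T)
    (hπ' : IsDGAction ℋ 𝒜' dH dΩ' π') (hT' : IsInvariantTrace ℋ 𝒜' S δ σ π' T') (i : ℤ)
    (x : Tot (TPow H) ℕ) :
    (idMap 0 (pull f)).prodMap (idMap 0 (pull f))
        ((functionalOps 𝒜').toPair (charTotal ℋ 𝒜' π' T' i x)) =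
      (functionalOps 𝒜).toPair (charTotal ℋ 𝒜 π T i x) := by
  suffices e : (idMap 0 (pull f)).prodMap (idMap 0 (pull f)) ∘ₗ (functionalOps 𝒜').toPair ∘ₗ
      charTotal ℋ 𝒜' π' T' i = (functionalOps 𝒜).toPair ∘ₗ charTotal ℋ 𝒜 π T i from
    LinearMap.congr_fun e x
  refine DirectSum.linearMap_ext ℂ fun p => LinearMap.ext fun x => ?_
  obtain ⟨k, r⟩ := p
  simp only [LinearMap.comp_apply]
  rw [charTotal_lof, charTotal_lof, map_zsmul, map_zsmul, map_zsmul]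
  refine congrArg _ (Prod.ext ?_ ?_)
  · change idMap 0 (pull f) (place k (r : ℤ) _) = place k (r : ℤ) _
    rw [idMap_place, add_zero, pull_charMap hf hfm hfπ hfT]
  · change idMap 0 (pull f) (dnMap 0 _ (place k (r : ℤ) _)) = dnMap 0 _ (place k (r : ℤ) _)
    cases k with
    | zero => rw [dnMap_place_zero, dnMap_place_zero, map_zero]
    | succ k =>
      rw [dnMap_place_succ, dnMap_place_succ, idMap_place, add_zero]
      refine congrArg _ ?_
      change pull f k (unitFront 𝒜' k (charMap ℋ 𝒜' π' T' (k + 1) x -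
        (-1 : ℂ) ^ (k + 1) • cyclicOp 𝒜' (k + 1) (charMap ℋ 𝒜' π' T' (k + 1) x))) =
        unitFront 𝒜 k (charMap ℋ 𝒜 π T (k + 1) x -
          (-1 : ℂ) ^ (k + 1) • cyclicOp 𝒜 (k + 1) (charMap ℋ 𝒜 π T (k + 1) x))
      rw [← charMap_hopfCyclic hπ' hT' hH hδσ, ← charMap_hopfCyclic hπ hT hH hδσ]
      simp only [map_sub, map_smul, pull_unitFront_charMap hf hfm hfπ hfT]

end Corner

/-! ### Twisted actions have cohomologous characteristic maps -/

section TwistInvariance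

variable {H : Type*} [Ring H] [Algebra ℂ H] [Coalgebra ℂ H] {ℋ : ℤ → Submodule ℂ H}
  [GradedAlgebra ℋ] {Ω : Type*} [Ring Ω] [Algebra ℂ Ω] {𝒜 : ℤ → Submodule ℂ Ω} [GradedAlgebra 𝒜]
  {π : H →ₗ[ℂ] Ω →ₗ[ℂ] Ω} {dH S : H →ₗ[ℂ] H} {dΩ : Ω →ₗ[ℂ] Ω} {δ : H →ₐ[ℂ] ℂ} {σ : H}
  {T : Ω →ₗ[ℂ] ℂ}

theorem continuous_twistedAct [TopologicalSpace Ω] [IsTopologicalRing Ω]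
    (hγ : Continuous (koszul 𝒜 1)) (hπc : ∀ h, Continuous (π h)) (p m : H →ₗ[ℂ] Ω) (h : H) :
    Continuous (twistedAct ℋ 𝒜 π p m h) := by
  have hr : ∀ h, Continuous (rightTwist ℋ 𝒜 π m h) := fun h => by
    change Continuous fun a => (∑ s ∈ Finset.range 2,
      conv (π.flip (parityPart 𝒜 s a)) (m ∘ₗ koszul ℋ s)) h
    simp only [LinearMap.sum_apply, conv_apply]
    refine continuous_finsetSum _ fun s _ => ?_
    induction (Coalgebra.comul (R := ℂ) h) with
    | zero => simpa using continuous_const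
    | add x y hx hy =>
      simp only [map_add]
      exact hx.add hy
    | tmul x y =>
      simp only [TensorProduct.map_tmul, LinearMap.mul'_apply, LinearMap.flip_apply]
      exact ((hπc x).comp (continuous_parityPart hγ s)).mul continuous_const
  change Continuous fun a => conv p ((rightTwist ℋ 𝒜 π m).flip a) h
  simp only [conv_apply]
  induction (Coalgebra.comul (R := ℂ) h) with
  | zero => simpa using continuous_const
  | add x y hx hy =>
    simp only [map_add]
    exact hx.add hy
  | tmul x y =>
    simp only [TensorProduct.map_tmul, LinearMap.mul'_apply, LinearMap.flip_apply]
    exact continuous_const.mul (hr y)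

variable (hH : IsDGHopfAlgebra ℋ dH S) (hδσ : IsModularPair ℋ dH S δ σ) (hΩ : IsDGAlgebra 𝒜 dΩ)
  (hA : ∀ n < 0, 𝒜 n = ⊥) (hπ : IsDGAction ℋ 𝒜 dH dΩ π) {q : ℤ}
  (hTw : ∀ n : ℤ, n ≠ q → ∀ a ∈ 𝒜 n, T a = 0) (hTd : ∀ a, T (dΩ a) = 0)
  {P Q : Fin 2 → H →ₗ[ℂ] Ω} (hPQ : ∀ i, IsCocyclePair ℋ 𝒜 dH dΩ σ π (P i) (Q i))
  (hTπ : IsInvariantTrace ℋ 𝒜 S δ σ π T)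
  (hT : ∀ i, IsInvariantTrace ℋ 𝒜 S δ σ (twistedAct ℋ 𝒜 π (P i) (Q i)) T)
include hH hδσ hΩ hA hπ hTw hTd hPQ hTπ hT

/-- For two twists of an action, the characteristic maps differ by a coboundary on cocycles: both
are restrictions to the corners of the characteristic map of an action on the matrices of size
two, and the corners are conjugate. -/
theorem charTotal_sub_charTotal_mem [TopologicalSpace Ω] [IsTopologicalRing Ω]
    (hγ : Continuous (koszul 𝒜 1)) (hdc : Continuous dΩ) (hπc : ∀ h, Continuous (π h))
    (hTc : Continuous T) {i : ℤ} {x : Tot (TPow H) ℕ}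
    (hx : x ∈ truncatedCocycles ℋ dH S δ σ q i) :
    charTotal ℋ 𝒜 (twistedAct ℋ 𝒜 π (P 0) (Q 0)) T i x -
      charTotal ℋ 𝒜 (twistedAct ℋ 𝒜 π (P 1) (Q 1)) T i x ∈
        (gradedSub (contWeight 𝒜) (i - q - 1)).map (periodicD 𝒜 dΩ) := by
  set ℳ := matGrading 𝒜 (Fin 2)
  set dM : Matrix (Fin 2) (Fin 2) Ω →ₗ[ℂ] Matrix (Fin 2) (Fin 2) Ω := dΩ.mapMatrix
  set Tr := traceFunctional (Fin 2) T
  set ρ := matrixAct ℋ 𝒜 π P Q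
  have hM : IsDGAlgebra ℳ dM := isDGAlgebra_matrix hΩ
  have hρ : IsDGAction ℋ ℳ dH dM ρ := matrixAct_isDGAction hH hπ hPQ hΩ
  have hTr : IsInvariantTrace ℋ ℳ S δ σ ρ Tr :=
    traceFunctional_isInvariantTrace hH hπ hPQ hδσ hΩ hTπ hT
  have hMA : ∀ n < 0, ℳ n = ⊥ := fun n hn => by
    rw [eq_bot_iff]
    intro m hm
    rw [Submodule.mem_bot]
    ext i j
    have := hm i j
    rw [hA n hn, Submodule.mem_bot] at this
    exact this
  have hTrw : ∀ n : ℤ, n ≠ q → ∀ m ∈ ℳ n, Tr m = 0 := fun n hn m hm => by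
    rw [traceFunctional_apply]
    exact Finset.sum_eq_zero fun i _ => hTw n hn _ (hm i i)
  have hTrd : ∀ m, Tr (dM m) = 0 := fun m => by
    rw [traceFunctional_apply]
    exact Finset.sum_eq_zero fun i _ => hTd _
  have hMγ : Continuous (koszul ℳ 1) := continuous_matrix fun i j =>
    (hγ.comp ((continuous_apply j).comp (continuous_apply i))).congr fun m =>
      (matrix_koszul_apply 1 m i j).symm
  have hMd : Continuous dM := continuous_matrix fun i j =>
    hdc.comp ((continuous_apply j).comp (continuous_apply i))
  have hρc : ∀ h, Continuous (ρ h) := fun h => continuous_matrix fun i j =>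
    (continuous_twistedAct hγ hπc _ _ h).comp ((continuous_apply j).comp (continuous_apply i))
  have hTrc : Continuous Tr := by
    change Continuous fun m => traceFunctional (Fin 2) T m
    simp only [traceFunctional_apply]
    exact continuous_finsetSum _ fun i _ =>
      hTc.comp ((continuous_apply i).comp (continuous_apply i))
  -- The cochain on the matrices, a cocycle, and the automorphism which exchanges the corners.
  set c := charTotal ℋ ℳ ρ Tr i x
  have hc : c ∈ gradedSub (contWeight ℳ) (i - q) :=
    charTotal_mem_gradedSub (𝒱 := contWeight ℳ) (fun k w y hy =>
      ⟨charMap_mem_weightPart hTrw hρ.act_mem hy, charMap_mem_continuousPart hMγ (fun _ h _ => hρc h) hTrc hy⟩) hx.1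
  have hdc' : CyclicOps.pairD (diffDer hM) ((functionalOps ℳ).toPair c) = 0 := by
    rw [← CyclicOps.toPair_unitalD, ← periodicD_eq hM,
      ← charTotal_hopfD hρ hTr hH hδσ hM hTrd hx.1,
      charTotal_eq_zero hTrw hMA hρ.act_mem (i + 1) hx.2, map_zero]
  set F : Matrix (Fin 2) (Fin 2) Ω := Matrix.single 0 1 1 + Matrix.single 1 0 1
  have hF : F ∈ ℳ 0 := Submodule.add_mem _
    (single_mem_matGrading 0 1 (SetLike.one_mem_graded 𝒜))
    (single_mem_matGrading 1 0 (SetLike.one_mem_graded 𝒜))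
  have hdF : dM F = 0 := by
    ext i j
    fin_cases i <;> fin_cases j <;> simp [dM, F, hΩ.d_one]
  have hFF : F * F = 1 := by
    ext i j
    fin_cases i <;> fin_cases j <;> simp [F, Matrix.mul_apply]
  obtain ⟨u, hu, hcu⟩ := exists_sub_conjMap_eq_pairD (halfAd_isGradedDerivation hF) halfAd_one
    (halfAd_pow_three hFF) hM (d_halfAd hM hF hdF) hMγ continuous_halfAd (halfAd_mem hF)
    ((functionalOps_stable hMγ).toPair_mem hc) hdc'
  -- The embeddings of the corners are equivariant nonunital homomorphisms.
  have hj : ∀ l : Fin 2, ∀ a b, Matrix.singleLinearMap ℂ l l (a * b) =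
      (Matrix.singleLinearMap ℂ l l a * Matrix.singleLinearMap ℂ l l b :
        Matrix (Fin 2) (Fin 2) Ω) := fun l a b => by
    simp [Matrix.single_mul_single_same]
  have hjm : ∀ l : Fin 2, ∀ n, ∀ a ∈ 𝒜 n, Matrix.singleLinearMap ℂ l l a ∈ ℳ n :=
    fun l n a ha => single_mem_matGrading l l ha
  have hjρ : ∀ l : Fin 2, ∀ h a, ρ h (Matrix.singleLinearMap ℂ l l a) =
      Matrix.singleLinearMap ℂ l l (twistedAct ℋ 𝒜 π (P l) (Q l) h a) := fun l h a => by
    ext i j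
    change twistedAct ℋ 𝒜 π (P i) (Q j) h (Matrix.single l l a i j) =
      Matrix.single l l (twistedAct ℋ 𝒜 π (P l) (Q l) h a) i j
    rw [Matrix.single_apply, Matrix.single_apply]
    split_ifs with h
    · obtain ⟨rfl, rfl⟩ := h
      rfl
    · rw [map_zero]
  have hjT : ∀ l : Fin 2, ∀ a, Tr (Matrix.singleLinearMap ℂ l l a) = T a := fun l a => by
    change T (Matrix.trace (Matrix.single l l a)) = T a
    rw [Matrix.trace_single_eq_same]
  have hpull : ∀ l : Fin 2, (idMap 0 (pull (Matrix.singleLinearMap ℂ l l))).prodMap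
      (idMap 0 (pull (Matrix.singleLinearMap ℂ l l))) ((functionalOps ℳ).toPair c) =
      (functionalOps 𝒜).toPair (charTotal ℋ 𝒜 (twistedAct ℋ 𝒜 π (P l) (Q l)) T i x) := fun l =>
    pull_toPair_charTotal (hj l) (hjm l) (hjρ l) (hjT l) hH hδσ
      (twistedAct_isDGAction hH hπ (hPQ l) hΩ) (hT l) hρ hTr i x
  have hjγ : ∀ a, Matrix.singleLinearMap ℂ (0 : Fin 2) (0 : Fin 2) (koszul 𝒜 1 a) =
      koszul ℳ 1 (Matrix.singleLinearMap ℂ 0 0 a) := fun a => by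
    ext i j
    change Matrix.single 0 0 _ i j = koszul ℳ 1 (Matrix.single 0 0 a) i j
    rw [matrix_koszul_apply, Matrix.single_apply, Matrix.single_apply]
    split_ifs
    · rfl
    · rw [map_zero]
  have hjd : ∀ a, Matrix.singleLinearMap ℂ (0 : Fin 2) (0 : Fin 2) (dΩ a) =
      dM (Matrix.singleLinearMap ℂ 0 0 a) := fun a => by
    ext i j
    change Matrix.single 0 0 _ i j = dΩ (Matrix.single 0 0 a i j)
    rw [Matrix.single_apply, Matrix.single_apply]
    split_ifs
    · rfl
    · rw [map_zero]
  have hjc : Continuous (Matrix.singleLinearMap ℂ (0 : Fin 2) (0 : Fin 2) (α := Ω)) :=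
    continuous_matrix fun i j => by
      change Continuous fun a => Matrix.single 0 0 a i j
      simp only [Matrix.single_apply]
      split_ifs
      · exact continuous_id
      · exact continuous_const
  -- The automorphism carries the first corner to the second.
  have hconj : ∀ z, (idMap 0 (pull (Matrix.singleLinearMap ℂ (0 : Fin 2) (0 : Fin 2))))
      (idMap 0 (pull (conjMap (halfAd F))) z) =
      idMap 0 (pull (Matrix.singleLinearMap ℂ (1 : Fin 2) (1 : Fin 2) (α := Ω))) z := fun z => by
    have e : ∀ a : Ω, conjMap (halfAd F) (Matrix.singleLinearMap ℂ (0 : Fin 2) (0 : Fin 2) a) =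
        Matrix.singleLinearMap ℂ (1 : Fin 2) (1 : Fin 2) a := fun a => by
      rw [conjMap_halfAd hFF]
      ext i j
      fin_cases i <;> fin_cases j <;> simp [F, Matrix.mul_apply]
    suffices e : idMap 0 (pull (Matrix.singleLinearMap ℂ (0 : Fin 2) (0 : Fin 2))) ∘ₗ
        idMap 0 (pull (conjMap (halfAd F))) =
        idMap 0 (pull (Matrix.singleLinearMap ℂ (1 : Fin 2) (1 : Fin 2) (α := Ω))) from
      LinearMap.congr_fun e z
    refine Tot.hom_ext fun k q φ => ?_
    simp only [LinearMap.comp_apply, idMap_place, add_zero]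
    refine congrArg _ (Functional.ext_seq fun a => ?_)
    simp only [pull_seq, e]
  -- The restriction of the homotopy to the first corner.
  have h0 := congrArg ((idMap 0 (pull (Matrix.singleLinearMap ℂ (0 : Fin 2) (0 : Fin 2)
    (α := Ω)))).prodMap (idMap 0 (pull (Matrix.singleLinearMap ℂ (0 : Fin 2) (0 : Fin 2))))) hcu
  rw [map_sub, hpull 0, (pull_map (hj 0) hjγ).pairD (Δ' := diffDer hΩ)
    (fun k j φ => pull_slotDer hjγ hjd k j φ)] at h0
  rw [periodicD_eq hΩ]
  refine (functionalOps_stable hγ).mem_map_unitalD (w := (idMap 0 (pull (Matrix.singleLinearMap ℂ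
    (0 : Fin 2) (0 : Fin 2)))).prodMap (idMap 0 (pull (Matrix.singleLinearMap ℂ (0 : Fin 2)
    (0 : Fin 2)))) u) ⟨?_, ?_⟩ ?_
  · exact idMap_mem (fun m k φ hφ => pull_mem_contWeight (hjm 0) hjc
      (by rwa [add_zero])) (by omega) hu.1
  · exact idMap_mem (fun m k φ hφ => pull_mem_contWeight (hjm 0) hjc
      (by rwa [add_zero])) (by omega) hu.2
  · rw [← h0, map_sub, ← hpull 1]
    exact congrArg _ (Prod.ext (hconj _).symm (hconj _).symm)

end TwistInvariance

/-! ### The induced maps in cohomology -/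

/-- A linear relation between cohomology spaces, given by maps to a third one of which the first
is bijective on classes, is the graph of a unique linear map. -/
theorem existsUnique_cohomology_map {V W U : Type*} [AddCommGroup V] [Module ℂ V] [AddCommGroup W]
    [Module ℂ W] [AddCommGroup U] [Module ℂ U] {Z B : Submodule ℂ V} {Z' B' : Submodule ℂ W}
    {N : Submodule ℂ U} (e : W →ₗ[ℂ] U) (f : V →ₗ[ℂ] U) (hex : ∀ x ∈ Z, ∃ y ∈ Z', e y - f x ∈ N)
    (hinj : ∀ y ∈ Z', e y ∈ N → y ∈ B') (he : ∀ y ∈ B', e y ∈ N) (hf : ∀ x ∈ B, f x ∈ N) :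
    ∃! Φ : Cohomology Z B →ₗ[ℂ] Cohomology Z' B', ∀ (x : ↥Z) (y : ↥Z'),
      Φ (Submodule.Quotient.mk x) = Submodule.Quotient.mk y ↔ e y - f x ∈ N := by
  set e' : Cohomology Z' B' →ₗ[ℂ] U ⧸ N := (B'.submoduleOf Z').liftQ (N.mkQ ∘ₗ e ∘ₗ Z'.subtype)
    fun y hy => (Submodule.Quotient.mk_eq_zero N).2 (he _ hy)
  set f' : Cohomology Z B →ₗ[ℂ] U ⧸ N := (B.submoduleOf Z).liftQ (N.mkQ ∘ₗ f ∘ₗ Z.subtype)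
    fun x hx => (Submodule.Quotient.mk_eq_zero N).2 (hf _ hx)
  have hker : LinearMap.ker e' = ⊥ := by
    rw [LinearMap.ker_eq_bot']
    intro m
    induction m using Submodule.Quotient.induction_on with
    | H y =>
      intro hy
      exact (Submodule.Quotient.mk_eq_zero _).2
        (hinj y y.2 ((Submodule.Quotient.mk_eq_zero N).1 hy))
  have hmem : ∀ (x : ↥Z) (y : ↥Z'), e y - f x ∈ N ↔
      e' (Submodule.Quotient.mk y) = f' (Submodule.Quotient.mk x) := fun x y =>
    (Submodule.Quotient.eq N).symm
  obtain ⟨g, hg⟩ := LinearMap.exists_leftInverse_of_injective e' hker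
  have hg' : ∀ m, g (e' m) = m := fun m => LinearMap.congr_fun hg m
  have hΦ : ∀ (x : ↥Z) (y : ↥Z'),
      (g ∘ₗ f') (Submodule.Quotient.mk x) = Submodule.Quotient.mk y ↔ e y - f x ∈ N := by
    intro x y
    obtain ⟨y₀, hy₀, h⟩ := hex x x.2
    have h₀ := (hmem x ⟨y₀, hy₀⟩).1 h
    rw [hmem, ← h₀, LinearMap.comp_apply, ← h₀, hg', eq_comm]
    exact (LinearMap.ker_eq_bot.1 hker).eq_iff.symm
  refine ⟨g ∘ₗ f', hΦ, fun Ψ hΨ => LinearMap.ext fun m => ?_⟩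
  induction m using Submodule.Quotient.induction_on with
  | H x =>
    obtain ⟨y₀, hy₀, h⟩ := hex x x.2
    rw [(hΨ x ⟨y₀, hy₀⟩).2 h, (hΦ x ⟨y₀, hy₀⟩).2 h]

theorem continuous_act_of_homogeneous {H : Type*} [Ring H] [Algebra ℂ H] {ℋ : ℤ → Submodule ℂ H}
    [GradedAlgebra ℋ] {Ω : Type*} [Ring Ω] [Algebra ℂ Ω] {π : H →ₗ[ℂ] Ω →ₗ[ℂ] Ω}
    [TopologicalSpace Ω] [ContinuousAdd Ω] (hπ : ∀ n, ∀ h ∈ ℋ n, Continuous (π h)) (h : H) :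
    Continuous (π h) := by
  induction h using DirectSum.Decomposition.inductionOn ℋ with
  | zero =>
    rw [map_zero]
    exact continuous_const
  | homogeneous h => exact hπ _ h h.2
  | add g h hg hh =>
    rw [map_add]
    exact hg.add hh

theorem extendByZero_mem_periodicCoboundaries {Ω : Type*} [Ring Ω] [Algebra ℂ Ω]
    {𝒜 : ℤ → Submodule ℂ Ω} [GradedAlgebra 𝒜] [TopologicalSpace Ω] {dΩ : Ω →ₗ[ℂ] Ω}
    (hΩ : IsDGAlgebra 𝒜 dΩ) (hA : ∀ n < 0, 𝒜 n = ⊥)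
    (hproj : ∀ n, Continuous (GradedAlgebra.proj 𝒜 n)) {j : ℤ}
    {y : Tot (Functional ↥(𝒜 0)) ℤ}
    (hy : y ∈ periodicCoboundaries (trivialGrading ↥(𝒜 0)) 0 j) :
    extendByZero 𝒜 y ∈ periodicCoboundaries 𝒜 dΩ j := by
  obtain ⟨w, hw, hwy⟩ := Submodule.mem_map.1 hy
  have h := extendByZero_mem hproj hw
  rw [← hwy, ← periodicD_extendByZero hΩ hA, periodicCoboundaries, periodicCochains_eq]
  exact Submodule.mem_map_of_mem (CyclicOps.weightIn_le h)

section Induced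

variable {H : Type*} [Ring H] [Algebra ℂ H] [Coalgebra ℂ H] {ℋ : ℤ → Submodule ℂ H}
  [GradedAlgebra ℋ] {Ω : Type*} [Ring Ω] [Algebra ℂ Ω] {𝒜 : ℤ → Submodule ℂ Ω} [GradedAlgebra 𝒜]
  [TopologicalSpace Ω] [IsTopologicalRing Ω]
  {π π' : H →ₗ[ℂ] Ω →ₗ[ℂ] Ω} {dH S : H →ₗ[ℂ] H} {dΩ : Ω →ₗ[ℂ] Ω} {δ : H →ₐ[ℂ] ℂ} {σ : H}
  {T : Ω →ₗ[ℂ] ℂ} {q : ℤ}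
  (hΩ : IsDGAlgebra 𝒜 dΩ) (hA : ∀ n < 0, 𝒜 n = ⊥)
  (hproj : ∀ n, Continuous (GradedAlgebra.proj 𝒜 n)) (hdc : Continuous dΩ)
  (hH : IsDGHopfAlgebra ℋ dH S) (hδσ : IsModularPair ℋ dH S δ σ)
  (hπ : IsDGAction ℋ 𝒜 dH dΩ π) (hπc : ∀ h, Continuous (π h)) (hTc : Continuous T)
  (hTw : ∀ n : ℤ, n ≠ q → ∀ a ∈ 𝒜 n, T a = 0) (hTd : ∀ a, T (dΩ a) = 0)
  (hT : IsInvariantTrace ℋ 𝒜 S δ σ π T)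
include hΩ hA hproj hdc hH hδσ hπ hπc hTc hTw hTd hT

omit hdc in
theorem charTotal_mem_periodicCocycles {i : ℤ} {x : Tot (TPow H) ℕ}
    (hx : x ∈ truncatedCocycles ℋ dH S δ σ q i) :
    charTotal ℋ 𝒜 π T i x ∈ periodicCocycles 𝒜 dΩ (i - q) := by
  refine ⟨charTotal_mem hTw hA hπ.act_mem hproj hπc hTc hx.1, ?_⟩
  change periodicD 𝒜 dΩ _ = 0
  rw [← charTotal_hopfD hπ hT hH hδσ hΩ hTd hx.1]
  exact charTotal_eq_zero hTw hA hπ.act_mem (i + 1) hx.2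

omit hdc in
theorem charTotal_mem_periodicCoboundaries {i : ℤ} {x : Tot (TPow H) ℕ}
    (hx : x ∈ truncatedCoboundaries ℋ dH S δ σ q i) :
    charTotal ℋ 𝒜 π T i x ∈ periodicCoboundaries 𝒜 dΩ (i - q) := by
  obtain ⟨_, ⟨w, hw, rfl⟩, v, hv, rfl⟩ := Submodule.mem_sup.1 hx
  have h := charTotal_hopfD hπ hT hH hδσ hΩ hTd hw
  rw [sub_add_cancel] at h
  rw [map_add, charTotal_eq_zero hTw hA hπ.act_mem i hv, add_zero, h]
  refine ⟨_, ?_, rfl⟩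
  rw [sub_right_comm]
  exact charTotal_mem hTw hA hπ.act_mem hproj hπc hTc hw

/-- The characteristic map of an action induces a unique map in cohomology. -/
theorem existsUnique_isInducedMap (i : ℤ) :
    ∃! Φ : HCtrunc ℋ dH S δ σ q i →ₗ[ℂ] HP ↥(𝒜 0) (i - q),
      IsInducedMap ℋ 𝒜 dH S δ σ dΩ π T q i Φ :=
  existsUnique_cohomology_map (extendByZero 𝒜) (charTotal ℋ 𝒜 π T i)
    (fun _ hx => exists_extendByZero_sub_mem hA hproj hΩ hdc
      (charTotal_mem_periodicCocycles hΩ hA hproj hH hδσ hπ hπc hTc hTw hTd hT hx))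
    (fun _ hy => mem_periodicCoboundaries_of_extendByZero hA hproj hΩ hdc hy.1)
    (fun _ hy => extendByZero_mem_periodicCoboundaries hΩ hA hproj hy)
    fun _ hx => charTotal_mem_periodicCoboundaries hΩ hA hproj hH hδσ hπ hπc hTc hTw hTd hT hx

/-- The characteristic maps of an action and of its twist agree in cohomology. -/
theorem charTotal_sub_mem_periodicCoboundaries {ρp ρm : H →ₗ[ℂ] Ω}
    (hρ : IsCocyclePair ℋ 𝒜 dH dΩ σ π ρp ρm) (hπ' : IsTwist ℋ 𝒜 π π' ρp ρm)
    (hT' : IsInvariantTrace ℋ 𝒜 S δ σ π' T) {i : ℤ} {x : Tot (TPow H) ℕ}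
    (hx : x ∈ truncatedCocycles ℋ dH S δ σ q i) :
    charTotal ℋ 𝒜 π T i x - charTotal ℋ 𝒜 π' T i x ∈ periodicCoboundaries 𝒜 dΩ (i - q) := by
  classical
  have h0 : twistedAct ℋ 𝒜 π (convOne H Ω) (convOne H Ω) = π :=
    LinearMap.ext fun h => LinearMap.ext fun a => twistedAct_convOne hH h a
  obtain rfl := hπ'.eq_twist
  rw [periodicCoboundaries, periodicCochains_eq, ← contWeight_component hA hproj]
  -- Conjugation in the matrices requires a continuous parity automorphism, which the topology of
  -- componentwise convergence provides. The action itself is the twist by the trivial pair.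
  have h := @charTotal_sub_charTotal_mem H _ _ _ ℋ _ Ω _ _ 𝒜 _ π dH S dΩ δ σ T hH hδσ hΩ hA hπ q
    hTw hTd ![convOne H Ω, ρp] ![convOne H Ω, ρm]
    (Fin.forall_fin_two.2 ⟨isCocyclePair_convOne hH hδσ hπ hΩ, hρ⟩) hT
    (Fin.forall_fin_two.2 ⟨by
      change IsInvariantTrace ℋ 𝒜 S δ σ (twistedAct ℋ 𝒜 π (convOne H Ω) (convOne H Ω)) T
      rwa [h0], hT'⟩)
    (componentTopology 𝒜) (component_isTopologicalRing hA) (component_continuous_koszul 1)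
    (component_continuous_map hΩ.d_mem hdc) (fun h => ?_)
    (component_continuous_functional hTw hTc) i x hx
  · change charTotal ℋ 𝒜 (twistedAct ℋ 𝒜 π (convOne H Ω) (convOne H Ω)) T i x - _ ∈ _ at h
    rwa [h0] at h
  · -- Continuity in the topology of components is clear for homogeneous `h`.
    refine @continuous_act_of_homogeneous H _ _ ℋ _ Ω _ _ π (componentTopology 𝒜)
      (component_isTopologicalRing hA).toIsTopologicalSemiring.toContinuousAdd (fun n h hh =>
        component_continuous_map (r := n) (fun k a ha => ?_) (hπc h)) h
    rw [add_comm]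
    exact hπ.act_mem n k h hh a ha

end Induced

end DGHopf

end

open DGHopf

theorem mainTheorem3
    -- the unital DG algebra `(Ω, dΩ)`, positively graded, with a topology
    {Ω : Type*} [Ring Ω] [Algebra ℂ Ω] [TopologicalSpace Ω] [IsTopologicalRing Ω]
    (𝒜 : ℤ → Submodule ℂ Ω) [GradedAlgebra 𝒜] (dΩ : Ω →ₗ[ℂ] Ω)
    (hΩ : IsDGAlgebra 𝒜 dΩ) (hΩ_nonneg : ∀ n : ℤ, n < 0 → 𝒜 n = ⊥)
    (hΩ_proj : ∀ n : ℤ, Continuous (GradedRing.proj 𝒜 n)) (hdΩ : Continuous dΩ)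
    -- the DG Hopf algebra `(H, dH)` with a modular pair `(δ, σ)`
    {H : Type*} [Ring H] [Algebra ℂ H] [Coalgebra ℂ H]
    (ℋ : ℤ → Submodule ℂ H) [GradedAlgebra ℋ] (dH S : H →ₗ[ℂ] H)
    (hH : IsDGHopfAlgebra ℋ dH S) (δ : H →ₐ[ℂ] ℂ) (σ : H) (hδσ : IsModularPair ℋ dH S δ σ)
    -- the action `π`
    (π : H →ₗ[ℂ] Ω →ₗ[ℂ] Ω) (hπ : IsDGAction ℋ 𝒜 dH dΩ π) (hπ_cont : ∀ h, Continuous (π h))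
    -- the closed functional `T` of weight `q`, a `δ`-invariant `σ`-trace for `π`
    (T : Ω →ₗ[ℂ] ℂ) (hT_cont : Continuous T) (q : ℤ)
    (hT_weight : ∀ n : ℤ, n ≠ q → ∀ a ∈ 𝒜 n, T a = 0) (hT_closed : ∀ a, T (dΩ a) = 0)
    (hT : IsInvariantTrace ℋ 𝒜 S δ σ π T) :
    -- `χ_π` is a map of complexes which lowers the total degree by `q`
    (∀ i : ℤ, ∀ x ∈ hopfCochains ℋ i,
      charTotal ℋ 𝒜 π T i x ∈ periodicCochains 𝒜 (i - q) ∧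
      charTotal ℋ 𝒜 π T (i + 1) (hopfD ℋ dH S δ σ x) =
        periodicD 𝒜 dΩ (charTotal ℋ 𝒜 π T i x)) ∧
    -- it vanishes on `F^{q+1}`
    (∀ i : ℤ, ∀ x ∈ hopfFiltration ℋ (q + 1), charTotal ℋ 𝒜 π T i x = 0) ∧
    -- it induces a map in cohomology `HC^i(H)_q → HP^{i-q}(𝒜 0)`
    (∀ i : ℤ, ∃! Φ : HCtrunc ℋ dH S δ σ q i →ₗ[ℂ] HP ↥(𝒜 0) (i - q),
      IsInducedMap ℋ 𝒜 dH S δ σ dΩ π T q i Φ) ∧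
    -- the twist of `π` by a cocycle induces the same map
    (∀ (ρp ρm : H →ₗ[ℂ] Ω) (π' : H →ₗ[ℂ] Ω →ₗ[ℂ] Ω),
      IsCocyclePair ℋ 𝒜 dH dΩ σ π ρp ρm → IsTwist ℋ 𝒜 π π' ρp ρm →
      IsInvariantTrace ℋ 𝒜 S δ σ π' T →
      ∀ (i : ℤ) (Φ : HCtrunc ℋ dH S δ σ q i →ₗ[ℂ] HP ↥(𝒜 0) (i - q)),
        IsInducedMap ℋ 𝒜 dH S δ σ dΩ π T q i Φ ↔
          IsInducedMap ℋ 𝒜 dH S δ σ dΩ π' T q i Φ) := by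
  have hA : ∀ n < 0, 𝒜 n = ⊥ := hΩ_nonneg
  have hproj : ∀ n, Continuous (GradedAlgebra.proj 𝒜 n) := hΩ_proj
  refine ⟨fun i x hx => ⟨charTotal_mem hT_weight hA hπ.act_mem hproj hπ_cont hT_cont hx,
      charTotal_hopfD hπ hT hH hδσ hΩ hT_closed hx⟩,
    fun i x hx => charTotal_eq_zero hT_weight hA hπ.act_mem i hx,
    existsUnique_isInducedMap hΩ hA hproj hdΩ hH hδσ hπ hπ_cont hT_cont hT_weight hT_closed hT,
    fun ρp ρm π' hρ hπ' hT' i Φ => forall_congr' fun x => forall_congr' fun y => ?_⟩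
  have h := charTotal_sub_mem_periodicCoboundaries hΩ hA hproj hdΩ hH hδσ hπ hπ_cont hT_cont
    hT_weight hT_closed hT hρ hπ' hT' x.2
  rw [← Submodule.add_mem_iff_left _ h, sub_add_sub_cancel]
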